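/- Let $k$ be a field of characteristic $0$. "Operad" means non-unital symmetric operad in chain complexes over $k$ (homological grading, differential of degree $-1$), given by partial compositions $\circ_i$; a "non-dg operad" is one in graded vector spaces. For an operation $m$ of arity $1$ and degree $-1$ put $[m,\nu]=m\circ_1\nu-(-1)^{|\nu|}\sum_i\nu\circ_i m$. Write $[x]$ for the free operad on one generator $x$, and $\vee$ for the coproduct of operads. Let $\mathrm{cL}_\infty$ be the free operad on generators $\ell_n$, $n\ge 0$, of arity $n$ and degree $-1$ with $\ell_n^\sigma=\ell_n$ for all $\sigma\in\mathbb S_n$, with differential $d\ell_n=-\sum_{p+q=n}\sum_{\sigma}(\ell_{p+1}\circ_1\ell_q)^\sigma$, where $\sigma$ runs over the unshuffles, i.e. over the $\binom{n}{q}$ ways to choose the inputs of $\ell_q$; let $\mathrm L_\infty=\mathrm{cL}_\infty/(\ell_0,\ell_1)$, and let $(\mathrm L_\infty\downarrow\mathrm{Op})$ be the category of operads under $\mathrm L_\infty$. A twisting structure is an operad morphism $\mathrm{cL}_\infty\to Q$ together with a non-dg suboperad $Q_{0,0}\subset Q$ such that (i) the natural map $[\ell_0]\vee[\ell_1]\vee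 Q_{0,0}\to Q$ is an isomorphism of non-dg operads; (ii) $Q_{0,0}$ contains the images of the $\ell_i$, $i>1$; (iii) $(d_Q+[\ell_1,\cdot\,])(Q_{0,0})$ consists of elements of degree $0$ in $\ell_1$ and of degree at most $1$ in $\ell_0$. A morphism $(Q,Q_{0,0})\to(Q',Q'_{0,0})$ is a morphism $Q\to Q'$ under $\mathrm{cL}_\infty$ carrying $Q_{0,0}$ into $Q'_{0,0}$. This gives the category $\mathrm{Twist}_\infty$. The operad $Q_{0,0}$ carries the differential induced by $Q_{0,0}\cong Q/(\ell_0,\ell_1)$ and a morphism $\mathrm L_\infty\to Q_{0,0}$, which defines a forgetful functor $\mathcal F:\mathrm{Twist}_\infty\to(\mathrm L_\infty\downarrow\mathrm{Op})$, $(Q,Q_{0,0})\mapsto(\mathrm L_\infty\to Q_{0,0})$. The twisting comonad $\mathrm{Tw}$ on $(\mathrm L_\infty\downarrow\mathrm{Op})$ is the following. For $P$ under $\mathrm L_\infty$, the non-dg operad underlying $\mathrm{Tw}(P)$ is the completion $P\,\hat\vee\,[\alpha]$ of $P\vee[\alpha]$ with respect to the number of $\alpha$'s, where $\alpha$ has arity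 $0$ and degree $0$. With $\ell_n^\alpha=\sum_{j\ge0}\frac1{j!}\ell_{n+j}(\alpha^j,-,\dots,-)$ (where $\ell_0=\ell_1=0$ in $P$), its differential is the continuous derivation with $d\nu=d_P\nu+[\ell_1^\alpha,\nu]$ for $\nu\in P$ and $d\alpha=-\ell_0^\alpha+[\ell_1^\alpha,\alpha]$, and $\mathrm L_\infty\to\mathrm{Tw}(P)$ sends $\ell_n$ to $\ell_n^\alpha$ for $n\ge2$. A morphism $f$ is sent to the continuous morphism with $\nu\mapsto f(\nu)$, $\alpha\mapsto\alpha$. The counit $\mathrm{Tw}(P)\to P$ is the continuous morphism with $\nu\mapsto\nu$, $\alpha\mapsto0$, and the comultiplication $\mathrm{Tw}(P)\to\mathrm{Tw}(\mathrm{Tw}(P))$ is the continuous morphism with $\nu\mapsto\nu$, $\alpha\mapsto\alpha'+\alpha$, where $\alpha'$ is adjoined by the second instance of $\mathrm{Tw}$. Theorem. The functor $\mathcal F$ is comonadic: it has a right adjoint $\mathcal G$, and the comparison functor from $\mathrm{Twist}_\infty$ to coalgebras over the comonad $\mathcal F\mathcal G$ is an equivalence of categories. The comonad $\mathcal F\mathcal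 G$ is isomorphic to $\mathrm{Tw}$. The same holds for nonsymmetric operads, with $\mathrm{cL}_\infty$ replaced by the operad $\mathrm{cA}_\infty$ freely generated by $\mu_n$, $n\ge0$, of arity $n$ and degree $-1$ with $d\mu_n=-\sum_{p+q+r=n}\mu_{p+1+r}\circ_{p+1}\mu_q$, with $\mathrm L_\infty$ replaced by $\mathrm A_\infty=\mathrm{cA}_\infty/(\mu_0,\mu_1)$, and with $\ell_n^\alpha$ replaced by $\mu_n^\alpha=\sum_{r_0,\dots,r_n\ge0}\mu_{n+r_0+\cdots+r_n}(\alpha^{r_0},-,\alpha^{r_1},-,\dots,-,\alpha^{r_n})$. -/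

import Mathlib

open CategoryTheory

universe u

noncomputable section

namespace OperadicTwisting

/-! ### Operads

All operads are non-unital, given by partial compositions. Symmetric and nonsymmetric operads are
treated together: the arity `n` part carries an action of the full symmetric group in the first
case and of the trivial group in the second. -/

/-- The two flavours of operads. -/
inductive Flavour
  | symmetric
  | nonsymmetric

/-- The group acting on operations of arity `n`. -/
def Flavour.perms : Flavour → (n : ℕ) → Subgroup (Equiv.Perm (Fin n))
  | .symmetric, _ => ⊤
  | .nonsymmetric, _ => ⊥

/-- In `x ∘_i y`, with `y` of arity `n`, the input `a ≠ i` of `x` becomes the input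
`outerSlot i n a` (and the input `b` of `y` becomes the input `i + b`). -/
def outerSlot (i n a : ℕ) : ℕ := if a < i then a else a + n - 1

/-- `ρ` is the block permutation that relabels the inputs of `x ∘_i y` when the inputs of `x` are
relabelled by `σ` and those of `y` by `τ`. -/
structure IsBlockPerm {m n r : ℕ} (i : Fin m) (σ : Equiv.Perm (Fin m)) (τ : Equiv.Perm (Fin n))
    (ρ : Equiv.Perm (Fin r)) : Prop where
  inner : ∀ (b : Fin n) (c : Fin r), (c : ℕ) = i + b → (ρ c : ℕ) = σ i + τ b
  outer : ∀ (a : Fin m) (c : Fin r), a ≠ i → (c : ℕ) = outerSlot i n a →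
    (ρ c : ℕ) = outerSlot (σ i) n (σ a)

/-- Non-unital operads in `ℤ`-graded vector spaces over `k`. The group acts on the left by
relabelling of inputs, so `act σ x` is `x ^ (σ⁻¹)` in terms of the usual right action.
Inputs are numbered from `0`; the composition `x ∘_i y` is `comp _ _ i x y`. -/
structure GrOperad (k : Type u) [Field k] (s : Flavour) where
  /-- `V n p` is the space of operations of arity `n` and degree `p`. -/
  V : ℕ → ℤ → Type u
  [addCommGroup : ∀ n p, AddCommGroup (V n p)]
  [module : ∀ n p, Module k (V n p)]
  act : ∀ {n : ℕ} {p : ℤ}, Representation k (s.perms n) (V n p)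
  comp : ∀ {m n r : ℕ} {p q t : ℤ} (_ : r + 1 = m + n) (_ : t = p + q) (_ : Fin m),
    V m p →ₗ[k] V n q →ₗ[k] V r t
  comp_act : ∀ {m n r : ℕ} {p q t : ℤ} (hr : r + 1 = m + n) (ht : t = p + q) (i : Fin m)
    (σ : s.perms m) (τ : s.perms n) (ρ : s.perms r),
    IsBlockPerm i (σ : Equiv.Perm (Fin m)) (τ : Equiv.Perm (Fin n)) (ρ : Equiv.Perm (Fin r)) →
    ∀ (x : V m p) (y : V n q),
      act ρ (comp hr ht i x y)
        = comp hr ht ((σ : Equiv.Perm (Fin m)) i) (act σ x) (act τ y)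
  comp_seq : ∀ {l m n a b r : ℕ} {p q t pq qt e : ℤ}
    (ha : a + 1 = l + m) (hb : b + 1 = m + n) (hr : r + 1 = a + n) (hr' : r + 1 = l + b)
    (hpq : pq = p + q) (hqt : qt = q + t) (he : e = pq + t) (he' : e = p + qt)
    (i : Fin l) (j : Fin m) (c : Fin a), (c : ℕ) = i + j →
    ∀ (x : V l p) (y : V m q) (z : V n t),
      comp hr he c (comp ha hpq i x y) z = comp hr' he' i x (comp hb hqt j y z)
  comp_par : ∀ {l m n a b r : ℕ} {p q t pq pt e : ℤ}
    (ha : a + 1 = l + m) (hb : b + 1 = l + n) (hr : r + 1 = a + n) (hr' : r + 1 = b + m)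
    (hpq : pq = p + q) (hpt : pt = p + t) (he : e = pq + t) (he' : e = pt + q)
    (i j : Fin l) (c : Fin a) (c' : Fin b), i < j → (c : ℕ) + 1 = j + m → (c' : ℕ) = i →
    ∀ (x : V l p) (y : V m q) (z : V n t),
      comp hr he c (comp ha hpq i x y) z
        = (q * t).negOnePow • comp hr' he' c' (comp hb hpt j x z) y

attribute [instance] GrOperad.addCommGroup GrOperad.module

/-- Non-unital operads in chain complexes over `k` (the differential has degree `-1`). -/
structure DGOperad (k : Type u) [Field k] (s : Flavour) extends GrOperad k s where
  d : ∀ {n : ℕ} {p q : ℤ} (_ : p = q + 1), V n p →ₗ[k] V n q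
  d_d : ∀ {n : ℕ} {p q t : ℤ} (h : p = q + 1) (h' : q = t + 1) (x : V n p), d h' (d h x) = 0
  d_act : ∀ {n : ℕ} {p q : ℤ} (h : p = q + 1) (σ : s.perms n) (x : V n p),
    d h (act σ x) = act σ (d h x)
  d_comp : ∀ {m n r : ℕ} {p p' q q' t t' : ℤ} (hr : r + 1 = m + n) (ht : t = p + q)
    (hp : p = p' + 1) (hq : q = q' + 1) (htt : t = t' + 1) (h₁ : t' = p' + q) (h₂ : t' = p + q')
    (i : Fin m) (x : V m p) (y : V n q),
    d htt (comp hr ht i x y)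
      = comp hr h₁ i (d hp x) y + p.negOnePow • comp hr h₂ i x (d hq y)

variable {k : Type u} [Field k] {s : Flavour}

/-- Morphisms of graded (non-dg) operads. -/
structure GrHom (P R : GrOperad k s) where
  app : ∀ {n : ℕ} {p : ℤ}, P.V n p →ₗ[k] R.V n p
  map_act : ∀ {n : ℕ} {p : ℤ} (σ : s.perms n) (x : P.V n p), app (P.act σ x) = R.act σ (app x)
  map_comp : ∀ {m n r : ℕ} {p q t : ℤ} (hr : r + 1 = m + n) (ht : t = p + q) (i : Fin m)
    (x : P.V m p) (y : P.V n q),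
    app (P.comp hr ht i x y) = R.comp hr ht i (app x) (app y)

/-- Morphisms of dg operads. -/
structure DGHom (P R : DGOperad k s) extends GrHom P.toGrOperad R.toGrOperad where
  map_d : ∀ {n : ℕ} {p q : ℤ} (h : p = q + 1) (x : P.V n p), app (P.d h x) = R.d h (app x)

theorem GrHom.ext {P R : GrOperad k s} {f g : GrHom P R}
    (h : ∀ (n : ℕ) (p : ℤ) (x : P.V n p), f.app x = g.app x) : f = g := by
  cases f with
  | mk a _ _ =>
    cases g with
    | mk b _ _ =>
      have : @a = @b := by
        funext n p
        exact LinearMap.ext (h n p)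
      subst this
      rfl

theorem DGHom.ext {P R : DGOperad k s} {f g : DGHom P R}
    (h : ∀ (n : ℕ) (p : ℤ) (x : P.V n p), f.app x = g.app x) : f = g := by
  have : f.toGrHom = g.toGrHom := GrHom.ext h
  cases f
  cases g
  cases this
  rfl

/-- The identity. -/
def GrHom.id (P : GrOperad k s) : GrHom P P where
  app := LinearMap.id
  map_act _ _ := rfl
  map_comp _ _ _ _ _ := rfl

/-- Composition (in diagrammatic order). -/
def GrHom.trans {P R S : GrOperad k s} (f : GrHom P R) (g : GrHom R S) : GrHom P S where
  app := g.app ∘ₗ f.app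
  map_act σ x := by simp [f.map_act, g.map_act]
  map_comp hr ht i x y := by simp [f.map_comp, g.map_comp]

instance : Category (DGOperad k s) where
  Hom P R := DGHom P R
  id P := { GrHom.id P.toGrOperad with map_d := fun _ _ => rfl }
  comp f g := { f.toGrHom.trans g.toGrHom with
    map_d := fun h x => by simp [GrHom.trans, f.map_d, g.map_d] }
  id_comp _ := DGHom.ext fun _ _ _ => rfl
  comp_id _ := DGHom.ext fun _ _ _ => rfl
  assoc _ _ _ := DGHom.ext fun _ _ _ => rfl

/-- The non-dg morphism underlying a morphism of dg operads. -/
def gr {P R : DGOperad k s} (f : P ⟶ R) : GrHom P.toGrOperad R.toGrOperad := DGHom.toGrHom f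

theorem gr_map_d {P R : DGOperad k s} (f : P ⟶ R) {n : ℕ} {p q : ℤ} (h : p = q + 1)
    (x : P.V n p) : (gr f).app (P.d h x) = R.d h ((gr f).app x) := DGHom.map_d f h x

/-- The bracket `[m, x] = m ∘ x - (-1) ^ |x| ∑ x ∘_i m` with an operation `m` of arity one and
degree `-1`. -/
def GrOperad.bracket (C : GrOperad k s) (m : C.V 1 (-1)) {n : ℕ} {p q : ℤ} (h : p = q + 1)
    (x : C.V n p) : C.V n q :=
  C.comp (Nat.add_comm n 1) (by omega) 0 m x
    - p.negOnePow • ∑ i : Fin n, C.comp (r := n) rfl (by omega) i x m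

/-! ### The operads `cL∞`, `L∞`, `cA∞`, `A∞` -/

/-- `σ` is increasing on the first `q` elements and on the remaining ones. -/
def IsUnshuffle {n : ℕ} (q : ℕ) (σ : Equiv.Perm (Fin n)) : Prop :=
  ∀ a b : Fin n, a < b → ((b : ℕ) < q ∨ q ≤ (a : ℕ)) → σ a < σ b

open scoped Classical in
/-- The quadratic expression in a family of operations `ℓ n` of arity `n` and degree `-1` that
appears in the differentials of `cL∞` and `cA∞`. In the symmetric case it is
`∑_{p + q = n} ∑_σ (ℓ_{p+1} ∘_1 ℓ_q)^σ`, the sum over all ways to distribute the `n` inputs to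
`ℓ_q` and the remaining inputs of `ℓ_{p+1}`; in the nonsymmetric case
`∑_{p + q + r = n} ℓ_{p+1+r} ∘_{p+1} ℓ_q`. -/
def quad : {s : Flavour} → (P : GrOperad k s) → (∀ n, P.V n (-1)) → (n : ℕ) → P.V n (-2)
  | .symmetric, P, ℓ, n => ∑ q : Fin (n + 1),
      ∑ σ ∈ Finset.univ.filter (fun σ : Equiv.Perm (Fin n) => IsUnshuffle q σ),
        P.act ⟨σ, Subgroup.mem_top σ⟩
          (P.comp (m := n - q + 1) (n := q) (by omega) (by norm_num) 0 (ℓ (n - q + 1)) (ℓ q))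
  | .nonsymmetric, P, ℓ, n => ∑ q : Fin (n + 1), ∑ i : Fin (n - q + 1),
      P.comp (n := q) (by omega) (by norm_num) i (ℓ (n - q + 1)) (ℓ q)

theorem map_quad {P R : GrOperad k s} (f : GrHom P R) (ℓ : ∀ n, P.V n (-1)) (n : ℕ) :
    f.app (quad P ℓ n) = quad R (fun n => f.app (ℓ n)) n := by
  cases s <;> simp [quad, map_sum, f.map_act, f.map_comp]

/-- The relations that define the curved operad: `ℓ n` is invariant under permutations and
`d (ℓ n)` is minus the quadratic expression. -/
structure IsCurved (P : DGOperad k s) (ℓ : ∀ n, P.V n (-1)) : Prop where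
  invariant : ∀ (n : ℕ) (σ : s.perms n), P.act σ (ℓ n) = ℓ n
  d_eq : ∀ n : ℕ, P.d (by norm_num) (ℓ n) = - quad P.toGrOperad ℓ n

/-- The relations that define the uncurved operad, the quotient of the curved one by `ℓ 0`
and `ℓ 1`. -/
structure IsFlat (P : DGOperad k s) (ℓ : ∀ n, P.V n (-1)) : Prop extends IsCurved P ℓ where
  zero_eq : ℓ 0 = 0
  one_eq : ℓ 1 = 0

theorem IsCurved.map {P R : DGOperad k s} (f : DGHom P R) {ℓ : ∀ n, P.V n (-1)}
    (h : IsCurved P ℓ) : IsCurved R (fun n => f.app (ℓ n)) where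
  invariant n σ := by rw [← f.map_act, h.invariant]
  d_eq n := by rw [← f.map_d, h.d_eq, map_neg, map_quad]

/-- Formal expressions in generators `ℓ n` of arity `n` and degree `-1`. -/
inductive Term (k : Type u) (s : Flavour) : ℕ → ℤ → Type u
  | gen (n : ℕ) : Term k s n (-1)
  | zero {n : ℕ} {p : ℤ} : Term k s n p
  | add {n : ℕ} {p : ℤ} : Term k s n p → Term k s n p → Term k s n p
  | smul {n : ℕ} {p : ℤ} : k → Term k s n p → Term k s n p
  | act {n : ℕ} {p : ℤ} : s.perms n → Term k s n p → Term k s n p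
  | comp {m n r : ℕ} {p q t : ℤ} (hr : r + 1 = m + n) (ht : t = p + q) (i : Fin m) :
      Term k s m p → Term k s n q → Term k s r t
  | d {n : ℕ} {p q : ℤ} (h : p = q + 1) : Term k s n p → Term k s n q

/-- The value of an expression in a dg operad, given values of the generators. -/
def Term.eval (P : DGOperad k s) (ℓ : ∀ n, P.V n (-1)) :
    {n : ℕ} → {p : ℤ} → Term k s n p → P.V n p
  | _, _, .gen n => ℓ n
  | _, _, .zero => 0
  | _, _, .add x y => x.eval P ℓ + y.eval P ℓ
  | _, _, .smul c x => c • x.eval P ℓ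
  | _, _, .act σ x => P.act σ (x.eval P ℓ)
  | _, _, .comp hr ht i x y => P.comp hr ht i (x.eval P ℓ) (y.eval P ℓ)
  | _, _, .d h x => P.d h (x.eval P ℓ)

/-- A system of relations on families of operations `ℓ n` of arity `n` and degree `-1`. -/
def Relations (k : Type u) [Field k] (s : Flavour) : Type (u + 1) :=
  (P : DGOperad k s) → (∀ n, P.V n (-1)) → Prop

/-- Two expressions are identified if they agree whenever the relations hold. -/
def presentedSetoid (H : Relations k s) (n : ℕ) (p : ℤ) : Setoid (Term k s n p) where
  r x y := ∀ (P : DGOperad k s) (ℓ : ∀ n, P.V n (-1)), H P ℓ → x.eval P ℓ = y.eval P ℓ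
  iseqv := ⟨fun _ _ _ _ => rfl, fun h P ℓ hP => (h P ℓ hP).symm,
    fun h h' P ℓ hP => (h P ℓ hP).trans (h' P ℓ hP)⟩

/-- The operations of the dg operad generated by the `ℓ n` subject to the relations `H`. -/
def PresentedV (H : Relations k s) (n : ℕ) (p : ℤ) : Type u := Quotient (presentedSetoid H n p)

namespace PresentedV

variable {H : Relations k s}

/-- The class of an expression. -/
def mk (H : Relations k s) {n : ℕ} {p : ℤ} (x : Term k s n p) : PresentedV H n p :=
  Quotient.mk _ x

/-- Evaluation in a dg operad where the relations hold. -/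
def eval (P : DGOperad k s) (ℓ : ∀ n, P.V n (-1)) (hP : H P ℓ) {n : ℕ} {p : ℤ}
    (x : PresentedV H n p) : P.V n p :=
  Quotient.lift (fun t : Term k s n p => t.eval P ℓ)
    (fun _ _ (h : (presentedSetoid H n p).r _ _) => h P ℓ hP) x

theorem ext {n : ℕ} {p : ℤ} {x y : PresentedV H n p}
    (h : ∀ (P : DGOperad k s) (ℓ : ∀ n, P.V n (-1)) (hP : H P ℓ),
      eval P ℓ hP x = eval P ℓ hP y) : x = y := by
  induction x using Quotient.inductionOn with | _ x
  induction y using Quotient.inductionOn with | _ y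
  exact Quotient.sound fun P ℓ hP => h P ℓ hP

instance (n : ℕ) (p : ℤ) : Zero (PresentedV H n p) := ⟨mk H .zero⟩

instance (n : ℕ) (p : ℤ) : Add (PresentedV H n p) :=
  ⟨Quotient.map₂ .add fun _ _ (h : (presentedSetoid H n p).r _ _)
    _ _ (h' : (presentedSetoid H n p).r _ _) P ℓ hP => by
      simp only [Term.eval, h P ℓ hP, h' P ℓ hP]⟩

instance (n : ℕ) (p : ℤ) : SMul k (PresentedV H n p) :=
  ⟨fun c => Quotient.map (.smul c) fun _ _ (h : (presentedSetoid H n p).r _ _) P ℓ hP => by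
    simp only [Term.eval, h P ℓ hP]⟩

instance (n : ℕ) (p : ℤ) : Neg (PresentedV H n p) := ⟨fun x => (-1 : k) • x⟩

/-- The group action, on classes. -/
def act {n : ℕ} {p : ℤ} (σ : s.perms n) : PresentedV H n p → PresentedV H n p :=
  Quotient.map (.act σ) fun _ _ h P ℓ hP => by simp only [Term.eval, h P ℓ hP]

/-- The differential, on classes. -/
def d {n : ℕ} {p q : ℤ} (e : p = q + 1) : PresentedV H n p → PresentedV H n q :=
  Quotient.map (.d e) fun _ _ h P ℓ hP => by simp only [Term.eval, h P ℓ hP]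

/-- Partial composition, on classes. -/
def comp {m n r : ℕ} {p q t : ℤ} (hr : r + 1 = m + n) (ht : t = p + q) (i : Fin m) :
    PresentedV H m p → PresentedV H n q → PresentedV H r t :=
  Quotient.map₂ (.comp hr ht i) fun _ _ h _ _ h' P ℓ hP => by
    simp only [Term.eval, h P ℓ hP, h' P ℓ hP]

section eval

variable (P : DGOperad k s) (ℓ : ∀ n, P.V n (-1)) (hP : H P ℓ)

@[simp] theorem eval_gen (n : ℕ) : eval P ℓ hP (mk H (.gen n)) = ℓ n := rfl

@[simp] theorem eval_zero {n : ℕ} {p : ℤ} : eval P ℓ hP (0 : PresentedV H n p) = 0 := rfl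

@[simp] theorem eval_add {n : ℕ} {p : ℤ} (x y : PresentedV H n p) :
    eval P ℓ hP (x + y) = eval P ℓ hP x + eval P ℓ hP y :=
  Quotient.inductionOn₂ x y fun _ _ => rfl

@[simp] theorem eval_smul {n : ℕ} {p : ℤ} (c : k) (x : PresentedV H n p) :
    eval P ℓ hP (c • x) = c • eval P ℓ hP x :=
  Quotient.inductionOn x fun _ => rfl

@[simp] theorem eval_act {n : ℕ} {p : ℤ} (σ : s.perms n) (x : PresentedV H n p) :
    eval P ℓ hP (act σ x) = P.act σ (eval P ℓ hP x) :=
  Quotient.inductionOn x fun _ => rfl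

@[simp] theorem eval_d {n : ℕ} {p q : ℤ} (e : p = q + 1) (x : PresentedV H n p) :
    eval P ℓ hP (d e x) = P.d e (eval P ℓ hP x) :=
  Quotient.inductionOn x fun _ => rfl

@[simp] theorem eval_comp {m n r : ℕ} {p q t : ℤ} (hr : r + 1 = m + n) (ht : t = p + q)
    (i : Fin m) (x : PresentedV H m p) (y : PresentedV H n q) :
    eval P ℓ hP (comp hr ht i x y) = P.comp hr ht i (eval P ℓ hP x) (eval P ℓ hP y) :=
  Quotient.inductionOn₂ x y fun _ _ => rfl

end eval

instance (n : ℕ) (p : ℤ) : AddCommGroup (PresentedV H n p) where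
  add_assoc _ _ _ := ext fun _ _ _ => by simp [add_assoc]
  zero_add _ := ext fun _ _ _ => by simp
  add_zero _ := ext fun _ _ _ => by simp
  add_comm _ _ := ext fun _ _ _ => by simp [add_comm]
  neg_add_cancel x := ext fun P ℓ hP => by
    change eval P ℓ hP ((-1 : k) • x + x) = 0
    simp
  nsmul := nsmulRec
  zsmul := zsmulRec

instance (n : ℕ) (p : ℤ) : Module k (PresentedV H n p) where
  one_smul _ := ext fun _ _ _ => by simp
  mul_smul _ _ _ := ext fun _ _ _ => by simp [mul_smul]
  smul_zero _ := ext fun _ _ _ => by simp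
  smul_add _ _ _ := ext fun _ _ _ => by simp
  add_smul _ _ _ := ext fun _ _ _ => by simp [add_smul]
  zero_smul _ := ext fun _ _ _ => by simp

/-- Evaluation as a linear map. -/
def evalL (P : DGOperad k s) (ℓ : ∀ n, P.V n (-1)) (hP : H P ℓ) {n : ℕ} {p : ℤ} :
    PresentedV H n p →ₗ[k] P.V n p where
  toFun := eval P ℓ hP
  map_add' := eval_add P ℓ hP
  map_smul' := eval_smul P ℓ hP

theorem extL {n : ℕ} {p : ℤ} {x y : PresentedV H n p}
    (h : ∀ (P : DGOperad k s) (ℓ : ∀ n, P.V n (-1)) (hP : H P ℓ),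
      evalL P ℓ hP x = evalL P ℓ hP y) : x = y := ext h

end PresentedV

open PresentedV in
/-- The dg operad generated by operations `ℓ n` of arity `n` and degree `-1`, subject to the
relations `H`. Its operations are expressions in the `ℓ n`, two expressions being equal if they
agree in every dg operad with operations that satisfy the relations. -/
def presented (H : Relations k s) : DGOperad k s where
  V := PresentedV H
  act :=
    { toFun := fun σ =>
        { toFun := PresentedV.act σ
          map_add' := fun _ _ => PresentedV.ext fun _ _ _ => by simp
          map_smul' := fun _ _ => PresentedV.ext fun _ _ _ => by simp }
      map_one' := LinearMap.ext fun _ => PresentedV.ext fun _ _ _ => by simp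
      map_mul' := fun _ _ => LinearMap.ext fun _ => PresentedV.ext fun _ _ _ => by simp }
  comp hr ht i := LinearMap.mk₂ k (PresentedV.comp hr ht i)
    (fun _ _ _ => PresentedV.ext fun _ _ _ => by simp)
    (fun _ _ _ => PresentedV.ext fun _ _ _ => by simp)
    (fun _ _ _ => PresentedV.ext fun _ _ _ => by simp)
    (fun _ _ _ => PresentedV.ext fun _ _ _ => by simp)
  comp_act hr ht i σ τ ρ h x y := PresentedV.ext fun P _ _ => by
    simpa using P.comp_act hr ht i σ τ ρ h _ _
  comp_seq ha hb hr hr' hpq hqt he he' i j c hc x y z := PresentedV.ext fun P _ _ => by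
    simpa using P.comp_seq ha hb hr hr' hpq hqt he he' i j c hc _ _ _
  comp_par ha hb hr hr' hpq hpt he he' i j c c' hij hc hc' x y z := PresentedV.extL fun P ℓ hP => by
    rw [Units.smul_def, map_zsmul, ← Units.smul_def]
    simpa [evalL] using P.comp_par ha hb hr hr' hpq hpt he he' i j c c' hij hc hc' _ _ _
  d h :=
    { toFun := PresentedV.d h
      map_add' := fun _ _ => PresentedV.ext fun _ _ _ => by simp
      map_smul' := fun _ _ => PresentedV.ext fun _ _ _ => by simp }
  d_d h h' x := PresentedV.ext fun P _ _ => by simpa using P.d_d h h' _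
  d_act h σ x := PresentedV.ext fun P _ _ => by simpa using P.d_act h σ _
  d_comp hr ht hp hq htt h₁ h₂ i x y := PresentedV.extL fun P ℓ hP => by
    rw [map_add, Units.smul_def, map_zsmul, ← Units.smul_def]
    simpa [evalL] using P.d_comp hr ht hp hq htt h₁ h₂ i _ _

/-- The generators. -/
def presentedGen (H : Relations k s) (n : ℕ) : (presented H).V n (-1) :=
  PresentedV.mk H (.gen n)

/-- The morphism out of a presented dg operad given by operations that satisfy the relations. -/
def presentedLift {H : Relations k s} (P : DGOperad k s) (ℓ : ∀ n, P.V n (-1)) (hP : H P ℓ) :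
    presented H ⟶ P :=
  DGHom.mk
    { app := PresentedV.evalL P ℓ hP
      map_act := fun _ _ => PresentedV.eval_act P ℓ hP _ _
      map_comp := fun _ _ _ _ _ => PresentedV.eval_comp P ℓ hP _ _ _ _ _ }
    (fun _ _ => PresentedV.eval_d P ℓ hP _ _)

theorem presentedLift_gen {H : Relations k s} (P : DGOperad k s) (ℓ : ∀ n, P.V n (-1))
    (hP : H P ℓ) (n : ℕ) : (gr (presentedLift P ℓ hP)).app (presentedGen H n) = ℓ n := rfl

theorem presented_hom_ext {H : Relations k s} {P : DGOperad k s} {f g : presented H ⟶ P}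
    (h : ∀ n, (gr f).app (presentedGen H n) = (gr g).app (presentedGen H n)) : f = g := by
  refine DGHom.ext fun n p x => ?_
  change (gr f).app x = (gr g).app x
  induction x using Quotient.inductionOn with | _ x
  induction x with
  | gen n => exact h n
  | zero => exact ((gr f).app.map_zero).trans ((gr g).app.map_zero).symm
  | add x y hx hy =>
    exact ((gr f).app.map_add (PresentedV.mk H x) (PresentedV.mk H y)).trans
      ((congrArg₂ (· + ·) hx hy).trans
        ((gr g).app.map_add (PresentedV.mk H x) (PresentedV.mk H y)).symm)
  | smul c x hx =>
    exact ((gr f).app.map_smul c (PresentedV.mk H x)).trans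
      ((congrArg (c • ·) hx).trans ((gr g).app.map_smul c (PresentedV.mk H x)).symm)
  | act σ x hx =>
    exact ((gr f).map_act σ (PresentedV.mk H x)).trans
      ((congrArg (P.act σ) hx).trans ((gr g).map_act σ (PresentedV.mk H x)).symm)
  | comp hr ht i x y hx hy =>
    exact ((gr f).map_comp hr ht i (PresentedV.mk H x) (PresentedV.mk H y)).trans
      ((congrArg₂ (fun a b => P.comp hr ht i a b) hx hy).trans
        ((gr g).map_comp hr ht i (PresentedV.mk H x) (PresentedV.mk H y)).symm)
  | d e x hx =>
    exact (gr_map_d f e (PresentedV.mk H x)).trans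
      ((congrArg (P.d e) hx).trans (gr_map_d g e (PresentedV.mk H x)).symm)

variable (k s) in
/-- The operad `cL∞` (symmetric case) or `cA∞` (nonsymmetric case): generated by operations `ℓ n`,
`n ≥ 0`, of arity `n` and degree `-1`, invariant under permutations, with the differential
`d (ℓ n) = - quad n`. -/
def curvedInf : DGOperad k s := presented IsCurved

variable (k s) in
/-- The operad `L∞` (symmetric case) or `A∞` (nonsymmetric case), i.e. the quotient of the curved
operad by `ℓ 0` and `ℓ 1`. -/
def flatInf : DGOperad k s := presented IsFlat

theorem isCurved_gen : IsCurved (curvedInf k s) (presentedGen IsCurved) where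
  invariant n σ := PresentedV.ext fun P ℓ hP => by
    exact (PresentedV.eval_act P ℓ hP σ (presentedGen IsCurved n)).trans (hP.invariant n σ)
  d_eq n := PresentedV.extL fun P ℓ hP => by
    have h := map_quad (gr (presentedLift P ℓ hP)) (presentedGen IsCurved) n
    refine (PresentedV.eval_d P ℓ hP _ (presentedGen IsCurved n)).trans ((hP.d_eq n).trans ?_)
    exact ((LinearMap.map_neg _ _).trans (congrArg Neg.neg h)).symm

/-! ### Twisting structures -/

/-- Suboperads of a graded operad. -/
structure SubOperad (P : GrOperad k s) where
  carrier : ∀ (n : ℕ) (p : ℤ), Submodule k (P.V n p)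
  act_mem : ∀ {n : ℕ} {p : ℤ} (σ : s.perms n) {x : P.V n p},
    x ∈ carrier n p → P.act σ x ∈ carrier n p
  comp_mem : ∀ {m n r : ℕ} {p q t : ℤ} (hr : r + 1 = m + n) (ht : t = p + q) (i : Fin m)
    {x : P.V m p} {y : P.V n q}, x ∈ carrier m p → y ∈ carrier n q →
    P.comp hr ht i x y ∈ carrier r t

/-- A suboperad as a graded operad. -/
def SubOperad.toGrOperad {P : GrOperad k s} (S : SubOperad P) : GrOperad k s where
  V n p := S.carrier n p
  act :=
    { toFun := fun σ => (P.act σ).restrict fun _ hx => S.act_mem σ hx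
      map_one' := LinearMap.ext fun x => Subtype.ext (by simp)
      map_mul' := fun σ τ => LinearMap.ext fun x => Subtype.ext (by simp) }
  comp hr ht i := LinearMap.mk₂ k
    (fun x y => ⟨P.comp hr ht i x.1 y.1, S.comp_mem hr ht i x.2 y.2⟩)
    (fun _ _ _ => Subtype.ext (by simp)) (fun _ _ _ => Subtype.ext (by simp))
    (fun _ _ _ => Subtype.ext (by simp)) (fun _ _ _ => Subtype.ext (by simp))
  comp_act hr ht i σ τ ρ h x y := Subtype.ext (P.comp_act hr ht i σ τ ρ h x.1 y.1)
  comp_seq ha hb hr hr' hpq hqt he he' i j c hc x y z :=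
    Subtype.ext (P.comp_seq ha hb hr hr' hpq hqt he he' i j c hc x.1 y.1 z.1)
  comp_par ha hb hr hr' hpq hpt he he' i j c c' hij hc hc' x y z :=
    Subtype.ext ((P.comp_par ha hb hr hr' hpq hpt he he' i j c c' hij hc hc' x.1 y.1 z.1).trans
      (by simp [Units.smul_def]))

/-- The inclusion of a suboperad. -/
def SubOperad.incl {P : GrOperad k s} (S : SubOperad P) : GrHom S.toGrOperad P where
  app := (S.carrier _ _).subtype
  map_act _ _ := rfl
  map_comp _ _ _ _ _ := rfl

/-- The natural morphism `[ℓ₀] ∨ [ℓ₁] ∨ S → P` of graded operads is an isomorphism, where `[ℓ₀]`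
and `[ℓ₁]` are the free operads on a generator of degree `-1` and arity `0` and `1`: `P`, with the
inclusion of `S` and the two elements, has the universal property of this coproduct. -/
def IsFreeExtension {P : GrOperad k s} (S : SubOperad P) (ℓ₀ : P.V 0 (-1)) (ℓ₁ : P.V 1 (-1)) :
    Prop :=
  ∀ (R : GrOperad k s) (φ : GrHom S.toGrOperad R) (a : R.V 0 (-1)) (b : R.V 1 (-1)),
    ∃! ψ : GrHom P R, S.incl.trans ψ = φ ∧ ψ.app ℓ₀ = a ∧ ψ.app ℓ₁ = b

/-- `HasWeight S ℓ₀ ℓ₁ i j x`: the element `x` is homogeneous of degree `i` in `ℓ₀` and of degree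
`j` in `ℓ₁`, i.e. a linear combination of composites of elements of `S` with `i` copies of `ℓ₀` and
`j` copies of `ℓ₁`. -/
inductive HasWeight {P : GrOperad k s} (S : SubOperad P) (ℓ₀ : P.V 0 (-1)) (ℓ₁ : P.V 1 (-1)) :
    ℕ → ℕ → {n : ℕ} → {p : ℤ} → P.V n p → Prop
  | mem {n : ℕ} {p : ℤ} (x : P.V n p) : x ∈ S.carrier n p → HasWeight S ℓ₀ ℓ₁ 0 0 x
  | ell₀ : HasWeight S ℓ₀ ℓ₁ 1 0 ℓ₀
  | ell₁ : HasWeight S ℓ₀ ℓ₁ 0 1 ℓ₁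
  | zero (i j : ℕ) (n : ℕ) (p : ℤ) : HasWeight S ℓ₀ ℓ₁ i j (0 : P.V n p)
  | add {i j n : ℕ} {p : ℤ} (x y : P.V n p) :
      HasWeight S ℓ₀ ℓ₁ i j x → HasWeight S ℓ₀ ℓ₁ i j y → HasWeight S ℓ₀ ℓ₁ i j (x + y)
  | smul {i j n : ℕ} {p : ℤ} (c : k) (x : P.V n p) :
      HasWeight S ℓ₀ ℓ₁ i j x → HasWeight S ℓ₀ ℓ₁ i j (c • x)
  | act {i j n : ℕ} {p : ℤ} (σ : s.perms n) (x : P.V n p) :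
      HasWeight S ℓ₀ ℓ₁ i j x → HasWeight S ℓ₀ ℓ₁ i j (P.act σ x)
  | comp {i j i' j' m n r : ℕ} {p q t : ℤ} (hr : r + 1 = m + n) (ht : t = p + q) (c : Fin m)
      (x : P.V m p) (y : P.V n q) :
      HasWeight S ℓ₀ ℓ₁ i j x → HasWeight S ℓ₀ ℓ₁ i' j' y →
        HasWeight S ℓ₀ ℓ₁ (i + i') (j + j') (P.comp hr ht c x y)

/-- The image of the generator `ℓ n` under a morphism from the curved operad. -/
def curvedOp {Q : DGOperad k s} (f : curvedInf k s ⟶ Q) (n : ℕ) : Q.V n (-1) :=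
  (gr f).app (presentedGen IsCurved n)

theorem isCurved_curvedOp {Q : DGOperad k s} (f : curvedInf k s ⟶ Q) :
    IsCurved Q (curvedOp f) := IsCurved.map f isCurved_gen

variable (k s) in
/-- Twisting structures: the objects of `Twist∞` (symmetric case) or of its nonsymmetric
analogue. -/
structure Twist where
  Q : DGOperad k s
  str : curvedInf k s ⟶ Q
  Q00 : SubOperad Q.toGrOperad
  free : IsFreeExtension Q00 (curvedOp str 0) (curvedOp str 1)
  op_mem : ∀ n : ℕ, 1 < n → curvedOp str n ∈ Q00.carrier n (-1)
  d_add_bracket : ∀ {n : ℕ} {p q : ℤ} (h : p = q + 1) (x : Q.V n p), x ∈ Q00.carrier n p →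
    ∃ y z : Q.V n q,
      HasWeight Q00 (curvedOp str 0) (curvedOp str 1) 0 0 y ∧
      HasWeight Q00 (curvedOp str 0) (curvedOp str 1) 1 0 z ∧
      Q.d h x + Q.bracket (curvedOp str 1) h x = y + z

/-- Morphisms of twisting structures. -/
@[ext]
structure Twist.Hom (X Y : Twist k s) where
  hom : X.Q ⟶ Y.Q
  w : X.str ≫ hom = Y.str
  map_mem : ∀ {n : ℕ} {p : ℤ} (x : X.Q.V n p), x ∈ X.Q00.carrier n p →
    (gr hom).app x ∈ Y.Q00.carrier n p

instance : Category (Twist k s) where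
  Hom := Twist.Hom
  id X := ⟨𝟙 _, Category.comp_id _, fun _ h => h⟩
  comp f g := ⟨f.hom ≫ g.hom, by rw [← Category.assoc, f.w, g.w],
    fun x h => g.map_mem _ (f.map_mem x h)⟩
  id_comp f := Twist.Hom.ext (Category.id_comp f.hom)
  comp_id f := Twist.Hom.ext (Category.comp_id f.hom)
  assoc f g h := Twist.Hom.ext (Category.assoc f.hom g.hom h.hom)

/-! ### The forgetful functor -/

namespace Twist

/-- The projection `Q → Q / (ℓ₀, ℓ₁) ≅ Q00` of graded operads: the identity on `Q00`, and zero on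
`ℓ₀` and `ℓ₁`. -/
def proj (X : Twist k s) : GrHom X.Q.toGrOperad X.Q00.toGrOperad :=
  (X.free X.Q00.toGrOperad (GrHom.id _) 0 0).choose

theorem proj_incl (X : Twist k s) : X.Q00.incl.trans X.proj = GrHom.id _ :=
  (X.free X.Q00.toGrOperad (GrHom.id _) 0 0).choose_spec.1.1

theorem proj_coe (X : Twist k s) {n : ℕ} {p : ℤ} (x : X.Q00.toGrOperad.V n p) :
    X.proj.app (X.Q00.incl.app x) = x :=
  congrArg (fun f : GrHom X.Q00.toGrOperad X.Q00.toGrOperad => f.app x) X.proj_incl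

theorem proj_zero (X : Twist k s) : X.proj.app (curvedOp X.str 0) = 0 :=
  (X.free X.Q00.toGrOperad (GrHom.id _) 0 0).choose_spec.1.2.1

theorem proj_one (X : Twist k s) : X.proj.app (curvedOp X.str 1) = 0 :=
  (X.free X.Q00.toGrOperad (GrHom.id _) 0 0).choose_spec.1.2.2

/-- `Q` is generated by `Q00`, `ℓ₀` and `ℓ₁`. -/
theorem mem_of_generators (X : Twist k s) (S : SubOperad X.Q.toGrOperad)
    (hS : ∀ (n : ℕ) (p : ℤ), X.Q00.carrier n p ≤ S.carrier n p)
    (h₀ : curvedOp X.str 0 ∈ S.carrier 0 (-1)) (h₁ : curvedOp X.str 1 ∈ S.carrier 1 (-1))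
    {n : ℕ} {p : ℤ} (x : X.Q.V n p) : x ∈ S.carrier n p := by
  let φ : GrHom X.Q00.toGrOperad S.toGrOperad :=
    { app := fun {n p} => Submodule.inclusion (hS n p)
      map_act := fun _ _ => rfl
      map_comp := fun _ _ _ _ _ => rfl }
  obtain ⟨ψ, ⟨hψ, hψ₀, hψ₁⟩, -⟩ := X.free S.toGrOperad φ ⟨_, h₀⟩ ⟨_, h₁⟩
  have key : ψ.trans S.incl = GrHom.id _ := by
    refine (X.free X.Q.toGrOperad X.Q00.incl (curvedOp X.str 0) (curvedOp X.str 1)).unique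
      ⟨?_, ?_, ?_⟩ ⟨rfl, rfl, rfl⟩
    · change (X.Q00.incl.trans ψ).trans S.incl = _
      rw [hψ]
      rfl
    · exact congrArg Subtype.val hψ₀
    · exact congrArg Subtype.val hψ₁
  have hx : (ψ.app x).1 = x :=
    congrArg (fun f : GrHom X.Q.toGrOperad X.Q.toGrOperad => f.app (n := n) (p := p) x) key
  exact hx ▸ (ψ.app x).2

theorem proj_quad (X : Twist k s) {n : ℕ} (hn : n ≤ 1) :
    X.proj.app (quad X.Q.toGrOperad (curvedOp X.str) n) = 0 := by
  have hz : ∀ q ≤ 1, X.proj.app (curvedOp X.str q) = 0 := by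
    intro q hq
    interval_cases q
    · exact X.proj_zero
    · exact X.proj_one
  rw [map_quad]
  cases s
  all_goals
    refine Finset.sum_eq_zero fun q _ => Finset.sum_eq_zero fun i _ => ?_
    have h := hz q (by omega)
    simp only [h, map_zero]

/-- The kernel of the projection is stable under the differential. -/
theorem proj_d (X : Twist k s) {n : ℕ} {p q : ℤ} (h : p = q + 1) (x : X.Q.V n p) :
    X.proj.app (X.Q.d h x) = X.proj.app (X.Q.d h (X.Q00.incl.app (X.proj.app x))) := by
  let S : SubOperad X.Q.toGrOperad :=
    { carrier := fun n p =>
        { carrier := {x | ∀ (q : ℤ) (h : p = q + 1), X.proj.app (X.Q.d h x)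
            = X.proj.app (X.Q.d h (X.Q00.incl.app (X.proj.app x)))}
          add_mem' := by
            intro x y hx hy q h
            simp only [map_add, hx q h, hy q h]
          zero_mem' := by
            intro q h
            simp only [map_zero]
          smul_mem' := by
            intro c x hx q h
            simp only [map_smul, hx q h] }
      act_mem := by
        intro n p σ x hx q h
        rw [X.proj.map_act, X.Q00.incl.map_act, X.Q.d_act, X.Q.d_act, X.proj.map_act,
          X.proj.map_act, hx q h]
      comp_mem := by
        intro m n r p q t hr ht i x y hx hy t' h
        have hp : p = (p - 1) + 1 := by omega
        have hq : q = (q - 1) + 1 := by omega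
        rw [X.proj.map_comp, X.Q00.incl.map_comp,
          X.Q.d_comp hr ht hp hq h (by omega) (by omega),
          X.Q.d_comp hr ht hp hq h (by omega) (by omega), Units.smul_def, Units.smul_def,
          map_add, map_add, map_zsmul, map_zsmul, X.proj.map_comp, X.proj.map_comp,
          X.proj.map_comp, X.proj.map_comp, ← hx _ hp, ← hy _ hq, X.proj_coe, X.proj_coe] }
  have hgen : ∀ n ≤ 1, curvedOp X.str n ∈ S.carrier n (-1) := by
    intro n hn q h
    obtain rfl : q = -2 := by omega
    have e : X.proj.app (curvedOp X.str n) = 0 := by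
      interval_cases n
      · exact X.proj_zero
      · exact X.proj_one
    rw [e, (isCurved_curvedOp X.str).d_eq, map_neg, X.proj_quad hn]
    simp only [map_zero, neg_zero]
  refine X.mem_of_generators S ?_ (hgen 0 (by omega)) (hgen 1 le_rfl) x q h
  intro n p x hx q h
  exact congrArg (fun z => X.proj.app (X.Q.d h z))
    (congrArg X.Q00.incl.app (X.proj_coe ⟨x, hx⟩)).symm

/-- `Q00` with the differential given by `Q00 ≅ Q / (ℓ₀, ℓ₁)`. -/
def dgQ00 (X : Twist k s) : DGOperad k s where
  toGrOperad := X.Q00.toGrOperad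
  d h := X.proj.app ∘ₗ X.Q.d h ∘ₗ X.Q00.incl.app
  d_d h h' x := by
    refine (X.proj_d h' (X.Q.d h (X.Q00.incl.app x))).symm.trans ?_
    rw [X.Q.d_d]
    exact map_zero _
  d_act h σ x := by
    simp only [LinearMap.comp_apply, X.Q00.incl.map_act, X.Q.d_act, X.proj.map_act]
  d_comp hr ht hp hq htt h₁ h₂ i x y := by
    have hx : X.proj.app (X.Q00.incl.app x) = x := X.proj_coe x
    have hy : X.proj.app (X.Q00.incl.app y) = y := X.proj_coe y
    simp only [LinearMap.comp_apply, X.Q00.incl.map_comp]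
    rw [X.Q.d_comp hr ht hp hq htt h₁ h₂, Units.smul_def, map_add, map_zsmul, X.proj.map_comp,
      X.proj.map_comp, hx, hy, Units.smul_def]

/-- The projection `Q → Q00` is a morphism of dg operads. -/
def dgProj (X : Twist k s) : X.Q ⟶ X.dgQ00 := DGHom.mk X.proj fun h x => X.proj_d h x

/-- The morphism `L∞ → Q00`; it sends `ℓ n` to the image of `ℓ n` in `Q / (ℓ₀, ℓ₁) ≅ Q00`. -/
def flatStr (X : Twist k s) : flatInf k s ⟶ X.dgQ00 :=
  presentedLift X.dgQ00 (curvedOp (X.str ≫ X.dgProj))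
    { toIsCurved := isCurved_curvedOp _
      zero_eq := X.proj_zero
      one_eq := X.proj_one }

/-- The restriction `Q00 → Q00'` of a morphism of twisting structures. -/
def grMap {X Y : Twist k s} (f : X ⟶ Y) : GrHom X.Q00.toGrOperad Y.Q00.toGrOperad where
  app {n p} := ((gr f.hom).app (n := n) (p := p)).restrict fun x hx => f.map_mem x hx
  map_act σ x := Subtype.ext ((gr f.hom).map_act σ x.1)
  map_comp hr ht i x y := Subtype.ext ((gr f.hom).map_comp hr ht i x.1 y.1)

theorem map_curvedOp {X Y : Twist k s} (f : X ⟶ Y) (n : ℕ) :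
    (gr f.hom).app (curvedOp X.str n) = curvedOp Y.str n :=
  congrArg (fun g => curvedOp g n) f.w

theorem grMap_proj {X Y : Twist k s} (f : X ⟶ Y) {n : ℕ} {p : ℤ} (x : X.Q.V n p) :
    (grMap f).app (X.proj.app x) = Y.proj.app ((gr f.hom).app x) := by
  have key : X.proj.trans (grMap f) = (gr f.hom).trans Y.proj := by
    refine (X.free Y.Q00.toGrOperad (grMap f) 0 0).unique ⟨?_, ?_, ?_⟩ ⟨?_, ?_, ?_⟩
    · exact GrHom.ext fun n p x => congrArg (grMap f).app (X.proj_coe x)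
    · exact (congrArg (grMap f).app X.proj_zero).trans (map_zero _)
    · exact (congrArg (grMap f).app X.proj_one).trans (map_zero _)
    · exact GrHom.ext fun n p x => Y.proj_coe ((grMap f).app x)
    · exact (congrArg Y.proj.app (map_curvedOp f 0)).trans Y.proj_zero
    · exact (congrArg Y.proj.app (map_curvedOp f 1)).trans Y.proj_one
  exact congrArg (fun g : GrHom X.Q.toGrOperad Y.Q00.toGrOperad => g.app x) key

/-- The restriction `Q00 → Q00'` is a morphism of dg operads. -/
def dgMap {X Y : Twist k s} (f : X ⟶ Y) : X.dgQ00 ⟶ Y.dgQ00 :=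
  DGHom.mk (grMap f) fun h x => (grMap_proj f (X.Q.d h (X.Q00.incl.app x))).trans
    (congrArg Y.proj.app (gr_map_d f.hom h (X.Q00.incl.app x)))

variable (k s) in
/-- The forgetful functor `Twist∞ → (L∞ ↓ Op)` that sends `(Q, Q00)` to `L∞ → Q00`. -/
def forget : Twist k s ⥤ Under (flatInf k s) where
  obj X := Under.mk X.flatStr
  map {X Y} f := Under.homMk (dgMap f) (presented_hom_ext fun n =>
    (grMap_proj f (curvedOp X.str n)).trans (congrArg Y.proj.app (map_curvedOp f n)))
  map_id _ := Under.UnderMorphism.ext (DGHom.ext fun _ _ _ => rfl)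
  map_comp _ _ := Under.UnderMorphism.ext (DGHom.ext fun _ _ _ => rfl)

end Twist

/-! ### The completed coproduct with a free operation `α` of arity zero and degree zero -/

/-- Formal expressions in the operations of `P` and a generator `α` of arity `0` and degree `0`;
the last index counts the occurrences of `α`. -/
inductive WTerm (P : GrOperad k s) : ℕ → ℤ → ℕ → Type u
  | of {n : ℕ} {p : ℤ} : P.V n p → WTerm P n p 0
  | alpha : WTerm P 0 0 1
  | zero {n : ℕ} {p : ℤ} {w : ℕ} : WTerm P n p w
  | add {n : ℕ} {p : ℤ} {w : ℕ} : WTerm P n p w → WTerm P n p w → WTerm P n p w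
  | smul {n : ℕ} {p : ℤ} {w : ℕ} : k → WTerm P n p w → WTerm P n p w
  | act {n : ℕ} {p : ℤ} {w : ℕ} : s.perms n → WTerm P n p w → WTerm P n p w
  | comp {m n r : ℕ} {p q t : ℤ} {v v' w : ℕ} (hr : r + 1 = m + n) (ht : t = p + q)
      (hw : v + v' = w) (i : Fin m) : WTerm P m p v → WTerm P n q v' → WTerm P r t w

/-- The value of an expression in a graded operad under `P` with an element `a` in place
of `α`. -/
def WTerm.eval {P : GrOperad k s} (R : GrOperad k s) (φ : GrHom P R) (a : R.V 0 0) :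
    {n : ℕ} → {p : ℤ} → {w : ℕ} → WTerm P n p w → R.V n p
  | _, _, _, .of x => φ.app x
  | _, _, _, .alpha => a
  | _, _, _, .zero => 0
  | _, _, _, .add x y => x.eval R φ a + y.eval R φ a
  | _, _, _, .smul c x => c • x.eval R φ a
  | _, _, _, .act σ x => R.act σ (x.eval R φ a)
  | _, _, _, .comp hr ht _ i x y => R.comp hr ht i (x.eval R φ a) (y.eval R φ a)

/-- Two expressions are identified if they agree in every graded operad under `P` with a chosen
element of arity `0` and degree `0`, i.e. if they agree in `P ∨ [α]`. -/
def coprodSetoid (P : GrOperad k s) (n : ℕ) (p : ℤ) (w : ℕ) : Setoid (WTerm P n p w) where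
  r x y := ∀ (R : GrOperad k s) (φ : GrHom P R) (a : R.V 0 0), x.eval R φ a = y.eval R φ a
  iseqv := ⟨fun _ _ _ _ => rfl, fun h R φ a => (h R φ a).symm,
    fun h h' R φ a => (h R φ a).trans (h' R φ a)⟩

/-- The part of the coproduct `P ∨ [α]` of arity `n`, degree `p` and degree `w` in `α`. -/
def CoprodV (P : GrOperad k s) (n : ℕ) (p : ℤ) (w : ℕ) : Type u :=
  Quotient (coprodSetoid P n p w)

namespace CoprodV

variable {P : GrOperad k s}

/-- Evaluation in a graded operad under `P` with a chosen element. -/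
def eval (R : GrOperad k s) (φ : GrHom P R) (a : R.V 0 0) {n : ℕ} {p : ℤ} {w : ℕ}
    (x : CoprodV P n p w) : R.V n p :=
  Quotient.lift (fun t : WTerm P n p w => t.eval R φ a)
    (fun _ _ (h : (coprodSetoid P n p w).r _ _) => h R φ a) x

theorem ext {n : ℕ} {p : ℤ} {w : ℕ} {x y : CoprodV P n p w}
    (h : ∀ (R : GrOperad k s) (φ : GrHom P R) (a : R.V 0 0), eval R φ a x = eval R φ a y) :
    x = y := by
  induction x using Quotient.inductionOn with | _ x
  induction y using Quotient.inductionOn with | _ y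
  exact Quotient.sound fun R φ a => h R φ a

/-- The operations of `P` in `P ∨ [α]`. -/
def of {n : ℕ} {p : ℤ} (x : P.V n p) : CoprodV P n p 0 := Quotient.mk _ (.of x)

variable (P) in
/-- The operation `α` of `P ∨ [α]`. -/
def alpha : CoprodV P 0 0 1 := Quotient.mk _ .alpha

instance (n : ℕ) (p : ℤ) (w : ℕ) : Zero (CoprodV P n p w) := ⟨Quotient.mk _ .zero⟩

instance (n : ℕ) (p : ℤ) (w : ℕ) : Add (CoprodV P n p w) :=
  ⟨Quotient.map₂ .add fun _ _ (h : (coprodSetoid P n p w).r _ _)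
    _ _ (h' : (coprodSetoid P n p w).r _ _) R φ a => by
      simp only [WTerm.eval, h R φ a, h' R φ a]⟩

instance (n : ℕ) (p : ℤ) (w : ℕ) : SMul k (CoprodV P n p w) :=
  ⟨fun c => Quotient.map (.smul c) fun _ _ (h : (coprodSetoid P n p w).r _ _) R φ a => by
    simp only [WTerm.eval, h R φ a]⟩

instance (n : ℕ) (p : ℤ) (w : ℕ) : Neg (CoprodV P n p w) := ⟨fun x => (-1 : k) • x⟩

/-- The group action, on classes. -/
def act {n : ℕ} {p : ℤ} {w : ℕ} (σ : s.perms n) : CoprodV P n p w → CoprodV P n p w :=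
  Quotient.map (.act σ) fun _ _ (h : (coprodSetoid P n p w).r _ _) R φ a => by
    simp only [WTerm.eval, h R φ a]

/-- Partial composition, on classes. -/
def comp {m n r : ℕ} {p q t : ℤ} {v v' w : ℕ} (hr : r + 1 = m + n) (ht : t = p + q)
    (hw : v + v' = w) (i : Fin m) : CoprodV P m p v → CoprodV P n q v' → CoprodV P r t w :=
  Quotient.map₂ (.comp hr ht hw i) fun _ _ (h : (coprodSetoid P m p v).r _ _)
    _ _ (h' : (coprodSetoid P n q v').r _ _) R φ a => by
      simp only [WTerm.eval, h R φ a, h' R φ a]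

section eval

variable (R : GrOperad k s) (φ : GrHom P R) (a : R.V 0 0)

@[simp] theorem eval_of {n : ℕ} {p : ℤ} (x : P.V n p) : eval R φ a (of x) = φ.app x := rfl

@[simp] theorem eval_alpha : eval R φ a (alpha P) = a := rfl

@[simp] theorem eval_zero {n : ℕ} {p : ℤ} {w : ℕ} :
    eval R φ a (0 : CoprodV P n p w) = 0 := rfl

@[simp] theorem eval_add {n : ℕ} {p : ℤ} {w : ℕ} (x y : CoprodV P n p w) :
    eval R φ a (x + y) = eval R φ a x + eval R φ a y :=
  Quotient.inductionOn₂ x y fun _ _ => rfl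

@[simp] theorem eval_smul {n : ℕ} {p : ℤ} {w : ℕ} (c : k) (x : CoprodV P n p w) :
    eval R φ a (c • x) = c • eval R φ a x :=
  Quotient.inductionOn x fun _ => rfl

@[simp] theorem eval_act {n : ℕ} {p : ℤ} {w : ℕ} (σ : s.perms n) (x : CoprodV P n p w) :
    eval R φ a (act σ x) = R.act σ (eval R φ a x) :=
  Quotient.inductionOn x fun _ => rfl

@[simp] theorem eval_comp {m n r : ℕ} {p q t : ℤ} {v v' w : ℕ} (hr : r + 1 = m + n)
    (ht : t = p + q) (hw : v + v' = w) (i : Fin m) (x : CoprodV P m p v) (y : CoprodV P n q v') :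
    eval R φ a (comp hr ht hw i x y) = R.comp hr ht i (eval R φ a x) (eval R φ a y) :=
  Quotient.inductionOn₂ x y fun _ _ => rfl

end eval

instance (n : ℕ) (p : ℤ) (w : ℕ) : AddCommGroup (CoprodV P n p w) where
  add_assoc _ _ _ := ext fun _ _ _ => by simp [add_assoc]
  zero_add _ := ext fun _ _ _ => by simp
  add_zero _ := ext fun _ _ _ => by simp
  add_comm _ _ := ext fun _ _ _ => by simp [add_comm]
  neg_add_cancel x := ext fun R φ a => by
    change eval R φ a ((-1 : k) • x + x) = 0
    simp
  nsmul := nsmulRec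
  zsmul := zsmulRec

instance (n : ℕ) (p : ℤ) (w : ℕ) : Module k (CoprodV P n p w) where
  one_smul _ := ext fun _ _ _ => by simp
  mul_smul _ _ _ := ext fun _ _ _ => by simp [mul_smul]
  smul_zero _ := ext fun _ _ _ => by simp
  smul_add _ _ _ := ext fun _ _ _ => by simp
  add_smul _ _ _ := ext fun _ _ _ => by simp [add_smul]
  zero_smul _ := ext fun _ _ _ => by simp

/-- Evaluation as a linear map. -/
def evalL (R : GrOperad k s) (φ : GrHom P R) (a : R.V 0 0) {n : ℕ} {p : ℤ} {w : ℕ} :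
    CoprodV P n p w →ₗ[k] R.V n p where
  toFun := eval R φ a
  map_add' := eval_add R φ a
  map_smul' := eval_smul R φ a

/-- The group action on a homogeneous part of `P ∨ [α]`. -/
def actL {n : ℕ} {p : ℤ} {w : ℕ} (σ : s.perms n) : CoprodV P n p w →ₗ[k] CoprodV P n p w where
  toFun := act σ
  map_add' _ _ := ext fun _ _ _ => by simp
  map_smul' _ _ := ext fun _ _ _ => by simp

/-- Partial composition of homogeneous elements of `P ∨ [α]`. -/
def compL {m n r : ℕ} {p q t : ℤ} {v v' w : ℕ} (hr : r + 1 = m + n) (ht : t = p + q)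
    (hw : v + v' = w) (i : Fin m) :
    CoprodV P m p v →ₗ[k] CoprodV P n q v' →ₗ[k] CoprodV P r t w :=
  LinearMap.mk₂ k (comp hr ht hw i)
    (fun _ _ _ => ext fun _ _ _ => by simp) (fun _ _ _ => ext fun _ _ _ => by simp)
    (fun _ _ _ => ext fun _ _ _ => by simp) (fun _ _ _ => ext fun _ _ _ => by simp)

end CoprodV

/-- The operations of the completed coproduct: formal series `∑ x_w` whose term `x_w` lies in
`P ∨ [α]` and is homogeneous of degree `w` in `α`. -/
def HatV (P : GrOperad k s) (n : ℕ) (p : ℤ) : Type u := ∀ w : ℕ, CoprodV P n p w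

namespace HatV

variable {P : GrOperad k s}

instance (n : ℕ) (p : ℤ) : AddCommGroup (HatV P n p) :=
  inferInstanceAs (AddCommGroup (∀ w : ℕ, CoprodV P n p w))

instance (n : ℕ) (p : ℤ) : Module k (HatV P n p) :=
  inferInstanceAs (Module k (∀ w : ℕ, CoprodV P n p w))

/-- The group acts on series term by term. -/
def actL {n : ℕ} {p : ℤ} (σ : s.perms n) : HatV P n p →ₗ[k] HatV P n p where
  toFun x w := CoprodV.actL σ (x w)
  map_add' _ _ := funext fun _ => map_add _ _ _
  map_smul' c x := funext fun w => (CoprodV.actL σ).map_smul c (x w)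

/-- Partial composition of series: the term of degree `w` of `x ∘_i y` is
`∑_{v + v' = w} x_v ∘_i y_v'`. -/
def comp {m n r : ℕ} {p q t : ℤ} (hr : r + 1 = m + n) (ht : t = p + q) (i : Fin m)
    (x : HatV P m p) (y : HatV P n q) : HatV P r t := fun w =>
  ∑ v : {v // v ∈ Finset.HasAntidiagonal.antidiagonal w},
    CoprodV.compL hr ht (Finset.HasAntidiagonal.mem_antidiagonal.1 v.2) i (x v.1.1) (y v.1.2)

/-- Evaluation of the terms of a series. -/
def ev (R : GrOperad k s) (φ : GrHom P R) (a : R.V 0 0) {n : ℕ} {p : ℤ} (w : ℕ) :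
    HatV P n p →ₗ[k] R.V n p where
  toFun x := CoprodV.evalL R φ a (x w)
  map_add' _ _ := CoprodV.eval_add R φ a _ _
  map_smul' _ _ := CoprodV.eval_smul R φ a _ _

theorem ext {n : ℕ} {p : ℤ} {x y : HatV P n p}
    (h : ∀ (R : GrOperad k s) (φ : GrHom P R) (a : R.V 0 0) (w : ℕ), ev R φ a w x = ev R φ a w y) :
    x = y :=
  funext fun w => CoprodV.ext fun R φ a => h R φ a w

theorem ev_act (R : GrOperad k s) (φ : GrHom P R) (a : R.V 0 0) {n : ℕ} {p : ℤ} (w : ℕ)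
    (σ : s.perms n) (x : HatV P n p) : ev R φ a w (actL σ x) = R.act σ (ev R φ a w x) :=
  CoprodV.eval_act R φ a σ (x w)

theorem ev_comp (R : GrOperad k s) (φ : GrHom P R) (a : R.V 0 0) {m n r : ℕ} {p q t : ℤ}
    (hr : r + 1 = m + n) (ht : t = p + q) (i : Fin m) (x : HatV P m p) (y : HatV P n q) (w : ℕ) :
    ev R φ a w (comp hr ht i x y)
      = ∑ v ∈ Finset.HasAntidiagonal.antidiagonal w, R.comp hr ht i (ev R φ a v.1 x) (ev R φ a v.2 y) := by
  rw [← Finset.sum_coe_sort]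
  refine (map_sum (CoprodV.evalL R φ a) _ _).trans (Finset.sum_congr rfl fun v _ => ?_)
  exact CoprodV.eval_comp R φ a hr ht _ i _ _

/-- Partial composition of series, as a bilinear map. -/
def compL {m n r : ℕ} {p q t : ℤ} (hr : r + 1 = m + n) (ht : t = p + q) (i : Fin m) :
    HatV P m p →ₗ[k] HatV P n q →ₗ[k] HatV P r t :=
  LinearMap.mk₂ k (comp hr ht i)
    (fun _ _ _ => ext fun _ _ _ _ => by simp [ev_comp, Finset.sum_add_distrib])
    (fun _ _ _ => ext fun _ _ _ _ => by simp [ev_comp, Finset.smul_sum])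
    (fun _ _ _ => ext fun _ _ _ _ => by simp [ev_comp, Finset.sum_add_distrib])
    (fun _ _ _ => ext fun _ _ _ _ => by simp [ev_comp, Finset.smul_sum])

theorem ev_compL (R : GrOperad k s) (φ : GrHom P R) (a : R.V 0 0) {m n r : ℕ} {p q t : ℤ}
    (hr : r + 1 = m + n) (ht : t = p + q) (i : Fin m) (x : HatV P m p) (y : HatV P n q) (w : ℕ) :
    ev R φ a w (compL hr ht i x y)
      = ∑ v ∈ Finset.HasAntidiagonal.antidiagonal w, R.comp hr ht i (ev R φ a v.1 x) (ev R φ a v.2 y) :=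
  ev_comp R φ a hr ht i x y w

end HatV

open HatV in
/-- The completed coproduct of `P` and `[α]`, as a graded operad. -/
def hat (P : GrOperad k s) : GrOperad k s where
  V := HatV P
  act :=
    { toFun := HatV.actL
      map_one' := LinearMap.ext fun _ => HatV.ext fun _ _ _ _ => by simp [ev_act]
      map_mul' := fun _ _ => LinearMap.ext fun _ => HatV.ext fun _ _ _ _ => by simp [ev_act] }
  comp := HatV.compL
  comp_act hr ht i σ τ ρ h x y := HatV.ext fun R φ a w => by
    simp only [MonoidHom.coe_mk, OneHom.coe_mk, ev_act, ev_compL, map_sum]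
    exact Finset.sum_congr rfl fun v _ => R.comp_act hr ht i σ τ ρ h _ _
  comp_seq ha hb hr hr' hpq hqt he he' i j c hc x y z := HatV.ext fun R φ a w => by
    simp only [ev_compL, map_sum, LinearMap.sum_apply, Finset.sum_sigma']
    refine Finset.sum_nbij'
      (fun v => ⟨(v.2.1, v.2.2 + v.1.2), (v.2.2, v.1.2)⟩)
      (fun v => ⟨(v.1.1 + v.2.1, v.2.2), (v.1.1, v.2.1)⟩) ?_ ?_ ?_ ?_ ?_
    · rintro ⟨⟨_, _⟩, ⟨_, _⟩⟩ h
      simp only [Finset.mem_sigma, Finset.HasAntidiagonal.mem_antidiagonal] at h ⊢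
      obtain ⟨rfl, rfl⟩ := h
      exact ⟨by ring, by trivial⟩
    · rintro ⟨⟨_, _⟩, ⟨_, _⟩⟩ h
      simp only [Finset.mem_sigma, Finset.HasAntidiagonal.mem_antidiagonal] at h ⊢
      obtain ⟨rfl, rfl⟩ := h
      exact ⟨by ring, by trivial⟩
    · rintro ⟨⟨_, _⟩, ⟨_, _⟩⟩ h
      simp only [Finset.mem_sigma, Finset.HasAntidiagonal.mem_antidiagonal] at h
      obtain ⟨rfl, rfl⟩ := h
      rfl
    · rintro ⟨⟨_, _⟩, ⟨_, _⟩⟩ h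
      simp only [Finset.mem_sigma, Finset.HasAntidiagonal.mem_antidiagonal] at h
      obtain ⟨rfl, rfl⟩ := h
      rfl
    · intro v _
      exact R.comp_seq ha hb hr hr' hpq hqt he he' i j c hc _ _ _
  comp_par ha hb hr hr' hpq hpt he he' i j c c' hij hc hc' x y z := HatV.ext fun R φ a w => by
    rw [Units.smul_def, map_zsmul, ← Units.smul_def]
    simp only [ev_compL, map_sum, LinearMap.sum_apply, Finset.sum_sigma', Finset.smul_sum]
    refine Finset.sum_nbij'
      (fun v => ⟨(v.2.1 + v.1.2, v.2.2), (v.2.1, v.1.2)⟩)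
      (fun v => ⟨(v.2.1 + v.1.2, v.2.2), (v.2.1, v.1.2)⟩) ?_ ?_ ?_ ?_ ?_
    · rintro ⟨⟨_, _⟩, ⟨_, _⟩⟩ h
      simp only [Finset.mem_sigma, Finset.HasAntidiagonal.mem_antidiagonal] at h ⊢
      obtain ⟨rfl, rfl⟩ := h
      exact ⟨by ring, by trivial⟩
    · rintro ⟨⟨_, _⟩, ⟨_, _⟩⟩ h
      simp only [Finset.mem_sigma, Finset.HasAntidiagonal.mem_antidiagonal] at h ⊢
      obtain ⟨rfl, rfl⟩ := h
      exact ⟨by ring, by trivial⟩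
    · rintro ⟨⟨_, _⟩, ⟨_, _⟩⟩ h
      simp only [Finset.mem_sigma, Finset.HasAntidiagonal.mem_antidiagonal] at h
      obtain ⟨rfl, rfl⟩ := h
      rfl
    · rintro ⟨⟨_, _⟩, ⟨_, _⟩⟩ h
      simp only [Finset.mem_sigma, Finset.HasAntidiagonal.mem_antidiagonal] at h
      obtain ⟨rfl, rfl⟩ := h
      rfl
    · intro v _
      exact R.comp_par ha hb hr hr' hpq hpt he he' i j c c' hij hc hc' _ _ _

/-- An operation of `P`, as a series concentrated in degree `0` in `α`. -/
def hatOf {P : GrOperad k s} {n : ℕ} {p : ℤ} (x : P.V n p) : (hat P).V n p :=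
  Pi.single (M := CoprodV P n p) 0 (CoprodV.of x)

/-- The operation `α`, as a series concentrated in degree `1` in `α`. -/
def hatAlpha (P : GrOperad k s) : (hat P).V 0 0 :=
  Pi.single (M := CoprodV P 0 0) 1 (CoprodV.alpha P)

/-- The `α`-filtration: the series all of whose terms have degree at least `m` in `α`. -/
def HatFilt {P : GrOperad k s} (m : ℕ) {n : ℕ} {p : ℤ} (x : (hat P).V n p) : Prop :=
  ∀ w < m, (x : HatV P n p) w = 0

/-- Given a decreasing filtration `F` of `P`: the elements of a homogeneous part of `P ∨ [α]` that
are linear combinations of composites of copies of `α` and operations in `F K₁`, `F K₂`, …, where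
`K₁ + K₂ + ⋯ ≥ K`. -/
inductive CoprodFilt {P : GrOperad k s} (F : ℕ → ∀ (n : ℕ) (p : ℤ), P.V n p → Prop) :
    ℕ → {n : ℕ} → {p : ℤ} → {w : ℕ} → CoprodV P n p w → Prop
  | of {K n : ℕ} {p : ℤ} (x : P.V n p) : F K n p x → CoprodFilt F K (CoprodV.of x)
  | alpha : CoprodFilt F 0 (CoprodV.alpha P)
  | zero (K n : ℕ) (p : ℤ) (w : ℕ) : CoprodFilt F K (0 : CoprodV P n p w)
  | add {K n : ℕ} {p : ℤ} {w : ℕ} (x y : CoprodV P n p w) :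
      CoprodFilt F K x → CoprodFilt F K y → CoprodFilt F K (x + y)
  | smul {K n : ℕ} {p : ℤ} {w : ℕ} (c : k) (x : CoprodV P n p w) :
      CoprodFilt F K x → CoprodFilt F K (c • x)
  | act {K n : ℕ} {p : ℤ} {w : ℕ} (σ : s.perms n) (x : CoprodV P n p w) :
      CoprodFilt F K x → CoprodFilt F K (CoprodV.actL σ x)
  | comp {K L m n r : ℕ} {p q t : ℤ} {v v' w : ℕ} (hr : r + 1 = m + n) (ht : t = p + q)
      (hw : v + v' = w) (i : Fin m) (x : CoprodV P m p v) (y : CoprodV P n q v') :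
      CoprodFilt F K x → CoprodFilt F L y → CoprodFilt F (K + L) (CoprodV.compL hr ht hw i x y)
  | mono {K L n : ℕ} {p : ℤ} {w : ℕ} (x : CoprodV P n p w) :
      K ≤ L → CoprodFilt F L x → CoprodFilt F K x

/-- Given a decreasing filtration `F` of `P`: the total filtration of the completed coproduct, that
combines `F` and the `α`-filtration. -/
def HatTotalFilt {P : GrOperad k s} (F : ℕ → ∀ (n : ℕ) (p : ℤ), P.V n p → Prop) (m : ℕ)
    {n : ℕ} {p : ℤ} (x : (hat P).V n p) : Prop :=
  ∀ w : ℕ, CoprodFilt F (m - w) ((x : HatV P n p) w)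

/-! ### The twisting comonad -/

/-- `x (a, …, a, -, …, -)`, with `a` in the first `j` inputs. -/
def plugFirst (C : GrOperad k s) (a : C.V 0 0) {n : ℕ} {p : ℤ} : (j : ℕ) → C.V (n + j) p → C.V n p
  | 0, x => x
  | j + 1, x => plugFirst C a j
      (C.comp (m := n + (j + 1)) (n := 0) (r := n + j) rfl (by omega) ⟨0, by omega⟩ x a)

/-- The sum of all operations obtained from `x` by inserting `a` in `j` of its inputs, all of
them smaller than `b`. (The largest of these inputs, `i`, is filled first.) -/
def plugAny (C : GrOperad k s) (a : C.V 0 0) {n : ℕ} {p : ℤ} :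
    (j b : ℕ) → C.V (n + j) p → C.V n p
  | 0, _, x => x
  | j + 1, b, x => ∑ i : Fin (n + (j + 1)), if (i : ℕ) < b then
      plugAny C a j i (C.comp (n := 0) (r := n + j) rfl (by omega) i x a) else 0

/-- The twisted operations: `ℓ_n^α = ∑_j (1 / j!) ℓ_{n+j} (α^j, -, …, -)` in the symmetric case, and
`μ_n^α = ∑ μ_{n + r_0 + ⋯ + r_n} (α^{r_0}, -, α^{r_1}, -, …, -, α^{r_n})` in the nonsymmetric
case. -/
def twistedOp : {s : Flavour} → (P : GrOperad k s) → (∀ n, P.V n (-1)) → (n : ℕ) →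
    (hat P).V n (-1)
  | .symmetric, P, ℓ, n => fun j =>
      (j.factorial : k)⁻¹ • (plugFirst (hat P) (hatAlpha P) j (hatOf (ℓ (n + j))) : HatV P n (-1)) j
  | .nonsymmetric, P, ℓ, n => fun j =>
      (plugAny (hat P) (hatAlpha P) j (n + j) (hatOf (ℓ (n + j))) : HatV P n (-1)) j

/-- The operation `ℓ n` of an operad under `L∞` (or `A∞`). -/
def flatOp (P : Under (flatInf k s)) (n : ℕ) : P.right.V n (-1) :=
  (gr (P := flatInf k s) (R := P.right) P.hom).app (presentedGen IsFlat n)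

/-- The graded operad underlying an operad under `L∞` (or `A∞`). -/
abbrev und (P : Under (flatInf k s)) : GrOperad k s := P.right.toGrOperad

/-- The non-dg morphism underlying a morphism of operads under `L∞` (or `A∞`). -/
def undMap {P R : Under (flatInf k s)} (f : P ⟶ R) : GrHom (und P) (und R) := gr f.right

/-- `T` is the twisting comonad `Tw` when the graded operad underlying `T P` is identified by `θ`
with the completed coproduct of `P` and `[α]`.

The differential, the action on morphisms, the counit and the comultiplication are prescribed on
the operations of `P` and on `α`, and continuous with respect to the `α`-filtrations. -/
structure IsTwistingVia (T : Comonad (Under (flatInf k s)))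
    (θ : ∀ P : Under (flatInf k s), GrHom (und (T.obj P)) (hat (und P))) : Prop where
  bijective : ∀ (P : Under (flatInf k s)) (n : ℕ) (p : ℤ),
    Function.Bijective ((θ P).app (n := n) (p := p))
  /-- `L∞ → Tw P` sends `ℓ n` to the twisted operation, for `n ≥ 2`. -/
  op : ∀ (P : Under (flatInf k s)) (n : ℕ), 1 < n →
    (θ P).app (flatOp (T.obj P) n) = twistedOp (und P) (flatOp P) n
  /-- `d ν = d_P ν + [ℓ_1^α, ν]` for `ν` in `P`. -/
  d_of : ∀ (P : Under (flatInf k s)) {n : ℕ} {p q : ℤ} (h : p = q + 1)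
    (x : (und (T.obj P)).V n p) (ν : (und P).V n p), (θ P).app x = hatOf ν →
    (θ P).app ((T.obj P).right.d h x)
      = hatOf (P.right.d h ν)
        + (hat (und P)).bracket (twistedOp (und P) (flatOp P) 1) h (hatOf ν)
  /-- `d α = - ℓ_0^α + [ℓ_1^α, α]`. -/
  d_alpha : ∀ (P : Under (flatInf k s)) (x : (und (T.obj P)).V 0 0),
    (θ P).app x = hatAlpha (und P) →
    (θ P).app ((T.obj P).right.d (q := -1) (by norm_num) x)
      = - twistedOp (und P) (flatOp P) 0
        + (hat (und P)).bracket (twistedOp (und P) (flatOp P) 1) (by norm_num) (hatAlpha (und P))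
  d_filt : ∀ (P : Under (flatInf k s)) (m : ℕ) {n : ℕ} {p q : ℤ} (h : p = q + 1)
    (x : (und (T.obj P)).V n p), HatFilt m ((θ P).app x) →
    HatFilt m ((θ P).app ((T.obj P).right.d h x))
  /-- `T f` is `f` on the operations of `P`. -/
  map_of : ∀ {P R : Under (flatInf k s)} (f : P ⟶ R) {n : ℕ} {p : ℤ}
    (x : (und (T.obj P)).V n p) (ν : (und P).V n p), (θ P).app x = hatOf ν →
    (θ R).app ((undMap (T.map f)).app x) = hatOf ((undMap f).app ν)
  /-- `T f` sends `α` to `α`. -/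
  map_alpha : ∀ {P R : Under (flatInf k s)} (f : P ⟶ R) (x : (und (T.obj P)).V 0 0),
    (θ P).app x = hatAlpha (und P) →
    (θ R).app ((undMap (T.map f)).app x) = hatAlpha (und R)
  map_filt : ∀ {P R : Under (flatInf k s)} (f : P ⟶ R) (m : ℕ) {n : ℕ} {p : ℤ}
    (x : (und (T.obj P)).V n p), HatFilt m ((θ P).app x) →
    HatFilt m ((θ R).app ((undMap (T.map f)).app x))
  /-- The counit sends `ν` to `ν`. -/
  counit_of : ∀ (P : Under (flatInf k s)) {n : ℕ} {p : ℤ}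
    (x : (und (T.obj P)).V n p) (ν : (und P).V n p), (θ P).app x = hatOf ν →
    (undMap (T.ε.app P)).app x = ν
  /-- The counit sends `α`, and all series of positive order in `α`, to zero. -/
  counit_filt : ∀ (P : Under (flatInf k s)) {n : ℕ} {p : ℤ}
    (x : (und (T.obj P)).V n p), HatFilt 1 ((θ P).app x) →
    (undMap (T.ε.app P)).app x = 0
  /-- The comultiplication sends `ν` to `ν`. -/
  comul_of : ∀ (P : Under (flatInf k s)) {n : ℕ} {p : ℤ}
    (x : (und (T.obj P)).V n p) (ν : (und P).V n p), (θ P).app x = hatOf ν →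
    (θ (T.obj P)).app ((undMap (T.δ.app P)).app x) = hatOf x
  /-- The comultiplication sends `α` to `α' + α`, where `α'` is the operation adjoined by the
  second instance of `T`. -/
  comul_alpha : ∀ (P : Under (flatInf k s)) (x : (und (T.obj P)).V 0 0),
    (θ P).app x = hatAlpha (und P) →
    (θ (T.obj P)).app ((undMap (T.δ.app P)).app x) = hatAlpha (und (T.obj P)) + hatOf x
  comul_filt : ∀ (P : Under (flatInf k s)) (m : ℕ) {n : ℕ} {p : ℤ}
    (x : (und (T.obj P)).V n p), HatFilt m ((θ P).app x) →
    HatTotalFilt (fun K _ _ y => HatFilt K ((θ P).app y)) m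
      ((θ (T.obj P)).app ((undMap (T.δ.app P)).app x))

/-- `T` is (isomorphic to) Willwacher's twisting comonad `Tw` on operads under `L∞`, or its
nonsymmetric analogue on nonsymmetric operads under `A∞`. -/
def IsTwistingComonad (T : Comonad (Under (flatInf k s))) : Prop :=
  ∃ θ : ∀ P : Under (flatInf k s), GrHom (und (T.obj P)) (hat (und P)), IsTwistingVia T θ

end OperadicTwisting

end

noncomputable section

namespace OperadicTwisting

variable {k : Type u} [Field k] {s : Flavour}

/-! ### Signs -/

@[simp] theorem map_sgn {V W : Type u} [AddCommGroup V] [AddCommGroup W] [Module k V] [Module k W]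
    (f : V →ₗ[k] W) (ε : ℤˣ) (x : V) : f (ε • x) = ε • f x := by
  rw [Units.smul_def, map_zsmul, ← Units.smul_def]

@[simp] theorem sgn_apply {V W : Type u} [AddCommGroup V] [AddCommGroup W] [Module k V] [Module k W]
    (f : V →ₗ[k] W) (ε : ℤˣ) (x : V) : (ε • f) x = ε • f x := rfl

theorem sgn_smul_comm {V : Type u} [AddCommGroup V] [Module k V] (ε : ℤˣ) (c : k) (x : V) :
    ε • c • x = c • ε • x := by
  rw [Units.smul_def, Units.smul_def, smul_comm]

theorem sgn_eq {a b c : ℤ} (h : a - b = c + c) : a.negOnePow = b.negOnePow :=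
  (Int.negOnePow_eq_iff a b).2 ⟨c, h⟩

theorem sgn_smul_sgn_smul {V : Type u} [AddCommGroup V] {a b c : ℤ} (d : ℤ) (x : V)
    (h : a + b - c = d + d) : a.negOnePow • b.negOnePow • x = c.negOnePow • x := by
  rw [smul_smul, ← Int.negOnePow_add, sgn_eq h]

/-! ### Square-zero extensions -/

/-- Infinitesimal bimodules over a graded operad. -/
structure InfBimod (R : GrOperad k s) where
  V : ℕ → ℤ → Type u
  [addCommGroup : ∀ n p, AddCommGroup (V n p)]
  [module : ∀ n p, Module k (V n p)]
  act : ∀ {n : ℕ} {p : ℤ}, Representation k (s.perms n) (V n p)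
  lcomp : ∀ {m n r : ℕ} {p q t : ℤ} (_ : r + 1 = m + n) (_ : t = p + q) (_ : Fin m),
    R.V m p →ₗ[k] V n q →ₗ[k] V r t
  rcomp : ∀ {m n r : ℕ} {p q t : ℤ} (_ : r + 1 = m + n) (_ : t = p + q) (_ : Fin m),
    V m p →ₗ[k] R.V n q →ₗ[k] V r t
  lcomp_act : ∀ {m n r : ℕ} {p q t : ℤ} (hr : r + 1 = m + n) (ht : t = p + q) (i : Fin m)
    (σ : s.perms m) (τ : s.perms n) (ρ : s.perms r),
    IsBlockPerm i (σ : Equiv.Perm (Fin m)) (τ : Equiv.Perm (Fin n)) (ρ : Equiv.Perm (Fin r)) →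
    ∀ (x : R.V m p) (y : V n q), act ρ (lcomp hr ht i x y)
        = lcomp hr ht ((σ : Equiv.Perm (Fin m)) i) (R.act σ x) (act τ y)
  rcomp_act : ∀ {m n r : ℕ} {p q t : ℤ} (hr : r + 1 = m + n) (ht : t = p + q) (i : Fin m)
    (σ : s.perms m) (τ : s.perms n) (ρ : s.perms r),
    IsBlockPerm i (σ : Equiv.Perm (Fin m)) (τ : Equiv.Perm (Fin n)) (ρ : Equiv.Perm (Fin r)) →
    ∀ (x : V m p) (y : R.V n q), act ρ (rcomp hr ht i x y)
        = rcomp hr ht ((σ : Equiv.Perm (Fin m)) i) (act σ x) (R.act τ y)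
  seq₁ : ∀ {l m n a b r : ℕ} {p q t pq qt e : ℤ}
    (ha : a + 1 = l + m) (hb : b + 1 = m + n) (hr : r + 1 = a + n) (hr' : r + 1 = l + b)
    (hpq : pq = p + q) (hqt : qt = q + t) (he : e = pq + t) (he' : e = p + qt)
    (i : Fin l) (j : Fin m) (c : Fin a), (c : ℕ) = i + j →
    ∀ (x : V l p) (y : R.V m q) (z : R.V n t),
      rcomp hr he c (rcomp ha hpq i x y) z = rcomp hr' he' i x (R.comp hb hqt j y z)
  seq₂ : ∀ {l m n a b r : ℕ} {p q t pq qt e : ℤ}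
    (ha : a + 1 = l + m) (hb : b + 1 = m + n) (hr : r + 1 = a + n) (hr' : r + 1 = l + b)
    (hpq : pq = p + q) (hqt : qt = q + t) (he : e = pq + t) (he' : e = p + qt)
    (i : Fin l) (j : Fin m) (c : Fin a), (c : ℕ) = i + j →
    ∀ (x : R.V l p) (y : V m q) (z : R.V n t),
      rcomp hr he c (lcomp ha hpq i x y) z = lcomp hr' he' i x (rcomp hb hqt j y z)
  seq₃ : ∀ {l m n a b r : ℕ} {p q t pq qt e : ℤ}
    (ha : a + 1 = l + m) (hb : b + 1 = m + n) (hr : r + 1 = a + n) (hr' : r + 1 = l + b)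
    (hpq : pq = p + q) (hqt : qt = q + t) (he : e = pq + t) (he' : e = p + qt)
    (i : Fin l) (j : Fin m) (c : Fin a), (c : ℕ) = i + j →
    ∀ (x : R.V l p) (y : R.V m q) (z : V n t),
      lcomp hr he c (R.comp ha hpq i x y) z = lcomp hr' he' i x (lcomp hb hqt j y z)
  par₁ : ∀ {l m n a b r : ℕ} {p q t pq pt e : ℤ}
    (ha : a + 1 = l + m) (hb : b + 1 = l + n) (hr : r + 1 = a + n) (hr' : r + 1 = b + m)
    (hpq : pq = p + q) (hpt : pt = p + t) (he : e = pq + t) (he' : e = pt + q)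
    (i j : Fin l) (c : Fin a) (c' : Fin b), i < j → (c : ℕ) + 1 = j + m → (c' : ℕ) = i →
    ∀ (x : V l p) (y : R.V m q) (z : R.V n t),
      rcomp hr he c (rcomp ha hpq i x y) z
        = (q * t).negOnePow • rcomp hr' he' c' (rcomp hb hpt j x z) y
  par₂ : ∀ {l m n a b r : ℕ} {p q t pq pt e : ℤ}
    (ha : a + 1 = l + m) (hb : b + 1 = l + n) (hr : r + 1 = a + n) (hr' : r + 1 = b + m)
    (hpq : pq = p + q) (hpt : pt = p + t) (he : e = pq + t) (he' : e = pt + q)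
    (i j : Fin l) (c : Fin a) (c' : Fin b), i < j → (c : ℕ) + 1 = j + m → (c' : ℕ) = i →
    ∀ (x : R.V l p) (y : V m q) (z : R.V n t),
      rcomp hr he c (lcomp ha hpq i x y) z
        = (q * t).negOnePow • lcomp hr' he' c' (R.comp hb hpt j x z) y
  par₃ : ∀ {l m n a b r : ℕ} {p q t pq pt e : ℤ}
    (ha : a + 1 = l + m) (hb : b + 1 = l + n) (hr : r + 1 = a + n) (hr' : r + 1 = b + m)
    (hpq : pq = p + q) (hpt : pt = p + t) (he : e = pq + t) (he' : e = pt + q)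
    (i j : Fin l) (c : Fin a) (c' : Fin b), i < j → (c : ℕ) + 1 = j + m → (c' : ℕ) = i →
    ∀ (x : R.V l p) (y : R.V m q) (z : V n t),
      lcomp hr he c (R.comp ha hpq i x y) z
        = (q * t).negOnePow • rcomp hr' he' c' (lcomp hb hpt j x z) y

attribute [instance] InfBimod.addCommGroup InfBimod.module

/-- The square-zero extension of an operad by an infinitesimal bimodule. -/
def sqZero (R : GrOperad k s) (M : InfBimod R) : GrOperad k s where
  V n p := R.V n p × M.V n p
  act :=
    { toFun := fun σ => (R.act σ).prodMap (M.act σ)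
      map_one' := by simp
      map_mul' := fun σ τ => by simp [LinearMap.prodMap_mul] }
  comp hr ht i := LinearMap.mk₂ k
    (fun x y => (R.comp hr ht i x.1 y.1, M.rcomp hr ht i x.2 y.1 + M.lcomp hr ht i x.1 y.2))
    (fun _ _ _ => by simp only [Prod.ext_iff, Prod.fst_add, Prod.snd_add, map_add,
      LinearMap.add_apply, true_and]; abel)
    (fun _ _ _ => by simp)
    (fun _ _ _ => by simp only [Prod.ext_iff, Prod.fst_add, Prod.snd_add, map_add, true_and]; abel)
    (fun _ _ _ => by simp)
  comp_act hr ht i σ τ ρ h x y := by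
    refine Prod.ext (R.comp_act hr ht i σ τ ρ h _ _) ?_
    exact (map_add (M.act ρ) _ _).trans (congrArg₂ (· + ·) (M.rcomp_act hr ht i σ τ ρ h _ _)
      (M.lcomp_act hr ht i σ τ ρ h _ _))
  comp_seq ha hb hr hr' hpq hqt he he' i j c hc x y z := by
    refine Prod.ext (R.comp_seq ha hb hr hr' hpq hqt he he' i j c hc _ _ _) ?_
    simp only [LinearMap.mk₂_apply, map_add, LinearMap.add_apply,
      M.seq₁ ha hb hr hr' hpq hqt he he' i j c hc, M.seq₂ ha hb hr hr' hpq hqt he he' i j c hc,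
      M.seq₃ ha hb hr hr' hpq hqt he he' i j c hc]
    abel
  comp_par ha hb hr hr' hpq hpt he he' i j c c' hij hc hc' x y z := by
    refine Prod.ext (R.comp_par ha hb hr hr' hpq hpt he he' i j c c' hij hc hc' _ _ _) ?_
    simp only [LinearMap.mk₂_apply, map_add, LinearMap.add_apply, Prod.smul_snd, smul_add,
      M.par₁ ha hb hr hr' hpq hpt he he' i j c c' hij hc hc',
      M.par₂ ha hb hr hr' hpq hpt he he' i j c c' hij hc hc',
      M.par₃ ha hb hr hr' hpq hpt he he' i j c c' hij hc hc']
    abel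

section sqZero

variable (R : GrOperad k s) (M : InfBimod R)

/-- The inclusion of the operad into its square-zero extension. -/
def sqZeroInl : GrHom R (sqZero R M) where
  app := LinearMap.inl k _ _
  map_act σ x := Prod.ext rfl (map_zero (M.act σ)).symm
  map_comp hr ht i x y := Prod.ext rfl (by
    change 0 = M.rcomp hr ht i 0 y + M.lcomp hr ht i x 0
    simp)

/-- The projection of a square-zero extension onto the operad. -/
def sqZeroFst : GrHom (sqZero R M) R where
  app := LinearMap.fst k _ _
  map_act _ _ := rfl
  map_comp _ _ _ _ _ := rfl

end sqZero

/-- An operad as an infinitesimal bimodule over itself, with degrees shifted by `e`. -/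
def shiftBimod (T : GrOperad k s) (e : ℤ) : InfBimod T where
  V n p := T.V n (p + e)
  act := T.act
  lcomp {m n r p q t} hr ht i := (e * p).negOnePow • T.comp hr (by omega) i
  rcomp {m n r p q t} hr ht i := T.comp hr (by omega) i
  lcomp_act hr ht i σ τ ρ h x y := by
    simp only [LinearMap.smul_apply, map_sgn]
    rw [T.comp_act hr _ i σ τ ρ h]
  rcomp_act hr ht i σ τ ρ h x y := T.comp_act hr _ i σ τ ρ h _ _
  seq₁ ha hb hr hr' hpq hqt he he' i j c hc x y z := T.comp_seq ha hb hr hr' _ _ _ _ i j c hc _ _ _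
  seq₂ ha hb hr hr' hpq hqt he he' i j c hc x y z := by
    simp only [LinearMap.smul_apply, map_sgn]
    rw [T.comp_seq ha hb hr hr' _ _ _ _ i j c hc]
  seq₃ {l m n a b r p q t pq qt e'} ha hb hr hr' hpq hqt he he' i j c hc x y z := by
    simp only [LinearMap.smul_apply, map_sgn]
    rw [T.comp_seq ha hb hr hr' (qt := qt + e) _ (by omega) _ (by omega) i j c hc,
      sgn_smul_sgn_smul (c := e * pq) 0 _ (by subst hpq; ring)]
  par₁ {l m n a b r p q t pq qt e'} ha hb hr hr' hpq hpt he he' i j c c' hij hc hc' x y z :=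
    T.comp_par ha hb hr hr' (by omega) (by omega) (by omega) (by omega) i j c c' hij hc hc' _ _ _
  par₂ {l m n a b r p q t pq pt e'} ha hb hr hr' hpq hpt he he' i j c c' hij hc hc' x y z := by
    simp only [LinearMap.smul_apply, map_sgn]
    rw [T.comp_par ha hb hr hr' (pt := pt) (by omega) hpt (by omega) (by omega) i j c c' hij hc hc',
      smul_smul, smul_smul, ← Int.negOnePow_add, ← Int.negOnePow_add]
    congr 1
    exact sgn_eq (c := 0) (by subst hpt; ring)
  par₃ {l m n a b r p q t pq pt e'} ha hb hr hr' hpq hpt he he' i j c c' hij hc hc' x y z := by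
    simp only [LinearMap.smul_apply, map_sgn]
    rw [T.comp_par ha hb hr hr' (pt := pt + e) hpq (by omega) (by omega) (by omega)
      i j c c' hij hc hc', smul_smul, smul_smul, ← Int.negOnePow_add, ← Int.negOnePow_add]
    congr 1
    exact sgn_eq (c := e * q) (by subst hpq; ring)

/-- Dual numbers over an operad, with an infinitesimal of degree `-e`. -/
abbrev dual (T : GrOperad k s) (e : ℤ) : GrOperad k s := sqZero T (shiftBimod T e)

/-! ### Derivations -/

/-- Derivations of degree `e` along a morphism of graded operads. -/
structure Deriv {R T : GrOperad k s} (f : GrHom R T) (e : ℤ) where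
  app : ∀ {n : ℕ} {p q : ℤ} (_ : q = p + e), R.V n p →ₗ[k] T.V n q
  map_act : ∀ {n : ℕ} {p q : ℤ} (h : q = p + e) (σ : s.perms n) (x : R.V n p),
    app h (R.act σ x) = T.act σ (app h x)
  map_comp : ∀ {m n r : ℕ} {p p' q q' t t' : ℤ} (hr : r + 1 = m + n) (ht : t = p + q)
    (hp : p' = p + e) (hq : q' = q + e) (htt : t' = t + e) (h₁ : t' = p' + q) (h₂ : t' = p + q')
    (i : Fin m) (x : R.V m p) (y : R.V n q),
    app htt (R.comp hr ht i x y)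
      = T.comp hr h₁ i (app hp x) (f.app y) + (e * p).negOnePow • T.comp hr h₂ i (f.app x) (app hq y)

namespace Deriv

variable {R T U : GrOperad k s} {f : GrHom R T} {e : ℤ}

/-- A derivation as a morphism to the dual numbers. -/
def toDual (D : Deriv f e) : GrHom R (dual T e) where
  app := f.app.prod (D.app rfl)
  map_act σ x := Prod.ext (f.map_act σ x) (D.map_act rfl σ x)
  map_comp {m n r p q t} hr ht i x y := by
    exact Prod.ext (f.map_comp hr ht i x y) (D.map_comp hr ht rfl rfl rfl _ _ i x y)

/-- The derivation given by a morphism to the dual numbers. -/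
def ofDual (g : GrHom R (dual T e)) (hg : g.trans (sqZeroFst _ _) = f) : Deriv f e where
  app {n p q} h := by subst h; exact LinearMap.snd k (T.V n p) (T.V n (p + e)) ∘ₗ g.app
  map_act h σ x := by subst h; exact congrArg Prod.snd (g.map_act σ x)
  map_comp {m n r p p' q q' t t'} hr ht hp hq htt h₁ h₂ i x y := by
    subst hg hp hq htt
    exact congrArg Prod.snd (g.map_comp hr ht i x y)

/-- The zero derivation. -/
def zero (f : GrHom R T) (e : ℤ) : Deriv f e where
  app _ := 0
  map_act _ _ _ := by simp
  map_comp _ _ _ _ _ _ _ _ _ _ := by simp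

/-- The sum of two derivations. -/
def add (D D' : Deriv f e) : Deriv f e where
  app h := D.app h + D'.app h
  map_act h σ x := by simp [D.map_act, D'.map_act]
  map_comp hr ht hp hq htt h₁ h₂ i x y := by
    simp only [LinearMap.add_apply, D.map_comp hr ht hp hq htt h₁ h₂,
      D'.map_comp hr ht hp hq htt h₁ h₂, map_add, smul_add]
    abel

/-- The negative of a derivation. -/
def neg (D : Deriv f e) : Deriv f e where
  app h := - D.app h
  map_act h σ x := by simp [D.map_act]
  map_comp hr ht hp hq htt h₁ h₂ i x y := by
    simp only [LinearMap.neg_apply, D.map_comp hr ht hp hq htt h₁ h₂, map_neg, smul_neg, neg_add]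

/-- Restriction of a derivation along a morphism. -/
def precomp (g : GrHom U R) (D : Deriv f e) : Deriv (g.trans f) e where
  app h := D.app h ∘ₗ g.app
  map_act h σ x := by simp [g.map_act, D.map_act]
  map_comp hr ht hp hq htt h₁ h₂ i x y := by
    simp only [LinearMap.comp_apply, g.map_comp, D.map_comp hr ht hp hq htt h₁ h₂]
    rfl

/-- Composition of a derivation with a morphism. -/
def postcomp (D : Deriv f e) (g : GrHom T U) : Deriv (f.trans g) e where
  app h := g.app ∘ₗ D.app h
  map_act h σ x := by simp [g.map_act, D.map_act]
  map_comp hr ht hp hq htt h₁ h₂ i x y := by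
    simp only [LinearMap.comp_apply, g.map_comp, D.map_comp hr ht hp hq htt h₁ h₂, map_add, map_sgn]
    rfl

end Deriv

/-- The differential of a dg operad, as a derivation. -/
def DGOperad.dDeriv (P : DGOperad k s) : Deriv (GrHom.id P.toGrOperad) (-1) where
  app h := P.d (by omega)
  map_act h σ x := P.d_act _ σ x
  map_comp {m n r p p' q q' t t'} hr ht hp hq htt h₁ h₂ i x y := by
    rw [P.d_comp hr ht (by omega) (by omega) (by omega) h₁ h₂, sgn_eq (a := -1 * p) (b := p) (c := -p)
      (by ring)]
    rfl

/-! ### Suboperads and generation -/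

/-- `Q` is freely generated over `R` by a family of operations. -/
def IsFreeOn {R Q : GrOperad k s} (ι : GrHom R Q) {G : ℕ → ℤ → Type} (g : ∀ n p, G n p → Q.V n p) :
    Prop :=
  ∀ (T : GrOperad k s) (φ : GrHom R T) (γ : ∀ n p, G n p → T.V n p),
    ∃! ψ : GrHom Q T, ι.trans ψ = φ ∧ ∀ n p x, ψ.app (g n p x) = γ n p x

namespace IsFreeOn

variable {R Q : GrOperad k s} {ι : GrHom R Q} {G : ℕ → ℤ → Type} {g : ∀ n p, G n p → Q.V n p}

/-- The morphism given by the universal property. -/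
def lift (H : IsFreeOn ι g) {T : GrOperad k s} (φ : GrHom R T) (γ : ∀ n p, G n p → T.V n p) :
    GrHom Q T := (H T φ γ).choose

theorem trans_lift (H : IsFreeOn ι g) {T : GrOperad k s} (φ : GrHom R T)
    (γ : ∀ n p, G n p → T.V n p) : ι.trans (H.lift φ γ) = φ := (H T φ γ).choose_spec.1.1

theorem lift_ι (H : IsFreeOn ι g) {T : GrOperad k s} (φ : GrHom R T)
    (γ : ∀ n p, G n p → T.V n p) {n : ℕ} {p : ℤ} (x : R.V n p) :
    (H.lift φ γ).app (ι.app x) = φ.app x :=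
  congrArg (fun f : GrHom R T => f.app x) (H.trans_lift φ γ)

theorem lift_gen (H : IsFreeOn ι g) {T : GrOperad k s} (φ : GrHom R T)
    (γ : ∀ n p, G n p → T.V n p) {n : ℕ} {p : ℤ} (x : G n p) :
    (H.lift φ γ).app (g n p x) = γ n p x := (H T φ γ).choose_spec.1.2 n p x

theorem hom_ext (H : IsFreeOn ι g) {T : GrOperad k s} {φ ψ : GrHom Q T}
    (h : ∀ n p (x : R.V n p), φ.app (ι.app x) = ψ.app (ι.app x))
    (h' : ∀ n p x, φ.app (g n p x) = ψ.app (g n p x)) : φ = ψ :=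
  (H T (ι.trans ψ) (fun n p x => ψ.app (g n p x))).unique ⟨GrHom.ext h, h'⟩ ⟨rfl, fun _ _ _ => rfl⟩

/-- A suboperad that contains the generators is everything. -/
theorem mem (H : IsFreeOn ι g) (S : SubOperad Q)
    (h : ∀ n p (x : R.V n p), ι.app x ∈ S.carrier n p) (h' : ∀ n p x, g n p x ∈ S.carrier n p)
    {n : ℕ} {p : ℤ} (x : Q.V n p) : x ∈ S.carrier n p := by
  let φ : GrHom R S.toGrOperad :=
    { app := fun {n p} => ι.app.codRestrict (S.carrier n p) (h n p)
      map_act := fun σ x => Subtype.ext (ι.map_act σ x)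
      map_comp := fun hr ht i x y => Subtype.ext (ι.map_comp hr ht i x y) }
  have key : (H.lift φ (fun n p x => ⟨g n p x, h' n p x⟩)).trans S.incl = GrHom.id _ := by
    refine H.hom_ext (fun n p x => ?_) (fun n p x => ?_)
    · exact congrArg Subtype.val (H.lift_ι φ _ x)
    · exact congrArg Subtype.val (H.lift_gen φ (fun n p x => ⟨g n p x, h' n p x⟩) x)
  have hx : ((H.lift φ (fun n p x => ⟨g n p x, h' n p x⟩)).app x).1 = x :=
    congrArg (fun f : GrHom Q Q => f.app (n := n) (p := p) x) key
  exact hx ▸ ((H.lift φ _).app x).2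

/-- The derivation with prescribed values on generators. -/
def deriv (H : IsFreeOn ι g) {T : GrOperad k s} (f : GrHom Q T) {e : ℤ} (D : Deriv (ι.trans f) e)
    (γ : ∀ n p, G n p → T.V n (p + e)) : Deriv f e :=
  Deriv.ofDual (H.lift D.toDual (fun n p x => (f.app (g n p x), γ n p x)))
    (H.hom_ext (fun n p x => congrArg Prod.fst (H.lift_ι D.toDual _ x))
      (fun n p x => congrArg Prod.fst
        (H.lift_gen D.toDual (fun n p x => (f.app (g n p x), γ n p x)) x)))

theorem deriv_ι (H : IsFreeOn ι g) {T : GrOperad k s} (f : GrHom Q T) {e : ℤ}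
    (D : Deriv (ι.trans f) e) (γ : ∀ n p, G n p → T.V n (p + e)) {n : ℕ} {p q : ℤ}
    (h : q = p + e) (x : R.V n p) : (H.deriv f D γ).app h (ι.app x) = D.app h x := by
  subst h
  exact congrArg Prod.snd (H.lift_ι D.toDual _ x)

theorem deriv_gen (H : IsFreeOn ι g) {T : GrOperad k s} (f : GrHom Q T) {e : ℤ}
    (D : Deriv (ι.trans f) e) (γ : ∀ n p, G n p → T.V n (p + e)) {n : ℕ} {p : ℤ} (x : G n p) :
    (H.deriv f D γ).app rfl (g n p x) = γ n p x :=
  congrArg Prod.snd (H.lift_gen D.toDual (fun n p x => (f.app (g n p x), γ n p x)) x)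

/-- Derivations that agree on generators are equal. -/
theorem deriv_ext (H : IsFreeOn ι g) {T : GrOperad k s} {f : GrHom Q T} {e : ℤ} {D D' : Deriv f e}
    (h : ∀ n p (x : R.V n p), D.app rfl (ι.app x) = D'.app rfl (ι.app x))
    (h' : ∀ n p x, D.app rfl (g n p x) = D'.app rfl (g n p x)) {n : ℕ} {p q : ℤ} (hq : q = p + e)
    (x : Q.V n p) : D.app hq x = D'.app hq x := by
  subst hq
  have : D.toDual = D'.toDual := H.hom_ext (fun n p x => Prod.ext rfl (h n p x))
    (fun n p x => Prod.ext rfl (h' n p x))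
  exact congrArg (fun F : GrHom Q (dual T e) => (F.app x).2) this

end IsFreeOn

/-- A morphism of graded operads that commutes with derivations on generators commutes with them. -/
theorem IsFreeOn.comm_deriv {R Q : GrOperad k s} {ι : GrHom R Q} {G : ℕ → ℤ → Type}
    {g : ∀ n p, G n p → Q.V n p} (H : IsFreeOn ι g) {T : GrOperad k s} (f : GrHom Q T) {e : ℤ}
    (D : Deriv (GrHom.id Q) e) (D' : Deriv (GrHom.id T) e)
    (h : ∀ n p (x : R.V n p), f.app (D.app rfl (ι.app x)) = D'.app rfl (f.app (ι.app x)))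
    (h' : ∀ n p x, f.app (D.app rfl (g n p x)) = D'.app rfl (f.app (g n p x)))
    {n : ℕ} {p q : ℤ} (hq : q = p + e) (x : Q.V n p) :
    f.app (D.app hq x) = D'.app hq (f.app x) :=
  H.deriv_ext (D := D.postcomp f) (D' := D'.precomp f) h h' hq x

/-- The kernel of the square of an odd derivation. -/
def Deriv.sqKer {Q : GrOperad k s} (D : Deriv (GrHom.id Q) (-1)) : SubOperad Q where
  carrier n p := LinearMap.ker (D.app (q := p + -1 + -1) rfl ∘ₗ D.app (p := p) rfl)
  act_mem := by
    intro n p σ x hx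
    simp only [LinearMap.mem_ker, LinearMap.comp_apply] at hx ⊢
    rw [D.map_act, D.map_act, hx, map_zero]
  comp_mem := by
    intro m n r p q t hr ht i x y hx hy
    simp only [LinearMap.mem_ker, LinearMap.comp_apply] at hx hy ⊢
    rw [D.map_comp hr ht rfl rfl rfl (by omega) (by omega), map_add, map_sgn,
      D.map_comp hr _ rfl rfl rfl (by omega) (by omega),
      D.map_comp hr _ rfl rfl rfl (by omega) (by omega), hx, hy]
    simp only [map_zero, LinearMap.zero_apply, zero_add, smul_zero, add_zero]
    change (-1 * (p + -1)).negOnePow • Q.comp hr _ i (D.app rfl x) (D.app rfl y)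
      + (-1 * p).negOnePow • Q.comp hr _ i (D.app rfl x) (D.app rfl y) = 0
    rw [show (-1 * (p + -1) : ℤ) = -1 * p + 1 by ring, Int.negOnePow_succ]
    simp

/-- The square of an odd derivation vanishes if it vanishes on generators. -/
theorem IsFreeOn.deriv_sq {R Q : GrOperad k s} {ι : GrHom R Q} {G : ℕ → ℤ → Type}
    {g : ∀ n p, G n p → Q.V n p} (H : IsFreeOn ι g) (D : Deriv (GrHom.id Q) (-1))
    (h : ∀ n p (x : R.V n p), D.app (q := p + -1 + -1) rfl (D.app rfl (ι.app x)) = 0)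
    (h' : ∀ n p x, D.app (q := p + -1 + -1) rfl (D.app rfl (g n p x)) = 0)
    {n : ℕ} {p q t : ℤ} (hq : q = p + -1) (ht : t = q + -1) (x : Q.V n p) :
    D.app ht (D.app hq x) = 0 := by
  subst hq ht
  exact H.mem D.sqKer h h' x

/-- The dg operad given by a free extension and an odd derivation. -/
def DGOperad.ofDeriv (Q : GrOperad k s) (D : Deriv (GrHom.id Q) (-1))
    (hD : ∀ {n : ℕ} {p q t : ℤ} (hq : q = p + -1) (ht : t = q + -1) (x : Q.V n p),
      D.app ht (D.app hq x) = 0) : DGOperad k s where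
  toGrOperad := Q
  d h := D.app (by omega)
  d_d h h' x := hD _ _ x
  d_act h σ x := D.map_act _ σ x
  d_comp {m n r p p' q q' t t'} hr ht hp hq htt h₁ h₂ i x y := by
    rw [D.map_comp hr ht (by omega) (by omega) (by omega) h₁ h₂,
      sgn_eq (a := -1 * p) (b := p) (c := -p) (by ring)]
    rfl

/-! ### Adjoining operations -/

/-- Formal expressions in the operations of `R` and generators `G`. -/
inductive ATerm (R : GrOperad k s) (G : ℕ → ℤ → Type) : ℕ → ℤ → Type u
  | of {n : ℕ} {p : ℤ} : R.V n p → ATerm R G n p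
  | gen {n : ℕ} {p : ℤ} : G n p → ATerm R G n p
  | zero {n : ℕ} {p : ℤ} : ATerm R G n p
  | add {n : ℕ} {p : ℤ} : ATerm R G n p → ATerm R G n p → ATerm R G n p
  | smul {n : ℕ} {p : ℤ} : k → ATerm R G n p → ATerm R G n p
  | act {n : ℕ} {p : ℤ} : s.perms n → ATerm R G n p → ATerm R G n p
  | comp {m n r : ℕ} {p q t : ℤ} (hr : r + 1 = m + n) (ht : t = p + q) (i : Fin m) :
      ATerm R G m p → ATerm R G n q → ATerm R G r t

/-- The value of an expression. -/
def ATerm.eval {R : GrOperad k s} {G : ℕ → ℤ → Type} (T : GrOperad k s) (φ : GrHom R T)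
    (γ : ∀ n p, G n p → T.V n p) : {n : ℕ} → {p : ℤ} → ATerm R G n p → T.V n p
  | _, _, .of x => φ.app x
  | _, _, .gen x => γ _ _ x
  | _, _, .zero => 0
  | _, _, .add x y => x.eval T φ γ + y.eval T φ γ
  | _, _, .smul c x => c • x.eval T φ γ
  | _, _, .act σ x => T.act σ (x.eval T φ γ)
  | _, _, .comp hr ht i x y => T.comp hr ht i (x.eval T φ γ) (y.eval T φ γ)

/-- Expressions are identified if they agree in every operad under `R`. -/
def adjSetoid (R : GrOperad k s) (G : ℕ → ℤ → Type) (n : ℕ) (p : ℤ) : Setoid (ATerm R G n p) where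
  r x y := ∀ (T : GrOperad k s) (φ : GrHom R T) (γ : ∀ n p, G n p → T.V n p),
    x.eval T φ γ = y.eval T φ γ
  iseqv := ⟨fun _ _ _ _ => rfl, fun h T φ a => (h T φ a).symm,
    fun h h' T φ a => (h T φ a).trans (h' T φ a)⟩

/-- The operations of the free extension of `R` by generators `G`. -/
def AdjV (R : GrOperad k s) (G : ℕ → ℤ → Type) (n : ℕ) (p : ℤ) : Type u :=
  Quotient (adjSetoid R G n p)

namespace AdjV

variable {R : GrOperad k s} {G : ℕ → ℤ → Type}

/-- Evaluation of classes of expressions. -/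
def eval (T : GrOperad k s) (φ : GrHom R T) (γ : ∀ n p, G n p → T.V n p) {n : ℕ} {p : ℤ}
    (x : AdjV R G n p) : T.V n p :=
  Quotient.lift (fun t : ATerm R G n p => t.eval T φ γ)
    (fun _ _ (h : (adjSetoid R G n p).r _ _) => h T φ γ) x

theorem ext {n : ℕ} {p : ℤ} {x y : AdjV R G n p}
    (h : ∀ (T : GrOperad k s) (φ : GrHom R T) (γ : ∀ n p, G n p → T.V n p),
      eval T φ γ x = eval T φ γ y) : x = y := by
  induction x using Quotient.inductionOn with | _ x
  induction y using Quotient.inductionOn with | _ y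
  exact Quotient.sound fun T φ γ => h T φ γ

instance (n : ℕ) (p : ℤ) : Zero (AdjV R G n p) := ⟨Quotient.mk _ .zero⟩

instance (n : ℕ) (p : ℤ) : Add (AdjV R G n p) :=
  ⟨Quotient.map₂ .add fun _ _ (h : (adjSetoid R G n p).r _ _)
    _ _ (h' : (adjSetoid R G n p).r _ _) T φ γ => by
      simp only [ATerm.eval, h T φ γ, h' T φ γ]⟩

instance (n : ℕ) (p : ℤ) : SMul k (AdjV R G n p) :=
  ⟨fun c => Quotient.map (.smul c) fun _ _ (h : (adjSetoid R G n p).r _ _) T φ γ => by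
    simp only [ATerm.eval, h T φ γ]⟩

instance (n : ℕ) (p : ℤ) : Neg (AdjV R G n p) := ⟨fun x => (-1 : k) • x⟩

/-- The group action, on classes. -/
def act {n : ℕ} {p : ℤ} (σ : s.perms n) : AdjV R G n p → AdjV R G n p :=
  Quotient.map (.act σ) fun _ _ (h : (adjSetoid R G n p).r _ _) T φ γ => by
    simp only [ATerm.eval, h T φ γ]

/-- Partial composition, on classes. -/
def comp {m n r : ℕ} {p q t : ℤ} (hr : r + 1 = m + n) (ht : t = p + q) (i : Fin m) :
    AdjV R G m p → AdjV R G n q → AdjV R G r t :=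
  Quotient.map₂ (.comp hr ht i) fun _ _ (h : (adjSetoid R G m p).r _ _)
    _ _ (h' : (adjSetoid R G n q).r _ _) T φ γ => by
      simp only [ATerm.eval, h T φ γ, h' T φ γ]

section eval

variable (T : GrOperad k s) (φ : GrHom R T) (γ : ∀ n p, G n p → T.V n p)

@[simp] theorem eval_zero {n : ℕ} {p : ℤ} : eval T φ γ (0 : AdjV R G n p) = 0 := rfl

@[simp] theorem eval_add {n : ℕ} {p : ℤ} (x y : AdjV R G n p) :
    eval T φ γ (x + y) = eval T φ γ x + eval T φ γ y := Quotient.inductionOn₂ x y fun _ _ => rfl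

@[simp] theorem eval_smul {n : ℕ} {p : ℤ} (c : k) (x : AdjV R G n p) :
    eval T φ γ (c • x) = c • eval T φ γ x := Quotient.inductionOn x fun _ => rfl

@[simp] theorem eval_act {n : ℕ} {p : ℤ} (σ : s.perms n) (x : AdjV R G n p) :
    eval T φ γ (act σ x) = T.act σ (eval T φ γ x) := Quotient.inductionOn x fun _ => rfl

@[simp] theorem eval_comp {m n r : ℕ} {p q t : ℤ} (hr : r + 1 = m + n)
    (ht : t = p + q) (i : Fin m) (x : AdjV R G m p) (y : AdjV R G n q) :
    eval T φ γ (comp hr ht i x y) = T.comp hr ht i (eval T φ γ x) (eval T φ γ y) :=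
  Quotient.inductionOn₂ x y fun _ _ => rfl

end eval

instance (n : ℕ) (p : ℤ) : AddCommGroup (AdjV R G n p) where
  add_assoc _ _ _ := ext fun _ _ _ => by simp [add_assoc]
  zero_add _ := ext fun _ _ _ => by simp
  add_zero _ := ext fun _ _ _ => by simp
  add_comm _ _ := ext fun _ _ _ => by simp [add_comm]
  neg_add_cancel x := ext fun T φ γ => by
    change eval T φ γ ((-1 : k) • x + x) = 0
    simp
  nsmul := nsmulRec
  zsmul := zsmulRec

instance (n : ℕ) (p : ℤ) : Module k (AdjV R G n p) where
  one_smul _ := ext fun _ _ _ => by simp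
  mul_smul _ _ _ := ext fun _ _ _ => by simp [mul_smul]
  smul_zero _ := ext fun _ _ _ => by simp
  smul_add _ _ _ := ext fun _ _ _ => by simp
  add_smul _ _ _ := ext fun _ _ _ => by simp [add_smul]
  zero_smul _ := ext fun _ _ _ => by simp

/-- Evaluation as a linear map. -/
def evalL (T : GrOperad k s) (φ : GrHom R T) (γ : ∀ n p, G n p → T.V n p) {n : ℕ} {p : ℤ} :
    AdjV R G n p →ₗ[k] T.V n p where
  toFun := eval T φ γ
  map_add' := eval_add T φ γ
  map_smul' := eval_smul T φ γ

theorem extL {n : ℕ} {p : ℤ} {x y : AdjV R G n p}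
    (h : ∀ (T : GrOperad k s) (φ : GrHom R T) (γ : ∀ n p, G n p → T.V n p),
      evalL T φ γ x = evalL T φ γ y) : x = y := ext h

end AdjV

/-- The free extension of `R` by generators `G`. -/
def adj (R : GrOperad k s) (G : ℕ → ℤ → Type) : GrOperad k s where
  V := AdjV R G
  act :=
    { toFun := fun σ =>
        { toFun := AdjV.act σ
          map_add' := fun _ _ => AdjV.ext fun _ _ _ => by simp
          map_smul' := fun _ _ => AdjV.ext fun _ _ _ => by simp }
      map_one' := LinearMap.ext fun _ => AdjV.ext fun _ _ _ => by simp
      map_mul' := fun _ _ => LinearMap.ext fun _ => AdjV.ext fun _ _ _ => by simp }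
  comp hr ht i := LinearMap.mk₂ k (AdjV.comp hr ht i)
    (fun _ _ _ => AdjV.ext fun _ _ _ => by simp)
    (fun _ _ _ => AdjV.ext fun _ _ _ => by simp)
    (fun _ _ _ => AdjV.ext fun _ _ _ => by simp)
    (fun _ _ _ => AdjV.ext fun _ _ _ => by simp)
  comp_act hr ht i σ τ ρ h x y := AdjV.ext fun P _ _ => by
    simpa using P.comp_act hr ht i σ τ ρ h _ _
  comp_seq ha hb hr hr' hpq hqt he he' i j c hc x y z := AdjV.ext fun P _ _ => by
    simpa using P.comp_seq ha hb hr hr' hpq hqt he he' i j c hc _ _ _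
  comp_par ha hb hr hr' hpq hpt he he' i j c c' hij hc hc' x y z := AdjV.extL fun P φ γ => by
    rw [map_sgn]
    simpa [AdjV.evalL] using P.comp_par ha hb hr hr' hpq hpt he he' i j c c' hij hc hc' _ _ _

namespace adj

variable (R : GrOperad k s) (G : ℕ → ℤ → Type)

/-- The inclusion of `R` in its free extension. -/
def of : GrHom R (adj R G) where
  app :=
    { toFun := fun x => Quotient.mk _ (.of x)
      map_add' := fun x y => AdjV.ext fun T φ γ => φ.app.map_add x y
      map_smul' := fun c x => AdjV.ext fun T φ γ => φ.app.map_smul c x }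
  map_act σ x := AdjV.ext fun T φ γ => φ.map_act σ x
  map_comp hr ht i x y := AdjV.ext fun T φ γ => φ.map_comp hr ht i x y

/-- The generators. -/
def gen (n : ℕ) (p : ℤ) (x : G n p) : (adj R G).V n p := Quotient.mk _ (.gen x)

theorem isFreeOn : IsFreeOn (of R G) (gen R G) := by
  intro T φ γ
  refine ⟨{ app := AdjV.evalL T φ γ
            map_act := fun _ _ => AdjV.eval_act T φ γ _ _
            map_comp := fun _ _ _ _ _ => AdjV.eval_comp T φ γ _ _ _ _ _ },
    ⟨GrHom.ext fun _ _ _ => rfl, fun _ _ _ => rfl⟩, ?_⟩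
  rintro ψ ⟨h, h'⟩
  refine GrHom.ext fun n p x => ?_
  induction x using Quotient.inductionOn with | _ x
  induction x with
  | of x => exact congrArg (fun f : GrHom R T => f.app x) h
  | gen x => exact h' _ _ x
  | zero => exact ψ.app.map_zero
  | add x y hx hy => exact (ψ.app.map_add _ _).trans (congrArg₂ (· + ·) hx hy)
  | smul c x hx => exact (ψ.app.map_smul c _).trans (congrArg (c • ·) hx)
  | act σ x hx => exact (ψ.map_act σ _).trans (congrArg (T.act σ) hx)
  | comp hr ht i x y hx hy =>
    exact (ψ.map_comp hr ht i _ _).trans (congrArg₂ (fun a b => T.comp hr ht i a b) hx hy)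

end adj

/-! ### The inputs of a composite -/

theorem outerSlot_lt {m n r i a : ℕ} (hr : r + 1 = m + n) (hi : i < m) (ha : a < m) (h : a ≠ i) :
    outerSlot i n a < r := by
  unfold outerSlot
  split_ifs <;> omega

/-- The inputs of `x ∘_i y` are the inputs of `x` other than `i` and the inputs of `y`. -/
def slotEquiv {m n r : ℕ} (hr : r + 1 = m + n) (i : Fin m) : {a : Fin m // a ≠ i} ⊕ Fin n ≃ Fin r :=
  Equiv.ofBijective
    (fun c => match c with
      | .inl a => ⟨outerSlot i n a.1, outerSlot_lt hr i.2 a.1.2 (fun h => a.2 (Fin.ext h))⟩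
      | .inr b => ⟨i + b, by omega⟩)
    (by
      constructor
      · rintro (⟨a, ha⟩ | b) (⟨a', ha'⟩ | b') h
        all_goals
          simp only [Fin.mk.injEq, outerSlot] at h
          try simp only [ne_eq, Fin.ext_iff] at ha
          try simp only [ne_eq, Fin.ext_iff] at ha'
        · congr 2
          ext
          split_ifs at h <;> omega
        · split_ifs at h <;> omega
        · split_ifs at h <;> omega
        · congr 1
          ext
          omega
      · intro c
        by_cases h : (c : ℕ) < i
        · refine ⟨.inl ⟨⟨c, by omega⟩, fun h' => ?_⟩, ?_⟩
          · simp [Fin.ext_iff] at h'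
            omega
          · ext
            simp [outerSlot, h]
        · by_cases h' : (c : ℕ) < i + n
          · refine ⟨.inr ⟨c - i, by omega⟩, ?_⟩
            ext
            simp
            omega
          · refine ⟨.inl ⟨⟨c + 1 - n, by omega⟩, fun h'' => ?_⟩, ?_⟩
            · simp [Fin.ext_iff] at h''
              omega
            · ext
              simp only [outerSlot]
              split_ifs <;> omega)

theorem slotEquiv_inl {m n r : ℕ} (hr : r + 1 = m + n) (i : Fin m) (a : {a : Fin m // a ≠ i}) :
    (slotEquiv hr i (.inl a) : ℕ) = outerSlot i n a.1 := rfl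

theorem slotEquiv_inr {m n r : ℕ} (hr : r + 1 = m + n) (i : Fin m) (b : Fin n) :
    (slotEquiv hr i (.inr b) : ℕ) = i + b := rfl

theorem sum_slots {A : Type*} [AddCommMonoid A] {m n r : ℕ} (hr : r + 1 = m + n) (i : Fin m)
    (F : Fin r → A) : ∑ c, F c
      = (∑ a : {a : Fin m // a ≠ i}, F (slotEquiv hr i (.inl a)))
        + ∑ b : Fin n, F (slotEquiv hr i (.inr b)) := by
  rw [← (slotEquiv hr i).sum_comp, Fintype.sum_sum_type]

/-- Composition with operations in two different inputs of `x`. -/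
theorem GrOperad.comp_outer (T : GrOperad k s) {l m n a b r : ℕ} {p q t pq pt e : ℤ}
    (ha : a + 1 = l + m) (hb : b + 1 = l + n) (hr : r + 1 = a + n) (hr' : r + 1 = b + m)
    (hpq : pq = p + q) (hpt : pt = p + t) (he : e = pq + t) (he' : e = pt + q)
    (i j : Fin l) (c : Fin a) (c' : Fin b) (hij : j ≠ i) (hc : (c : ℕ) = outerSlot i m j)
    (hc' : (c' : ℕ) = outerSlot j n i) (x : T.V l p) (y : T.V m q) (z : T.V n t) :
    T.comp hr he c (T.comp ha hpq i x y) z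
      = (q * t).negOnePow • T.comp hr' he' c' (T.comp hb hpt j x z) y := by
  rw [ne_eq, Fin.ext_iff] at hij
  rcases lt_or_gt_of_ne hij with h | h
  · rw [outerSlot, if_pos h] at hc
    rw [outerSlot, if_neg (by omega)] at hc'
    rw [T.comp_par hb ha hr' hr hpt hpq he' he j i c' c h (by omega) hc x z y, smul_smul,
      ← Int.negOnePow_add, sgn_eq (b := 0) (c := q * t) (by ring)]
    simp
  · rw [outerSlot, if_neg (by omega)] at hc
    rw [outerSlot, if_pos h] at hc'
    exact T.comp_par ha hb hr hr' hpq hpt he he' i j c c' h (by omega) hc' x y z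

/-! ### Inner derivations -/

namespace GrOperad

variable (T : GrOperad k s)

/-- The bracket with an operation of arity one and degree `e`. -/
def adL {e : ℤ} (μ : T.V 1 e) {n : ℕ} {p q : ℤ} (h : q = p + e) : T.V n p →ₗ[k] T.V n q :=
  T.comp (Nat.add_comm n 1) (by omega) 0 μ
    - (e * p).negOnePow • ∑ i : Fin n, (T.comp (r := n) rfl h i).flip μ

theorem adL_apply {e : ℤ} (μ : T.V 1 e) {n : ℕ} {p q : ℤ} (h : q = p + e) (x : T.V n p) :
    T.adL μ h x = T.comp (Nat.add_comm n 1) (by omega) 0 μ x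
      - (e * p).negOnePow • ∑ i : Fin n, T.comp (r := n) rfl h i x μ := by
  simp [adL]

theorem bracket_eq (μ : T.V 1 (-1)) {n : ℕ} {p q : ℤ} (h : p = q + 1) (x : T.V n p) :
    T.bracket μ h x = T.adL μ (by omega) x := by
  rw [adL_apply, bracket, sgn_eq (a := -1 * p) (b := p) (c := -p) (by ring)]

theorem adL_add {e : ℤ} (μ μ' : T.V 1 e) {n : ℕ} {p q : ℤ} (h : q = p + e) (x : T.V n p) :
    T.adL (μ + μ') h x = T.adL μ h x + T.adL μ' h x := by
  simp only [adL_apply, map_add, LinearMap.add_apply, Finset.sum_add_distrib, smul_add]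
  abel

theorem adL_neg {e : ℤ} (μ : T.V 1 e) {n : ℕ} {p q : ℤ} (h : q = p + e) (x : T.V n p) :
    T.adL (-μ) h x = - T.adL μ h x := by
  simp only [adL_apply, map_neg, LinearMap.neg_apply, Finset.sum_neg_distrib, smul_neg]
  abel

theorem adL_zero {e : ℤ} {n : ℕ} {p q : ℤ} (h : q = p + e) (x : T.V n p) :
    T.adL (0 : T.V 1 e) h x = 0 := by
  simp [adL_apply]

theorem adL_arity_zero {e : ℤ} (μ : T.V 1 e) {p q : ℤ} (h : q = p + e) (x : T.V 0 p) :
    T.adL μ h x = T.comp (m := 1) (n := 0) rfl (by omega) 0 μ x := by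
  simp [adL_apply]

/-- The bracket with an operation of arity one is a derivation. -/
def ad {e : ℤ} (μ : T.V 1 e) : Deriv (GrHom.id T) e where
  app h := T.adL μ h
  map_act {n p q} h σ x := by
    simp only [adL_apply, map_sub, map_sgn, map_sum]
    congr 1
    · rw [T.comp_act _ _ (0 : Fin 1) 1 σ σ ⟨fun b c hc => ?_, fun a c ha => ?_⟩]
      · simp
      · simp only [Fin.isValue, Fin.coe_ofNat_eq_mod, Nat.zero_mod, zero_add] at hc
        simp [Fin.ext hc]
      · omega
    · congr 1
      rw [← Equiv.sum_comp (σ : Equiv.Perm (Fin n))]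
      refine Finset.sum_congr rfl fun i _ => ?_
      rw [T.comp_act _ _ i σ 1 σ ⟨fun b c hc => ?_, fun a c ha hc => ?_⟩]
      · simp
      · have : c = i := Fin.ext (by omega)
        subst this
        have hb : (b : ℕ) = 0 := by omega
        simp [hb]
      · have : c = a := Fin.ext (by rw [hc, outerSlot]; split_ifs <;> omega)
        subst this
        rw [outerSlot]
        split_ifs <;> omega
  map_comp {m n r p p' q q' t t'} hr ht hp hq htt h₁ h₂ i x y := by
    have e₁ : T.comp (Nat.add_comm r 1) (by omega) 0 μ (T.comp hr ht i x y)
        = T.comp hr h₁ i (T.comp (Nat.add_comm m 1) (by omega) 0 μ x) y :=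
      (T.comp_seq _ _ _ _ _ _ _ _ 0 i i (by simp) μ x y).symm
    have e₂ : ∑ c : Fin r, T.comp (r := r) rfl htt c (T.comp hr ht i x y) μ
        = (q * e).negOnePow • (∑ a : {a : Fin m // a ≠ i},
            T.comp hr h₁ i (T.comp (r := m) rfl hp a.1 x μ) y)
          + ∑ b : Fin n, T.comp hr h₂ i x (T.comp (r := n) rfl hq b y μ) := by
      rw [sum_slots hr i, Finset.smul_sum]
      congr 1
      · refine Finset.sum_congr rfl fun a _ => ?_
        exact T.comp_outer hr rfl rfl hr ht hp htt h₁ i a.1 _ i a.2 (slotEquiv_inl hr i a)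
          (by rw [outerSlot]; split_ifs <;> omega) x y μ
      · refine Finset.sum_congr rfl fun b _ => ?_
        exact T.comp_seq _ _ _ _ _ _ _ _ i b _ (slotEquiv_inr hr i b) x y μ
    have e₃ : ∑ a : Fin m, T.comp hr h₁ i (T.comp (r := m) rfl hp a x μ) y
        = T.comp hr h₂ i x (T.comp (Nat.add_comm n 1) (by omega) 0 μ y)
          + ∑ a : {a : Fin m // a ≠ i}, T.comp hr h₁ i (T.comp (r := m) rfl hp a.1 x μ) y := by
      rw [Fintype.sum_eq_add_sum_subtype_ne _ i]
      congr 1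
      exact T.comp_seq _ _ _ _ _ _ _ _ i 0 i (by simp) x μ y
    have s₁ : (e * t).negOnePow • (q * e).negOnePow • (∑ a : {a : Fin m // a ≠ i},
            T.comp hr h₁ i (T.comp (r := m) rfl hp a.1 x μ) y)
        = (e * p).negOnePow • (∑ a : {a : Fin m // a ≠ i},
            T.comp hr h₁ i (T.comp (r := m) rfl hp a.1 x μ) y) :=
      sgn_smul_sgn_smul (e * q) _ (by subst ht; ring)
    have s₂ : (e * p).negOnePow • (e * q).negOnePow •
          (∑ b : Fin n, T.comp hr h₂ i x (T.comp (r := n) rfl hq b y μ))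
        = (e * t).negOnePow • (∑ b : Fin n, T.comp hr h₂ i x (T.comp (r := n) rfl hq b y μ)) :=
      sgn_smul_sgn_smul 0 _ (by subst ht; ring)
    simp only [adL_apply, GrHom.id, LinearMap.id_apply, map_sub, LinearMap.sub_apply, map_sgn,
      map_sum, LinearMap.sum_apply, LinearMap.smul_apply, smul_sub]
    rw [e₁, e₂, s₂, smul_add, s₁]
    have e₃' := congrArg ((e * p).negOnePow • ·) e₃
    simp only [smul_add] at e₃'
    rw [e₃']
    abel

end GrOperad

theorem GrHom.map_adL {R T : GrOperad k s} (f : GrHom R T) {e : ℤ} (μ : R.V 1 e) {n : ℕ} {p q : ℤ}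
    (h : q = p + e) (x : R.V n p) : f.app (R.adL μ h x) = T.adL (f.app μ) h (f.app x) := by
  simp only [GrOperad.adL_apply, map_sub, map_sgn, map_sum, f.map_comp]

/-- A derivation of a bracket. -/
theorem Deriv.map_adL {T : GrOperad k s} {e' : ℤ} (D : Deriv (GrHom.id T) e') {e : ℤ} (μ : T.V 1 e)
    {n : ℕ} {p q t e'' p' : ℤ} (h : q = p + e) (ht : t = q + e') (he : e'' = e + e')
    (hp : p' = p + e') (x : T.V n p) :
    D.app ht (T.adL μ h x) = T.adL (D.app he μ) (by omega) x
      + (e' * e).negOnePow • T.adL μ (by omega) (D.app hp x) := by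
  simp only [GrOperad.adL_apply, map_sub, map_sgn, map_sum, smul_sub]
  rw [D.map_comp _ _ he hp ht (by omega) (by omega)]
  have : ∀ i : Fin n, D.app ht (T.comp (r := n) rfl h i x μ)
      = T.comp (r := n) rfl (by omega) i (D.app hp x) μ
        + (e' * p).negOnePow • T.comp (r := n) rfl (by omega) i x (D.app he μ) := fun i =>
    D.map_comp _ _ hp he ht _ _ i x μ
  simp only [this, Finset.sum_add_distrib, smul_add, ← Finset.smul_sum]
  rw [sgn_smul_sgn_smul (c := e'' * p) 0 _ (by subst he; ring),
    sgn_smul_sgn_smul (c := e * p) (e' * e) _ (by subst hp; ring)]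
  change T.comp _ _ 0 _ x + (e' * e).negOnePow • T.comp _ _ 0 μ _ - _ = _
  abel

/-- The square of the bracket with an odd operation. -/
theorem GrOperad.adL_adL [CharZero k] (T : GrOperad k s) (μ : T.V 1 (-1)) {n : ℕ} {p q t : ℤ}
    (h : q = p + -1) (ht : t = q + -1) (x : T.V n p) :
    T.adL μ ht (T.adL μ h x)
      = T.adL (e := -2) (T.comp (m := 1) (n := 1) rfl rfl 0 μ μ) (by omega) x := by
  have key := (T.ad μ).map_adL μ h ht (e'' := -2) rfl h x
  have e₁ : (T.ad μ).app (p := -1) (q := -2) rfl μ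
      = (2 : k) • T.comp (m := 1) (n := 1) rfl rfl 0 μ μ := by
    change T.adL μ _ μ = _
    rw [adL_apply, sgn_eq (a := -1 * -1) (b := 1) (c := 0) (by ring)]
    simp only [Int.negOnePow_one, Finset.univ_unique, Finset.sum_singleton, Units.neg_smul, one_smul,
      sub_neg_eq_add]
    rw [two_smul]
    rfl
  rw [e₁, show ((-1 : ℤ) * -1).negOnePow = -1 by decide] at key
  have e₂ : T.adL (e := -2) ((2 : k) • T.comp (m := 1) (n := 1) rfl rfl 0 μ μ)
      (by omega : t = p + -2) x
      = (2 : k) • T.adL (e := -2) (T.comp (m := 1) (n := 1) rfl rfl 0 μ μ) (by omega) x := by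
    rw [two_smul, adL_add, two_smul]
  rw [e₂] at key
  have h2 : (2 : k) • T.adL μ ht (T.adL μ h x) = (2 : k) • T.adL (e := -2)
      (T.comp (m := 1) (n := 1) rfl rfl 0 μ μ) (by omega) x := by
    rw [two_smul]
    nth_rewrite 1 [show T.adL μ ht (T.adL μ h x) = (T.ad μ).app ht (T.adL μ h x) from rfl]
    rw [key]
    change _ + (-1 : ℤˣ) • T.adL μ ht (T.adL μ h x) + _ = _
    simp
  exact smul_right_injective _ (two_ne_zero (α := k)) h2

/-- The graded commutator of an odd and an odd derivation. -/
def Deriv.oddComm {T : GrOperad k s} (D : Deriv (GrHom.id T) (-1)) (E : Deriv (GrHom.id T) 1) :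
    Deriv (GrHom.id T) 0 where
  app {n p q} h := D.app (p := p + 1) (by omega) ∘ₗ E.app rfl + E.app (p := p - 1) (by omega) ∘ₗ
    D.app (by omega)
  map_act h σ x := by simp [D.map_act, E.map_act]
  map_comp {m n r p p' q q' t t'} hr ht hp hq htt h₁ h₂ i x y := by
    obtain rfl : p' = p := by omega
    obtain rfl : q' = q := by omega
    obtain rfl : t' = t := by omega
    simp only [LinearMap.add_apply, LinearMap.comp_apply]
    rw [E.map_comp hr ht rfl rfl rfl (by omega) (by omega),
      D.map_comp hr ht (show p' - 1 = _ by omega) (show q' - 1 = _ by omega) _ (by omega) (by omega),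
      map_add, map_add, map_sgn, map_sgn,
      D.map_comp hr _ (show p' = _ by omega) (show q' - 1 = _ by omega) _ (by omega) (by omega),
      D.map_comp hr _ (show p' - 1 = _ by omega) (show q' = _ by omega) _ (by omega) (by omega),
      E.map_comp hr _ (show p' = _ by omega) (show q' + 1 = _ by omega) _ (by omega) (by omega),
      E.map_comp hr _ (show p' + 1 = _ by omega) (show q' = _ by omega) _ (by omega) (by omega)]
    simp only [GrHom.id, LinearMap.id_apply, map_add, LinearMap.add_apply, smul_add, smul_smul,
      ← Int.negOnePow_add]
    rw [sgn_eq (a := 1 * p' + -1 * p') (b := 0) (c := 0) (by ring),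
      sgn_eq (a := -1 * p' + 1 * p') (b := 0) (c := 0) (by ring),
      sgn_eq (a := -1 * (p' + 1)) (b := p' + 1) (c := -(p' + 1)) (by ring),
      sgn_eq (a := 1 * (p' - 1)) (b := p' + 1) (c := -1) (by ring),
      sgn_eq (a := 1 * p') (b := p') (c := 0) (by ring),
      sgn_eq (a := -1 * p') (b := p') (c := -p') (by ring), Int.negOnePow_succ,
      sgn_eq (a := 0 * p') (b := 0) (c := 0) (by ring)]
    simp only [Int.negOnePow_zero, one_smul, Units.neg_smul]
    abel

/-! ### Power series -/

/-- Power series with coefficients in an operad. -/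
def ps (T : GrOperad k s) : GrOperad k s where
  V n p := ℕ → T.V n p
  act :=
    { toFun := fun σ => (T.act σ).compLeft ℕ
      map_one' := by ext; simp
      map_mul' := fun _ _ => by ext; simp }
  comp hr ht i := LinearMap.mk₂ k
    (fun x y w => ∑ v ∈ Finset.HasAntidiagonal.antidiagonal w, T.comp hr ht i (x v.1) (y v.2))
    (fun _ _ _ => by ext; simp [Finset.sum_add_distrib])
    (fun _ _ _ => by ext; simp [Finset.smul_sum])
    (fun _ _ _ => by ext; simp [Finset.sum_add_distrib])
    (fun _ _ _ => by ext; simp [Finset.smul_sum])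
  comp_act hr ht i σ τ ρ h x y := funext fun w => by
    change T.act ρ (∑ v ∈ Finset.HasAntidiagonal.antidiagonal w, T.comp hr ht i (x v.1) (y v.2))
      = ∑ v ∈ Finset.HasAntidiagonal.antidiagonal w, T.comp hr ht ((σ : Equiv.Perm _) i)
        (T.act σ (x v.1)) (T.act τ (y v.2))
    rw [map_sum]
    refine Finset.sum_congr rfl fun v _ => ?_
    exact T.comp_act hr ht i σ τ ρ h _ _
  comp_seq ha hb hr hr' hpq hqt he he' i j c hc x y z := funext fun w => by
    simp only [LinearMap.mk₂_apply, map_sum, LinearMap.sum_apply, Finset.sum_sigma']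
    refine Finset.sum_nbij'
      (fun v => ⟨(v.2.1, v.2.2 + v.1.2), (v.2.2, v.1.2)⟩)
      (fun v => ⟨(v.1.1 + v.2.1, v.2.2), (v.1.1, v.2.1)⟩) ?_ ?_ ?_ ?_ ?_
    iterate 2
      rintro ⟨⟨_, _⟩, ⟨_, _⟩⟩ h
      simp only [Finset.mem_sigma, Finset.HasAntidiagonal.mem_antidiagonal] at h ⊢
      obtain ⟨rfl, rfl⟩ := h
      exact ⟨by ring, by trivial⟩
    iterate 2
      rintro ⟨⟨_, _⟩, ⟨_, _⟩⟩ h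
      simp only [Finset.mem_sigma, Finset.HasAntidiagonal.mem_antidiagonal] at h
      obtain ⟨rfl, rfl⟩ := h
      rfl
    intro v _
    exact T.comp_seq ha hb hr hr' hpq hqt he he' i j c hc _ _ _
  comp_par ha hb hr hr' hpq hpt he he' i j c c' hij hc hc' x y z := funext fun w => by
    simp only [LinearMap.mk₂_apply, map_sum, LinearMap.sum_apply, Finset.sum_sigma', Pi.smul_apply,
      Finset.smul_sum]
    refine Finset.sum_nbij'
      (fun v => ⟨(v.2.1 + v.1.2, v.2.2), (v.2.1, v.1.2)⟩)
      (fun v => ⟨(v.2.1 + v.1.2, v.2.2), (v.2.1, v.1.2)⟩) ?_ ?_ ?_ ?_ ?_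
    iterate 2
      rintro ⟨⟨_, _⟩, ⟨_, _⟩⟩ h
      simp only [Finset.mem_sigma, Finset.HasAntidiagonal.mem_antidiagonal] at h ⊢
      obtain ⟨rfl, rfl⟩ := h
      exact ⟨by ring, by trivial⟩
    iterate 2
      rintro ⟨⟨_, _⟩, ⟨_, _⟩⟩ h
      simp only [Finset.mem_sigma, Finset.HasAntidiagonal.mem_antidiagonal] at h
      obtain ⟨rfl, rfl⟩ := h
      rfl
    intro v _
    exact T.comp_par ha hb hr hr' hpq hpt he he' i j c c' hij hc hc' _ _ _

namespace ps

variable {T U : GrOperad k s}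

/-- The coefficient of a power series. -/
def coeff (T : GrOperad k s) {n : ℕ} {p : ℤ} (w : ℕ) : (ps T).V n p →ₗ[k] T.V n p :=
  LinearMap.proj w

theorem ext {n : ℕ} {p : ℤ} {x y : (ps T).V n p} (h : ∀ w, coeff T w x = coeff T w y) : x = y :=
  funext h

theorem coeff_comp {m n r : ℕ} {p q t : ℤ} (hr : r + 1 = m + n) (ht : t = p + q) (i : Fin m)
    (x : (ps T).V m p) (y : (ps T).V n q) (w : ℕ) : coeff T w ((ps T).comp hr ht i x y)
      = ∑ v ∈ Finset.HasAntidiagonal.antidiagonal w,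
          T.comp hr ht i (coeff T v.1 x) (coeff T v.2 y) := rfl

/-- Monomials. -/
def mono (T : GrOperad k s) {n : ℕ} {p : ℤ} (w : ℕ) : T.V n p →ₗ[k] (ps T).V n p :=
  LinearMap.single k (fun _ : ℕ => T.V n p) w

theorem coeff_mono {n : ℕ} {p : ℤ} (w v : ℕ) (x : T.V n p) :
    coeff T v (mono T w x) = if v = w then x else 0 := by
  change (Pi.single w x : ℕ → T.V n p) v = _
  rw [Pi.single_apply]

theorem coeff_mono_same {n : ℕ} {p : ℤ} (w : ℕ) (x : T.V n p) : coeff T w (mono T w x) = x := by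
  rw [coeff_mono, if_pos rfl]

theorem coeff_comp_mono {m n r : ℕ} {p q t : ℤ} (hr : r + 1 = m + n) (ht : t = p + q) (i : Fin m)
    (x : (ps T).V m p) (w v : ℕ) (y : T.V n q) :
    coeff T (w + v) ((ps T).comp hr ht i x (mono T v y)) = T.comp hr ht i (coeff T w x) y := by
  rw [coeff_comp, Finset.sum_eq_single (w, v)]
  · rw [coeff_mono_same]
  · rintro ⟨a, b⟩ h h'
    rw [Finset.HasAntidiagonal.mem_antidiagonal] at h
    rw [coeff_mono, if_neg, map_zero]
    rintro rfl
    apply h'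
    congr 1
    simp only at h
    omega
  · intro h
    simp at h

theorem coeff_comp_mono_lt {m n r : ℕ} {p q t : ℤ} (hr : r + 1 = m + n) (ht : t = p + q)
    (i : Fin m) (x : (ps T).V m p) {w v : ℕ} (hw : w < v) (y : T.V n q) :
    coeff T w ((ps T).comp hr ht i x (mono T v y)) = 0 := by
  rw [coeff_comp]
  refine Finset.sum_eq_zero fun u hu => ?_
  rw [Finset.HasAntidiagonal.mem_antidiagonal] at hu
  rw [coeff_mono, if_neg (by omega), map_zero]

theorem mono_comp_mono {m n r : ℕ} {p q t : ℤ} (hr : r + 1 = m + n) (ht : t = p + q) (i : Fin m)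
    (v w : ℕ) (x : T.V m p) (y : T.V n q) :
    (ps T).comp hr ht i (mono T v x) (mono T w y) = mono T (v + w) (T.comp hr ht i x y) := by
  refine ext fun u => ?_
  by_cases h : w ≤ u
  · obtain ⟨u, rfl⟩ := Nat.exists_eq_add_of_le' h
    rw [coeff_comp_mono, coeff_mono, coeff_mono]
    by_cases h' : u = v
    · simp [h']
    · rw [if_neg h', if_neg (by omega)]
      simp
  · rw [coeff_comp_mono_lt _ _ _ _ (by omega), coeff_mono, if_neg (by omega)]

/-- The action of a morphism on power series. -/
def map (f : GrHom T U) : GrHom (ps T) (ps U) where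
  app := f.app.compLeft ℕ
  map_act σ x := funext fun w => f.map_act σ (x w)
  map_comp hr ht i x y := funext fun w => by
    change f.app (coeff T w ((ps T).comp hr ht i x y)) = coeff U w ((ps U).comp hr ht i _ _)
    rw [coeff_comp, coeff_comp, map_sum]
    refine Finset.sum_congr rfl fun v _ => ?_
    exact f.map_comp hr ht i _ _

theorem coeff_map (f : GrHom T U) {n : ℕ} {p : ℤ} (x : (ps T).V n p) (w : ℕ) :
    coeff U w ((map f).app x) = f.app (coeff T w x) := rfl

theorem map_mono (f : GrHom T U) {n : ℕ} {p : ℤ} (w : ℕ) (x : T.V n p) :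
    (map f).app (mono T w x) = mono U w (f.app x) := ext fun v => by
  rw [coeff_map, coeff_mono, coeff_mono]
  split_ifs <;> simp

/-- The action of a derivation on power series. -/
def deriv {f : GrHom T U} {e : ℤ} (D : Deriv f e) : Deriv (map f) e where
  app h := (D.app h).compLeft ℕ
  map_act h σ x := funext fun w => D.map_act h σ (x w)
  map_comp hr ht hp hq htt h₁ h₂ i x y := ext fun w => by
    change D.app htt (coeff T w ((ps T).comp hr ht i x y)) = _
    rw [coeff_comp, map_sum, map_add, map_sgn, coeff_comp, coeff_comp, Finset.smul_sum, ← Finset.sum_add_distrib]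
    refine Finset.sum_congr rfl fun v _ => ?_
    exact D.map_comp hr ht hp hq htt h₁ h₂ i _ _

theorem coeff_deriv {f : GrHom T U} {e : ℤ} (D : Deriv f e) {n : ℕ} {p q : ℤ} (h : q = p + e)
    (x : (ps T).V n p) (w : ℕ) : coeff U w ((deriv D).app h x) = D.app h (coeff T w x) := rfl

end ps

/-! ### Exponentials -/

namespace Deriv

variable {T : GrOperad k s} (D : Deriv (GrHom.id T) 0)

/-- The divided powers of a derivation of degree zero. -/
def divPow : ℕ → ∀ {n : ℕ} {p : ℤ}, T.V n p →ₗ[k] T.V n p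
  | 0, _, _ => LinearMap.id
  | w + 1, _, _ => ((w + 1 : ℕ) : k)⁻¹ • (D.app (by omega) ∘ₗ divPow w)

theorem divPow_succ (w : ℕ) {n : ℕ} {p : ℤ} (x : T.V n p) :
    D.divPow (w + 1) x = ((w + 1 : ℕ) : k)⁻¹ • D.app (by omega) (D.divPow w x) := rfl

variable [CharZero k]

theorem app_divPow (w : ℕ) {n : ℕ} {p : ℤ} (x : T.V n p) :
    D.app (by omega) (D.divPow w x) = ((w + 1 : ℕ) : k) • D.divPow (w + 1) x := by
  rw [divPow_succ, smul_smul, mul_inv_cancel₀ (Nat.cast_ne_zero.2 (Nat.succ_ne_zero w)), one_smul]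

theorem divPow_act (w : ℕ) {n : ℕ} {p : ℤ} (σ : s.perms n) (x : T.V n p) :
    D.divPow w (T.act σ x) = T.act σ (D.divPow w x) := by
  induction w with
  | zero => rfl
  | succ w ih => rw [divPow_succ, ih, D.map_act, divPow_succ, map_smul]

theorem divPow_comp (w : ℕ) {m n r : ℕ} {p q t : ℤ} (hr : r + 1 = m + n) (ht : t = p + q)
    (i : Fin m) (x : T.V m p) (y : T.V n q) : D.divPow w (T.comp hr ht i x y)
      = ∑ v ∈ Finset.HasAntidiagonal.antidiagonal w,
          T.comp hr ht i (D.divPow v.1 x) (D.divPow v.2 y) := by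
  induction w with
  | zero => simp [divPow]
  | succ w ih =>
    have hw : ((w + 1 : ℕ) : k) ≠ 0 := Nat.cast_ne_zero.2 (Nat.succ_ne_zero w)
    apply smul_right_injective _ hw
    simp only
    rw [← app_divPow, ih, map_sum]
    have e₁ : ∀ v : ℕ × ℕ, D.app (p := t) (q := t) (by omega)
        (T.comp hr ht i (D.divPow v.1 x) (D.divPow v.2 y))
        = ((v.1 + 1 : ℕ) : k) • T.comp hr ht i (D.divPow (v.1 + 1) x) (D.divPow v.2 y)
          + ((v.2 + 1 : ℕ) : k) • T.comp hr ht i (D.divPow v.1 x) (D.divPow (v.2 + 1) y) := by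
      intro v
      rw [D.map_comp hr ht (by omega) (by omega) _ ht ht, app_divPow, app_divPow]
      simp [GrHom.id]
    rw [Finset.sum_congr rfl fun v _ => e₁ v, Finset.sum_add_distrib, Finset.smul_sum]
    have e₂ : ∀ v ∈ Finset.HasAntidiagonal.antidiagonal (w + 1),
        ((w + 1 : ℕ) : k) • T.comp hr ht i (D.divPow v.1 x) (D.divPow v.2 y)
        = (v.1 : k) • T.comp hr ht i (D.divPow v.1 x) (D.divPow v.2 y)
          + (v.2 : k) • T.comp hr ht i (D.divPow v.1 x) (D.divPow v.2 y) := by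
      intro v hv
      rw [Finset.HasAntidiagonal.mem_antidiagonal] at hv
      rw [← hv, Nat.cast_add, add_smul]
    rw [Finset.sum_congr rfl e₂, Finset.sum_add_distrib]
    congr 1
    · rw [Finset.Nat.sum_antidiagonal_succ]
      simp
    · rw [Finset.Nat.sum_antidiagonal_succ']
      simp

/-- The exponential of a derivation of degree zero. -/
def exp : GrHom T (ps T) where
  app := LinearMap.pi fun w => D.divPow w
  map_act σ x := funext fun w => D.divPow_act w σ x
  map_comp hr ht i x y := funext fun w => D.divPow_comp w hr ht i x y

theorem divPow_comm {e : ℤ} (E : Deriv (GrHom.id T) e)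
    (h : ∀ {n : ℕ} {p q : ℤ} (hq : q = p + e) (x : T.V n p),
      E.app hq (D.app (by omega) x) = D.app (by omega) (E.app hq x))
    (w : ℕ) {n : ℕ} {p q : ℤ} (hq : q = p + e) (x : T.V n p) :
    E.app hq (D.divPow w x) = D.divPow w (E.app hq x) := by
  induction w with
  | zero => rfl
  | succ w ih => rw [divPow_succ, map_smul, h, ih, divPow_succ]

end Deriv

/-! ### Permutations that move a marked input -/

theorem val_succAbove {n : ℕ} (j : Fin (n + 1)) (a : Fin n) :
    (j.succAbove a : ℕ) = if (a : ℕ) < j then (a : ℕ) else a + 1 := by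
  rw [Fin.succAbove]
  split_ifs with h h' h'
  · rfl
  · exact absurd h h'
  · exact absurd h' h
  · rfl

/-- The permutation that sends `j` to `j'` and is `σ` on the other elements. -/
def insPerm {n : ℕ} (j j' : Fin (n + 1)) (σ : Equiv.Perm (Fin n)) : Equiv.Perm (Fin (n + 1)) :=
  (finSuccEquiv' j).trans ((Equiv.optionCongr σ).trans (finSuccEquiv' j').symm)

@[simp] theorem insPerm_self {n : ℕ} (j j' : Fin (n + 1)) (σ : Equiv.Perm (Fin n)) :
    insPerm j j' σ j = j' := by
  simp [insPerm]

@[simp] theorem insPerm_succAbove {n : ℕ} (j j' : Fin (n + 1)) (σ : Equiv.Perm (Fin n)) (a : Fin n) :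
    insPerm j j' σ (j.succAbove a) = j'.succAbove (σ a) := by
  simp [insPerm]

theorem perm_ext_succAbove {n : ℕ} (j : Fin (n + 1)) {τ τ' : Equiv.Perm (Fin (n + 1))}
    (h : τ j = τ' j) (h' : ∀ a, τ (j.succAbove a) = τ' (j.succAbove a)) : τ = τ' := by
  ext v
  rcases Fin.eq_self_or_eq_succAbove j v with rfl | ⟨a, rfl⟩
  · rw [h]
  · rw [h']

theorem insPerm_one {n : ℕ} (j : Fin (n + 1)) : insPerm j j 1 = 1 :=
  perm_ext_succAbove j (by simp) (by simp)

theorem insPerm_mul {n : ℕ} (j j' j'' : Fin (n + 1)) (σ τ : Equiv.Perm (Fin n)) :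
    insPerm j' j'' σ * insPerm j j' τ = insPerm j j'' (σ * τ) :=
  perm_ext_succAbove j (by simp) (by simp)

/-- `τ` induces `σ` on the complement of the marked element `j`. -/
def IsMark {n : ℕ} (j : Fin (n + 1)) (τ : Equiv.Perm (Fin (n + 1))) (σ : Equiv.Perm (Fin n)) : Prop :=
  IsBlockPerm j τ (1 : Equiv.Perm (Fin 0)) σ

theorem isMark_iff {n : ℕ} {j : Fin (n + 1)} {τ : Equiv.Perm (Fin (n + 1))} {σ : Equiv.Perm (Fin n)} :
    IsMark j τ σ ↔ ∀ a, τ (j.succAbove a) = (τ j).succAbove (σ a) := by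
  constructor
  · intro h a
    have h' := h.outer (j.succAbove a) a (Fin.succAbove_ne j a) (by
      rw [outerSlot, val_succAbove]
      split_ifs <;> omega)
    have hne : τ (j.succAbove a) ≠ τ j := fun h => Fin.succAbove_ne j a (τ.injective h)
    rw [ne_eq, Fin.ext_iff] at hne
    ext
    rw [val_succAbove, h', outerSlot]
    split_ifs <;> omega
  · intro h
    refine ⟨fun b => b.elim0, fun a c ha hc => ?_⟩
    obtain ⟨a', rfl⟩ := Fin.exists_succAbove_eq ha
    have : c = a' := Fin.ext (by
      rw [hc, outerSlot, val_succAbove]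
      split_ifs <;> omega)
    subst this
    rw [h c, outerSlot, val_succAbove]
    split_ifs <;> omega

theorem isMark_insPerm {n : ℕ} (j j' : Fin (n + 1)) (σ : Equiv.Perm (Fin n)) :
    IsMark j (insPerm j j' σ) σ := isMark_iff.2 (by simp)

theorem IsMark.eq_insPerm {n : ℕ} {j : Fin (n + 1)} {τ : Equiv.Perm (Fin (n + 1))}
    {σ : Equiv.Perm (Fin n)} (h : IsMark j τ σ) : τ = insPerm j (τ j) σ :=
  perm_ext_succAbove j (by simp) (by simpa using isMark_iff.1 h)

/-- Extension of a permutation by a fixed element. -/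
def extP {n : ℕ} (j : Fin (n + 1)) (σ : s.perms n) : s.perms (n + 1) :=
  ⟨insPerm j j σ, by
    obtain ⟨σ, hσ⟩ := σ
    cases s with
    | symmetric => exact Subgroup.mem_top _
    | nonsymmetric =>
      rw [Flavour.perms, Subgroup.mem_bot] at hσ ⊢
      subst hσ
      exact insPerm_one j⟩

theorem coe_extP {n : ℕ} (j : Fin (n + 1)) (σ : s.perms n) :
    (extP j σ : Equiv.Perm (Fin (n + 1))) = insPerm j j σ := rfl

theorem exists_blockPerm {m n r : ℕ} (hr : r + 1 = m + n) (i : Fin m) (σ : s.perms m)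
    (τ : s.perms n) : ∃ ρ : s.perms r, IsBlockPerm i (σ : Equiv.Perm (Fin m))
      (τ : Equiv.Perm (Fin n)) (ρ : Equiv.Perm (Fin r)) := by
  obtain ⟨σ, hσ⟩ := σ
  obtain ⟨τ, hτ⟩ := τ
  cases s with
  | nonsymmetric =>
    rw [Flavour.perms, Subgroup.mem_bot] at hσ hτ
    subst hσ hτ
    exact ⟨1, fun b c hc => by simpa using hc, fun a c _ hc => by simpa using hc⟩
  | symmetric =>
    let e : Equiv.Perm (Fin r) := (slotEquiv hr i).symm.trans
      ((Equiv.sumCongr (σ.subtypeEquiv (p := (· ≠ i)) (q := (· ≠ σ i)) (by simp)) τ).trans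
        (slotEquiv hr (σ i)))
    refine ⟨⟨e, Subgroup.mem_top _⟩, fun b c hc => ?_, fun a c ha hc => ?_⟩
    · obtain rfl : slotEquiv hr i (.inr b) = c := Fin.ext hc.symm
      simp [e, slotEquiv_inr]
    · obtain rfl : slotEquiv hr i (.inl ⟨a, ha⟩) = c := Fin.ext hc.symm
      simp [e, slotEquiv_inl]

theorem blockPerm_mark_inner {m n r : ℕ} (hr : r + 1 = m + n) {i : Fin m}
    {σ : Equiv.Perm (Fin m)} {τ : Equiv.Perm (Fin n)} {ρ : Equiv.Perm (Fin r)}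
    {j : Fin (n + 1)} {τ' : Equiv.Perm (Fin (n + 1))} {ρ' : Equiv.Perm (Fin (r + 1))}
    (h : IsBlockPerm i σ τ ρ) (hj : IsMark j τ' τ) (h' : IsBlockPerm i σ τ' ρ')
    (c : Fin (r + 1)) (hc : (c : ℕ) = i + j) : IsMark c ρ' ρ := by
  have hc' := h'.inner j c hc
  refine ⟨fun b => b.elim0, fun v w hv hw => ?_⟩
  rw [ne_eq, Fin.ext_iff] at hv
  have hr' : r + 1 + 1 = m + (n + 1) := by omega
  obtain ⟨(⟨a, ha⟩ | b), rfl⟩ := (slotEquiv hr' i).surjective v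
  · rw [slotEquiv_inl] at hv hw
    have hσ : σ a ≠ σ i := fun h => ha (σ.injective h)
    rw [ne_eq, Fin.ext_iff] at ha hσ
    have e₁ := h'.outer a _ (fun h => ha (congrArg _ h)) (slotEquiv_inl hr' i ⟨a, fun h => ha (congrArg _ h)⟩)
    have e₂ := h.outer a w (fun h => ha (congrArg _ h)) (by
      rw [hw]
      simp only [outerSlot]
      split_ifs <;> omega)
    have := (τ' j).2
    rw [e₂, e₁, hc']
    simp only [outerSlot]
    split_ifs <;> omega
  · rw [slotEquiv_inr] at hv hw
    have hb : b ≠ j := fun h => hv (by rw [h]; omega)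
    have hb' : τ' b ≠ τ' j := fun h => hb (τ'.injective h)
    have e₁ := h'.inner b _ (slotEquiv_inr hr' i b)
    rw [ne_eq, Fin.ext_iff] at hb'
    have hbn : outerSlot j 0 b < n := outerSlot_lt (m := n + 1) (n := 0) rfl j.2 b.2 (fun h => hb (Fin.ext h))
    have e₃ := hj.outer b ⟨_, hbn⟩ hb rfl
    have e₂ := h.inner ⟨_, hbn⟩ w (by
      rw [hw]
      rw [ne_eq, Fin.ext_iff] at hb
      simp only [outerSlot]
      split_ifs <;> omega)
    rw [e₂, e₁, hc', e₃]
    simp only [outerSlot]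
    split_ifs <;> omega

theorem blockPerm_mark_outer {m n r : ℕ} (hr : r + 1 = m + n) {i : Fin m}
    {σ : Equiv.Perm (Fin m)} {τ : Equiv.Perm (Fin n)} {ρ : Equiv.Perm (Fin r)}
    {j : Fin (m + 1)} {σ' : Equiv.Perm (Fin (m + 1))} {ρ' : Equiv.Perm (Fin (r + 1))}
    (h : IsBlockPerm i σ τ ρ) (hj : IsMark j σ' σ) (h' : IsBlockPerm (j.succAbove i) σ' τ ρ')
    (c : Fin (r + 1)) (hc : (c : ℕ) = outerSlot (j.succAbove i) n j) : IsMark c ρ' ρ := by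
  have hji : j ≠ j.succAbove i := (Fin.succAbove_ne j i).symm
  have hc' := h'.outer j c hji hc
  have hs : ∀ a, (σ' (j.succAbove a) : ℕ) = if (σ a : ℕ) < σ' j then (σ a : ℕ) else σ a + 1 := by
    intro a
    rw [isMark_iff.1 hj a, val_succAbove]
  have hr' : r + 1 + 1 = m + 1 + n := by omega
  refine ⟨fun b => b.elim0, fun v w hv hw => ?_⟩
  rw [ne_eq, Fin.ext_iff] at hv
  obtain ⟨(⟨a, ha⟩ | b), rfl⟩ := (slotEquiv hr' (j.succAbove i)).surjective v
  · have e₁ := h'.outer a _ ha (slotEquiv_inl hr' _ ⟨a, ha⟩)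
    rw [slotEquiv_inl] at hv hw
    have haj : a ≠ j := fun h => hv (by subst h; exact hc.symm)
    obtain ⟨a, rfl⟩ := Fin.exists_succAbove_eq haj
    have hai : a ≠ i := fun h => ha (by rw [h])
    have hσ : σ a ≠ σ i := fun h => hai (σ.injective h)
    rw [ne_eq, Fin.ext_iff] at hσ
    have hai' : (a : ℕ) ≠ i := fun h => hai (Fin.ext h)
    have e₂ := h.outer a w hai (by
      rw [hw, hc, val_succAbove, val_succAbove]
      simp only [outerSlot]
      split_ifs <;> omega)
    rw [e₂, e₁, hc', hs, hs]
    simp only [outerSlot]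
    split_ifs <;> omega
  · have e₁ := h'.inner b _ (slotEquiv_inr hr' _ b)
    rw [slotEquiv_inr] at hv hw
    have e₂ := h.inner b w (by
      rw [hw, hc, val_succAbove]
      simp only [outerSlot]
      have := b.2
      split_ifs <;> omega)
    have := (τ b).2
    rw [e₂, e₁, hc', hs]
    simp only [outerSlot]
    split_ifs <;> omega

/-! ### Transport between equal arities and degrees -/

/-- Transport along equalities of arities and degrees, and zero if these do not hold. -/
def GrOperad.castL (T : GrOperad k s) {m : ℕ} {p : ℤ} (m' : ℕ) (p' : ℤ) :
    T.V m p →ₗ[k] T.V m' p' :=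
  if h : m = m' ∧ p = p' then h.1 ▸ h.2 ▸ LinearMap.id else 0

theorem GrOperad.castL_self (T : GrOperad k s) {m : ℕ} {p : ℤ} (x : T.V m p) :
    T.castL m p x = x := by
  rw [castL, dif_pos ⟨rfl, rfl⟩]
  rfl

theorem GrOperad.castL_of_ne (T : GrOperad k s) {m m' : ℕ} {p p' : ℤ} (h : ¬ (m = m' ∧ p = p'))
    (x : T.V m p) : T.castL m' p' x = 0 := by
  rw [castL, dif_neg h]
  rfl

theorem GrHom.map_castL {R T : GrOperad k s} (f : GrHom R T) {m m' : ℕ} {p p' : ℤ} (x : R.V m p) :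
    f.app (R.castL m' p' x) = T.castL m' p' (f.app x) := by
  by_cases h : m = m' ∧ p = p'
  · obtain ⟨rfl, rfl⟩ := h
    rw [R.castL_self, T.castL_self]
  · rw [R.castL_of_ne h, T.castL_of_ne h, map_zero]

/-! ### Families of operations with a marked input -/

/-- Families of operations, one for each position of an additional marked input. The scalar is the
coefficient of the identity operation, whose only input is marked. -/
abbrev Fam (R : GrOperad k s) (n : ℕ) (p : ℤ) : Type u := (Fin (n + 1) → R.V (n + 1) p) × k

namespace Fam

variable {R T U : GrOperad k s}

/-- An operation with the input `j` marked. -/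
def sing {n : ℕ} {p : ℤ} (j : Fin (n + 1)) : R.V (n + 1) p →ₗ[k] Fam R n p :=
  LinearMap.inl k _ _ ∘ₗ LinearMap.single k (fun _ => R.V (n + 1) p) j

/-- Multiples of the identity operation. -/
def unit {n : ℕ} {p : ℤ} (r : k) : Fam R n p := (0, r)

theorem eq_sum {n : ℕ} {p : ℤ} (Y : Fam R n p) : Y = ∑ j, sing j (Y.1 j) + unit Y.2 := by
  refine Prod.ext ?_ ?_
  · simp only [sing, unit, LinearMap.comp_apply, Prod.fst_add, Prod.fst_sum, LinearMap.inl_apply,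
      add_zero, LinearMap.coe_single]
    exact (Finset.univ_sum_single Y.1).symm
  · simp [sing, unit, Prod.snd_sum]

theorem induction {n : ℕ} {p : ℤ} {C : Fam R n p → Prop} (h : ∀ j y, C (sing j y))
    (h₀ : ∀ r, C (unit r)) (ha : ∀ Y Y', C Y → C Y' → C (Y + Y')) (Y : Fam R n p) : C Y := by
  rw [eq_sum Y]
  refine ha _ _ ?_ (h₀ _)
  refine Finset.sum_induction _ C ha ?_ fun j _ => h j _
  have := h 0 0
  rwa [map_zero] at this

theorem sing_congr {n : ℕ} {p : ℤ} {j j' : Fin (n + 1)} {y y' : R.V (n + 1) p} (h : (j : ℕ) = j')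
    (hy : y = y') : sing j y = sing j' y' := by
  rw [Fin.ext h, hy]

/-- The action of a morphism on families. -/
def map (f : GrHom R T) {n : ℕ} {p : ℤ} : Fam R n p →ₗ[k] Fam T n p :=
  (f.app.compLeft (Fin (n + 1))).prodMap LinearMap.id

theorem map_sing (f : GrHom R T) {n : ℕ} {p : ℤ} (j : Fin (n + 1)) (y : R.V (n + 1) p) :
    map f (sing j y) = sing j (f.app y) := by
  refine Prod.ext (funext fun i => ?_) rfl
  change f.app ((Pi.single j y : Fin (n + 1) → R.V (n + 1) p) i)
    = (Pi.single j (f.app y) : Fin (n + 1) → T.V (n + 1) p) i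
  rw [Pi.single_apply, Pi.single_apply]
  split_ifs <;> simp

theorem map_unit (f : GrHom R T) {n : ℕ} {p : ℤ} (r : k) :
    map f (unit r : Fam R n p) = unit r :=
  Prod.ext (funext fun _ => map_zero f.app) rfl

/-- Insertion of an operation of arity zero in the marked input. -/
def ins (f : GrHom R T) {e : ℤ} (b : T.V 0 e) {n : ℕ} {p q : ℤ} (h : q = p + e) :
    Fam R n p →ₗ[k] T.V n q :=
  LinearMap.coprod
    (∑ j : Fin (n + 1), (T.comp (n := 0) (r := n) rfl h j).flip b ∘ₗ f.app ∘ₗ LinearMap.proj j)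
    (LinearMap.toSpanSingleton k _ (T.castL n q b))

theorem ins_apply (f : GrHom R T) {e : ℤ} (b : T.V 0 e) {n : ℕ} {p q : ℤ} (h : q = p + e)
    (Y : Fam R n p) : ins f b h Y
      = ∑ j, T.comp (n := 0) (r := n) rfl h j (f.app (Y.1 j)) b + Y.2 • T.castL n q b := by
  simp [ins]

theorem ins_sing (f : GrHom R T) {e : ℤ} (b : T.V 0 e) {n : ℕ} {p q : ℤ} (h : q = p + e)
    (j : Fin (n + 1)) (y : R.V (n + 1) p) :
    ins f b h (sing j y) = T.comp (n := 0) (r := n) rfl h j (f.app y) b := by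
  rw [ins_apply, Finset.sum_eq_single j]
  · simp [sing]
  · intro i _ hi
    simp [sing, hi]
  · simp

theorem ins_unit (f : GrHom R T) {e : ℤ} (b : T.V 0 e) {n : ℕ} {p q : ℤ} (h : q = p + e)
    (r : k) : ins f b h (unit r : Fam R n p) = r • T.castL n q b := by
  rw [ins_apply]
  simp [unit]

theorem ins_map (f : GrHom R T) (g : GrHom T U) {e : ℤ} (b : U.V 0 e) {n : ℕ} {p q : ℤ}
    (h : q = p + e) (Y : Fam R n p) : ins g b h (map f Y) = ins (f.trans g) b h Y := by
  rw [ins_apply, ins_apply]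
  rfl

theorem map_ins (f : GrHom R T) (g : GrHom T U) {e : ℤ} (b : T.V 0 e) {n : ℕ} {p q : ℤ}
    (h : q = p + e) (Y : Fam R n p) : g.app (ins f b h Y) = ins (f.trans g) (g.app b) h Y := by
  rw [ins_apply, ins_apply, map_add, map_sum, map_smul, g.map_castL]
  simp only [g.map_comp]
  rfl

theorem ins_add (f : GrHom R T) {e : ℤ} (b b' : T.V 0 e) {n : ℕ} {p q : ℤ} (h : q = p + e)
    (Y : Fam R n p) : ins f (b + b') h Y = ins f b h Y + ins f b' h Y := by
  simp only [ins_apply, map_add, Finset.sum_add_distrib, smul_add]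
  abel

theorem ins_zero (f : GrHom R T) {e : ℤ} {n : ℕ} {p q : ℤ} (h : q = p + e)
    (Y : Fam R n p) : ins f (0 : T.V 0 e) h Y = 0 := by
  simp only [ins_apply, map_zero, Finset.sum_const_zero, smul_zero, add_zero]

/-- The group action on families. -/
def act {n : ℕ} {p : ℤ} (σ : s.perms n) : Fam R n p →ₗ[k] Fam R n p :=
  (LinearMap.pi fun j => R.act (extP j σ) ∘ₗ LinearMap.proj j).prodMap LinearMap.id

theorem act_sing {n : ℕ} {p : ℤ} (σ : s.perms n) (j : Fin (n + 1)) (y : R.V (n + 1) p) :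
    act σ (sing j y) = sing j (R.act (extP j σ) y) := by
  refine Prod.ext (funext fun i => ?_) rfl
  change R.act (extP i σ) ((Pi.single j y : Fin (n + 1) → R.V (n + 1) p) i)
    = (Pi.single j (R.act (extP j σ) y) : Fin (n + 1) → R.V (n + 1) p) i
  by_cases h : i = j
  · subst h
    simp
  · simp [h]

theorem act_unit {n : ℕ} {p : ℤ} (σ : s.perms n) (r : k) :
    act σ (unit r : Fam R n p) = unit r :=
  Prod.ext (funext fun i => map_zero (R.act (extP i σ))) rfl

/-- Composition with an operation below. -/
def lcomp {m n r : ℕ} {p q t : ℤ} (hr : r + 1 = m + n) (ht : t = p + q) (i : Fin m) :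
    R.V m p →ₗ[k] Fam R n q →ₗ[k] Fam R r t :=
  LinearMap.mk₂ k
    (fun x Y => ∑ j : Fin (n + 1), sing ⟨i + j, by omega⟩
        (R.comp (r := r + 1) (by omega) ht i x (Y.1 j))
      + Y.2 • sing ⟨i, by omega⟩ (R.castL (r + 1) t x))
    (fun _ _ _ => by simp only [map_add, LinearMap.add_apply, Finset.sum_add_distrib, smul_add]; abel)
    (fun c _ _ => by simp only [map_smul, LinearMap.smul_apply, Finset.smul_sum, smul_add,
      smul_comm c])
    (fun _ _ _ => by simp only [Prod.fst_add, Prod.snd_add, Pi.add_apply, map_add,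
      Finset.sum_add_distrib, add_smul]; abel)
    (fun _ _ _ => by simp only [Prod.smul_fst, Prod.smul_snd, Pi.smul_apply, map_smul, smul_add,
      Finset.smul_sum, smul_smul, smul_eq_mul])

theorem lcomp_sing {m n r : ℕ} {p q t : ℤ} (hr : r + 1 = m + n) (ht : t = p + q) (i : Fin m)
    (x : R.V m p) (j : Fin (n + 1)) (y : R.V (n + 1) q) :
    lcomp hr ht i x (sing j y)
      = sing ⟨i + j, by omega⟩ (R.comp (r := r + 1) (by omega) ht i x y) := by
  rw [lcomp, LinearMap.mk₂_apply, Finset.sum_eq_single j]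
  · simp [sing]
  · intro i _ hi
    simp [sing, hi]
  · simp

theorem lcomp_unit {m n r : ℕ} {p q t : ℤ} (hr : r + 1 = m + n) (ht : t = p + q) (i : Fin m)
    (x : R.V m p) (c : k) : lcomp hr ht i x (unit c : Fam R n q)
      = c • sing ⟨i, by omega⟩ (R.castL (r + 1) t x) := by
  rw [lcomp, LinearMap.mk₂_apply]
  simp [unit]

/-- Composition with an operation above. -/
def rcomp {m n r : ℕ} {p q t : ℤ} (hr : r + 1 = m + n) (ht : t = p + q) (i : Fin m) :
    Fam R m p →ₗ[k] R.V n q →ₗ[k] Fam R r t :=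
  LinearMap.mk₂ k
    (fun Y z => ∑ j : Fin (m + 1), sing ⟨outerSlot (j.succAbove i) n j,
        outerSlot_lt (by omega) (j.succAbove i).2 j.2 (fun h => Fin.succAbove_ne j i (Fin.ext h.symm))⟩
        (R.comp (r := r + 1) (by omega) ht (j.succAbove i) (Y.1 j) z))
    (fun _ _ _ => by simp only [Prod.fst_add, Pi.add_apply, map_add, LinearMap.add_apply,
      Finset.sum_add_distrib])
    (fun c _ _ => by simp only [Prod.smul_fst, Pi.smul_apply, map_smul, LinearMap.smul_apply,
      Finset.smul_sum])
    (fun _ _ _ => by simp only [map_add, Finset.sum_add_distrib])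
    (fun _ _ _ => by simp only [map_smul, Finset.smul_sum])

theorem rcomp_sing {m n r : ℕ} {p q t : ℤ} (hr : r + 1 = m + n) (ht : t = p + q) (i : Fin m)
    (j : Fin (m + 1)) (y : R.V (m + 1) p) (z : R.V n q) :
    rcomp hr ht i (sing j y) z = sing ⟨outerSlot (j.succAbove i) n j,
        outerSlot_lt (by omega) (j.succAbove i).2 j.2 (fun h => Fin.succAbove_ne j i (Fin.ext h.symm))⟩
        (R.comp (r := r + 1) (by omega) ht (j.succAbove i) y z) := by
  rw [rcomp, LinearMap.mk₂_apply, Finset.sum_eq_single j]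
  · simp [sing]
  · intro i _ hi
    simp [sing, hi]
  · simp

theorem rcomp_unit {m n r : ℕ} {p q t : ℤ} (hr : r + 1 = m + n) (ht : t = p + q) (i : Fin m)
    (c : k) (z : R.V n q) : rcomp hr ht i (unit c : Fam R m p) z = 0 := by
  rw [rcomp, LinearMap.mk₂_apply]
  simp [unit]

/-! #### Compatibility of insertion with the operations -/

theorem ins_act (f : GrHom R T) {e : ℤ} (b : T.V 0 e) {n : ℕ} {p q : ℤ} (h : q = p + e)
    (σ : s.perms n) (Y : Fam R n p) : ins f b h (act σ Y) = T.act σ (ins f b h Y) := by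
  induction Y using induction with
  | h j y =>
    rw [act_sing, ins_sing, ins_sing, f.map_act, T.comp_act (m := n + 1) (n := 0) (r := n) rfl h j (extP j σ) 1 σ
      (isMark_insPerm j j σ)]
    simp [coe_extP]
  | h₀ r =>
    rw [act_unit, ins_unit, map_smul]
    by_cases hn : 0 = n ∧ e = q
    · obtain ⟨rfl, rfl⟩ := hn
      rw [T.castL_self]
      have : σ = 1 := Subtype.ext (Subsingleton.elim _ _)
      rw [this]
      simp
    · rw [T.castL_of_ne hn, map_zero]
  | ha Y Y' hY hY' => simp only [map_add, hY, hY']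

theorem comp_ins (f : GrHom R T) {e : ℤ} (b : T.V 0 e) {m n r : ℕ} {p q t q' t' : ℤ}
    (hr : r + 1 = m + n) (ht : t = p + q) (hq : q' = q + e) (ht' : t' = p + q') (i : Fin m)
    (x : R.V m p) (Y : Fam R n q) :
    T.comp hr ht' i (f.app x) (ins f b hq Y) = ins f b (by omega) (lcomp hr ht i x Y) := by
  induction Y using induction with
  | h j y =>
    rw [lcomp_sing, ins_sing, ins_sing, f.map_comp]
    exact (T.comp_seq _ _ _ _ _ _ _ _ i j _ rfl _ _ _).symm
  | h₀ c =>
    rw [lcomp_unit, ins_unit, map_smul, map_smul, ins_sing, f.map_castL]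
    congr 1
    by_cases hn : 0 = n ∧ e = q'
    · obtain ⟨rfl, rfl⟩ := hn
      obtain rfl : m = r + 1 := by omega
      obtain rfl : t = p := by omega
      rw [T.castL_self, T.castL_self]
    · rw [T.castL_of_ne hn, T.castL_of_ne (by omega)]
      simp
  | ha Y Y' hY hY' => simp only [map_add, hY, hY']

theorem ins_comp (f : GrHom R T) {e : ℤ} (b : T.V 0 e) {m n r : ℕ} {p q t p' t' : ℤ}
    (hr : r + 1 = m + n) (ht : t = p + q) (hp : p' = p + e) (ht' : t' = p' + q) (i : Fin m)
    (Y : Fam R m p) (z : R.V n q) :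
    T.comp hr ht' i (ins f b hp Y) (f.app z)
      = (e * q).negOnePow • ins f b (by omega) (rcomp hr ht i Y z) := by
  induction Y using induction with
  | h j y =>
    rw [rcomp_sing, ins_sing, ins_sing, f.map_comp]
    refine T.comp_outer (l := m + 1) (m := 0) (a := m) (b := r + 1) (r := r) rfl (by omega) hr rfl hp ht ht'
      (by omega) j (j.succAbove i) i _ (Fin.succAbove_ne j i) ?_ rfl _ _ _
    rw [outerSlot, val_succAbove]
    split_ifs <;> omega
  | h₀ c =>
    rw [rcomp_unit, ins_unit, map_zero, smul_zero, T.castL_of_ne, smul_zero, map_zero,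
      LinearMap.zero_apply]
    have := i.2
    omega
  | ha Y Y' hY hY' => simp only [map_add, LinearMap.add_apply, hY, hY', smul_add]

/-! #### Associativity -/

theorem seq₁ {l m n a b r : ℕ} {p q t pq qt e : ℤ}
    (ha : a + 1 = l + m) (hb : b + 1 = m + n) (hr : r + 1 = a + n) (hr' : r + 1 = l + b)
    (hpq : pq = p + q) (hqt : qt = q + t) (he : e = pq + t) (he' : e = p + qt)
    (i : Fin l) (j : Fin m) (c : Fin a) (hc : (c : ℕ) = i + j)
    (x : Fam R l p) (y : R.V m q) (z : R.V n t) :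
    rcomp hr he c (rcomp ha hpq i x y) z = rcomp hr' he' i x (R.comp hb hqt j y z) := by
  induction x using induction with
  | h v x =>
    rw [rcomp_sing, rcomp_sing, rcomp_sing]
    refine sing_congr ?_ (R.comp_seq _ _ _ _ _ _ _ _ _ j _ ?_ _ _ _)
    all_goals
      simp only [val_succAbove, outerSlot]
      split_ifs <;> omega
  | h₀ c => simp [rcomp_unit]
  | ha Y Y' hY hY' => simp only [map_add, LinearMap.add_apply, hY, hY']

theorem seq₂ {l m n a b r : ℕ} {p q t pq qt e : ℤ}
    (ha : a + 1 = l + m) (hb : b + 1 = m + n) (hr : r + 1 = a + n) (hr' : r + 1 = l + b)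
    (hpq : pq = p + q) (hqt : qt = q + t) (he : e = pq + t) (he' : e = p + qt)
    (i : Fin l) (j : Fin m) (c : Fin a) (hc : (c : ℕ) = i + j)
    (x : R.V l p) (y : Fam R m q) (z : R.V n t) :
    rcomp hr he c (lcomp ha hpq i x y) z = lcomp hr' he' i x (rcomp hb hqt j y z) := by
  induction y using induction with
  | h v x =>
    rw [rcomp_sing, lcomp_sing, lcomp_sing, rcomp_sing]
    refine sing_congr ?_ (R.comp_seq _ _ _ _ _ _ _ _ _ _ _ ?_ _ _ _)
    all_goals
      try simp only [val_succAbove, outerSlot]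
      split_ifs <;> omega
  | h₀ d =>
    rw [lcomp_unit, rcomp_unit, R.castL_of_ne (by have := j.2; omega)]
    simp
  | ha Y Y' hY hY' => simp only [map_add, LinearMap.add_apply, hY, hY']

theorem seq₃ {l m n a b r : ℕ} {p q t pq qt e : ℤ}
    (ha : a + 1 = l + m) (hb : b + 1 = m + n) (hr : r + 1 = a + n) (hr' : r + 1 = l + b)
    (hpq : pq = p + q) (hqt : qt = q + t) (he : e = pq + t) (he' : e = p + qt)
    (i : Fin l) (j : Fin m) (c : Fin a) (hc : (c : ℕ) = i + j)
    (x : R.V l p) (y : R.V m q) (z : Fam R n t) :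
    lcomp hr he c (R.comp ha hpq i x y) z = lcomp hr' he' i x (lcomp hb hqt j y z) := by
  induction z using induction with
  | h v x =>
    rw [lcomp_sing, lcomp_sing, lcomp_sing]
    exact sing_congr (by simp only; omega) (R.comp_seq _ _ _ _ _ _ _ _ _ _ _ hc _ _ _)
  | h₀ d =>
    rw [lcomp_unit, lcomp_unit, map_smul, lcomp_sing]
    congr 1
    by_cases hn : 0 = n ∧ t = 0
    · obtain ⟨rfl, rfl⟩ := hn
      obtain rfl : a = r + 1 := by omega
      obtain rfl : m = b + 1 := by omega
      obtain rfl : e = pq := by omega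
      obtain rfl : qt = q := by omega
      rw [R.castL_self, R.castL_self]
      exact sing_congr hc rfl
    · rw [R.castL_of_ne (by omega), R.castL_of_ne (by omega)]
      simp
  | ha Y Y' hY hY' => simp only [map_add, hY, hY']

theorem par₁ {l m n a b r : ℕ} {p q t pq pt e : ℤ}
    (ha : a + 1 = l + m) (hb : b + 1 = l + n) (hr : r + 1 = a + n) (hr' : r + 1 = b + m)
    (hpq : pq = p + q) (hpt : pt = p + t) (he : e = pq + t) (he' : e = pt + q)
    (i j : Fin l) (c : Fin a) (c' : Fin b) (hij : i < j) (hc : (c : ℕ) + 1 = j + m)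
    (hc' : (c' : ℕ) = i) (x : Fam R l p) (y : R.V m q) (z : R.V n t) :
    rcomp hr he c (rcomp ha hpq i x y) z
      = (q * t).negOnePow • rcomp hr' he' c' (rcomp hb hpt j x z) y := by
  rw [Fin.lt_def] at hij
  induction x using induction with
  | h v x =>
    rw [rcomp_sing, rcomp_sing, rcomp_sing, rcomp_sing, ← map_sgn]
    refine sing_congr ?_ (R.comp_par _ _ _ _ _ _ _ _ _ _ _ _ ?_ ?_ ?_ _ _ _)
    all_goals
      try rw [Fin.lt_def]
      simp only [val_succAbove, outerSlot]
      split_ifs <;> omega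
  | h₀ c => simp [rcomp_unit]
  | ha Y Y' hY hY' => simp only [map_add, LinearMap.add_apply, hY, hY', smul_add]

theorem par₂ {l m n a b r : ℕ} {p q t pq pt e : ℤ}
    (ha : a + 1 = l + m) (hb : b + 1 = l + n) (hr : r + 1 = a + n) (hr' : r + 1 = b + m)
    (hpq : pq = p + q) (hpt : pt = p + t) (he : e = pq + t) (he' : e = pt + q)
    (i j : Fin l) (c : Fin a) (c' : Fin b) (hij : i < j) (hc : (c : ℕ) + 1 = j + m)
    (hc' : (c' : ℕ) = i) (x : R.V l p) (y : Fam R m q) (z : R.V n t) :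
    rcomp hr he c (lcomp ha hpq i x y) z
      = (q * t).negOnePow • lcomp hr' he' c' (R.comp hb hpt j x z) y := by
  rw [Fin.lt_def] at hij
  induction y using induction with
  | h v y =>
    rw [lcomp_sing, rcomp_sing, lcomp_sing, ← map_sgn]
    refine sing_congr ?_ (R.comp_par _ _ _ _ _ _ _ _ _ _ _ _ hij ?_ hc' _ _ _)
    all_goals
      try simp only [val_succAbove, outerSlot]
      split_ifs <;> omega
  | h₀ d =>
    rw [lcomp_unit, lcomp_unit]
    simp only [map_smul, LinearMap.smul_apply]
    rw [sgn_smul_comm]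
    congr 1
    by_cases hn : 0 = m ∧ q = 0
    · obtain ⟨rfl, rfl⟩ := hn
      obtain rfl : l = a + 1 := by omega
      obtain rfl : b = r + 1 := by omega
      obtain rfl : pq = p := by omega
      obtain rfl : e = pt := by omega
      rw [R.castL_self, R.castL_self, rcomp_sing]
      have hj : j = Fin.succAbove ⟨(i : ℕ), i.2⟩ c := Fin.ext (by
        rw [val_succAbove]
        simp only
        split_ifs <;> omega)
      subst hj
      simp only [zero_mul, Int.negOnePow_zero, one_smul]
      refine sing_congr ?_ rfl
      simp only [outerSlot]
      split_ifs <;> omega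
    · rw [R.castL_of_ne (by omega), R.castL_of_ne (by omega)]
      simp
  | ha Y Y' hY hY' => simp only [map_add, LinearMap.add_apply, hY, hY', smul_add]

theorem par₃ {l m n a b r : ℕ} {p q t pq pt e : ℤ}
    (ha : a + 1 = l + m) (hb : b + 1 = l + n) (hr : r + 1 = a + n) (hr' : r + 1 = b + m)
    (hpq : pq = p + q) (hpt : pt = p + t) (he : e = pq + t) (he' : e = pt + q)
    (i j : Fin l) (c : Fin a) (c' : Fin b) (hij : i < j) (hc : (c : ℕ) + 1 = j + m)
    (hc' : (c' : ℕ) = i) (x : R.V l p) (y : R.V m q) (z : Fam R n t) :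
    lcomp hr he c (R.comp ha hpq i x y) z
      = (q * t).negOnePow • rcomp hr' he' c' (lcomp hb hpt j x z) y := by
  rw [Fin.lt_def] at hij
  induction z using induction with
  | h v y =>
    rw [lcomp_sing, lcomp_sing, rcomp_sing, ← map_sgn]
    refine sing_congr ?_ (R.comp_par _ _ _ _ _ _ _ _ _ _ _ _ hij hc ?_ _ _ _)
    all_goals
      try simp only [val_succAbove, outerSlot]
      split_ifs <;> omega
  | h₀ d =>
    rw [lcomp_unit, lcomp_unit]
    simp only [map_smul, LinearMap.smul_apply]
    rw [sgn_smul_comm]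
    congr 1
    by_cases hn : 0 = n ∧ t = 0
    · obtain ⟨rfl, rfl⟩ := hn
      obtain rfl : l = b + 1 := by omega
      obtain rfl : a = r + 1 := by omega
      obtain rfl : pt = p := by omega
      obtain rfl : e = pq := by omega
      rw [R.castL_self, R.castL_self, rcomp_sing]
      have hi : i = Fin.succAbove ⟨(j : ℕ), j.2⟩ c' := Fin.ext (by
        rw [val_succAbove]
        simp only
        split_ifs <;> omega)
      subst hi
      simp only [mul_zero, Int.negOnePow_zero, one_smul]
      refine sing_congr ?_ rfl
      simp only [outerSlot]
      split_ifs <;> omega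
    · rw [R.castL_of_ne (by omega), R.castL_of_ne (by omega)]
      simp
  | ha Y Y' hY hY' => simp only [map_add, LinearMap.add_apply, hY, hY', smul_add]

end Fam

/-! ### The bimodule of operations with a marked input -/

/-- The inclusion of the bimodule in a square-zero extension. -/
def sqZeroInr (R : GrOperad k s) (M : InfBimod R) {n : ℕ} {p : ℤ} :
    M.V n p →ₗ[k] (sqZero R M).V n p := LinearMap.inr k _ _

namespace Fam

variable {R T U : GrOperad k s}

/-- The relations between families: the marked input may be moved. -/
def rel (R : GrOperad k s) (n : ℕ) (p : ℤ) : Submodule k (Fam R n p) :=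
  Submodule.span k
    ({Y | ∃ (j : Fin (n + 1)) (τ : s.perms (n + 1)) (y : R.V (n + 1) p),
        IsMark j (τ : Equiv.Perm (Fin (n + 1))) 1 ∧
        Y = sing j y - sing ((τ : Equiv.Perm (Fin (n + 1))) j) (R.act τ y)}
      ∪ {Y | ∃ r : k, ¬ (n = 0 ∧ p = 0) ∧ Y = unit r})

theorem sing_sub_mem_rel {n : ℕ} {p : ℤ} (j : Fin (n + 1)) (τ : s.perms (n + 1))
    (y : R.V (n + 1) p) (h : IsMark j (τ : Equiv.Perm (Fin (n + 1))) 1) :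
    sing j y - sing ((τ : Equiv.Perm (Fin (n + 1))) j) (R.act τ y) ∈ rel R n p :=
  Submodule.subset_span (Or.inl ⟨j, τ, y, h, rfl⟩)

theorem unit_mem_rel {n : ℕ} {p : ℤ} (h : ¬ (n = 0 ∧ p = 0)) (r : k) :
    (unit r : Fam R n p) ∈ rel R n p :=
  Submodule.subset_span (Or.inr ⟨r, h, rfl⟩)

theorem rel_induction {n : ℕ} {p : ℤ} {V : Type u} [AddCommGroup V] [Module k V]
    (F : Fam R n p →ₗ[k] V) (W : Submodule k V)
    (h : ∀ (j : Fin (n + 1)) (τ : s.perms (n + 1)) (y : R.V (n + 1) p),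
      IsMark j (τ : Equiv.Perm (Fin (n + 1))) 1 →
      F (sing j y) - F (sing ((τ : Equiv.Perm (Fin (n + 1))) j) (R.act τ y)) ∈ W)
    (h₀ : ∀ r : k, ¬ (n = 0 ∧ p = 0) → F (unit r) ∈ W) : rel R n p ≤ W.comap F := by
  refine Submodule.span_le.2 ?_
  rintro Y (⟨j, τ, y, hτ, rfl⟩ | ⟨r, hr, rfl⟩)
  · have := h j τ y hτ
    rwa [← map_sub] at this
  · exact h₀ r hr

theorem isMark_mul {n : ℕ} {j : Fin (n + 1)} {τ τ' : Equiv.Perm (Fin (n + 1))}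
    {σ σ' : Equiv.Perm (Fin n)} (h : IsMark j τ σ) (h' : IsMark (τ j) τ' σ') :
    IsMark j (τ' * τ) (σ' * σ) := by
  rw [isMark_iff] at h h' ⊢
  intro a
  simp [h, h']

theorem isMark_extP {n : ℕ} (j : Fin (n + 1)) (σ : s.perms n) :
    IsMark j (extP j σ : Equiv.Perm (Fin (n + 1))) σ := isMark_insPerm j j σ

theorem extP_mul {n : ℕ} (j : Fin (n + 1)) (σ τ : s.perms n) :
    extP j (σ * τ) = extP j σ * extP j τ :=
  Subtype.ext (insPerm_mul j j j (σ : Equiv.Perm (Fin n)) τ).symm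

theorem extP_one {n : ℕ} (j : Fin (n + 1)) : extP j (1 : s.perms n) = 1 :=
  Subtype.ext (insPerm_one j)

/-- Relabelling by a permutation that need not fix the marked input. -/
theorem act_sub_mem_rel {n : ℕ} {p : ℤ} (j : Fin (n + 1)) (τ : s.perms (n + 1)) (σ : s.perms n)
    (y : R.V (n + 1) p) (h : IsMark j (τ : Equiv.Perm (Fin (n + 1))) (σ : Equiv.Perm (Fin n))) :
    act σ (sing j y) - sing ((τ : Equiv.Perm (Fin (n + 1))) j) (R.act τ y) ∈ rel R n p := by
  have hm : IsMark j ((τ * extP j σ⁻¹ : s.perms (n + 1)) : Equiv.Perm (Fin (n + 1))) 1 := by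
    have := isMark_mul (isMark_extP j σ⁻¹) (τ' := (τ : Equiv.Perm (Fin (n + 1)))) (σ' := σ) (by
      rw [coe_extP, insPerm_self]
      exact h)
    simpa using this
  have := sing_sub_mem_rel j _ (R.act (extP j σ) y) hm
  rw [← Module.End.mul_apply, ← map_mul, mul_assoc, ← extP_mul, inv_mul_cancel, extP_one, mul_one] at this
  rw [act_sing]
  convert this using 2
  refine sing_congr (congrArg Fin.val ?_) rfl
  change _ = (τ : Equiv.Perm (Fin (n + 1))) ((extP j σ⁻¹ : Equiv.Perm (Fin (n + 1))) j)
  rw [coe_extP, insPerm_self]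

theorem act_mem_rel {n : ℕ} {p : ℤ} (σ : s.perms n) : rel R n p ≤ (rel R n p).comap (act σ) := by
  refine rel_induction _ _ (fun j τ y h => ?_) (fun r hr => ?_)
  · have h₁ := act_sub_mem_rel j (extP ((τ : Equiv.Perm (Fin (n + 1))) j) σ * τ) σ y (by
      simpa using isMark_mul h (isMark_extP _ σ))
    rw [act_sing σ ((τ : Equiv.Perm (Fin (n + 1))) j)]
    convert h₁ using 2
    refine sing_congr ?_ ?_
    · simp [coe_extP]
    · rw [map_mul]
      rfl
  · rw [act_unit]
    exact unit_mem_rel hr r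

theorem lcomp_mem_rel {m n r : ℕ} {p q t : ℤ} (hr : r + 1 = m + n) (ht : t = p + q) (i : Fin m)
    (x : R.V m p) : rel R n q ≤ (rel R r t).comap (lcomp hr ht i x) := by
  refine rel_induction _ _ (fun j τ y h => ?_) (fun c hc => ?_)
  · have hr' : r + 1 + 1 = m + (n + 1) := by omega
    obtain ⟨ρ, hρ⟩ := exists_blockPerm hr' i (1 : s.perms m) τ
    rw [lcomp_sing, lcomp_sing]
    have h1 : IsBlockPerm i (1 : Equiv.Perm (Fin m)) (1 : Equiv.Perm (Fin n))
        (1 : Equiv.Perm (Fin r)) := ⟨fun b c hc => hc, fun a c _ hc => hc⟩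
    have := sing_sub_mem_rel ⟨(i : ℕ) + j, by omega⟩ ρ (R.comp hr' ht i x y)
      (blockPerm_mark_inner hr h1 h hρ _ rfl)
    convert this using 2
    refine sing_congr (hρ.inner j _ rfl).symm ?_
    rw [R.comp_act hr' ht i 1 τ ρ hρ]
    simp
  · rw [lcomp_unit, R.castL_of_ne (by omega)]
    simp

theorem rcomp_mem_rel {m n r : ℕ} {p q t : ℤ} (hr : r + 1 = m + n) (ht : t = p + q) (i : Fin m)
    (z : R.V n q) : rel R m p ≤ (rel R r t).comap ((rcomp hr ht i).flip z) := by
  refine rel_induction _ _ (fun j τ y h => ?_) (fun c hc => ?_)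
  · have hr' : r + 1 + 1 = m + 1 + n := by omega
    obtain ⟨ρ, hρ⟩ := exists_blockPerm hr' (j.succAbove i) τ (1 : s.perms n)
    simp only [LinearMap.flip_apply]
    rw [rcomp_sing, rcomp_sing]
    have h1 : IsBlockPerm i (1 : Equiv.Perm (Fin m)) (1 : Equiv.Perm (Fin n))
        (1 : Equiv.Perm (Fin r)) := ⟨fun b c hc => hc, fun a c _ hc => hc⟩
    have h2 := isMark_iff.1 h i
    rw [Equiv.Perm.one_apply] at h2
    have := sing_sub_mem_rel _ ρ (R.comp hr' ht (j.succAbove i) y z)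
      (blockPerm_mark_outer hr h1 h hρ ⟨outerSlot (j.succAbove i) n j,
        outerSlot_lt (by omega) (j.succAbove i).2 j.2
          (fun h => Fin.succAbove_ne j i (Fin.ext h.symm))⟩ rfl)
    convert this using 2
    refine sing_congr ?_ ?_
    · rw [hρ.outer j _ (Fin.succAbove_ne j i).symm rfl, h2]
    · rw [R.comp_act hr' ht _ τ 1 ρ hρ, h2]
      simp
  · rw [LinearMap.flip_apply, rcomp_unit]
    exact zero_mem _

theorem lcomp_act {m n r : ℕ} {p q t : ℤ} (hr : r + 1 = m + n) (ht : t = p + q) (i : Fin m)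
    (σ : s.perms m) (τ : s.perms n) (ρ : s.perms r)
    (h : IsBlockPerm i (σ : Equiv.Perm (Fin m)) (τ : Equiv.Perm (Fin n)) (ρ : Equiv.Perm (Fin r)))
    (x : R.V m p) (y : Fam R n q) : act ρ (lcomp hr ht i x y)
        - lcomp hr ht ((σ : Equiv.Perm (Fin m)) i) (R.act σ x) (act τ y) ∈ rel R r t := by
  induction y using induction with
  | h j y =>
    have hr' : r + 1 + 1 = m + (n + 1) := by omega
    obtain ⟨ρ', hρ⟩ := exists_blockPerm hr' i σ (extP j τ)
    rw [lcomp_sing, act_sing τ, lcomp_sing]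
    have := act_sub_mem_rel ⟨(i : ℕ) + j, by omega⟩ ρ' ρ (R.comp hr' ht i x y)
      (blockPerm_mark_inner hr h (isMark_extP j τ) hρ _ rfl)
    convert this using 2
    refine sing_congr ?_ ?_
    · rw [hρ.inner j _ rfl, coe_extP, insPerm_self]
    · rw [R.comp_act hr' ht i σ _ ρ' hρ]
  | h₀ c =>
    rw [act_unit, lcomp_unit, lcomp_unit, map_smul, ← smul_sub]
    refine Submodule.smul_mem _ _ ?_
    by_cases hn : 0 = n ∧ q = 0
    · obtain ⟨rfl, rfl⟩ := hn
      obtain rfl : m = r + 1 := by omega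
      obtain rfl : t = p := by omega
      rw [R.castL_self, R.castL_self]
      refine act_sub_mem_rel i σ ρ x ?_
      rwa [show (τ : Equiv.Perm (Fin 0)) = 1 from Subsingleton.elim _ _] at h
    · rw [R.castL_of_ne (by omega), R.castL_of_ne (by omega)]
      simp
  | ha Y Y' hY hY' =>
    simp only [map_add]
    rw [add_sub_add_comm]
    exact add_mem hY hY'

theorem rcomp_act {m n r : ℕ} {p q t : ℤ} (hr : r + 1 = m + n) (ht : t = p + q) (i : Fin m)
    (σ : s.perms m) (τ : s.perms n) (ρ : s.perms r)
    (h : IsBlockPerm i (σ : Equiv.Perm (Fin m)) (τ : Equiv.Perm (Fin n)) (ρ : Equiv.Perm (Fin r)))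
    (x : Fam R m p) (y : R.V n q) : act ρ (rcomp hr ht i x y)
        - rcomp hr ht ((σ : Equiv.Perm (Fin m)) i) (act σ x) (R.act τ y) ∈ rel R r t := by
  induction x using induction with
  | h j x =>
    have hr' : r + 1 + 1 = m + 1 + n := by omega
    obtain ⟨ρ', hρ⟩ := exists_blockPerm hr' (j.succAbove i) (extP j σ) τ
    rw [rcomp_sing, act_sing σ, rcomp_sing]
    have h2 := isMark_iff.1 (isMark_extP j σ) i
    rw [coe_extP, insPerm_self] at h2
    have := act_sub_mem_rel _ ρ' ρ (R.comp hr' ht (j.succAbove i) x y)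
      (blockPerm_mark_outer hr h (isMark_extP j σ) hρ ⟨outerSlot (j.succAbove i) n j,
        outerSlot_lt (by omega) (j.succAbove i).2 j.2
          (fun h => Fin.succAbove_ne j i (Fin.ext h.symm))⟩ rfl)
    convert this using 2
    refine sing_congr ?_ ?_
    · rw [hρ.outer j _ (Fin.succAbove_ne j i).symm rfl, coe_extP, h2, insPerm_self]
    · rw [R.comp_act hr' ht _ _ τ ρ' hρ, coe_extP, h2]
  | h₀ c =>
    rw [act_unit, rcomp_unit, rcomp_unit, map_zero, sub_zero]
    exact zero_mem _
  | ha Y Y' hY hY' =>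
    simp only [map_add, LinearMap.add_apply]
    rw [add_sub_add_comm]
    exact add_mem hY hY'

theorem ins_of_mem_rel (f : GrHom R T) {e : ℤ} (b : T.V 0 e) {n : ℕ} {p q : ℤ} (h : q = p + e)
    {Y : Fam R n p} (hY : Y ∈ rel R n p) : ins f b h Y = 0 := by
  refine rel_induction (ins f b h) ⊥ (fun j τ y hτ => ?_) (fun c hc => ?_) hY
  · rw [Submodule.mem_bot, ins_sing, ins_sing, f.map_act, sub_eq_zero]
    have := T.comp_act (m := n + 1) (n := 0) (r := n) rfl h j τ 1 1 hτ (f.app y) b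
    simpa using this
  · rw [Submodule.mem_bot, ins_unit, T.castL_of_ne (by omega), smul_zero]

/-- Normalization of a family: in the symmetric case the marked input is moved to the front. -/
def norm : {s : Flavour} → (R : GrOperad k s) → {n : ℕ} → {p : ℤ} → Fam R n p →ₗ[k] Fam R n p
  | .symmetric, R, n, p =>
    (sing 0 ∘ₗ ∑ j : Fin (n + 1), R.act ⟨insPerm j 0 1, Subgroup.mem_top _⟩ ∘ₗ LinearMap.proj j
        ∘ₗ LinearMap.fst k _ _)
      + if n = 0 ∧ p = 0 then LinearMap.inr k _ _ ∘ₗ LinearMap.snd k _ _ else 0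
  | .nonsymmetric, _, n, p =>
    if n = 0 ∧ p = 0 then LinearMap.id else LinearMap.inl k _ _ ∘ₗ LinearMap.fst k _ _

theorem norm_unit {n : ℕ} {p : ℤ} (r : k) :
    norm R (unit r : Fam R n p) = if n = 0 ∧ p = 0 then unit r else 0 := by
  cases s
  · by_cases h : n = 0 ∧ p = 0
    · simp [norm, unit, h]
    · simp [norm, unit, h]
  · by_cases h : n = 0 ∧ p = 0
    · simp [norm, unit, h]
    · simp [norm, unit, h]

theorem norm_sing_symm {R : GrOperad k .symmetric} {n : ℕ} {p : ℤ} (j : Fin (n + 1))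
    (y : R.V (n + 1) p) : norm R (sing j y)
      = sing 0 (R.act ⟨insPerm j 0 1, Subgroup.mem_top _⟩ y) := by
  have : (if n = 0 ∧ p = 0 then LinearMap.inr k _ _ ∘ₗ LinearMap.snd k _ _ else
      (0 : Fam R n p →ₗ[k] Fam R n p)) (sing j y) = 0 := by
    split_ifs
    · simp [sing]
    · rfl
  rw [norm, LinearMap.add_apply, this, add_zero, LinearMap.comp_apply, LinearMap.sum_apply,
    Finset.sum_eq_single j]
  · simp [sing]
  · intro i _ hi
    simp [sing, hi]
  · simp

theorem norm_sing_nonsymm {R : GrOperad k .nonsymmetric} {n : ℕ} {p : ℤ} (j : Fin (n + 1))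
    (y : R.V (n + 1) p) : norm R (sing j y) = sing j y := by
  rw [norm]
  split_ifs
  · rfl
  · rfl

theorem norm_of_mem_rel {n : ℕ} {p : ℤ} {Y : Fam R n p} (hY : Y ∈ rel R n p) : norm R Y = 0 := by
  refine rel_induction (norm R) ⊥ (fun j τ y hτ => ?_) (fun c hc => ?_) hY
  · rw [Submodule.mem_bot, sub_eq_zero]
    cases s
    · rw [norm_sing_symm, norm_sing_symm, ← Module.End.mul_apply, ← map_mul]
      congr 3
      refine Subtype.ext ?_
      change _ = insPerm _ 0 1 * (τ : Equiv.Perm (Fin (n + 1)))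
      conv_rhs => rw [hτ.eq_insPerm, insPerm_self]
      rw [insPerm_mul, mul_one]
    · have : τ = 1 := Subtype.ext (Subgroup.mem_bot.1 τ.2)
      subst this
      simp
  · rw [Submodule.mem_bot, norm_unit, if_neg hc]

theorem sub_norm_mem_rel {n : ℕ} {p : ℤ} (Y : Fam R n p) : Y - norm R Y ∈ rel R n p := by
  induction Y using induction with
  | h j y =>
    cases s
    · rw [norm_sing_symm]
      have := sing_sub_mem_rel j (⟨insPerm j 0 1, Subgroup.mem_top _⟩ : Flavour.symmetric.perms (n + 1)) y
        (isMark_insPerm j 0 1)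
      rwa [insPerm_self] at this
    · rw [norm_sing_nonsymm, sub_self]
      exact zero_mem _
  | h₀ r =>
    rw [norm_unit]
    split_ifs with h
    · rw [sub_self]
      exact zero_mem _
    · rw [sub_zero]
      exact unit_mem_rel h r
  | ha Y Y' hY hY' =>
    rw [map_add, add_sub_add_comm]
    exact add_mem hY hY'

theorem mem_rel_iff {n : ℕ} {p : ℤ} {Y : Fam R n p} : Y ∈ rel R n p ↔ norm R Y = 0 :=
  ⟨norm_of_mem_rel, fun h => by simpa [h] using sub_norm_mem_rel Y⟩

end Fam

/-- The infinitesimal bimodule of operations with a marked input. -/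
def markBimod (R : GrOperad k s) : InfBimod R where
  V n p := Fam R n p ⧸ Fam.rel R n p
  act {n p} :=
    { toFun := fun σ => (Fam.rel R n p).mapQ (Fam.rel R n p) (Fam.act σ) (Fam.act_mem_rel σ)
      map_one' := by
        refine Submodule.linearMap_qext _ (LinearMap.ext fun Y => congrArg (Fam.rel R n p).mkQ ?_)
        refine Prod.ext (funext fun j => ?_) rfl
        change R.act (extP j 1) (Y.1 j) = Y.1 j
        rw [Fam.extP_one, map_one]
        rfl
      map_mul' := fun σ τ => by
        refine Submodule.linearMap_qext _ (LinearMap.ext fun Y => congrArg (Fam.rel R n p).mkQ ?_)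
        refine Prod.ext (funext fun j => ?_) rfl
        change R.act (extP j (σ * τ)) (Y.1 j) = R.act (extP j σ) (R.act (extP j τ) (Y.1 j))
        rw [Fam.extP_mul, map_mul]
        rfl }
  lcomp {m n r p q t} hr ht i := LinearMap.flip ((Fam.rel R n q).liftQ
    (LinearMap.flip ((Fam.lcomp hr ht i).compr₂ (Fam.rel R r t).mkQ)) (fun Y hY =>
      LinearMap.ext fun x => (Submodule.Quotient.mk_eq_zero _).2 (Fam.lcomp_mem_rel hr ht i x hY)))
  rcomp {m n r p q t} hr ht i := (Fam.rel R m p).liftQ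
    ((Fam.rcomp hr ht i).compr₂ (Fam.rel R r t).mkQ) (fun Y hY =>
      LinearMap.ext fun z => (Submodule.Quotient.mk_eq_zero _).2 (Fam.rcomp_mem_rel hr ht i z hY))
  lcomp_act hr ht i σ τ ρ h x y := by
    induction y using Submodule.Quotient.induction_on with | _ y
    exact (Submodule.Quotient.eq _).2 (Fam.lcomp_act hr ht i σ τ ρ h x y)
  rcomp_act hr ht i σ τ ρ h x y := by
    induction x using Submodule.Quotient.induction_on with | _ x
    exact (Submodule.Quotient.eq _).2 (Fam.rcomp_act hr ht i σ τ ρ h x y)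
  seq₁ ha hb hr hr' hpq hqt he he' i j c hc x y z := by
    induction x using Submodule.Quotient.induction_on with | _ x
    exact congrArg (Submodule.mkQ _) (Fam.seq₁ ha hb hr hr' hpq hqt he he' i j c hc x y z)
  seq₂ ha hb hr hr' hpq hqt he he' i j c hc x y z := by
    induction y using Submodule.Quotient.induction_on with | _ y
    exact congrArg (Submodule.mkQ _) (Fam.seq₂ ha hb hr hr' hpq hqt he he' i j c hc x y z)
  seq₃ ha hb hr hr' hpq hqt he he' i j c hc x y z := by
    induction z using Submodule.Quotient.induction_on with | _ z
    exact congrArg (Submodule.mkQ _) (Fam.seq₃ ha hb hr hr' hpq hqt he he' i j c hc x y z)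
  par₁ ha hb hr hr' hpq hpt he he' i j c c' hij hc hc' x y z := by
    induction x using Submodule.Quotient.induction_on with | _ x
    exact (congrArg (Submodule.mkQ _) (Fam.par₁ ha hb hr hr' hpq hpt he he' i j c c' hij hc hc' x y z)).trans
      (map_sgn _ _ _)
  par₂ ha hb hr hr' hpq hpt he he' i j c c' hij hc hc' x y z := by
    induction y using Submodule.Quotient.induction_on with | _ y
    exact (congrArg (Submodule.mkQ _) (Fam.par₂ ha hb hr hr' hpq hpt he he' i j c c' hij hc hc' x y z)).trans
      (map_sgn _ _ _)
  par₃ ha hb hr hr' hpq hpt he he' i j c c' hij hc hc' x y z := by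
    induction z using Submodule.Quotient.induction_on with | _ z
    exact (congrArg (Submodule.mkQ _) (Fam.par₃ ha hb hr hr' hpq hpt he he' i j c c' hij hc hc' x y z)).trans
      (map_sgn _ _ _)

namespace markBimod

variable {R T : GrOperad k s}

/-- The class of a family. -/
def mk (R : GrOperad k s) {n : ℕ} {p : ℤ} : Fam R n p →ₗ[k] (markBimod R).V n p :=
  (Fam.rel R n p).mkQ

theorem mk_eq_zero {n : ℕ} {p : ℤ} {Y : Fam R n p} : mk R Y = 0 ↔ Fam.norm R Y = 0 := by
  rw [← Fam.mem_rel_iff]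
  exact Submodule.Quotient.mk_eq_zero _

theorem induction {n : ℕ} {p : ℤ} {C : (markBimod R).V n p → Prop} (h : ∀ Y, C (mk R Y))
    (y : (markBimod R).V n p) : C y := Submodule.Quotient.induction_on _ y h

theorem act_mk {n : ℕ} {p : ℤ} (σ : s.perms n) (Y : Fam R n p) :
    (markBimod R).act σ (mk R Y) = mk R (Fam.act σ Y) := rfl

theorem lcomp_mk {m n r : ℕ} {p q t : ℤ} (hr : r + 1 = m + n) (ht : t = p + q) (i : Fin m)
    (x : R.V m p) (Y : Fam R n q) :
    (markBimod R).lcomp hr ht i x (mk R Y) = mk R (Fam.lcomp hr ht i x Y) := rfl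

theorem rcomp_mk {m n r : ℕ} {p q t : ℤ} (hr : r + 1 = m + n) (ht : t = p + q) (i : Fin m)
    (Y : Fam R m p) (z : R.V n q) :
    (markBimod R).rcomp hr ht i (mk R Y) z = mk R (Fam.rcomp hr ht i Y z) := rfl

/-- The normalized representative. -/
def nf (R : GrOperad k s) {n : ℕ} {p : ℤ} : (markBimod R).V n p →ₗ[k] Fam R n p :=
  (Fam.rel R n p).liftQ (Fam.norm R) fun _ hY => Fam.norm_of_mem_rel hY

theorem nf_mk {n : ℕ} {p : ℤ} (Y : Fam R n p) : nf R (mk R Y) = Fam.norm R Y := rfl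

theorem mk_nf {n : ℕ} {p : ℤ} (y : (markBimod R).V n p) : mk R (nf R y) = y := by
  induction y using induction with | h Y
  rw [nf_mk]
  refine (sub_eq_zero.1 ?_).symm
  rw [← map_sub, mk_eq_zero]
  exact Fam.norm_of_mem_rel (Fam.sub_norm_mem_rel Y)

/-- Insertion in the square-zero extension. -/
theorem ins_sqZero {n : ℕ} {p : ℤ} (h : p = p + 0) (Y : Fam R n p) :
    Fam.ins (sqZeroInl R (markBimod R)) (sqZeroInr R (markBimod R) (mk R (Fam.unit 1))) h Y
      = sqZeroInr R (markBimod R) (mk R Y) := by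
  induction Y using Fam.induction with
  | h j y =>
    rw [Fam.ins_sing]
    refine Prod.ext (map_zero (R.comp _ _ j y)) ?_
    change (markBimod R).rcomp _ _ j 0 0 + (markBimod R).lcomp _ _ j y (mk R (Fam.unit 1)) = _
    rw [map_zero, zero_add, lcomp_mk, Fam.lcomp_unit, one_smul, R.castL_self]
    rfl
  | h₀ r =>
    rw [Fam.ins_unit]
    by_cases h : 0 = n ∧ 0 = p
    · obtain ⟨rfl, rfl⟩ := h
      rw [GrOperad.castL_self]
      rw [← map_smul, ← map_smul]
      congr 2
      simp [Fam.unit]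
    · rw [GrOperad.castL_of_ne _ h, smul_zero, mk_eq_zero.2, map_zero]
      rw [Fam.norm_unit, if_neg (by omega)]
  | ha Y Y' hY hY' =>
    rw [map_add, hY, hY', map_add, map_add]

/-- Insertion in a marked input, on classes of families. -/
def ins (f : GrHom R T) {e : ℤ} (b : T.V 0 e) {n : ℕ} {p q : ℤ} (h : q = p + e) :
    (markBimod R).V n p →ₗ[k] T.V n q :=
  (Fam.rel R n p).liftQ (Fam.ins f b h) fun _ hY => Fam.ins_of_mem_rel f b h hY

theorem ins_mk (f : GrHom R T) {e : ℤ} (b : T.V 0 e) {n : ℕ} {p q : ℤ} (h : q = p + e)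
    (Y : Fam R n p) : ins f b h (mk R Y) = Fam.ins f b h Y := rfl

end markBimod

/-- A family is determined, up to moving the marked input, by the insertions. -/
theorem Fam.norm_eq_zero {R : GrOperad k s} {n : ℕ} {p : ℤ} {Y : Fam R n p}
    (h : ∀ (T : GrOperad k s) (f : GrHom R T) (b : T.V 0 0),
      Fam.ins f b (add_zero p).symm Y = 0) :
    Fam.norm R Y = 0 := by
  have := h (sqZero R (markBimod R)) (sqZeroInl R (markBimod R))
    (sqZeroInr R (markBimod R) (markBimod.mk R (Fam.unit 1)))
  rw [markBimod.ins_sqZero] at this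
  exact markBimod.mk_eq_zero.1 (congrArg Prod.snd this)

/-! ### The completed coproduct -/

namespace CoprodV

theorem induction {P : GrOperad k s} {C : ∀ {n : ℕ} {p : ℤ} {w : ℕ}, CoprodV P n p w → Prop}
    (of : ∀ {n : ℕ} {p : ℤ} (x : P.V n p), C (CoprodV.of x)) (alpha : C (CoprodV.alpha P))
    (zero : ∀ {n : ℕ} {p : ℤ} {w : ℕ}, C (0 : CoprodV P n p w))
    (add : ∀ {n : ℕ} {p : ℤ} {w : ℕ} (x y : CoprodV P n p w), C x → C y → C (x + y))
    (smul : ∀ {n : ℕ} {p : ℤ} {w : ℕ} (c : k) (x : CoprodV P n p w), C x → C (c • x))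
    (act : ∀ {n : ℕ} {p : ℤ} {w : ℕ} (σ : s.perms n) (x : CoprodV P n p w), C x → C (actL σ x))
    (comp : ∀ {m n r : ℕ} {p q t : ℤ} {v v' w : ℕ} (hr : r + 1 = m + n) (ht : t = p + q)
      (hw : v + v' = w) (i : Fin m) (x : CoprodV P m p v) (y : CoprodV P n q v'), C x → C y →
      C (compL hr ht hw i x y)) {n : ℕ} {p : ℤ} {w : ℕ} (x : CoprodV P n p w) : C x := by
  induction x using Quotient.inductionOn with | _ x
  induction x with
  | of x => exact of x
  | alpha => exact alpha
  | zero => exact zero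
  | add x y hx hy => exact add _ _ hx hy
  | smul c x hx => exact smul c _ hx
  | act σ x hx => exact act σ _ hx
  | comp hr ht hw i x y hx hy => exact comp hr ht hw i _ _ hx hy

variable {P : GrOperad k s} (R : GrOperad k s) (φ : GrHom P R) (a : R.V 0 0)

theorem evalL_of {n : ℕ} {p : ℤ} (x : P.V n p) : evalL R φ a (of x) = φ.app x := rfl

theorem evalL_alpha : evalL R φ a (alpha P) = a := rfl

theorem evalL_act {n : ℕ} {p : ℤ} {w : ℕ} (σ : s.perms n) (x : CoprodV P n p w) :
    evalL R φ a (actL σ x) = R.act σ (evalL R φ a x) := eval_act R φ a σ x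

theorem evalL_comp {m n r : ℕ} {p q t : ℤ} {v v' w : ℕ} (hr : r + 1 = m + n) (ht : t = p + q)
    (hw : v + v' = w) (i : Fin m) (x : CoprodV P m p v) (y : CoprodV P n q v') :
    evalL R φ a (compL hr ht hw i x y) = R.comp hr ht i (evalL R φ a x) (evalL R φ a y) :=
  eval_comp R φ a hr ht hw i x y

end CoprodV

theorem GrHom.map_eval {P R T : GrOperad k s} (φ : GrHom P R) (a : R.V 0 0) (g : GrHom R T)
    {n : ℕ} {p : ℤ} {w : ℕ} (x : CoprodV P n p w) :
    g.app (CoprodV.evalL R φ a x) = CoprodV.evalL T (φ.trans g) (g.app a) x := by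
  induction x using CoprodV.induction with
  | of x => rfl
  | alpha => rfl
  | zero => simp
  | add x y hx hy => simp only [map_add, hx, hy]
  | smul c x hx => simp only [map_smul, hx]
  | act σ x hx => rw [CoprodV.evalL_act, g.map_act, hx, CoprodV.evalL_act]
  | comp hr ht hw i x y hx hy => rw [CoprodV.evalL_comp, g.map_comp, hx, hy, CoprodV.evalL_comp]

namespace hat

variable {P : GrOperad k s}

/-- The coefficient of degree `w` in `α`. -/
def coeff (P : GrOperad k s) (w : ℕ) {n : ℕ} {p : ℤ} : (hat P).V n p →ₗ[k] CoprodV P n p w :=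
  LinearMap.proj (φ := fun w => CoprodV P n p w) w

/-- A homogeneous element as a series. -/
def single (P : GrOperad k s) (w : ℕ) {n : ℕ} {p : ℤ} : CoprodV P n p w →ₗ[k] (hat P).V n p :=
  LinearMap.single k (fun w => CoprodV P n p w) w

theorem ext {n : ℕ} {p : ℤ} {x y : (hat P).V n p} (h : ∀ w, coeff P w x = coeff P w y) : x = y :=
  funext h

theorem coeff_single_same (w : ℕ) {n : ℕ} {p : ℤ} (x : CoprodV P n p w) :
    coeff P w (single P w x) = x := Pi.single_eq_same (M := CoprodV P n p) w x

theorem coeff_single_of_ne {v w : ℕ} (h : v ≠ w) {n : ℕ} {p : ℤ} (x : CoprodV P n p w) :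
    coeff P v (single P w x) = 0 := Pi.single_eq_of_ne (M := CoprodV P n p) h x

theorem ev_eq (R : GrOperad k s) (φ : GrHom P R) (a : R.V 0 0) {n : ℕ} {p : ℤ} (w : ℕ)
    (x : (hat P).V n p) : HatV.ev R φ a w x = CoprodV.evalL R φ a (coeff P w x) := rfl

theorem ev_single (R : GrOperad k s) (φ : GrHom P R) (a : R.V 0 0) {n : ℕ} {p : ℤ} (v w : ℕ)
    (x : CoprodV P n p w) :
    HatV.ev R φ a v (single P w x) = if v = w then CoprodV.evalL R φ a x else 0 := by
  rw [ev_eq]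
  split_ifs with h
  · subst h
    rw [coeff_single_same]
  · rw [coeff_single_of_ne h, map_zero]

theorem single_comp {m n r : ℕ} {p q t : ℤ} {v v' w : ℕ} (hr : r + 1 = m + n) (ht : t = p + q)
    (hw : v + v' = w) (i : Fin m) (x : CoprodV P m p v) (y : CoprodV P n q v') :
    (hat P).comp hr ht i (single P v x) (single P v' y)
      = single P w (CoprodV.compL hr ht hw i x y) := by
  refine HatV.ext fun R φ a u => ?_
  rw [ev_single]
  refine (HatV.ev_compL R φ a hr ht i _ _ u).trans ?_
  have : CoprodV.evalL R φ a (CoprodV.compL hr ht hw i x y)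
      = R.comp hr ht i (CoprodV.evalL R φ a x) (CoprodV.evalL R φ a y) :=
    CoprodV.eval_comp R φ a hr ht hw i x y
  rw [this]
  subst hw
  split_ifs with h
  · subst h
    rw [Finset.sum_eq_single (v, v')]
    · rw [ev_single, ev_single, if_pos rfl, if_pos rfl]
    · rintro ⟨c, c'⟩ - hc
      rw [ev_single, ev_single]
      by_cases h₁ : c = v
      · have h₂ : c' ≠ v' := fun h => hc (by rw [h₁, h])
        simp [h₂]
      · simp [h₁]
    · intro h
      simp at h
  · refine Finset.sum_eq_zero ?_
    rintro ⟨c, c'⟩ hc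
    rw [Finset.HasAntidiagonal.mem_antidiagonal] at hc
    rw [ev_single, ev_single]
    by_cases h₁ : c = v
    · have h₂ : c' ≠ v' := fun h' => h (by rw [← hc, ← h', ← h₁])
      simp [h₂]
    · simp [h₁]

theorem single_act {n : ℕ} {p : ℤ} {w : ℕ} (σ : s.perms n) (x : CoprodV P n p w) :
    (hat P).act σ (single P w x) = single P w (CoprodV.actL σ x) := by
  refine HatV.ext fun R φ a u => ?_
  refine (HatV.ev_act R φ a u σ _).trans ?_
  rw [ev_single, ev_single]
  split_ifs
  · exact (CoprodV.eval_act R φ a σ x).symm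
  · exact map_zero _

theorem coeff_act {n : ℕ} {p : ℤ} (w : ℕ) (σ : s.perms n) (x : (hat P).V n p) :
    coeff P w ((hat P).act σ x) = CoprodV.actL σ (coeff P w x) := rfl

/-- The operations of `P` in the completed coproduct. -/
def of (P : GrOperad k s) : GrHom P (hat P) where
  app :=
    { toFun := fun x => single P 0 (CoprodV.of x)
      map_add' := fun x y => by
        rw [← map_add]
        exact congrArg _ (CoprodV.ext fun R φ a => by simp)
      map_smul' := fun c x => by
        rw [RingHom.id_apply, ← map_smul]
        exact congrArg _ (CoprodV.ext fun R φ a => by simp) }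
  map_act σ x := by
    refine (congrArg (single P 0) ?_).trans (single_act σ (CoprodV.of x)).symm
    exact CoprodV.ext fun R φ a => (φ.map_act σ x).trans
      (CoprodV.evalL_act R φ a σ (CoprodV.of x)).symm
  map_comp hr ht i x y := by
    refine (congrArg (single P 0) ?_).trans
      (single_comp hr ht (Nat.zero_add 0) i (CoprodV.of x) (CoprodV.of y)).symm
    exact CoprodV.ext fun R φ a => (φ.map_comp hr ht i x y).trans
      (CoprodV.evalL_comp R φ a hr ht (Nat.zero_add 0) i (CoprodV.of x) (CoprodV.of y)).symm

theorem of_app {n : ℕ} {p : ℤ} (x : P.V n p) : (of P).app x = hatOf x := rfl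

theorem evalL_self {n : ℕ} {p : ℤ} {w : ℕ} (x : CoprodV P n p w) :
    CoprodV.evalL (hat P) (of P) (hatAlpha P) x = single P w x := by
  induction x using CoprodV.induction with
  | of x => rfl
  | alpha => rfl
  | zero => simp
  | add x y hx hy => simp only [map_add, hx, hy]
  | smul c x hx => simp only [map_smul, hx]
  | act σ x hx => rw [CoprodV.evalL_act, hx, single_act]
  | comp hr ht hw i x y hx hy => rw [CoprodV.evalL_comp, hx, hy, single_comp]

/-- A suboperad that contains `P` and `α` contains the homogeneous elements. -/
theorem single_mem (S : SubOperad (hat P)) (h : ∀ n p (x : P.V n p), hatOf x ∈ S.carrier n p)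
    (hα : hatAlpha P ∈ S.carrier 0 0) {n : ℕ} {p : ℤ} {w : ℕ} (x : CoprodV P n p w) :
    single P w x ∈ S.carrier n p := by
  induction x using CoprodV.induction with
  | of x => exact h _ _ x
  | alpha => exact hα
  | zero => simp
  | add x y hx hy => rw [map_add]; exact add_mem hx hy
  | smul c x hx => rw [map_smul]; exact Submodule.smul_mem _ c hx
  | act σ x hx => rw [← single_act]; exact S.act_mem σ hx
  | comp hr ht hw i x y hx hy => rw [← single_comp]; exact S.comp_mem hr ht i hx hy

/-- The homogeneous parts of a series. -/
def pi (P : GrOperad k s) (w : ℕ) {n : ℕ} {p : ℤ} : (hat P).V n p →ₗ[k] (hat P).V n p :=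
  single P w ∘ₗ coeff P w

theorem pi_apply (w : ℕ) {n : ℕ} {p : ℤ} (x : (hat P).V n p) :
    pi P w x = single P w (coeff P w x) := rfl

theorem pi_single_same (w : ℕ) {n : ℕ} {p : ℤ} (x : CoprodV P n p w) :
    pi P w (single P w x) = single P w x := by rw [pi_apply, coeff_single_same]

theorem pi_single_of_ne {v w : ℕ} (h : v ≠ w) {n : ℕ} {p : ℤ} (x : CoprodV P n p w) :
    pi P v (single P w x) = 0 := by rw [pi_apply, coeff_single_of_ne h, map_zero]

theorem pi_act {n : ℕ} {p : ℤ} (w : ℕ) (σ : s.perms n) (x : (hat P).V n p) :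
    pi P w ((hat P).act σ x) = (hat P).act σ (pi P w x) := by
  rw [pi_apply, coeff_act, pi_apply, single_act]

theorem eq_of_pi {n : ℕ} {p : ℤ} {x y : (hat P).V n p} (h : ∀ w, pi P w x = pi P w y) : x = y := by
  refine ext fun w => ?_
  rw [← coeff_single_same w (coeff P w x), ← pi_apply, h, pi_apply, coeff_single_same]

theorem single_coeff_comp {m n r : ℕ} {p q t : ℤ} (hr : r + 1 = m + n) (ht : t = p + q) (i : Fin m)
    (x : (hat P).V m p) (y : (hat P).V n q) (w : ℕ) : coeff P w ((hat P).comp hr ht i x y)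
      = ∑ v : {v // v ∈ Finset.HasAntidiagonal.antidiagonal w},
        CoprodV.compL hr ht (Finset.HasAntidiagonal.mem_antidiagonal.1 v.2) i (coeff P v.1.1 x)
          (coeff P v.1.2 y) := rfl

theorem pi_comp {m n r : ℕ} {p q t : ℤ} (hr : r + 1 = m + n) (ht : t = p + q) (i : Fin m)
    (x : (hat P).V m p) (y : (hat P).V n q) (w : ℕ) : pi P w ((hat P).comp hr ht i x y)
      = ∑ v ∈ Finset.HasAntidiagonal.antidiagonal w,
        (hat P).comp hr ht i (pi P v.1 x) (pi P v.2 y) := by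
  rw [pi_apply, single_coeff_comp, map_sum,
    ← Finset.sum_coe_sort (Finset.HasAntidiagonal.antidiagonal w)]
  refine Finset.sum_congr rfl fun v _ => ?_
  rw [pi_apply, pi_apply, single_comp]

end hat

/-! ### Continuous derivations of the completed coproduct -/

/-- A complete grading on an infinitesimal bimodule over the completed coproduct. -/
structure Grading {P : GrOperad k s} (N : InfBimod (hat P)) where
  pi : ℕ → ∀ {n : ℕ} {p : ℤ}, N.V n p →ₗ[k] N.V n p
  pi_act : ∀ (w : ℕ) {n : ℕ} {p : ℤ} (σ : s.perms n) (y : N.V n p),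
    pi w (N.act σ y) = N.act σ (pi w y)
  pi_lcomp : ∀ (w : ℕ) {m n r : ℕ} {p q t : ℤ} (hr : r + 1 = m + n) (ht : t = p + q) (i : Fin m)
    (x : (hat P).V m p) (y : N.V n q), pi w (N.lcomp hr ht i x y)
      = ∑ v ∈ Finset.HasAntidiagonal.antidiagonal w, N.lcomp hr ht i (hat.pi P v.1 x) (pi v.2 y)
  pi_rcomp : ∀ (w : ℕ) {m n r : ℕ} {p q t : ℤ} (hr : r + 1 = m + n) (ht : t = p + q) (i : Fin m)
    (y : N.V m p) (x : (hat P).V n q), pi w (N.rcomp hr ht i y x)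
      = ∑ v ∈ Finset.HasAntidiagonal.antidiagonal w, N.rcomp hr ht i (pi v.1 y) (hat.pi P v.2 x)
  sum : ∀ {n : ℕ} {p : ℤ}, (ℕ → N.V n p) →ₗ[k] N.V n p
  pi_sum : ∀ (w : ℕ) {n : ℕ} {p : ℤ} (y : ℕ → N.V n p), pi w (sum y) = pi w (y w)
  sep : ∀ {n : ℕ} {p : ℤ} (y : N.V n p), (∀ w, pi w y = 0) → y = 0

theorem sum_antidiagonal_add {A : Type*} [AddCommMonoid A] (w e : ℕ) (F : ℕ × ℕ → A)
    (h : ∀ a b, a < e → F (a, b) = 0) : ∑ v ∈ Finset.HasAntidiagonal.antidiagonal (w + e), F v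
      = ∑ v ∈ Finset.HasAntidiagonal.antidiagonal w, F (v.1 + e, v.2) := by
  induction e generalizing F with
  | zero => rfl
  | succ e ih =>
    rw [← Nat.add_assoc, Finset.Nat.sum_antidiagonal_succ, h 0 _ (Nat.succ_pos e), zero_add,
      ih (fun v => F (v.1 + 1, v.2)) (fun a b ha => h _ _ (by omega))]
    rfl

theorem sum_antidiagonal_add' {A : Type*} [AddCommMonoid A] (w e : ℕ) (F : ℕ × ℕ → A)
    (h : ∀ a b, b < e → F (a, b) = 0) : ∑ v ∈ Finset.HasAntidiagonal.antidiagonal (w + e), F v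
      = ∑ v ∈ Finset.HasAntidiagonal.antidiagonal w, F (v.1, v.2 + e) := by
  rw [← Finset.Nat.sum_antidiagonal_swap (n := w + e), ← Finset.Nat.sum_antidiagonal_swap (n := w),
    sum_antidiagonal_add w e (fun v => F v.swap) (fun a b ha => h b a ha)]
  rfl

namespace Grading

variable {P : GrOperad k s} {N : InfBimod (hat P)} (Γ : Grading N)

theorem eq_of_pi {n : ℕ} {p : ℤ} {y y' : N.V n p} (h : ∀ w, Γ.pi w y = Γ.pi w y') : y = y' :=
  sub_eq_zero.1 (Γ.sep _ fun w => by rw [map_sub, h, sub_self])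

variable (f : GrHom P (sqZero (hat P) N)) (hf : f.trans (sqZeroFst _ _) = hat.of P) (ν : N.V 0 0)

/-- The value of a derivation on homogeneous elements. -/
def onHom (f : GrHom P (sqZero (hat P) N)) (ν : N.V 0 0) {n : ℕ} {p : ℤ} {w : ℕ} :
    CoprodV P n p w →ₗ[k] N.V n p :=
  LinearMap.snd k ((hat P).V n p) (N.V n p) ∘ₗ CoprodV.evalL (sqZero (hat P) N) f (hatAlpha P, ν)

include hf in
theorem evalL_eq {n : ℕ} {p : ℤ} {w : ℕ} (x : CoprodV P n p w) :
    CoprodV.evalL (sqZero (hat P) N) f (hatAlpha P, ν) x = (hat.single P w x, onHom f ν x) := by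
  refine Prod.ext ?_ rfl
  have := GrHom.map_eval f (hatAlpha P, ν) (sqZeroFst (hat P) N) x
  rw [hf] at this
  exact this.trans (hat.evalL_self x)

include hf in
theorem onHom_comp {m n r : ℕ} {p q t : ℤ} {v v' w : ℕ} (hr : r + 1 = m + n) (ht : t = p + q)
    (hw : v + v' = w) (i : Fin m) (x : CoprodV P m p v) (y : CoprodV P n q v') :
    onHom f ν (CoprodV.compL hr ht hw i x y)
      = N.rcomp hr ht i (onHom f ν x) (hat.single P v' y)
        + N.lcomp hr ht i (hat.single P v x) (onHom f ν y) := by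
  have := CoprodV.eval_comp (sqZero (hat P) N) f (hatAlpha P, ν) hr ht hw i x y
  refine (congrArg Prod.snd this).trans ?_
  change N.rcomp hr ht i _ (CoprodV.evalL (sqZero (hat P) N) f (hatAlpha P, ν) y).1
    + N.lcomp hr ht i (CoprodV.evalL (sqZero (hat P) N) f (hatAlpha P, ν) x).1 _ = _
  rw [evalL_eq f hf, evalL_eq f hf]
  rfl

theorem onHom_act {n : ℕ} {p : ℤ} {w : ℕ} (σ : s.perms n) (x : CoprodV P n p w) :
    onHom f ν (CoprodV.actL σ x) = N.act σ (onHom f ν x) :=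
  congrArg Prod.snd (CoprodV.eval_act (sqZero (hat P) N) f (hatAlpha P, ν) σ x)

variable (e : ℕ) (hfe : ∀ {n : ℕ} {p : ℤ} (x : P.V n p) (w : ℕ), w + e ≠ 0 → Γ.pi w (f.app x).2 = 0)
  (hν : ∀ w, w + e ≠ 1 → Γ.pi w ν = 0)

include hf hfe hν in
theorem pi_onHom {n : ℕ} {p : ℤ} {w : ℕ} (x : CoprodV P n p w) (v : ℕ) (hv : v + e ≠ w) :
    Γ.pi v (onHom f ν x) = 0 := by
  induction x using CoprodV.induction generalizing v with
  | of x => exact hfe x v hv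
  | alpha => exact hν v hv
  | zero => simp
  | add x y hx hy => rw [map_add, map_add, hx v hv, hy v hv, add_zero]
  | smul c x hx => rw [map_smul, map_smul, hx v hv, smul_zero]
  | act σ x hx => rw [onHom_act, Γ.pi_act, hx v hv, map_zero]
  | @comp _ _ _ _ _ _ a a' w hr ht hw i x y hx hy =>
    rw [onHom_comp f hf ν hr ht hw i]
    rw [map_add, Γ.pi_rcomp, Γ.pi_lcomp, Finset.sum_eq_zero, Finset.sum_eq_zero, add_zero]
    · rintro ⟨b, b'⟩ hb
      rw [Finset.HasAntidiagonal.mem_antidiagonal] at hb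
      simp only at hb ⊢
      by_cases h : b = a
      · rw [hy b' (by omega), map_zero]
      · rw [hat.pi_single_of_ne h, map_zero, LinearMap.zero_apply]
    · rintro ⟨b, b'⟩ hb
      rw [Finset.HasAntidiagonal.mem_antidiagonal] at hb
      simp only at hb ⊢
      by_cases h : b' = a'
      · rw [hx b (by omega), map_zero, LinearMap.zero_apply]
      · rw [hat.pi_single_of_ne h, map_zero]

/-- The continuous derivation with prescribed values on `P` and `α`. -/
def ext (f : GrHom P (sqZero (hat P) N)) (ν : N.V 0 0) (e : ℕ) {n : ℕ} {p : ℤ} :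
    (hat P).V n p →ₗ[k] N.V n p :=
  Γ.sum ∘ₗ LinearMap.pi fun v => onHom f ν ∘ₗ hat.coeff P (v + e)

theorem pi_ext {n : ℕ} {p : ℤ} (x : (hat P).V n p) (v : ℕ) :
    Γ.pi v (Γ.ext f ν e x) = Γ.pi v (onHom f ν (hat.coeff P (v + e) x)) := Γ.pi_sum v _

include hf hfe hν in
theorem ext_single {n : ℕ} {p : ℤ} {w : ℕ} (x : CoprodV P n p w) :
    Γ.ext f ν e (hat.single P w x) = onHom f ν x := by
  refine Γ.eq_of_pi fun v => ?_
  rw [pi_ext]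
  by_cases h : v + e = w
  · subst h
    rw [hat.coeff_single_same]
  · rw [hat.coeff_single_of_ne h, map_zero, map_zero, Γ.pi_onHom f hf ν e hfe hν _ _ h]

include hf hfe hν in
theorem ext_of {n : ℕ} {p : ℤ} (x : P.V n p) : Γ.ext f ν e (hatOf x) = (f.app x).2 :=
  Γ.ext_single f hf ν e hfe hν _

include hf hfe hν in
theorem ext_alpha : Γ.ext f ν e (hatAlpha P) = ν := Γ.ext_single f hf ν e hfe hν _

theorem ext_act {n : ℕ} {p : ℤ} (σ : s.perms n) (x : (hat P).V n p) :
    Γ.ext f ν e ((hat P).act σ x) = N.act σ (Γ.ext f ν e x) := by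
  refine Γ.eq_of_pi fun v => ?_
  rw [Γ.pi_act, pi_ext, pi_ext, hat.coeff_act, onHom_act, Γ.pi_act]

include hf hfe hν in
theorem pi_onHom_coeff {n : ℕ} {p : ℤ} (x : (hat P).V n p) (v w : ℕ) :
    Γ.pi v (onHom f ν (hat.coeff P w x)) = if w = v + e then Γ.pi v (Γ.ext f ν e x) else 0 := by
  split_ifs with h
  · subst h
    rw [pi_ext]
  · exact Γ.pi_onHom f hf ν e hfe hν _ _ (Ne.symm h)

include hf hfe hν in
theorem ext_comp {m n r : ℕ} {p q t : ℤ} (hr : r + 1 = m + n) (ht : t = p + q) (i : Fin m)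
    (x : (hat P).V m p) (y : (hat P).V n q) : Γ.ext f ν e ((hat P).comp hr ht i x y)
      = N.rcomp hr ht i (Γ.ext f ν e x) y + N.lcomp hr ht i x (Γ.ext f ν e y) := by
  refine Γ.eq_of_pi fun v => ?_
  rw [pi_ext, hat.single_coeff_comp, map_sum, map_sum, map_add, Γ.pi_rcomp, Γ.pi_lcomp]
  have e₁ : ∀ u : {u // u ∈ Finset.HasAntidiagonal.antidiagonal (v + e)},
      Γ.pi v (onHom f ν (CoprodV.compL hr ht (Finset.HasAntidiagonal.mem_antidiagonal.1 u.2) i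
        (hat.coeff P u.1.1 x) (hat.coeff P u.1.2 y)))
      = (if e ≤ u.1.1 then N.rcomp hr ht i (Γ.pi (u.1.1 - e) (Γ.ext f ν e x)) (hat.pi P u.1.2 y) else 0)
        + (if e ≤ u.1.2 then N.lcomp hr ht i (hat.pi P u.1.1 x) (Γ.pi (u.1.2 - e) (Γ.ext f ν e y)) else 0) := by
    rintro ⟨⟨a, a'⟩, hu⟩
    rw [Finset.HasAntidiagonal.mem_antidiagonal] at hu
    simp only at hu ⊢
    rw [onHom_comp f hf, map_add, Γ.pi_rcomp, Γ.pi_lcomp]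
    congr 1
    · split_ifs with ha
      · rw [Finset.sum_eq_single (a - e, a')]
        · rw [Γ.pi_onHom_coeff f hf ν e hfe hν, if_pos (by omega), hat.pi_single_same,
            ← hat.pi_apply]
        · rintro ⟨b, b'⟩ hb hne
          rw [Finset.HasAntidiagonal.mem_antidiagonal] at hb
          simp only at hb ⊢
          have : b' ≠ a' := fun h => hne (by rw [h, show b = a - e by omega])
          rw [hat.pi_single_of_ne this, map_zero]
        · intro h
          rw [Finset.HasAntidiagonal.mem_antidiagonal] at h
          simp only at h
          omega
      · refine Finset.sum_eq_zero fun b _ => ?_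
        rw [Γ.pi_onHom_coeff f hf ν e hfe hν, if_neg (by omega), map_zero, LinearMap.zero_apply]
    · split_ifs with ha
      · rw [Finset.sum_eq_single (a, a' - e)]
        · rw [Γ.pi_onHom_coeff f hf ν e hfe hν, if_pos (by omega), hat.pi_single_same,
            ← hat.pi_apply]
        · rintro ⟨b, b'⟩ hb hne
          rw [Finset.HasAntidiagonal.mem_antidiagonal] at hb
          simp only at hb ⊢
          have : b ≠ a := fun h => hne (by rw [h, show b' = a' - e by omega])
          rw [hat.pi_single_of_ne this, map_zero, LinearMap.zero_apply]
        · intro h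
          rw [Finset.HasAntidiagonal.mem_antidiagonal] at h
          simp only at h
          omega
      · refine Finset.sum_eq_zero fun b _ => ?_
        rw [Γ.pi_onHom_coeff f hf ν e hfe hν, if_neg (by omega), map_zero]
  rw [Finset.sum_congr rfl fun u _ => e₁ u, Finset.sum_add_distrib]
  congr 1
  · rw [Finset.sum_coe_sort (Finset.HasAntidiagonal.antidiagonal (v + e)) (fun u =>
        if e ≤ u.1 then N.rcomp hr ht i (Γ.pi (u.1 - e) (Γ.ext f ν e x)) (hat.pi P u.2 y) else 0),
      sum_antidiagonal_add _ _ _ (fun a b ha => if_neg (by omega))]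
    refine Finset.sum_congr rfl fun u _ => ?_
    simp
  · rw [Finset.sum_coe_sort (Finset.HasAntidiagonal.antidiagonal (v + e)) (fun u =>
        if e ≤ u.2 then N.lcomp hr ht i (hat.pi P u.1 x) (Γ.pi (u.2 - e) (Γ.ext f ν e y)) else 0),
      sum_antidiagonal_add' _ _ _ (fun a b ha => if_neg (by omega))]
    refine Finset.sum_congr rfl fun u _ => ?_
    simp

end Grading

/-! ### Formal differentiation with respect to `α` -/

theorem Deriv.map_comp_id {R : GrOperad k s} {e : ℤ} (D : Deriv (GrHom.id R) e) {m n r : ℕ}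
    {p p' q q' t t' : ℤ} (hr : r + 1 = m + n) (ht : t = p + q) (hp : p' = p + e) (hq : q' = q + e)
    (htt : t' = t + e) (h₁ : t' = p' + q) (h₂ : t' = p + q') (i : Fin m) (x : R.V m p) (y : R.V n q) :
    D.app htt (R.comp hr ht i x y)
      = R.comp hr h₁ i (D.app hp x) y + (e * p).negOnePow • R.comp hr h₂ i x (D.app hq y) :=
  D.map_comp hr ht hp hq htt h₁ h₂ i x y

theorem hat.pi_castL {P : GrOperad k s} (w : ℕ) {m m' : ℕ} {p p' : ℤ} (x : (hat P).V m p) :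
    hat.pi P w ((hat P).castL m' p' x) = (hat P).castL m' p' (hat.pi P w x) := by
  by_cases h : m = m' ∧ p = p'
  · obtain ⟨rfl, rfl⟩ := h
    rw [GrOperad.castL_self, GrOperad.castL_self]
  · rw [GrOperad.castL_of_ne _ h, GrOperad.castL_of_ne _ h, map_zero]

namespace Fam

variable {P : GrOperad k s}

/-- The homogeneous parts of a family of series. -/
def pi (P : GrOperad k s) (w : ℕ) {n : ℕ} {p : ℤ} : Fam (hat P) n p →ₗ[k] Fam (hat P) n p :=
  ((hat.pi P w).compLeft (Fin (n + 1))).prodMap (if w = 0 then LinearMap.id else 0)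

theorem pi_sing (w : ℕ) {n : ℕ} {p : ℤ} (j : Fin (n + 1)) (y : (hat P).V (n + 1) p) :
    pi P w (sing j y) = sing j (hat.pi P w y) := by
  refine Prod.ext (funext fun i => ?_) ?_
  · change hat.pi P w ((Pi.single j y : Fin (n + 1) → (hat P).V (n + 1) p) i)
      = (Pi.single j (hat.pi P w y) : Fin (n + 1) → (hat P).V (n + 1) p) i
    rw [Pi.single_apply, Pi.single_apply]
    split_ifs <;> simp
  · simp [pi, sing]

theorem pi_unit (w : ℕ) {n : ℕ} {p : ℤ} (r : k) :
    pi P w (unit r : Fam (hat P) n p) = if w = 0 then unit r else 0 := by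
  refine Prod.ext (funext fun i => ?_) ?_
  · split_ifs <;> exact map_zero (hat.pi P w)
  · simp only [pi, unit, LinearMap.prodMap_apply]
    split_ifs <;> rfl

theorem pi_fst (w : ℕ) {n : ℕ} {p : ℤ} (Y : Fam (hat P) n p) (j : Fin (n + 1)) :
    (pi P w Y).1 j = hat.pi P w (Y.1 j) := rfl

theorem pi_mem_rel (w : ℕ) {n : ℕ} {p : ℤ} :
    rel (hat P) n p ≤ (rel (hat P) n p).comap (pi P w) := by
  refine rel_induction _ _ (fun j τ y h => ?_) (fun r hr => ?_)
  · rw [pi_sing, pi_sing, hat.pi_act]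
    exact sing_sub_mem_rel j τ _ h
  · rw [pi_unit]
    split_ifs
    · exact unit_mem_rel hr r
    · exact zero_mem _

theorem pi_act (w : ℕ) {n : ℕ} {p : ℤ} (σ : s.perms n) (Y : Fam (hat P) n p) :
    pi P w (act σ Y) = act σ (pi P w Y) := by
  induction Y using induction with
  | h j y => rw [act_sing, pi_sing, pi_sing, act_sing, hat.pi_act]
  | h₀ r =>
    rw [act_unit, pi_unit]
    split_ifs
    · rw [act_unit]
    · rw [map_zero]
  | ha Y Y' hY hY' => simp only [map_add, hY, hY']

theorem pi_lcomp (w : ℕ) {m n r : ℕ} {p q t : ℤ} (hr : r + 1 = m + n) (ht : t = p + q) (i : Fin m)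
    (x : (hat P).V m p) (Y : Fam (hat P) n q) : pi P w (lcomp hr ht i x Y)
      = ∑ v ∈ Finset.HasAntidiagonal.antidiagonal w, lcomp hr ht i (hat.pi P v.1 x) (pi P v.2 Y) := by
  induction Y using induction with
  | h j y =>
    rw [lcomp_sing, pi_sing, hat.pi_comp, map_sum]
    refine Finset.sum_congr rfl fun v _ => ?_
    rw [pi_sing, lcomp_sing]
  | h₀ c =>
    rw [lcomp_unit, map_smul, pi_sing, hat.pi_castL, Finset.sum_eq_single (w, 0)]
    · rw [pi_unit, if_pos rfl, lcomp_unit]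
    · rintro ⟨a, b⟩ hab hne
      rw [Finset.HasAntidiagonal.mem_antidiagonal] at hab
      have : b ≠ 0 := fun h => hne (by subst h; simpa using hab)
      rw [pi_unit, if_neg this, map_zero]
    · intro h
      simp at h
  | ha Y Y' hY hY' => simp only [map_add, hY, hY', Finset.sum_add_distrib]

theorem pi_rcomp (w : ℕ) {m n r : ℕ} {p q t : ℤ} (hr : r + 1 = m + n) (ht : t = p + q) (i : Fin m)
    (Y : Fam (hat P) m p) (x : (hat P).V n q) : pi P w (rcomp hr ht i Y x)
      = ∑ v ∈ Finset.HasAntidiagonal.antidiagonal w, rcomp hr ht i (pi P v.1 Y) (hat.pi P v.2 x) := by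
  induction Y using induction with
  | h j y =>
    rw [rcomp_sing, pi_sing, hat.pi_comp, map_sum]
    refine Finset.sum_congr rfl fun v _ => ?_
    rw [pi_sing, rcomp_sing]
  | h₀ c =>
    rw [rcomp_unit, map_zero]
    refine (Finset.sum_eq_zero fun v _ => ?_).symm
    rw [pi_unit]
    split_ifs
    · rw [rcomp_unit]
    · rw [map_zero, LinearMap.zero_apply]
  | ha Y Y' hY hY' => simp only [map_add, LinearMap.add_apply, hY, hY', Finset.sum_add_distrib]

theorem norm_pi (w : ℕ) {n : ℕ} {p : ℤ} (Y : Fam (hat P) n p) :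
    norm (hat P) (pi P w Y) = pi P w (norm (hat P) Y) := by
  induction Y using induction with
  | h j y =>
    cases s
    · rw [pi_sing, norm_sing_symm, norm_sing_symm, pi_sing, hat.pi_act]
    · rw [pi_sing, norm_sing_nonsymm, norm_sing_nonsymm, pi_sing]
  | h₀ r =>
    rw [pi_unit, norm_unit]
    split_ifs with h₁ h₂ h₃
    · rw [norm_unit, if_pos h₂, pi_unit, if_pos h₁]
    · rw [norm_unit, if_neg h₂, map_zero]
    · rw [map_zero, pi_unit, if_neg h₁]
    · rw [map_zero, map_zero]
  | ha Y Y' hY hY' => simp only [map_add, hY, hY']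

end Fam

namespace markBimod

variable {P : GrOperad k s}

/-- The homogeneous parts, on classes of families. -/
def pi (P : GrOperad k s) (w : ℕ) {n : ℕ} {p : ℤ} :
    (markBimod (hat P)).V n p →ₗ[k] (markBimod (hat P)).V n p :=
  (Fam.rel (hat P) n p).mapQ (Fam.rel (hat P) n p) (Fam.pi P w) (Fam.pi_mem_rel w)

theorem pi_mk (w : ℕ) {n : ℕ} {p : ℤ} (Y : Fam (hat P) n p) :
    pi P w (mk (hat P) Y) = mk (hat P) (Fam.pi P w Y) := rfl

theorem nf_pi (w : ℕ) {n : ℕ} {p : ℤ} (y : (markBimod (hat P)).V n p) :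
    nf (hat P) (pi P w y) = Fam.pi P w (nf (hat P) y) := by
  induction y using induction with | h Y
  rw [pi_mk, nf_mk, nf_mk, Fam.norm_pi]

/-- Differentiation of series takes values in a complete bimodule. -/
def grading (P : GrOperad k s) : Grading (markBimod (hat P)) where
  pi w := pi P w
  pi_act w n p σ y := by
    induction y using induction with | h Y
    rw [act_mk, pi_mk, Fam.pi_act, pi_mk, act_mk]
  pi_lcomp w m n r p q t hr ht i x y := by
    induction y using induction with | h Y
    rw [lcomp_mk, pi_mk, Fam.pi_lcomp, map_sum]
    rfl
  pi_rcomp w m n r p q t hr ht i y x := by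
    induction y using induction with | h Y
    rw [rcomp_mk, pi_mk, Fam.pi_rcomp, map_sum]
    rfl
  sum {n p} := mk (hat P) ∘ₗ
    { toFun := fun y => (fun j w => hat.coeff P w ((nf (hat P) (y w)).1 j), (nf (hat P) (y 0)).2)
      map_add' := fun y y' => by
        refine Prod.ext (funext fun j => funext fun w => ?_) ?_
        · change hat.coeff P w ((nf (hat P) (y w + y' w)).1 j) = _
          rw [map_add]
          rfl
        · change (nf (hat P) (y 0 + y' 0)).2 = _
          rw [map_add]
          rfl
      map_smul' := fun c y => by
        refine Prod.ext (funext fun j => funext fun w => ?_) ?_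
        · change hat.coeff P w ((nf (hat P) (c • y w)).1 j) = _
          rw [map_smul]
          rfl
        · change (nf (hat P) (c • y 0)).2 = _
          rw [map_smul]
          rfl }
  pi_sum w n p y := by
    rw [LinearMap.comp_apply, pi_mk]
    conv_rhs => rw [← mk_nf (y w), pi_mk]
    congr 1
    refine Prod.ext (funext fun j => rfl) ?_
    by_cases h : w = 0
    · subst h
      rfl
    · simp [Fam.pi, h]
  sep {n p} y h := by
    have key : nf (hat P) y = 0 := by
      have h' : ∀ w, Fam.pi P w (nf (hat P) y) = 0 := fun w => by rw [← nf_pi, h, map_zero]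
      refine Prod.ext (funext fun j => hat.eq_of_pi fun w => ?_) ?_
      · refine Eq.trans ?_ (map_zero (hat.pi P w)).symm
        exact congrFun (congrArg Prod.fst (h' w)) j
      · simpa [Fam.pi] using congrArg Prod.snd (h' 0)
    rw [← mk_nf y, key, map_zero]

end markBimod

section mark

variable {P : GrOperad k s}

theorem mark_gen_of {n : ℕ} {p : ℤ} (x : P.V n p) (w : ℕ) (_ : w + 1 ≠ 0) :
    (markBimod.grading P).pi w
      (((hat.of P).trans (sqZeroInl (hat P) (markBimod (hat P)))).app x).2 = 0 :=
  map_zero _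

theorem mark_gen_alpha (w : ℕ) (hw : w + 1 ≠ 1) :
    (markBimod.grading P).pi w (markBimod.mk (hat P) (Fam.unit 1) : (markBimod (hat P)).V 0 0) = 0 := by
  change markBimod.pi P w _ = 0
  rw [markBimod.pi_mk, Fam.pi_unit, if_neg (by omega), map_zero]

/-- The formal derivative of a series with respect to `α`: one copy of `α` is replaced by a marked
input. -/
def mark (P : GrOperad k s) {n : ℕ} {p : ℤ} : (hat P).V n p →ₗ[k] (markBimod (hat P)).V n p :=
  (markBimod.grading P).ext ((hat.of P).trans (sqZeroInl _ _)) (markBimod.mk (hat P) (Fam.unit 1)) 1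

theorem mark_of {n : ℕ} {p : ℤ} (x : P.V n p) : mark P (hatOf x) = 0 :=
  (markBimod.grading P).ext_of _ rfl _ 1 mark_gen_of mark_gen_alpha x

theorem mark_alpha : mark P (hatAlpha P) = markBimod.mk (hat P) (Fam.unit 1) :=
  (markBimod.grading P).ext_alpha _ rfl _ 1 mark_gen_of mark_gen_alpha

theorem mark_act {n : ℕ} {p : ℤ} (σ : s.perms n) (x : (hat P).V n p) :
    mark P ((hat P).act σ x) = (markBimod (hat P)).act σ (mark P x) :=
  (markBimod.grading P).ext_act _ _ 1 σ x

theorem mark_comp {m n r : ℕ} {p q t : ℤ} (hr : r + 1 = m + n) (ht : t = p + q) (i : Fin m)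
    (x : (hat P).V m p) (y : (hat P).V n q) : mark P ((hat P).comp hr ht i x y)
      = (markBimod (hat P)).rcomp hr ht i (mark P x) y
        + (markBimod (hat P)).lcomp hr ht i x (mark P y) :=
  (markBimod.grading P).ext_comp _ rfl _ 1 mark_gen_of mark_gen_alpha hr ht i x y

theorem pi_mark {n : ℕ} {p : ℤ} (x : (hat P).V n p) (w : ℕ) :
    markBimod.pi P w (mark P x) = markBimod.pi P w (mark P (hat.pi P (w + 1) x)) := by
  refine ((markBimod.grading P).pi_ext _ _ 1 x w).trans
    (Eq.trans ?_ ((markBimod.grading P).pi_ext _ _ 1 (hat.pi P (w + 1) x) w).symm)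
  rw [hat.pi_apply, hat.coeff_single_same]

end mark

theorem markBimod.ins_act {R T : GrOperad k s} (f : GrHom R T) {e : ℤ} (b : T.V 0 e) {n : ℕ}
    {p q : ℤ} (h : q = p + e) (σ : s.perms n) (y : (markBimod R).V n p) :
    ins f b h ((markBimod R).act σ y) = T.act σ (ins f b h y) := by
  induction y using markBimod.induction with | h Y
  rw [act_mk, ins_mk, ins_mk, Fam.ins_act]

/-- The derivation along `f` that is zero on `P` and `b` on `α`. -/
def dsub {P T : GrOperad k s} (f : GrHom (hat P) T) {e : ℤ} (b : T.V 0 e) : Deriv f e where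
  app {n p q} h := (e * p).negOnePow • (markBimod.ins f b h ∘ₗ mark P)
  map_act h σ x := by
    simp only [LinearMap.smul_apply, LinearMap.comp_apply]
    rw [mark_act, markBimod.ins_act, map_sgn]
  map_comp {m n r p p' q q' t t'} hr ht hp hq htt h₁ h₂ i x y := by
    simp only [LinearMap.smul_apply, LinearMap.comp_apply, map_sgn]
    rw [mark_comp, map_add, smul_add]
    generalize mark P x = X
    generalize mark P y = Y
    induction X using markBimod.induction with | h X
    induction Y using markBimod.induction with | h Y
    rw [markBimod.rcomp_mk, markBimod.lcomp_mk, markBimod.ins_mk, markBimod.ins_mk,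
      markBimod.ins_mk, markBimod.ins_mk, Fam.ins_comp f b hr ht hp h₁,
      Fam.comp_ins f b hr ht hq h₂, sgn_smul_sgn_smul (c := e * t) 0 _ (by subst ht; ring),
      sgn_smul_sgn_smul (c := e * t) 0 _ (by subst ht; ring)]

theorem dsub_app {P T : GrOperad k s} (f : GrHom (hat P) T) {e : ℤ} (b : T.V 0 e) {n : ℕ} {p q : ℤ}
    (h : q = p + e) (x : (hat P).V n p) :
    (dsub f b).app h x = (e * p).negOnePow • markBimod.ins f b h (mark P x) := rfl

theorem dsub_of {P T : GrOperad k s} (f : GrHom (hat P) T) {e : ℤ} (b : T.V 0 e) {n : ℕ} {p q : ℤ}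
    (h : q = p + e) (x : P.V n p) : (dsub f b).app h (hatOf x) = 0 := by
  rw [dsub_app, mark_of, map_zero, smul_zero]

theorem dsub_alpha {P T : GrOperad k s} (f : GrHom (hat P) T) {e : ℤ} (b : T.V 0 e)
    (h : e = 0 + e) : (dsub f b).app h (hatAlpha P) = b := by
  rw [dsub_app, mark_alpha, markBimod.ins_mk, Fam.ins_unit, T.castL_self]
  simp

/-! ### Termwise derivations -/

/-- The square of an odd derivation of the completed coproduct vanishes on homogeneous elements if
it vanishes on `P` and `α`. -/
theorem Deriv.sq_single {P : GrOperad k s} (D : Deriv (GrHom.id (hat P)) (-1))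
    (h : ∀ {n : ℕ} {p : ℤ} (x : P.V n p), D.app (q := p + -1 + -1) rfl (D.app rfl (hatOf x)) = 0)
    (h' : D.app (q := 0 + -1 + -1) rfl (D.app rfl (hatAlpha P)) = 0)
    {n : ℕ} {p q t : ℤ} (hq : q = p + -1) (ht : t = q + -1) {w : ℕ} (x : CoprodV P n p w) :
    D.app ht (D.app hq (hat.single P w x)) = 0 := by
  subst hq ht
  exact hat.single_mem D.sqKer (fun n p x => h x) h' x

/-- The grading of the completed coproduct, as a bimodule over itself. -/
def hat.grading (P : GrOperad k s) (e : ℤ) : Grading (shiftBimod (hat P) e) where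
  pi w n p := hat.pi P (n := n) (p := p + e) w
  pi_act w n p σ y := hat.pi_act w σ y
  pi_lcomp w m n r p q t hr ht i x y := by
    exact (map_sgn (hat.pi P w) _ _).trans
      ((congrArg ((e * p).negOnePow • ·) (hat.pi_comp hr (by omega) i x y w)).trans Finset.smul_sum)
  pi_rcomp w m n r p q t hr ht i y x := hat.pi_comp hr _ i y x w
  sum {n p} :=
    { toFun := fun y w => hat.coeff P (n := n) (p := p + e) w (y w)
      map_add' := fun _ _ => rfl
      map_smul' := fun _ _ => rfl }
  pi_sum w n p y := rfl
  sep y h := hat.eq_of_pi fun w => (h w).trans (map_zero (hat.pi P w)).symm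

section hatDeriv

variable {P : GrOperad k s} {e : ℤ} (δ : Deriv (GrHom.id P) e)

theorem hatDeriv_gen_of {n : ℕ} {p : ℤ} (x : P.V n p) (w : ℕ) (hw : w + 0 ≠ 0) :
    (hat.grading P e).pi w ((δ.postcomp (hat.of P)).toDual.app x).2 = 0 :=
  hat.pi_single_of_ne hw _

theorem hatDeriv_gen_alpha (w : ℕ) (_ : w + 0 ≠ 1) :
    (hat.grading P e).pi w (0 : (shiftBimod (hat P) e).V 0 0) = 0 := map_zero _

/-- The continuous extension of a derivation of `P`, zero on `α`. -/
def hatDeriv : Deriv (GrHom.id (hat P)) e where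
  app {n p q} h := by
    subst h
    exact (hat.grading P e).ext (δ.postcomp (hat.of P)).toDual 0 0
  map_act h σ x := by
    subst h
    exact (hat.grading P e).ext_act _ _ 0 σ x
  map_comp {m n r p p' q q' t t'} hr ht hp hq htt h₁ h₂ i x y := by
    subst hp hq htt
    exact (hat.grading P e).ext_comp _ rfl _ 0 (hatDeriv_gen_of δ) hatDeriv_gen_alpha hr ht i x y

theorem hatDeriv_of {n : ℕ} {p q : ℤ} (h : q = p + e) (x : P.V n p) :
    (hatDeriv δ).app h (hatOf x) = hatOf (δ.app h x) := by
  subst h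
  exact (hat.grading P e).ext_of _ rfl _ 0 (hatDeriv_gen_of δ) hatDeriv_gen_alpha x

theorem hatDeriv_alpha {q : ℤ} (h : q = 0 + e) : (hatDeriv δ).app h (hatAlpha P) = 0 := by
  subst h
  exact (hat.grading P e).ext_alpha _ rfl _ 0 (hatDeriv_gen_of δ) hatDeriv_gen_alpha

theorem pi_hatDeriv {n : ℕ} {p q : ℤ} (h : q = p + e) (x : (hat P).V n p) (w : ℕ) :
    hat.pi P w ((hatDeriv δ).app h x) = (hatDeriv δ).app h (hat.pi P w x) := by
  subst h
  refine hat.eq_of_pi fun v => ?_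
  have key : ∀ (x : (hat P).V n p) (v : ℕ), hat.pi P v ((hatDeriv δ).app rfl x)
      = hat.pi P v (Grading.onHom (N := shiftBimod (hat P) e) (δ.postcomp (hat.of P)).toDual 0
        (hat.coeff P v x)) :=
    fun x v => (hat.grading P e).pi_ext (δ.postcomp (hat.of P)).toDual 0 0 x v
  rw [key (hat.pi P w x) v]
  by_cases hv : v = w
  · subst hv
    rw [hat.pi_apply v ((hatDeriv δ).app rfl x), hat.pi_single_same, ← hat.pi_apply, key,
      hat.pi_apply v x, hat.coeff_single_same]
  · rw [hat.pi_apply w, hat.pi_single_of_ne hv, hat.pi_apply w x, hat.coeff_single_of_ne hv, map_zero]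
    exact (map_zero (hat.pi P v)).symm

end hatDeriv

theorem hatDeriv_hatDeriv {P : GrOperad k s} (δ : Deriv (GrHom.id P) (-1))
    (hδ : ∀ {n : ℕ} {p q t : ℤ} (hq : q = p + -1) (ht : t = q + -1) (x : P.V n p),
      δ.app ht (δ.app hq x) = 0) {n : ℕ} {p q t : ℤ} (hq : q = p + -1) (ht : t = q + -1)
    (x : (hat P).V n p) : (hatDeriv δ).app ht ((hatDeriv δ).app hq x) = 0 := by
  refine hat.eq_of_pi fun w => ?_
  rw [pi_hatDeriv, pi_hatDeriv, map_zero, hat.pi_apply]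
  exact (hatDeriv δ).sq_single (fun x => by rw [hatDeriv_of, hatDeriv_of, hδ]; exact map_zero (hat.of P).app)
    (by rw [hatDeriv_alpha, map_zero]) hq ht _

/-! ### Derivations of families -/

namespace Fam

variable {R T : GrOperad k s}

/-- The extension of a derivation to families, zero on the marked input. -/
def deriv {e : ℤ} (δ : Deriv (GrHom.id R) e) {n : ℕ} {p q : ℤ} (h : q = p + e) :
    Fam R n p →ₗ[k] Fam R n q :=
  ((δ.app h).compLeft (Fin (n + 1))).prodMap 0

variable {e : ℤ} (δ : Deriv (GrHom.id R) e)

theorem deriv_sing {n : ℕ} {p q : ℤ} (h : q = p + e) (j : Fin (n + 1)) (y : R.V (n + 1) p) :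
    deriv δ h (sing j y) = sing j (δ.app h y) := by
  refine Prod.ext (funext fun i => ?_) rfl
  change δ.app h ((Pi.single j y : Fin (n + 1) → R.V (n + 1) p) i)
    = (Pi.single j (δ.app h y) : Fin (n + 1) → R.V (n + 1) q) i
  rw [Pi.single_apply, Pi.single_apply]
  split_ifs <;> simp

theorem deriv_unit {n : ℕ} {p q : ℤ} (h : q = p + e) (r : k) :
    deriv δ h (unit r : Fam R n p) = 0 :=
  Prod.ext (funext fun _ => map_zero (δ.app h)) rfl

theorem deriv_mem_rel {n : ℕ} {p q : ℤ} (h : q = p + e) :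
    rel R n p ≤ (rel R n q).comap (deriv δ h) := by
  refine rel_induction _ _ (fun j τ y hτ => ?_) (fun r hr => ?_)
  · rw [deriv_sing, deriv_sing, δ.map_act]
    exact sing_sub_mem_rel j τ _ hτ
  · rw [deriv_unit]
    exact zero_mem _

theorem deriv_act {n : ℕ} {p q : ℤ} (h : q = p + e) (σ : s.perms n) (Y : Fam R n p) :
    deriv δ h (act σ Y) = act σ (deriv δ h Y) := by
  induction Y using induction with
  | h j y => rw [act_sing, deriv_sing, deriv_sing, act_sing, δ.map_act]
  | h₀ r => rw [act_unit, deriv_unit, map_zero]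
  | ha Y Y' hY hY' => simp only [map_add, hY, hY']

theorem app_castL {m m' : ℕ} {p p' q q' : ℤ} (h : q = p + e) (h' : q' = p' + e) (x : R.V m p) :
    δ.app h' (R.castL m' p' x) = R.castL m' q' (δ.app h x) := by
  by_cases hm : m = m' ∧ p = p'
  · obtain ⟨rfl, rfl⟩ := hm
    obtain rfl : q' = q := by omega
    rw [R.castL_self, R.castL_self]
  · rw [R.castL_of_ne hm, R.castL_of_ne (by omega), map_zero]

theorem deriv_lcomp {m n r : ℕ} {p p' q q' t t' : ℤ} (hr : r + 1 = m + n) (ht : t = p + q)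
    (hp : p' = p + e) (hq : q' = q + e) (htt : t' = t + e) (h₁ : t' = p' + q) (h₂ : t' = p + q')
    (i : Fin m) (x : R.V m p) (Y : Fam R n q) : deriv δ htt (lcomp hr ht i x Y)
      = lcomp hr h₁ i (δ.app hp x) Y + (e * p).negOnePow • lcomp hr h₂ i x (deriv δ hq Y) := by
  induction Y using induction with
  | h j y =>
    rw [lcomp_sing, deriv_sing, lcomp_sing, deriv_sing, lcomp_sing, ← map_sgn, ← map_add,
      δ.map_comp _ ht hp hq htt h₁ h₂]
    rfl
  | h₀ c =>
    rw [lcomp_unit, lcomp_unit, deriv_unit, map_zero, smul_zero, add_zero, map_smul, deriv_sing,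
      app_castL δ hp]
  | ha Y Y' hY hY' =>
    simp only [map_add, hY, hY', smul_add]
    abel

theorem deriv_rcomp {m n r : ℕ} {p p' q q' t t' : ℤ} (hr : r + 1 = m + n) (ht : t = p + q)
    (hp : p' = p + e) (hq : q' = q + e) (htt : t' = t + e) (h₁ : t' = p' + q) (h₂ : t' = p + q')
    (i : Fin m) (Y : Fam R m p) (z : R.V n q) : deriv δ htt (rcomp hr ht i Y z)
      = rcomp hr h₁ i (deriv δ hp Y) z + (e * p).negOnePow • rcomp hr h₂ i Y (δ.app hq z) := by
  induction Y using induction with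
  | h j y =>
    rw [rcomp_sing, deriv_sing, rcomp_sing, deriv_sing, rcomp_sing, ← map_sgn, ← map_add,
      δ.map_comp _ ht hp hq htt h₁ h₂]
    rfl
  | h₀ c =>
    rw [rcomp_unit, rcomp_unit, deriv_unit, map_zero, LinearMap.map_zero, LinearMap.zero_apply,
      smul_zero, add_zero]
  | ha Y Y' hY hY' =>
    simp only [map_add, LinearMap.add_apply, hY, hY', smul_add]
    abel

/-- A derivation of an insertion. -/
theorem app_ins (f : GrHom R T) (D : Deriv (GrHom.id T) e)
    (hD : ∀ {n : ℕ} {p q : ℤ} (h : q = p + e) (x : R.V n p), D.app h (f.app x) = f.app (δ.app h x))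
    {e' e'' : ℤ} (b : T.V 0 e') (hb : e'' = e' + e) {n : ℕ} {p q p' t : ℤ} (h : q = p + e')
    (hp : p' = p + e) (ht : t = q + e) (Y : Fam R n p) :
    D.app ht (ins f b h Y) = ins f b (by omega) (deriv δ hp Y)
      + (e * p).negOnePow • ins f (D.app hb b) (by omega) Y := by
  induction Y using induction with
  | h j y =>
    rw [deriv_sing, ins_sing, ins_sing, ins_sing, D.map_comp _ h hp hb ht (by omega) (by omega), hD]
    rfl
  | h₀ c =>
    rw [deriv_unit, ins_unit, ins_unit, map_zero, zero_add, map_smul, app_castL D hb]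
    by_cases hn : 0 = n ∧ e'' = t
    · have : unit c ∈ rel R n p ∨ p = 0 := by omega
      obtain rfl : p = 0 := by omega
      simp
    · rw [T.castL_of_ne hn]
      simp
  | ha Y Y' hY hY' =>
    simp only [map_add, hY, hY', smul_add]
    abel

end Fam

/-- Differentiation with respect to `α` commutes with termwise derivations. -/
theorem mark_hatDeriv {P : GrOperad k s} {e : ℤ} (δ : Deriv (GrHom.id P) e) {n : ℕ} {p q : ℤ}
    (h : q = p + e) (x : (hat P).V n p) : mark P ((hatDeriv δ).app h x)
      = (Fam.rel (hat P) n p).mapQ (Fam.rel (hat P) n q) (Fam.deriv (hatDeriv δ) h)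
        (Fam.deriv_mem_rel (hatDeriv δ) h) (mark P x) := by
  let B : ∀ {n : ℕ} {p q : ℤ} (_ : q = p + e),
      (markBimod (hat P)).V n p →ₗ[k] (markBimod (hat P)).V n q := fun {n p q} h =>
    (Fam.rel (hat P) n p).mapQ (Fam.rel (hat P) n q) (Fam.deriv (hatDeriv δ) h)
      (Fam.deriv_mem_rel (hatDeriv δ) h)
  have hB : ∀ {n : ℕ} {p q : ℤ} (h : q = p + e) (Y : Fam (hat P) n p),
      B h (markBimod.mk (hat P) Y) = markBimod.mk (hat P) (Fam.deriv (hatDeriv δ) h Y) :=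
    fun _ _ => rfl
  let S : SubOperad (hat P) :=
    { carrier := fun n p => LinearMap.ker
        (mark P ∘ₗ (hatDeriv δ).app (n := n) (p := p) rfl - B rfl ∘ₗ mark P)
      act_mem := by
        intro n p σ x hx
        simp only [LinearMap.mem_ker, LinearMap.sub_apply, LinearMap.comp_apply, sub_eq_zero] at hx ⊢
        rw [(hatDeriv δ).map_act, mark_act, mark_act, hx]
        generalize mark P x = X
        induction X using markBimod.induction with | h X
        rw [hB, markBimod.act_mk, markBimod.act_mk, hB, Fam.deriv_act]
      comp_mem := by
        intro m n r p q t hr ht i x y hx hy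
        simp only [LinearMap.mem_ker, LinearMap.sub_apply, LinearMap.comp_apply, sub_eq_zero] at hx hy ⊢
        rw [(hatDeriv δ).map_comp_id hr ht rfl rfl rfl (by omega) (by omega), map_add, map_sgn, mark_comp,
          mark_comp, mark_comp, hx, hy]
        generalize mark P x = X
        generalize mark P y = Y
        induction X using markBimod.induction with | h X
        induction Y using markBimod.induction with | h Y
        rw [hB, hB, map_add, markBimod.rcomp_mk hr ht, markBimod.lcomp_mk hr ht, hB, hB,
          Fam.deriv_lcomp (hatDeriv δ) hr ht rfl rfl rfl (by omega) (by omega),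
          Fam.deriv_rcomp (hatDeriv δ) hr ht rfl rfl rfl (by omega) (by omega), map_add, map_add,
          map_sgn, map_sgn, smul_add]
        simp only [← markBimod.rcomp_mk, ← markBimod.lcomp_mk]
        abel }
  have key : ∀ {n : ℕ} {p : ℤ} {w : ℕ} (x : CoprodV P n p w),
      mark P ((hatDeriv δ).app rfl (hat.single P w x)) = B rfl (mark P (hat.single P w x)) := by
    intro n p w x
    have := hat.single_mem S (fun n p x => ?_) ?_ x
    · simpa only [S, LinearMap.mem_ker, LinearMap.sub_apply, LinearMap.comp_apply, sub_eq_zero] using this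
    · simp only [S, LinearMap.mem_ker, LinearMap.sub_apply, LinearMap.comp_apply, sub_eq_zero]
      rw [hatDeriv_of, mark_of, mark_of, map_zero]
    · simp only [S, LinearMap.mem_ker, LinearMap.sub_apply, LinearMap.comp_apply, sub_eq_zero]
      rw [hatDeriv_alpha, map_zero, mark_alpha, hB, Fam.deriv_unit, map_zero]
  subst h
  refine (markBimod.grading P).eq_of_pi fun w => ?_
  change markBimod.pi P w _ = markBimod.pi P w (B rfl _)
  have hpi : ∀ (X : (markBimod (hat P)).V n p),
      markBimod.pi P w (B rfl X) = B rfl (markBimod.pi P w X) := by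
    intro X
    induction X using markBimod.induction with | h X
    rw [hB, markBimod.pi_mk, markBimod.pi_mk, hB]
    congr 1
    induction X using Fam.induction with
    | h j y => rw [Fam.deriv_sing, Fam.pi_sing, Fam.pi_sing, Fam.deriv_sing, pi_hatDeriv]
    | h₀ r =>
      rw [Fam.deriv_unit, map_zero, Fam.pi_unit]
      split_ifs
      · rw [Fam.deriv_unit]
      · rw [map_zero]
    | ha Y Y' hY hY' => simp only [map_add, hY, hY']
  rw [pi_mark, pi_hatDeriv, hat.pi_apply, key, hpi, hpi, pi_mark x, hat.pi_apply]

/-- The derivation in the direction of an element commutes with termwise derivations. -/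
theorem dsub_hatDeriv {P T : GrOperad k s} {e : ℤ} (δ : Deriv (GrHom.id P) e) (f : GrHom (hat P) T)
    (D : Deriv (GrHom.id T) e) (hD : ∀ {n : ℕ} {p q : ℤ} (h : q = p + e) (x : (hat P).V n p),
      D.app h (f.app x) = f.app ((hatDeriv δ).app h x))
    {e' e'' : ℤ} (b : T.V 0 e') (he : e'' = e' + e) (hb : D.app he b = 0) {n : ℕ} {p q t p' : ℤ}
    (h : q = p + e') (ht : t = q + e) (hp : p' = p + e) (x : (hat P).V n p) :
    D.app ht ((dsub f b).app h x)
      = (e * e').negOnePow • (dsub f b).app (by omega) ((hatDeriv δ).app hp x) := by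
  rw [dsub_app, dsub_app, mark_hatDeriv, map_sgn]
  generalize mark P x = X
  induction X using markBimod.induction with | h X
  change _ • D.app ht (Fam.ins f b h X) = _ • _ • Fam.ins f b _ (Fam.deriv (hatDeriv δ) hp X)
  rw [Fam.app_ins (hatDeriv δ) f D hD b he h hp ht, hb, Fam.ins_zero, smul_zero, add_zero,
    sgn_smul_sgn_smul (c := e' * p) (e' * e) _ (by subst hp; ring)]

/-! ### The second derivative -/

section second

variable {R T : GrOperad k s}

/-- Insertion of two operations of arity zero in two marked inputs. -/
def ins₂ (f : GrHom R T) {e e' : ℤ} (b : T.V 0 e) (c : T.V 0 e') {n : ℕ} {p q t : ℤ}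
    (hq : q = p + e) (ht : t = q + e') : (Fin (n + 1) → (markBimod R).V (n + 1) p) →ₗ[k] T.V n t :=
  ∑ j, (T.comp (n := 0) (r := n) rfl ht j).flip c ∘ₗ markBimod.ins f b hq ∘ₗ LinearMap.proj j

theorem ins₂_apply (f : GrHom R T) {e e' : ℤ} (b : T.V 0 e) (c : T.V 0 e') {n : ℕ} {p q t : ℤ}
    (hq : q = p + e) (ht : t = q + e') (V : Fin (n + 1) → (markBimod R).V (n + 1) p) :
    ins₂ f b c hq ht V
      = ∑ j, T.comp (n := 0) (r := n) rfl ht j (markBimod.ins f b hq (V j)) c := by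
  simp [ins₂]

/-- Exchange of two marked inputs. -/
def swapIdx {n : ℕ} (a : Fin (n + 1) × Fin (n + 1 + 1)) : Fin (n + 1) × Fin (n + 1 + 1) :=
  (⟨outerSlot (a.2.succAbove a.1) 0 a.2, outerSlot_lt (m := n + 2) (n := 0) rfl
    (a.2.succAbove a.1).2 a.2.2 (fun h => Fin.succAbove_ne a.2 a.1 (Fin.ext h.symm))⟩,
    a.2.succAbove a.1)

theorem swapIdx_involutive {n : ℕ} : Function.Involutive (swapIdx (n := n)) := by
  rintro ⟨j, i⟩
  have h := val_succAbove i j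
  refine Prod.ext (Fin.ext ?_) (Fin.ext ?_)
  all_goals
    simp only [swapIdx, val_succAbove, outerSlot]
    split_ifs <;> omega

/-- Exchange of the two marked inputs in a family. -/
def swapMarks (R : GrOperad k s) {n : ℕ} {p : ℤ} :
    (Fin (n + 1) → (markBimod R).V (n + 1) p) →ₗ[k] (Fin (n + 1) → (markBimod R).V (n + 1) p) where
  toFun V j := markBimod.mk R (fun i => (markBimod.nf R (V (swapIdx (j, i)).1)).1 (swapIdx (j, i)).2, 0)
  map_add' V V' := funext fun j => by
    simp only [Pi.add_apply]
    rw [← map_add]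
    congr 1
    refine Prod.ext (funext fun i => ?_) (add_zero _).symm
    simp only [map_add]
    rfl
  map_smul' a V := funext fun j => by
    simp only [Pi.smul_apply, RingHom.id_apply]
    rw [← map_smul]
    congr 1
    refine Prod.ext (funext fun i => ?_) (smul_zero _).symm
    simp only [map_smul]
    rfl

theorem ins₂_eq (f : GrHom R T) {e e' : ℤ} (b : T.V 0 e) (c : T.V 0 e') {n : ℕ} {p q t : ℤ}
    (hq : q = p + e) (ht : t = q + e') (W : Fin (n + 1) → Fam R (n + 1) p) :
    ins₂ f b c hq ht (fun j => markBimod.mk R (W j))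
      = ∑ a : Fin (n + 1) × Fin (n + 1 + 1), T.comp (n := 0) (r := n) rfl ht a.1
          (T.comp (n := 0) (r := n + 1) rfl hq a.2 (f.app ((W a.1).1 a.2)) b) c := by
  rw [ins₂_apply, Fintype.sum_prod_type]
  refine Finset.sum_congr rfl fun j _ => ?_
  rw [markBimod.ins_mk, Fam.ins_apply, T.castL_of_ne (by omega), smul_zero, add_zero, map_sum,
    LinearMap.sum_apply]

theorem ins₂_swapMarks (f : GrHom R T) {e e' : ℤ} (b : T.V 0 e) (c : T.V 0 e') {n : ℕ}
    {p q t q' : ℤ} (hq : q = p + e) (ht : t = q + e') (hq' : q' = p + e') (ht' : t = q' + e)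
    (V : Fin (n + 1) → (markBimod R).V (n + 1) p) :
    ins₂ f b c hq ht (swapMarks R V) = (e * e').negOnePow • ins₂ f c b hq' ht' V := by
  have hV : V = fun j => markBimod.mk R (markBimod.nf R (V j)) :=
    funext fun j => (markBimod.mk_nf _).symm
  conv_rhs => rw [hV]
  rw [ins₂_eq, ← Equiv.sum_comp swapIdx_involutive.toPerm, Finset.smul_sum]
  refine (ins₂_eq f b c hq ht _).trans (Finset.sum_congr rfl fun a _ => ?_)
  obtain ⟨j, i⟩ := a
  exact T.comp_outer (l := n + 2) (m := 0) (n := 0) (a := n + 1) (b := n + 1) (r := n) rfl rfl rfl rfl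
    hq hq' ht ht' i (i.succAbove j) j _ (Fin.succAbove_ne i j) (by
      rw [outerSlot, val_succAbove]
      split_ifs <;> omega) rfl _ _ _

/-- Families with two marked inputs that are equivalent to zero. -/
def Null₂ : {s : Flavour} → (R : GrOperad k s) → {n : ℕ} → {p : ℤ} →
    (Fin (n + 1) → (markBimod R).V (n + 1) p) → Prop
  | .symmetric, R, _, _, V =>
    ∑ j, (markBimod R).act ⟨insPerm j 0 1, Subgroup.mem_top _⟩ (V j) = 0
  | .nonsymmetric, _, _, _, V => V = 0

theorem Fam.sing_eq_zero {n : ℕ} {p : ℤ} {j : Fin (n + 1)} {y : R.V (n + 1) p}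
    (h : sing j y = 0) : y = 0 := by
  have := congrFun (congrArg Prod.fst h) j
  simpa [sing] using this

theorem null₂_of {n : ℕ} {p : ℤ} {V : Fin (n + 1) → (markBimod R).V (n + 1) p}
    (h : ∀ (T : GrOperad k s) (f : GrHom R T) (b c : T.V 0 0),
      ins₂ f b c (add_zero p).symm (add_zero p).symm V = 0) : Null₂ R V := by
  let S := sqZero R (markBimod R)
  let b : S.V 0 0 := sqZeroInr R (markBimod R) (markBimod.mk R (Fam.unit 1))
  let F : Fin (n + 1) → S.V (n + 1) p := fun j => sqZeroInr R (markBimod R) (V j)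
  have key : Fam.norm S (F, 0) = 0 := by
    have := h (sqZero S (markBimod S)) ((sqZeroInl R (markBimod R)).trans (sqZeroInl S (markBimod S)))
      ((sqZeroInl S (markBimod S)).app b) (sqZeroInr S (markBimod S) (markBimod.mk S (Fam.unit 1)))
    rw [ins₂_apply] at this
    have e₁ : ∀ j, markBimod.ins ((sqZeroInl R (markBimod R)).trans (sqZeroInl S (markBimod S)))
        ((sqZeroInl S (markBimod S)).app b) (add_zero p).symm (V j)
        = (sqZeroInl S (markBimod S)).app (F j) := by
      intro j
      obtain ⟨Y, hY⟩ : ∃ Y, V j = markBimod.mk R Y := ⟨_, (markBimod.mk_nf (V j)).symm⟩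
      simp only [F]
      rw [hY, markBimod.ins_mk, ← Fam.map_ins]
      congr 1
      exact markBimod.ins_sqZero _ Y
    simp only [e₁] at this
    have e₂ := Fam.ins_apply (sqZeroInl S (markBimod S))
      (sqZeroInr S (markBimod S) (markBimod.mk S (Fam.unit 1))) (add_zero p).symm (F, (0 : k))
    have e₃ := (markBimod.ins_sqZero (add_zero p).symm (F, (0 : k))).symm.trans (e₂.trans
      ((congrArg₂ (· + ·) this (zero_smul k _)).trans (add_zero _)))
    exact markBimod.mk_eq_zero.1 (congrArg Prod.snd e₃)
  rw [Fam.eq_sum (F, (0 : k)), map_add, Fam.norm_unit, map_sum] at key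
  have h0 : (if n = 0 ∧ p = 0 then Fam.unit ((F, (0 : k)) : Fam S n p).2 else (0 : Fam S n p)) = 0 := by
    split_ifs <;> rfl
  rw [h0, add_zero] at key
  cases s
  · simp only [Fam.norm_sing_symm] at key
    rw [← map_sum] at key
    have := Fam.sing_eq_zero key
    change ∑ j, (markBimod R).act ⟨insPerm j 0 1, Subgroup.mem_top _⟩ (V j) = 0
    have e₃ := congrArg (LinearMap.snd k (R.V (n + 1) p) ((markBimod R).V (n + 1) p)) this
    exact (map_sum (LinearMap.snd k (R.V (n + 1) p) ((markBimod R).V (n + 1) p)) _ _).symm.trans e₃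
  · simp only [Fam.norm_sing_nonsymm] at key
    have e₄ : ∑ j, Fam.sing j (F j) = ((F, (0 : k)) : Fam S n p) := by
      conv_rhs => rw [Fam.eq_sum (F, (0 : k))]
      exact (add_zero _).symm
    rw [e₄] at key
    refine funext fun j => ?_
    exact congrArg Prod.snd (congrFun (congrArg Prod.fst key) j)

theorem Null₂.ins₂ {n : ℕ} {p : ℤ} {V : Fin (n + 1) → (markBimod R).V (n + 1) p} (h : Null₂ R V)
    (f : GrHom R T) {e e' : ℤ} (b : T.V 0 e) (c : T.V 0 e') {q t : ℤ} (hq : q = p + e)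
    (ht : t = q + e') : ins₂ f b c hq ht V = 0 := by
  cases s
  · rw [ins₂_apply]
    have h' := congrArg (fun y => T.comp (n := 0) (r := n) rfl ht 0 (markBimod.ins f b hq y) c) h
    simp only [map_zero, LinearMap.zero_apply, map_sum, LinearMap.sum_apply] at h'
    rw [← h']
    refine Finset.sum_congr rfl fun j _ => ?_
    have := T.comp_act (m := n + 1) (n := 0) (r := n) rfl ht j ⟨insPerm j 0 1, Subgroup.mem_top _⟩ 1 1
      (isMark_insPerm j 0 1) (markBimod.ins f b hq (V j)) c
    rw [markBimod.ins_act]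
    simpa using this
  · obtain rfl : V = 0 := h
    rw [map_zero]

theorem null₂_of_pi {P : GrOperad k s} {n : ℕ} {p : ℤ}
    {V : Fin (n + 1) → (markBimod (hat P)).V (n + 1) p}
    (h : ∀ w, Null₂ (hat P) (fun j => markBimod.pi P w (V j))) : Null₂ (hat P) V := by
  cases s
  · refine (markBimod.grading P).sep _ fun w => ?_
    rw [map_sum, ← h w]
    exact Finset.sum_congr rfl fun j _ => (markBimod.grading P).pi_act w _ _
  · exact funext fun j => (markBimod.grading P).sep _ fun w => congrFun (h w) j

/-- The second derivative of a series. -/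
def mark₂ (P : GrOperad k s) {n : ℕ} {p : ℤ} :
    (hat P).V n p →ₗ[k] (Fin (n + 1) → (markBimod (hat P)).V (n + 1) p) :=
  LinearMap.pi fun j => mark P ∘ₗ LinearMap.proj j ∘ₗ
    LinearMap.fst k (Fin (n + 1) → (hat P).V (n + 1) p) k ∘ₗ markBimod.nf (hat P) ∘ₗ mark P

theorem mark₂_apply {P : GrOperad k s} {n : ℕ} {p : ℤ} (x : (hat P).V n p) (j : Fin (n + 1)) :
    mark₂ P x j = mark P ((markBimod.nf (hat P) (mark P x)).1 j) := rfl

theorem pi_mark₂ {P : GrOperad k s} {n : ℕ} {p : ℤ} (x : (hat P).V n p) (j : Fin (n + 1)) (w : ℕ) :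
    markBimod.pi P w (mark₂ P x j) = markBimod.pi P w (mark₂ P (hat.pi P (w + 1 + 1) x) j) := by
  rw [mark₂_apply, mark₂_apply, pi_mark, ← Fam.pi_fst, ← markBimod.nf_pi, pi_mark x,
    markBimod.nf_pi, Fam.pi_fst, ← pi_mark]

/-- The second component of an element of the dual numbers. -/
def dualSnd (T : GrOperad k s) (e : ℤ) {n : ℕ} {p : ℤ} : (dual T e).V n p →ₗ[k] T.V n (p + e) :=
  LinearMap.snd k (T.V n p) (T.V n (p + e))

theorem dualSnd_inl {e : ℤ} {n : ℕ} {p : ℤ} (x : T.V n p) :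
    dualSnd T e ((sqZeroInl T (shiftBimod T e)).app x) = 0 := rfl

section dualNumbers

variable {P : GrOperad k s} (f : GrHom (hat P) T) (b c : T.V 0 0)

/-- The second derivative in two directions. -/
def dsub₂ {n : ℕ} {p : ℤ} : (hat P).V n p →ₗ[k] T.V n (p + 0 + 0) :=
  LinearMap.snd k (T.V n (p + 0)) (T.V n (p + 0 + 0)) ∘ₗ
    (dsub (T := dual T 0) (dsub f b).toDual (e := 0) ((sqZeroInl T (shiftBimod T 0)).app c)).app (p := p) rfl

theorem dsub_toDual_fst {n : ℕ} {p : ℤ} (x : (hat P).V n p) :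
    ((dsub (T := dual T 0) (dsub f b).toDual (e := 0) ((sqZeroInl T (shiftBimod T 0)).app c)).app (p := p) rfl x).1
      = (dsub f c).app rfl x := by
  refine (congrArg Prod.fst (dsub_app _ _ _ x)).trans ?_
  rw [dsub_app]
  refine (map_sgn (sqZeroFst T (shiftBimod T 0)).app _ _).trans (congrArg _ ?_)
  generalize mark P x = X
  induction X using markBimod.induction with | h X
  exact Fam.map_ins _ (sqZeroFst T (shiftBimod T 0)) _ _ X

theorem dsub₂_comp {m n r : ℕ} {p q t : ℤ} (hr : r + 1 = m + n) (ht : t = p + q) (i : Fin m)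
    (x : (hat P).V m p) (y : (hat P).V n q) : dsub₂ f b c ((hat P).comp hr ht i x y)
      = T.comp hr (by omega) i (dsub₂ f b c x) (f.app y)
        + T.comp hr (by omega) i ((dsub f c).app rfl x) ((dsub f b).app rfl y)
        + T.comp hr (by omega) i ((dsub f b).app rfl x) ((dsub f c).app rfl y)
        + T.comp hr (by omega) i (f.app x) (dsub₂ f b c y) := by
  have := (dsub (T := dual T 0) (dsub f b).toDual (e := 0) ((sqZeroInl T (shiftBimod T 0)).app c)).map_comp hr ht rfl rfl rfl
    (by omega) (by omega) i x y
  refine (congrArg Prod.snd this).trans ?_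
  have h0 : ∀ a : ℤ, (0 * a).negOnePow = 1 := fun a => by simp
  rw [h0, one_smul]
  change ((shiftBimod T 0).rcomp hr _ i (dsub₂ f b c x) (f.app y)
      + (shiftBimod T 0).lcomp hr _ i
        ((dsub (T := dual T 0) (dsub f b).toDual (e := 0) ((sqZeroInl T (shiftBimod T 0)).app c)).app rfl x).1 ((dsub f b).app rfl y))
    + ((shiftBimod T 0).rcomp hr _ i ((dsub f b).app rfl x)
        ((dsub (T := dual T 0) (dsub f b).toDual (e := 0) ((sqZeroInl T (shiftBimod T 0)).app c)).app rfl y).1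
      + (shiftBimod T 0).lcomp hr _ i (f.app x) (dsub₂ f b c y)) = _
  rw [dsub_toDual_fst, dsub_toDual_fst]
  change (T.comp hr _ i (dsub₂ f b c x) (f.app y)
      + (0 * (p + 0)).negOnePow • T.comp hr _ i ((dsub f c).app rfl x) ((dsub f b).app rfl y))
    + (T.comp hr _ i ((dsub f b).app rfl x) ((dsub f c).app rfl y)
      + (0 * p).negOnePow • T.comp hr _ i (f.app x) (dsub₂ f b c y)) = _
  rw [h0, h0, one_smul, one_smul]
  abel

theorem dsub₂_eq {n : ℕ} {p : ℤ} (x : (hat P).V n p) :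
    dsub₂ f b c x = ins₂ f b c rfl rfl (mark₂ P x) := by
  have h0 : ∀ a : ℤ, (0 * a).negOnePow = 1 := fun a => by simp
  rw [ins₂_apply]
  have e₀ : dsub₂ f b c x = dualSnd T 0 ((dsub (T := dual T 0) (dsub f b).toDual (e := 0)
    ((sqZeroInl T (shiftBimod T 0)).app c)).app (p := p) rfl x) := rfl
  rw [e₀, dsub_app, h0, one_smul, ← markBimod.mk_nf (mark P x), markBimod.ins_mk, Fam.ins_apply,
    map_add, map_smul, map_sum, ← GrHom.map_castL, dualSnd_inl, smul_zero]
  refine (add_zero _).trans (Finset.sum_congr rfl fun j _ => ?_)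
  rw [mark₂_apply]
  have e₁ : (dsub f b).app rfl ((markBimod.nf (hat P) (mark P x)).1 j)
      = markBimod.ins f b rfl (mark P ((markBimod.nf (hat P) (mark P x)).1 j)) := by
    rw [dsub_app, h0, one_smul]
  rw [← e₁]
  exact (congrArg (T.comp (n := 0) (r := n) rfl rfl j ((dsub f b).app rfl
    ((markBimod.nf (hat P) (mark P x)).1 j)) c + ·) (map_zero ((shiftBimod T 0).lcomp (n := 0) (r := n)
      rfl rfl j (f.app ((markBimod.nf (hat P) (mark P x)).1 j))))).trans (add_zero _)

theorem dsub₂_single {n : ℕ} {p : ℤ} {w : ℕ} (x : CoprodV P n p w) :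
    dsub₂ f b c (hat.single P w x) = dsub₂ f c b (hat.single P w x) := by
  let S : SubOperad (hat P) :=
    { carrier := fun n p => LinearMap.ker (dsub₂ f b c (n := n) (p := p) - dsub₂ f c b)
      act_mem := by
        intro n p σ x hx
        simp only [LinearMap.mem_ker, LinearMap.sub_apply, sub_eq_zero] at hx ⊢
        have e₁ : ∀ b c : T.V 0 0, dsub₂ f b c ((hat P).act σ x) = T.act σ (dsub₂ f b c x) :=
          fun b c => congrArg Prod.snd ((dsub (T := dual T 0) (dsub f b).toDual (e := 0) ((sqZeroInl T (shiftBimod T 0)).app c)).map_act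
            rfl σ x)
        rw [e₁, e₁, hx]
      comp_mem := by
        intro m n r p q t hr ht i x y hx hy
        simp only [LinearMap.mem_ker, LinearMap.sub_apply, sub_eq_zero] at hx hy ⊢
        rw [dsub₂_comp, dsub₂_comp, hx, hy]
        abel }
  have := hat.single_mem S (fun n p x => ?_) ?_ x
  · simpa only [S, LinearMap.mem_ker, LinearMap.sub_apply, sub_eq_zero] using this
  · have e₁ : ∀ b c : T.V 0 0, dsub₂ f b c (hatOf x) = 0 :=
      fun b c => congrArg Prod.snd (dsub_of (T := dual T 0) (dsub f b).toDual (e := 0) ((sqZeroInl T (shiftBimod T 0)).app c) rfl x)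
    simp only [S, LinearMap.mem_ker, LinearMap.sub_apply, e₁, sub_zero]
  · have e₁ : ∀ b c : T.V 0 0, dsub₂ f b c (hatAlpha P) = 0 :=
      fun b c => congrArg Prod.snd (dsub_alpha (T := dual T 0) (dsub f b).toDual (e := 0) ((sqZeroInl T (shiftBimod T 0)).app c) rfl)
    simp only [S, LinearMap.mem_ker, LinearMap.sub_apply, e₁, sub_zero]

end dualNumbers

/-- The symmetry of the second derivative. -/
theorem null₂_mark₂_sub {P : GrOperad k s} {n : ℕ} {p : ℤ} (x : (hat P).V n p) :
    Null₂ (hat P) (mark₂ P x - swapMarks (hat P) (mark₂ P x)) := by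
  have key : ∀ {w : ℕ} (x : CoprodV P n p w),
      Null₂ (hat P) (mark₂ P (hat.single P w x) - swapMarks (hat P) (mark₂ P (hat.single P w x))) := by
    intro w x
    refine null₂_of fun T f b c => ?_
    have e₁ : ∀ (V : Fin (n + 1) → (markBimod (hat P)).V (n + 1) p) (q t : ℤ) (hq : q = p + 0)
        (ht : t = q + 0), ins₂ f b c hq ht V = 0 → ins₂ f b c (add_zero p).symm (add_zero p).symm V = 0 := by
      intro V q t hq ht h
      obtain rfl : p = q := by omega
      obtain rfl : p = t := by omega
      exact h
    refine e₁ _ _ _ rfl rfl ?_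
    rw [map_sub, ins₂_swapMarks f b c rfl rfl rfl rfl, ← dsub₂_eq, ← dsub₂_eq, dsub₂_single]
    simp
  refine null₂_of_pi fun w => ?_
  have hsw : ∀ (V : Fin (n + 1) → (markBimod (hat P)).V (n + 1) p) (j : Fin (n + 1)),
      markBimod.pi P w (swapMarks (hat P) V j)
        = swapMarks (hat P) (fun j => markBimod.pi P w (V j)) j := by
    intro V j
    refine (markBimod.pi_mk w _).trans (congrArg (markBimod.mk (hat P)) ?_)
    refine Prod.ext (funext fun i => ?_) ?_
    · rw [Fam.pi_fst]
      exact (congrArg (fun Y : Fam (hat P) (n + 1) p => Y.1 (swapIdx (j, i)).2) (markBimod.nf_pi w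
        (V (swapIdx (j, i)).1))).symm
    · simp [Fam.pi]
  have hx := key (hat.coeff P (w + 1 + 1) x)
  rw [← hat.pi_apply] at hx
  have e₂ : ∀ j, markBimod.pi P w ((mark₂ P x - swapMarks (hat P) (mark₂ P x)) j)
      = markBimod.pi P w ((mark₂ P (hat.pi P (w + 1 + 1) x)
        - swapMarks (hat P) (mark₂ P (hat.pi P (w + 1 + 1) x))) j) := by
    intro j
    simp only [Pi.sub_apply, map_sub, hsw]
    simp only [← pi_mark₂]
  simp only [e₂]
  cases s
  · have := congrArg (markBimod.pi P w) hx
    rw [map_zero, map_sum] at this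
    refine Eq.trans (Finset.sum_congr rfl fun j _ => ?_) this
    exact ((markBimod.grading P).pi_act w _ _).symm
  · refine funext fun j => ?_
    have := congrArg (markBimod.pi P w) (congrFun hx j)
    exact this.trans (map_zero _)

/-- The square of the derivation in the direction of an odd element vanishes. -/
theorem dsub_dsub [CharZero k] {P : GrOperad k s} (f : GrHom (hat P) T) (u : T.V 0 (-1))
    (D : Deriv (GrHom.id T) (-1)) (hD : ∀ {n : ℕ} {p q : ℤ} (h : q = p + -1) (x : (hat P).V n p),
      D.app h (f.app x) = (dsub f u).app h x) (hu : D.app (q := -2) rfl u = 0)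
    {n : ℕ} {p q t : ℤ} (hq : q = p + -1) (ht : t = q + -1) (x : (hat P).V n p) :
    D.app ht ((dsub f u).app hq x) = 0 := by
  have key : ins₂ f u u hq ht (mark₂ P x) = 0 := by
    have h₁ := (null₂_mark₂_sub x).ins₂ f u u hq ht
    rw [map_sub, ins₂_swapMarks f u u hq ht hq ht, show ((-1 : ℤ) * -1).negOnePow = -1 by decide,
      Units.neg_smul, one_smul, sub_neg_eq_add, ← two_smul k] at h₁
    exact (smul_eq_zero.1 h₁).resolve_left two_ne_zero
  rw [dsub_app, map_sgn, ← markBimod.mk_nf (mark P x), markBimod.ins_mk, Fam.ins_apply, map_add,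
    map_smul, Fam.app_castL D (show (-2 : ℤ) = -1 + -1 from rfl), hu, map_zero, smul_zero, add_zero,
    map_sum]
  have e₁ : ∀ j : Fin (n + 1), D.app ht (T.comp (n := 0) (r := n) rfl hq j
        (f.app ((markBimod.nf (hat P) (mark P x)).1 j)) u)
      = (-1 * p).negOnePow • T.comp (n := 0) (r := n) rfl ht j (markBimod.ins f u hq (mark₂ P x j)) u := by
    intro j
    rw [D.map_comp_id (m := n + 1) (n := 0) (r := n) rfl hq hq (show (-2 : ℤ) = -1 + -1 from rfl) ht (by omega) (by omega), hu, hD,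
      map_zero, smul_zero, add_zero, dsub_app, map_sgn, sgn_apply]
    rfl
  rw [Finset.sum_congr rfl fun j _ => e₁ j, ← Finset.smul_sum, ← ins₂_apply, key, smul_zero, smul_zero]

end second

/-! ### Quadratic expressions -/

theorem exists_insPerm {n : ℕ} (j : Fin (n + 1)) (τ : Equiv.Perm (Fin (n + 1))) :
    ∃ σ : Equiv.Perm (Fin n), τ = insPerm j (τ j) σ := by
  have h : ∀ a : Fin n, ∃ b, (τ j).succAbove b = τ (j.succAbove a) := fun a =>
    Fin.exists_succAbove_eq fun e => Fin.succAbove_ne j a (τ.injective e)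
  choose g hg using h
  have hinj : Function.Injective g := fun a b hab =>
    Fin.succAbove_right_injective (τ.injective ((hg a).symm.trans ((congrArg _ hab).trans (hg b))))
  refine ⟨Equiv.ofBijective g (Finite.injective_iff_bijective.1 hinj),
    perm_ext_succAbove j (by simp) fun a => ?_⟩
  rw [insPerm_succAbove]
  exact (hg a).symm

theorem insPerm_injective {n : ℕ} (j j' : Fin (n + 1)) : Function.Injective (insPerm j j') := by
  intro σ σ' h
  ext a
  have := congrArg (fun τ : Equiv.Perm (Fin (n + 1)) => τ (j.succAbove a)) h
  simp only [insPerm_succAbove] at this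
  rw [Fin.succAbove_right_injective this]

theorem isUnshuffle_insPerm_zero {n q : ℕ} (σ : Equiv.Perm (Fin n)) :
    IsUnshuffle (q + 1) (insPerm 0 0 σ) ↔ IsUnshuffle q σ := by
  constructor
  · intro h a b hab hq
    have := h (Fin.succAbove 0 a) (Fin.succAbove 0 b) (by simpa using hab) (by
      simp only [Fin.zero_succAbove, Fin.val_succ]
      omega)
    rw [insPerm_succAbove, insPerm_succAbove] at this
    simpa using this
  · intro h a b hab hq
    induction a using Fin.cases with
    | zero =>
      obtain ⟨b, rfl⟩ := Fin.exists_succ_eq.2 (Fin.pos_iff_ne_zero.1 hab)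
      rw [insPerm_self, ← Fin.zero_succAbove, insPerm_succAbove]
      simp
    | succ a =>
      obtain ⟨b, rfl⟩ := Fin.exists_succ_eq.2 (Fin.pos_iff_ne_zero.1 ((Fin.zero_le _).trans_lt hab))
      simp only [Fin.val_succ] at hq
      rw [← Fin.zero_succAbove, ← Fin.zero_succAbove, insPerm_succAbove, insPerm_succAbove]
      simpa using h a b (by simpa using hab) (by omega)

theorem isUnshuffle_insPerm_self {n q : ℕ} (hq : q < n + 1) (σ : Equiv.Perm (Fin n)) :
    IsUnshuffle q (insPerm ⟨q, hq⟩ 0 σ) ↔ IsUnshuffle q σ := by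
  have hval := val_succAbove (⟨q, hq⟩ : Fin (n + 1))
  constructor
  · intro h a b hab hq'
    have := h (Fin.succAbove ⟨q, hq⟩ a) (Fin.succAbove ⟨q, hq⟩ b)
      (Fin.succAbove_lt_succAbove_iff.2 hab) (by
        rw [hval, hval]
        have := Fin.lt_def.1 hab
        simp only
        split_ifs <;> omega)
    simpa using this
  · intro h a b hab hq'
    rcases Fin.eq_self_or_eq_succAbove ⟨q, hq⟩ a with rfl | ⟨a, rfl⟩
    · rcases Fin.eq_self_or_eq_succAbove ⟨q, hq⟩ b with rfl | ⟨b, rfl⟩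
      · exact absurd hab (lt_irrefl _)
      · rw [insPerm_self, insPerm_succAbove]
        simp
    · rcases Fin.eq_self_or_eq_succAbove ⟨q, hq⟩ b with rfl | ⟨b, rfl⟩
      · rw [Fin.lt_def, hval] at hab
        rw [hval] at hq'
        simp only at hab hq'
        split_ifs at hab hq' <;> omega
      · rw [insPerm_succAbove, insPerm_succAbove]
        refine Fin.succAbove_lt_succAbove_iff.2 (h a b (Fin.succAbove_lt_succAbove_iff.1 hab) ?_)
        rw [hval, hval] at hq'
        simp only at hq'
        split_ifs at hq' <;> omega

open scoped Classical in
/-- The unshuffles of the first `q` elements. -/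
def unsh (n q : ℕ) : Finset (Equiv.Perm (Fin n)) :=
  Finset.univ.filter fun σ => IsUnshuffle q σ

theorem mem_unsh {n q : ℕ} {σ : Equiv.Perm (Fin n)} : σ ∈ unsh n q ↔ IsUnshuffle q σ := by
  simp [unsh]

theorem isUnshuffle_symm_zero {n q : ℕ} {σ : Equiv.Perm (Fin (n + 1))} (h : IsUnshuffle q σ)
    (h' : ¬ (1 ≤ q ∧ σ 0 = 0)) (hq : q ≤ n + 1) : ∃ hq : q < n + 1, σ ⟨q, hq⟩ = 0 := by
  obtain ⟨a, ha⟩ := σ.surjective 0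
  have h₁ : ¬ ((a : ℕ) < q) := by
    intro haq
    by_cases ha0 : a = 0
    · subst ha0
      exact h' ⟨by omega, ha⟩
    · have := h 0 a (Fin.pos_iff_ne_zero.2 ha0) (Or.inl haq)
      rw [ha] at this
      exact absurd this (Fin.not_lt_zero _)
  refine ⟨by have := a.2; omega, ?_⟩
  by_contra hne
  have h₂ : (a : ℕ) ≠ q := by
    rintro rfl
    exact hne ha
  have := h ⟨q, by have := a.2; omega⟩ a (Fin.lt_def.2 (by simp only; omega)) (Or.inr le_rfl)
  rw [ha] at this
  exact absurd this (Fin.not_lt_zero _)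

theorem sum_unsh {A : Type*} [AddCommMonoid A] {n q : ℕ} (hq : q ≤ n + 1)
    (F : Equiv.Perm (Fin (n + 1)) → A) : ∑ σ ∈ unsh (n + 1) q, F σ
      = (if 1 ≤ q then ∑ σ ∈ unsh n (q - 1), F (insPerm 0 0 σ) else 0)
        + if h : q < n + 1 then ∑ σ ∈ unsh n q, F (insPerm ⟨q, h⟩ 0 σ) else 0 := by
  classical
  rw [← Finset.sum_filter_add_sum_filter_not _ (fun σ => 1 ≤ q ∧ σ 0 = 0)]
  congr 1
  · split_ifs with h
    · symm
      refine Finset.sum_bij (fun σ _ => insPerm 0 0 σ) ?_ ?_ ?_ (fun _ _ => rfl)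
      · intro σ hσ
        rw [mem_unsh] at hσ
        rw [Finset.mem_filter, mem_unsh]
        obtain ⟨q, rfl⟩ := Nat.exists_eq_add_of_le' h
        exact ⟨(isUnshuffle_insPerm_zero σ).2 hσ, h, insPerm_self _ _ _⟩
      · intro σ _ σ' _ e
        exact insPerm_injective 0 0 e
      · intro τ hτ
        rw [Finset.mem_filter, mem_unsh] at hτ
        obtain ⟨σ, hσ⟩ := exists_insPerm 0 τ
        rw [hτ.2.2] at hσ
        refine ⟨σ, ?_, hσ.symm⟩
        obtain ⟨q, rfl⟩ := Nat.exists_eq_add_of_le' h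
        rw [mem_unsh]
        exact (isUnshuffle_insPerm_zero σ).1 (hσ ▸ hτ.1)
    · refine Finset.sum_eq_zero fun σ hσ => ?_
      rw [Finset.mem_filter] at hσ
      exact absurd hσ.2.1 h
  · split_ifs with h
    · symm
      refine Finset.sum_bij (fun σ _ => insPerm ⟨q, h⟩ 0 σ) ?_ ?_ ?_ (fun _ _ => rfl)
      · intro σ hσ
        rw [mem_unsh] at hσ
        rw [Finset.mem_filter, mem_unsh]
        refine ⟨(isUnshuffle_insPerm_self h σ).2 hσ, fun h' => ?_⟩
        have e := insPerm_self ⟨q, h⟩ 0 σ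
        have := (insPerm ⟨q, h⟩ 0 σ).injective (h'.2.trans e.symm)
        have h0 := congrArg Fin.val this
        simp only [Fin.val_zero] at h0
        omega
      · intro σ _ σ' _ e
        exact insPerm_injective _ _ e
      · intro τ hτ
        rw [Finset.mem_filter, mem_unsh] at hτ
        obtain ⟨_, e⟩ := isUnshuffle_symm_zero hτ.1 hτ.2 hq
        obtain ⟨σ, hσ⟩ := exists_insPerm ⟨q, h⟩ τ
        rw [e] at hσ
        refine ⟨σ, ?_, hσ.symm⟩
        rw [mem_unsh]
        exact (isUnshuffle_insPerm_self h σ).1 (hσ ▸ hτ.1)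
    · refine Finset.sum_eq_zero fun σ hσ => ?_
      rw [Finset.mem_filter, mem_unsh] at hσ
      exact absurd (isUnshuffle_symm_zero hσ.1 hσ.2 hq).choose h

theorem isUnshuffle_one_iff {n q : ℕ} (h : q = 0 ∨ n ≤ q) {σ : Equiv.Perm (Fin n)} :
    IsUnshuffle q σ ↔ σ = 1 := by
  constructor
  · intro hσ
    have hm : StrictMono σ := fun a b hab => hσ a b hab (by omega)
    have := Subsingleton.elim (hm.orderIsoOfSurjective σ σ.surjective) (OrderIso.refl (Fin n))
    ext a
    exact congrArg (fun f : Fin n ≃o Fin n => ((f a : Fin n) : ℕ)) this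
  · rintro rfl a b hab _
    exact hab

theorem unsh_one {n q : ℕ} (h : q = 0 ∨ n ≤ q) : unsh n q = {1} := by
  ext σ
  rw [mem_unsh, isUnshuffle_one_iff h, Finset.mem_singleton]

section quad

variable (T : GrOperad k s)

/-- The part of the quadratic expression with inner operations of arity `q`. -/
def quadTerm : {s : Flavour} → (T : GrOperad k s) → {e e' t : ℤ} → t = e + e' → {n : ℕ} → (p q : ℕ) →
    n = p + q → T.V (p + 1) e →ₗ[k] T.V q e' →ₗ[k] T.V n t
  | .symmetric, T, _, _, _, ht, n, p, q, h => ∑ σ ∈ unsh n q,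
      (T.comp (m := p + 1) (n := q) (r := n) (by omega) ht 0).compr₂ (T.act ⟨σ, Subgroup.mem_top σ⟩)
  | .nonsymmetric, T, _, _, _, ht, n, p, q, h =>
      ∑ i : Fin (p + 1), T.comp (n := q) (r := n) (by omega) ht i

/-- The bilinear expression in two families of operations whose diagonal values are `quad`. -/
def quad₂ {e e' t : ℤ} (ht : t = e + e') (ℓ : ∀ n, T.V n e) (ℓ' : ∀ n, T.V n e') (n : ℕ) : T.V n t :=
  ∑ q : Fin (n + 1), quadTerm T ht (n - q) q (by omega) (ℓ (n - q + 1)) (ℓ' q)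

theorem quad_eq (ℓ : ∀ n, T.V n (-1)) (n : ℕ) : quad T ℓ n = quad₂ T rfl ℓ ℓ n := by
  cases s
  · simp only [quad₂, quadTerm, LinearMap.sum_apply]
    rfl
  · simp only [quad₂, quadTerm, LinearMap.sum_apply]
    rfl

variable {T}

theorem quad₂_add_left {e e' t : ℤ} (ht : t = e + e') (ℓ₁ ℓ₂ : ∀ n, T.V n e) (ℓ' : ∀ n, T.V n e') (n : ℕ) :
    quad₂ T ht (ℓ₁ + ℓ₂) ℓ' n = quad₂ T ht ℓ₁ ℓ' n + quad₂ T ht ℓ₂ ℓ' n := by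
  simp only [quad₂, Pi.add_apply, map_add, LinearMap.add_apply, Finset.sum_add_distrib]

theorem quad₂_add_right {e e' t : ℤ} (ht : t = e + e') (ℓ : ∀ n, T.V n e) (ℓ₁ ℓ₂ : ∀ n, T.V n e')
    (n : ℕ) : quad₂ T ht ℓ (ℓ₁ + ℓ₂) n = quad₂ T ht ℓ ℓ₁ n + quad₂ T ht ℓ ℓ₂ n := by
  simp only [quad₂, Pi.add_apply, map_add, Finset.sum_add_distrib]

theorem quad₂_smul_left {e e' t : ℤ} (ht : t = e + e') (c : k) (ℓ : ∀ n, T.V n e) (ℓ' : ∀ n, T.V n e')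
    (n : ℕ) : quad₂ T ht (c • ℓ) ℓ' n = c • quad₂ T ht ℓ ℓ' n := by
  simp only [quad₂, Pi.smul_apply, map_smul, LinearMap.smul_apply, Finset.smul_sum]

theorem quad₂_smul_right {e e' t : ℤ} (ht : t = e + e') (c : k) (ℓ : ∀ n, T.V n e) (ℓ' : ∀ n, T.V n e')
    (n : ℕ) : quad₂ T ht ℓ (c • ℓ') n = c • quad₂ T ht ℓ ℓ' n := by
  simp only [quad₂, Pi.smul_apply, map_smul, Finset.smul_sum]

theorem GrHom.map_quadTerm {R : GrOperad k s} (f : GrHom R T) {e e' t : ℤ} (ht : t = e + e') {n p q : ℕ}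
    (h : n = p + q) (x : R.V (p + 1) e) (y : R.V q e') :
    f.app (quadTerm R ht p q h x y) = quadTerm T ht p q h (f.app x) (f.app y) := by
  cases s <;> simp [quadTerm, f.map_act, f.map_comp]

theorem GrHom.map_quad₂ {R : GrOperad k s} (f : GrHom R T) {e e' t : ℤ} (ht : t = e + e')
    (ℓ : ∀ n, R.V n e) (ℓ' : ∀ n, R.V n e') (n : ℕ) : f.app (quad₂ R ht ℓ ℓ' n)
      = quad₂ T ht (fun n => f.app (ℓ n)) (fun n => f.app (ℓ' n)) n := by
  simp only [quad₂, map_sum, f.map_quadTerm]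

theorem Deriv.map_quadTerm {ε : ℤ} (D : Deriv (GrHom.id T) ε) {e e' t e₁ e₁' t₁ : ℤ} (ht : t = e + e')
    (he : e₁ = e + ε) (he' : e₁' = e' + ε) (ht₁ : t₁ = t + ε) {n p q : ℕ} (h : n = p + q)
    (x : T.V (p + 1) e) (y : T.V q e') : D.app ht₁ (quadTerm T ht p q h x y)
      = quadTerm T (by omega) p q h (D.app he x) y
        + (ε * e).negOnePow • quadTerm T (by omega) p q h x (D.app he' y) := by
  cases s
  · simp only [quadTerm, LinearMap.sum_apply, map_sum, LinearMap.compr₂_apply, D.map_act]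
    rw [Finset.smul_sum, ← Finset.sum_add_distrib]
    refine Finset.sum_congr rfl fun σ _ => ?_
    rw [D.map_comp_id _ ht he he' ht₁ (by omega) (by omega), map_add, map_sgn]
  · simp only [quadTerm, LinearMap.sum_apply, map_sum]
    rw [Finset.smul_sum, ← Finset.sum_add_distrib]
    refine Finset.sum_congr rfl fun i _ => ?_
    rw [D.map_comp_id _ ht he he' ht₁ (by omega) (by omega)]

theorem Deriv.map_quad₂ {ε : ℤ} (D : Deriv (GrHom.id T) ε) {e e' t e₁ e₁' t₁ : ℤ} (ht : t = e + e')
    (he : e₁ = e + ε) (he' : e₁' = e' + ε) (ht₁ : t₁ = t + ε) (ℓ : ∀ n, T.V n e) (ℓ' : ∀ n, T.V n e')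
    (n : ℕ) : D.app ht₁ (quad₂ T ht ℓ ℓ' n)
      = quad₂ T (by omega) (fun n => D.app he (ℓ n)) ℓ' n
        + (ε * e).negOnePow • quad₂ T (by omega) ℓ (fun n => D.app he' (ℓ' n)) n := by
  simp only [quad₂, map_sum, D.map_quadTerm ht he he' ht₁]
  rw [Finset.smul_sum, ← Finset.sum_add_distrib]

/-! #### Insertion in families of operations -/

/-- The family whose insertions are `ℓ_{n+1}(b, -, …, -)` in the symmetric case, and the sum of all
insertions of `b` in `ℓ_{n+1}` in the nonsymmetric case. -/
def plugFam : {s : Flavour} → {R : GrOperad k s} → {p : ℤ} → (∀ n, R.V n p) → (n : ℕ) → Fam R n p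
  | .symmetric, _, _, ℓ, n => Fam.sing 0 (ℓ (n + 1))
  | .nonsymmetric, _, _, ℓ, n => (fun _ => ℓ (n + 1), 0)

/-- Insertion of an operation of arity zero in a family of operations. -/
def plug {e : ℤ} (b : T.V 0 e) {p q : ℤ} (h : q = p + e) (ℓ : ∀ n, T.V n p) (n : ℕ) : T.V n q :=
  Fam.ins (GrHom.id T) b h (plugFam ℓ n)

theorem plug_symm {T : GrOperad k .symmetric} {e : ℤ} (b : T.V 0 e) {p q : ℤ} (h : q = p + e)
    (ℓ : ∀ n, T.V n p) (n : ℕ) : plug b h ℓ n = T.comp (n := 0) (r := n) rfl h 0 (ℓ (n + 1)) b :=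
  Fam.ins_sing _ _ _ _ _

theorem plug_nonsymm {T : GrOperad k .nonsymmetric} {e : ℤ} (b : T.V 0 e) {p q : ℤ} (h : q = p + e)
    (ℓ : ∀ n, T.V n p) (n : ℕ) :
    plug b h ℓ n = ∑ j, T.comp (n := 0) (r := n) rfl h j (ℓ (n + 1)) b := by
  rw [plug, Fam.ins_apply]
  simp [plugFam, GrHom.id]

theorem map_plugFam {R : GrOperad k s} (f : GrHom R T) {p : ℤ} (ℓ : ∀ n, R.V n p) (n : ℕ) :
    Fam.map f (plugFam ℓ n) = plugFam (fun n => f.app (ℓ n)) n := by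
  cases s
  · exact Fam.map_sing f _ _
  · rfl

theorem ins_plugFam {R : GrOperad k s} (f : GrHom R T) {e : ℤ} (b : T.V 0 e) {p q : ℤ} (h : q = p + e)
    (ℓ : ∀ n, R.V n p) (n : ℕ) :
    Fam.ins f b h (plugFam ℓ n) = plug b h (fun n => f.app (ℓ n)) n := by
  rw [plug, ← map_plugFam, Fam.ins_map]
  rfl

theorem GrHom.map_plug {R : GrOperad k s} (f : GrHom R T) {e : ℤ} (b : R.V 0 e) {p q : ℤ} (h : q = p + e)
    (ℓ : ∀ n, R.V n p) (n : ℕ) : f.app (plug b h ℓ n) = plug (f.app b) h (fun n => f.app (ℓ n)) n := by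
  rw [plug, Fam.map_ins, ← ins_plugFam]
  rfl

theorem plug_smul {e : ℤ} (b : T.V 0 e) {p q : ℤ} (h : q = p + e) (c : k) (ℓ : ∀ n, T.V n p) (n : ℕ) :
    plug b h (c • ℓ) n = c • plug b h ℓ n := by
  cases s
  · simp [plug_symm]
  · simp [plug_nonsymm, Finset.smul_sum]

theorem plug_neg {e : ℤ} (b : T.V 0 e) {p q : ℤ} (h : q = p + e) (ℓ : ∀ n, T.V n p) (n : ℕ) :
    plug b h (fun n => - ℓ n) n = - plug b h ℓ n := by
  cases s
  · simp [plug_symm]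
  · simp [plug_nonsymm]

/-- Invariance of a family of operations under permutations. -/
def Invariant {p : ℤ} (ℓ : ∀ n, T.V n p) : Prop := ∀ (n : ℕ) (σ : s.perms n), T.act σ (ℓ n) = ℓ n

theorem Invariant.plug {e : ℤ} (b : T.V 0 e) {p q : ℤ} (h : q = p + e) {ℓ : ∀ n, T.V n p}
    (hℓ : Invariant ℓ) : Invariant (plug b h ℓ) := by
  intro n σ
  cases s
  · rw [plug_symm]
    have := T.comp_act (m := n + 1) (n := 0) (r := n) rfl h 0 (extP 0 σ) 1 σ (Fam.isMark_extP 0 σ)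
      (ℓ (n + 1)) b
    rw [this, hℓ, map_one, coe_extP, insPerm_self]
    rfl
  · have : σ = 1 := Subtype.ext (Subgroup.mem_bot.1 σ.2)
    rw [this, map_one]
    rfl

theorem Invariant.smul {p : ℤ} {ℓ : ∀ n, T.V n p} (hℓ : Invariant ℓ) (c : k) : Invariant (c • ℓ) := by
  intro n σ
  rw [Pi.smul_apply, map_smul, hℓ]

/-- Insertion in an arbitrary input of an invariant operation. -/
theorem Invariant.comp_eq {T : GrOperad k .symmetric} {e : ℤ} (b : T.V 0 e) {p q : ℤ} (h : q = p + e)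
    {ℓ : ∀ n, T.V n p} (hℓ : Invariant ℓ) {n : ℕ} (j : Fin (n + 1)) :
    T.comp (n := 0) (r := n) rfl h j (ℓ (n + 1)) b = T.comp (n := 0) (r := n) rfl h 0 (ℓ (n + 1)) b := by
  have := T.comp_act (m := n + 1) (n := 0) (r := n) rfl h j ⟨insPerm j 0 1, Subgroup.mem_top _⟩ 1 1
    (isMark_insPerm j 0 1) (ℓ (n + 1)) b
  rw [hℓ, map_one, map_one] at this
  simpa using this

theorem comp_quadTerm_symm {T : GrOperad k .symmetric} (α : T.V 0 0) {e e' t : ℤ} (ht : t = e + e')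
    {n p q : ℕ} (h : n + 1 = p + q) (hq : q ≤ n + 1) (x : T.V (p + 1) e) (y : T.V q e') :
    T.comp (n := 0) (r := n) rfl (add_zero t).symm 0 (quadTerm T ht p q h x y) α
      = (if hq : 1 ≤ q then quadTerm T ht p (q - 1) (by omega) x
          (T.comp (n := 0) (r := q - 1) (by omega) (add_zero e').symm ⟨0, by omega⟩ y α) else 0)
        + if hq : q < n + 1 then quadTerm T ht (p - 1) q (by omega)
          (T.comp (n := 0) (r := p - 1 + 1) (by omega) (add_zero e).symm ⟨1, by omega⟩ x α) y else 0 := by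
  have key : ∀ (a : Fin (n + 1)) (σ : Equiv.Perm (Fin n)), T.comp (n := 0) (r := n) rfl (add_zero t).symm 0
      (T.act ⟨insPerm a 0 σ, Subgroup.mem_top _⟩ (T.comp (r := n + 1) (by omega) ht 0 x y)) α
      = T.act ⟨σ, Subgroup.mem_top _⟩ (T.comp (n := 0) (r := n) rfl (add_zero t).symm a
        (T.comp (r := n + 1) (by omega) ht 0 x y) α) := by
    intro a σ
    rw [T.comp_act (m := n + 1) (n := 0) (r := n) rfl (add_zero t).symm a
      ⟨insPerm a 0 σ, Subgroup.mem_top _⟩ 1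
      ⟨σ, Subgroup.mem_top _⟩ (isMark_insPerm a 0 σ), map_one, insPerm_self]
    rfl
  simp only [quadTerm, LinearMap.sum_apply, map_sum, LinearMap.compr₂_apply]
  rw [sum_unsh hq]
  congr 1
  · split_ifs with hq₁
    · refine Finset.sum_congr rfl fun σ _ => ?_
      rw [key]
      congr 1
      exact T.comp_seq _ _ _ _ _ _ _ _ 0 ⟨0, _⟩ 0 (by simp) x y α
    · rfl
  · split_ifs with hq₁
    · refine Finset.sum_congr rfl fun σ _ => ?_
      rw [key]
      congr 1
      rw [T.comp_outer (by omega) (b := p - 1 + 1) (by omega) (by omega) (by omega) ht (add_zero e).symm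
        (add_zero t).symm ht 0 ⟨1, by omega⟩ ⟨q, hq₁⟩ 0 (by simp [Fin.ext_iff]) (by simp [outerSlot])
        (by simp [outerSlot]) x y α, mul_zero, Int.negOnePow_zero, one_smul]
    · rfl

theorem plug_quad₂_symm {T : GrOperad k .symmetric} (α : T.V 0 0) {e e' t : ℤ} (ht : t = e + e')
    {ℓ : ∀ n, T.V n e} (hℓ : Invariant ℓ) (ℓ' : ∀ n, T.V n e') (n : ℕ) :
    plug α (add_zero t).symm (quad₂ T ht ℓ ℓ') n
      = quad₂ T ht (plug α (add_zero e).symm ℓ) ℓ' n + quad₂ T ht ℓ (plug α (add_zero e').symm ℓ') n := by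
  rw [plug_symm]
  simp only [quad₂, map_sum, LinearMap.sum_apply]
  rw [Finset.sum_congr rfl fun (q : Fin (n + 1 + 1)) _ => comp_quadTerm_symm α ht
    (show n + 1 = n + 1 - q + q by omega) (by omega) (ℓ (n + 1 - q + 1)) (ℓ' q), Finset.sum_add_distrib,
    add_comm]
  congr 1
  · rw [Fin.sum_univ_castSucc, dif_neg (by simp), add_zero]
    refine Finset.sum_congr rfl fun q _ => ?_
    rw [dif_pos (by simp; omega)]
    have : ∀ (p p' : ℕ) (_ : p + 1 = p') (h : n = p + q) (h' : n = p' - 1 + q) (i : Fin (p' + 1))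
        (h'' : p' - 1 + 1 + 1 = p' + 1 + 0),
        quadTerm T ht (p' - 1) q h' (T.comp (n := 0) (r := p' - 1 + 1) h''
          (add_zero e).symm i (ℓ (p' + 1)) α) (ℓ' q)
          = quadTerm T ht p q h (plug α (add_zero e).symm ℓ (p + 1)) (ℓ' q) := by
      rintro p p' rfl h h' i h''
      rw [plug_symm]
      congr 1
      exact congrArg _ (hℓ.comp_eq α _ _)
    exact this (n - q) (n + 1 - q) (by omega) _ _ _ _
  · rw [Fin.sum_univ_succ, dif_neg (by simp), zero_add]
    refine Finset.sum_congr rfl fun q _ => ?_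
    rw [dif_pos (by simp)]
    have : ∀ (q p p' : ℕ) (_ : p = p') (h : n = p + q) (h' : n = p' + (q + 1 - 1))
        (h'' : q + 1 - 1 + 1 = q + 1 + 0),
        quadTerm T ht p' (q + 1 - 1) h' (ℓ (p' + 1)) (T.comp (n := 0) (r := q + 1 - 1) h''
          (add_zero e').symm ⟨0, by omega⟩ (ℓ' (q + 1)) α)
          = quadTerm T ht p q h (ℓ (p + 1)) (plug α (add_zero e').symm ℓ' q) := by
      rintro q p p' rfl h h' h''
      rw [plug_symm]
      rfl
    exact this q (n - q) _ (by simp) _ _ _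

theorem comp_quadTerm_nonsymm {T : GrOperad k .nonsymmetric} (α : T.V 0 0) {e e' t : ℤ} (ht : t = e + e')
    {n p q : ℕ} (h : n + 1 = p + q) (x : T.V (p + 1) e) (y : T.V q e') :
    ∑ c, T.comp (n := 0) (r := n) rfl (add_zero t).symm c (quadTerm T ht p q h x y) α
      = (if hq : 1 ≤ q then quadTerm T ht p (q - 1) (by omega) x
          (∑ b : Fin q, T.comp (n := 0) (r := q - 1) (by omega) (add_zero e').symm b y α) else 0)
        + if hq : q < n + 1 then quadTerm T ht (p - 1) q (by omega)
          (∑ a : Fin (p + 1), T.comp (n := 0) (r := p - 1 + 1) (by omega) (add_zero e).symm a x α) y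
          else 0 := by
  simp only [quadTerm, LinearMap.sum_apply, map_sum]
  rw [Finset.sum_comm]
  have e₁ := fun (i : Fin (p + 1)) => sum_slots (A := T.V n t) (show n + 1 + 1 = p + 1 + q by omega) i
    (fun c => T.comp (n := 0) (r := n) rfl (add_zero t).symm c
      (T.comp (n := q) (r := n + 1) (by omega) ht i x y) α)
  rw [Finset.sum_congr rfl fun i _ => e₁ i, Finset.sum_add_distrib, add_comm]
  congr 1
  · split_ifs with hq
    · rw [Finset.sum_comm]
      refine Finset.sum_congr rfl fun b _ => Finset.sum_congr rfl fun i _ => ?_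
      exact T.comp_seq _ _ _ _ _ _ _ _ i b _ (slotEquiv_inr _ _ _) x y α
    · obtain rfl : q = 0 := by omega
      simp
  · split_ifs with hq
    · obtain ⟨p, rfl⟩ : ∃ p', p = p' + 1 := ⟨p - 1, by omega⟩
      change _ = ∑ a : Fin (p + 1 + 1), ∑ i : Fin (p + 1), T.comp (n := q) (r := n)
        (show n + 1 = p + 1 + q by omega) ht i (T.comp (n := 0) (r := p + 1) rfl (add_zero e).symm a x α) y
      rw [Finset.sum_comm (s := (Finset.univ : Finset (Fin (p + 1 + 1)))), Finset.sum_sigma',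
        Finset.sum_sigma']
      refine Finset.sum_bij' (fun v _ => ⟨⟨outerSlot v.2.1 0 v.1, outerSlot_lt (m := p + 2) (n := 0)
          (by omega) v.2.1.2 v.1.2 fun h => v.2.2 (Fin.ext h.symm)⟩, v.2.1⟩)
        (fun v _ => ⟨v.2.succAbove v.1, ⟨v.2, fun h => Fin.succAbove_ne _ _ h.symm⟩⟩) ?_ ?_ ?_ ?_ ?_
      · simp
      · simp
      · rintro ⟨i, a, ha⟩ _
        have ha' : (a : ℕ) ≠ i := fun h => ha (Fin.ext h)
        have : a.succAbove ⟨outerSlot a 0 i, outerSlot_lt (m := p + 2) (n := 0) (r := p + 1)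
            (by omega) a.2 i.2 fun h => ha (Fin.ext h.symm)⟩ = i := by
          ext
          rw [val_succAbove]
          simp only [outerSlot]
          split_ifs <;> omega
        exact Sigma.subtype_ext this rfl
      · rintro ⟨i, a⟩ _
        refine Sigma.ext (Fin.ext ?_) HEq.rfl
        simp only [outerSlot, val_succAbove]
        split_ifs <;> omega
      · rintro ⟨i, a, ha⟩ _
        have := T.comp_outer (l := p + 2) (m := q) (n := 0) (a := n + 1) (b := p + 1) (r := n) (by omega)
          (by omega) rfl (by omega) ht (add_zero e).symm (add_zero t).symm ht i a
          (slotEquiv (show n + 1 + 1 = p + 1 + 1 + q by omega) i (.inl ⟨a, ha⟩))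
          ⟨outerSlot a 0 i, outerSlot_lt (m := p + 2) (n := 0) (by omega) a.2 i.2
            fun h => ha (Fin.ext h.symm)⟩ ha (slotEquiv_inl _ _ _) rfl x y α
        rw [mul_zero, Int.negOnePow_zero, one_smul] at this
        exact this
    · obtain rfl : p = 0 := by omega
      refine Finset.sum_eq_zero fun i _ => Finset.sum_eq_zero fun a _ => ?_
      exact absurd (Fin.ext (by omega)) a.2

theorem plug_quad₂ (α : T.V 0 0) {e e' t : ℤ} (ht : t = e + e') {ℓ : ∀ n, T.V n e} (hℓ : Invariant ℓ)
    (ℓ' : ∀ n, T.V n e') (n : ℕ) : plug α (add_zero t).symm (quad₂ T ht ℓ ℓ') n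
      = quad₂ T ht (plug α (add_zero e).symm ℓ) ℓ' n + quad₂ T ht ℓ (plug α (add_zero e').symm ℓ') n := by
  cases s
  · exact plug_quad₂_symm α ht hℓ ℓ' n
  · rw [plug_nonsymm]
    simp only [quad₂, map_sum, LinearMap.sum_apply]
    rw [Finset.sum_comm, Finset.sum_congr rfl fun (q : Fin (n + 1 + 1)) _ => comp_quadTerm_nonsymm α ht
      (show n + 1 = n + 1 - q + q by omega) (ℓ (n + 1 - q + 1)) (ℓ' q), Finset.sum_add_distrib,
      add_comm]
    congr 1
    · rw [Fin.sum_univ_castSucc, dif_neg (by simp), add_zero]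
      refine Finset.sum_congr rfl fun q _ => ?_
      rw [dif_pos (by simp; omega)]
      have : ∀ (p p' : ℕ) (_ : p + 1 = p') (h : n = p + q) (h' : n = p' - 1 + q)
          (h'' : p' - 1 + 1 + 1 = p' + 1 + 0),
          quadTerm T ht (p' - 1) q h' (∑ a : Fin (p' + 1), T.comp (n := 0) (r := p' - 1 + 1) h''
            (add_zero e).symm a (ℓ (p' + 1)) α) (ℓ' q)
            = quadTerm T ht p q h (plug α (add_zero e).symm ℓ (p + 1)) (ℓ' q) := by
        rintro p p' rfl h h' h''
        rw [plug_nonsymm]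
        rfl
      exact this (n - q) (n + 1 - q) (by omega) _ _ _
    · rw [Fin.sum_univ_succ, dif_neg (by simp), zero_add]
      refine Finset.sum_congr rfl fun q _ => ?_
      rw [dif_pos (by simp)]
      have : ∀ (q p p' : ℕ) (_ : p = p') (h : n = p + q) (h' : n = p' + (q + 1 - 1))
          (h'' : q + 1 - 1 + 1 = q + 1 + 0),
          quadTerm T ht p' (q + 1 - 1) h' (ℓ (p' + 1)) (∑ b : Fin (q + 1), T.comp (n := 0)
            (r := q + 1 - 1) h'' (add_zero e').symm b (ℓ' (q + 1)) α)
            = quadTerm T ht p q h (ℓ (p + 1)) (plug α (add_zero e').symm ℓ' q) := by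
        rintro q p p' rfl h h' h''
        rw [plug_nonsymm]
        rfl
      exact this q (n - q) _ (by simp) _ _ _

/-! #### Families concentrated in one arity -/

theorem quad₂_castL_zero_right {e e' t : ℤ} (ht : t = e + e') (ℓ : ∀ n, T.V n e) (u : T.V 0 e') (n : ℕ) :
    quad₂ T ht ℓ (fun q => T.castL q e' u) n = plug u ht ℓ n := by
  rw [quad₂, Finset.sum_eq_single 0]
  · have : ∀ (q : ℕ) (_ : 0 = q) (h : n = n + q), quadTerm T ht n q h (ℓ (n + 1)) (T.castL q e' u)
        = plug u ht ℓ n := by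
      rintro q rfl h
      rw [T.castL_self]
      cases s
      · rw [plug_symm]
        simp only [quadTerm, unsh_one (Or.inl rfl), Finset.sum_singleton, LinearMap.compr₂_apply]
        exact LinearMap.congr_fun (map_one T.act) _
      · rw [plug_nonsymm]
        simp only [quadTerm, LinearMap.sum_apply]
    exact this 0 rfl rfl
  · intro q _ hq
    have : ¬ (0 = (q : ℕ) ∧ e' = e') := fun h => hq (Fin.ext (by simp [← h.1]))
    rw [T.castL_of_ne this, map_zero]
  · simp

theorem quad₂_castL_zero_left {e e' t : ℤ} (ht : t = e + e') (u : T.V 0 e) (ℓ' : ∀ n, T.V n e') (n : ℕ) :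
    quad₂ T ht (fun q => T.castL q e u) ℓ' n = 0 := by
  refine Finset.sum_eq_zero fun q _ => ?_
  simp only
  rw [T.castL_of_ne (by omega), map_zero, LinearMap.zero_apply]

theorem quad₂_castL_one_left {e e' t : ℤ} (ht : t = e + e') (μ : T.V 1 e) (ℓ' : ∀ n, T.V n e') (n : ℕ) :
    quad₂ T ht (fun q => T.castL q e μ) ℓ' n = T.comp (Nat.add_comm n 1) ht 0 μ (ℓ' n) := by
  rw [quad₂, Finset.sum_eq_single (Fin.last n)]
  · have : ∀ p (_ : 0 = p) (h : n = p + n), quadTerm T ht p n h (T.castL (p + 1) e μ) (ℓ' n)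
        = T.comp (Nat.add_comm n 1) ht 0 μ (ℓ' n) := by
      rintro p rfl h
      rw [T.castL_self]
      cases s
      · simp only [quadTerm, unsh_one (Or.inr (le_refl n)), Finset.sum_singleton, LinearMap.compr₂_apply]
        exact LinearMap.congr_fun (map_one T.act) _
      · simp only [quadTerm, LinearMap.sum_apply, Nat.reduceAdd, Finset.univ_unique, Finset.sum_singleton]
        rfl
    exact this _ (by simp) _
  · intro q _ hq
    have : (q : ℕ) ≠ n := fun h => hq (Fin.ext h)
    rw [T.castL_of_ne (by omega), map_zero, LinearMap.zero_apply]
  · simp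

theorem sum_unsh_one {A : Type*} [AddCommMonoid A] {n : ℕ} (F : Equiv.Perm (Fin (n + 1)) → A) :
    ∑ σ ∈ unsh (n + 1) 1, F σ = ∑ i, F (insPerm 0 i 1) := by
  symm
  refine Finset.sum_bij (fun i _ => insPerm 0 i 1) ?_ ?_ ?_ (fun _ _ => rfl)
  · intro i _
    rw [mem_unsh]
    intro a b hab h
    obtain ⟨a, rfl⟩ := Fin.exists_succ_eq.2 (Fin.pos_iff_ne_zero.1 (show 0 < a by
      rw [Fin.lt_def, Fin.val_zero]; have := Fin.lt_def.1 hab; omega))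
    obtain ⟨b, rfl⟩ := Fin.exists_succ_eq.2 (Fin.pos_iff_ne_zero.1 ((Fin.zero_le _).trans_lt hab))
    rw [← Fin.zero_succAbove, ← Fin.zero_succAbove, insPerm_succAbove, insPerm_succAbove]
    simpa using hab
  · intro i _ i' _ h
    have := congrArg (fun τ : Equiv.Perm (Fin (n + 1)) => τ 0) h
    simpa using this
  · intro τ hτ
    rw [mem_unsh] at hτ
    obtain ⟨σ, hσ⟩ := exists_insPerm 0 τ
    refine ⟨τ 0, Finset.mem_univ _, ?_⟩
    rw [hσ] at hτ
    have : σ = 1 := by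
      refine (isUnshuffle_one_iff (q := 0) (Or.inl rfl)).1 fun a b hab _ => ?_
      have := hτ (Fin.succAbove 0 a) (Fin.succAbove 0 b) (by simpa using hab) (by simp)
      rw [insPerm_succAbove, insPerm_succAbove] at this
      simpa using this
    conv_rhs => rw [hσ, this]

theorem quad₂_castL_one_right {e e' t : ℤ} (ht : t = e + e') {ℓ : ∀ n, T.V n e} (hℓ : Invariant ℓ)
    (μ : T.V 1 e') (n : ℕ) :
    quad₂ T ht ℓ (fun q => T.castL q e' μ) n = ∑ i : Fin n, T.comp (r := n) rfl ht i (ℓ n) μ := by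
  rw [quad₂]
  cases n with
  | zero =>
    refine (Finset.sum_eq_zero fun q _ => ?_).trans (by simp)
    rw [T.castL_of_ne (by omega), map_zero]
  | succ n =>
    rw [Finset.sum_eq_single 1]
    · have : ∀ (p q : ℕ) (_ : n = p) (_ : 1 = q) (h : n + 1 = p + q),
          quadTerm T ht p q h (ℓ (p + 1)) (T.castL q e' μ)
          = ∑ i : Fin (n + 1), T.comp (r := n + 1) rfl ht i (ℓ (n + 1)) μ := by
        rintro p q rfl rfl h
        rw [T.castL_self]
        cases s
        · simp only [quadTerm, LinearMap.sum_apply, LinearMap.compr₂_apply]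
          rw [sum_unsh_one]
          refine Finset.sum_congr rfl fun i _ => ?_
          rw [T.comp_act (m := n + 1) (n := 1) (r := n + 1) rfl ht 0 ⟨insPerm 0 i 1, Subgroup.mem_top _⟩ 1
            ⟨insPerm 0 i 1, Subgroup.mem_top _⟩ ⟨?_, ?_⟩, hℓ, map_one, insPerm_self]
          · rfl
          · intro b c hc
            obtain rfl : c = 0 := Fin.ext (by simp at hc ⊢; omega)
            have : b = 0 := Subsingleton.elim _ _
            subst this
            simp
          · intro a c ha hc
            have ha' : (a : ℕ) ≠ 0 := fun h => ha (Fin.ext h)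
            obtain rfl : c = a := Fin.ext (by rw [hc, outerSlot]; simp)
            simp only [outerSlot]
            split_ifs <;> simp
        · simp only [quadTerm, LinearMap.sum_apply]
      exact this (n + 1 - (1 : Fin (n + 2))) (1 : Fin (n + 2)) (by simp) (by simp) _
    · intro q _ hq
      have : ¬ (1 = (q : ℕ) ∧ e' = e') := fun h => hq (Fin.ext (by simp [← h.1]))
      rw [T.castL_of_ne this, map_zero]
    · simp

/-- The quadratic expression after a change of the operations of arity zero and one. -/
theorem quad_add_castL {ℓ : ∀ n, T.V n (-1)} (hℓ : Invariant ℓ) (u : T.V 0 (-1)) (μ : T.V 1 (-1)) (n : ℕ) :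
    quad T (fun n => ℓ n + T.castL n (-1) u + T.castL n (-1) μ) n
      = quad T ℓ n + plug u (q := -2) rfl ℓ n + T.adL μ (q := -2) rfl (ℓ n)
        + T.castL n (-2) (T.comp (m := 1) (n := 0) (t := -2) rfl rfl 0 μ u)
        + T.castL n (-2) (T.comp (m := 1) (n := 1) (t := -2) rfl rfl 0 μ μ) := by
  have hc : ∀ {m : ℕ} (v : T.V m (-1)), T.comp (t := -2) (Nat.add_comm n 1) rfl 0 μ (T.castL n (-1) v)
      = T.castL n (-2) (T.comp (t := -2) (Nat.add_comm m 1) rfl 0 μ v) := by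
    intro m v
    by_cases h : m = n
    · subst h
      rw [T.castL_self, T.castL_self]
    · rw [T.castL_of_ne (by omega), T.castL_of_ne (by omega), map_zero]
  rw [quad_eq, quad_eq]
  change quad₂ T rfl (ℓ + (fun n => T.castL n (-1) u) + (fun n => T.castL n (-1) μ))
    (ℓ + (fun n => T.castL n (-1) u) + (fun n => T.castL n (-1) μ)) n = _
  simp only [quad₂_add_left]
  simp only [quad₂_add_right]
  simp only [quad₂_castL_zero_left, quad₂_castL_one_left]
  simp only [quad₂_castL_zero_right, quad₂_castL_one_right _ hℓ, hc]
  rw [T.adL_apply, show ((-1 : ℤ) * -1).negOnePow = -1 by decide, Units.neg_smul, one_smul, sub_neg_eq_add]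
  abel

end quad

/-! ### Divided powers of insertion -/

section dpow

variable {T : GrOperad k s}

/-- The divided powers of the insertion of an operation of arity zero and degree zero. -/
def dpow (α : T.V 0 0) {p : ℤ} (ℓ : ∀ n, T.V n p) : ℕ → ∀ n, T.V n p
  | 0 => ℓ
  | j + 1 => ((j + 1 : ℕ) : k)⁻¹ • plug α (add_zero p).symm (dpow α ℓ j)

variable (α : T.V 0 0) {p : ℤ}

theorem dpow_zero (ℓ : ∀ n, T.V n p) : dpow α ℓ 0 = ℓ := rfl

theorem dpow_succ (ℓ : ∀ n, T.V n p) (j : ℕ) :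
    dpow α ℓ (j + 1) = ((j + 1 : ℕ) : k)⁻¹ • plug α (add_zero p).symm (dpow α ℓ j) := rfl

theorem plug_dpow [CharZero k] (ℓ : ∀ n, T.V n p) (j : ℕ) :
    plug α (add_zero p).symm (dpow α ℓ j) = ((j + 1 : ℕ) : k) • dpow α ℓ (j + 1) := by
  rw [dpow_succ, smul_smul, mul_inv_cancel₀ (Nat.cast_ne_zero.2 (Nat.succ_ne_zero j)), one_smul]

theorem dpow_succ' (ℓ : ∀ n, T.V n p) (j : ℕ) :
    dpow α ℓ (j + 1) = ((j + 1 : ℕ) : k)⁻¹ • dpow α (plug α (add_zero p).symm ℓ) j := by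
  induction j with
  | zero => rfl
  | succ j ih =>
    rw [dpow_succ, ih, dpow_succ]
    congr 1
    funext n
    rw [plug_smul]
    rfl

theorem Invariant.dpow {ℓ : ∀ n, T.V n p} (hℓ : Invariant ℓ) (j : ℕ) : Invariant (dpow α ℓ j) := by
  induction j with
  | zero => exact hℓ
  | succ j ih => exact (ih.plug α _).smul _

theorem GrHom.map_dpow {R : GrOperad k s} (f : GrHom R T) (α : R.V 0 0) (ℓ : ∀ n, R.V n p) (j n : ℕ) :
    f.app (OperadicTwisting.dpow α ℓ j n)
      = OperadicTwisting.dpow (f.app α) (fun n => f.app (ℓ n)) j n := by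
  induction j generalizing n with
  | zero => rfl
  | succ j ih =>
    rw [dpow_succ, dpow_succ, Pi.smul_apply, Pi.smul_apply, map_smul, f.map_plug]
    congr 2
    exact funext ih

theorem dpow_neg (ℓ : ∀ n, T.V n p) (j n : ℕ) : dpow α (fun n => - ℓ n) j n = - dpow α ℓ j n := by
  induction j generalizing n with
  | zero => rfl
  | succ j ih =>
    rw [dpow_succ, dpow_succ, Pi.smul_apply, Pi.smul_apply, ← smul_neg, ← plug_neg]
    congr 2
    exact funext ih

theorem dpow_quad₂ [CharZero k] {e e' t : ℤ} (ht : t = e + e') {ℓ : ∀ n, T.V n e} (hℓ : Invariant ℓ)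
    (ℓ' : ∀ n, T.V n e') (w n : ℕ) : dpow α (quad₂ T ht ℓ ℓ') w n
      = ∑ v ∈ Finset.HasAntidiagonal.antidiagonal w, quad₂ T ht (dpow α ℓ v.1) (dpow α ℓ' v.2) n := by
  induction w generalizing n with
  | zero => simp [dpow_zero]
  | succ w ih =>
    have hw : ((w + 1 : ℕ) : k) ≠ 0 := Nat.cast_ne_zero.2 (Nat.succ_ne_zero w)
    apply smul_right_injective _ hw
    simp only
    have e₀ : ((w + 1 : ℕ) : k) • dpow α (quad₂ T ht ℓ ℓ') (w + 1) n
        = plug α (add_zero t).symm (dpow α (quad₂ T ht ℓ ℓ') w) n := by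
      rw [plug_dpow]
      rfl
    have e₁ : plug α (add_zero t).symm (dpow α (quad₂ T ht ℓ ℓ') w) n
        = ∑ v ∈ Finset.HasAntidiagonal.antidiagonal w, plug α (add_zero t).symm
            (quad₂ T ht (dpow α ℓ v.1) (dpow α ℓ' v.2)) n := by
      cases s
      · simp only [plug_symm, ih, map_sum, LinearMap.sum_apply]
      · simp only [plug_nonsymm, ih, map_sum, LinearMap.sum_apply]
        rw [Finset.sum_comm]
    rw [e₀, e₁, Finset.smul_sum]
    have e₂ : ∀ v : ℕ × ℕ, plug α (add_zero t).symm (quad₂ T ht (dpow α ℓ v.1) (dpow α ℓ' v.2)) n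
        = ((v.1 + 1 : ℕ) : k) • quad₂ T ht (dpow α ℓ (v.1 + 1)) (dpow α ℓ' v.2) n
          + ((v.2 + 1 : ℕ) : k) • quad₂ T ht (dpow α ℓ v.1) (dpow α ℓ' (v.2 + 1)) n := by
      intro v
      rw [plug_quad₂ α ht (hℓ.dpow α v.1), plug_dpow, plug_dpow, quad₂_smul_left, quad₂_smul_right]
    rw [Finset.sum_congr rfl fun v _ => e₂ v, Finset.sum_add_distrib]
    have e₃ : ∀ v ∈ Finset.HasAntidiagonal.antidiagonal (w + 1),
        ((w + 1 : ℕ) : k) • quad₂ T ht (dpow α ℓ v.1) (dpow α ℓ' v.2) n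
        = (v.1 : k) • quad₂ T ht (dpow α ℓ v.1) (dpow α ℓ' v.2) n
          + (v.2 : k) • quad₂ T ht (dpow α ℓ v.1) (dpow α ℓ' v.2) n := by
      intro v hv
      rw [Finset.HasAntidiagonal.mem_antidiagonal] at hv
      rw [← hv, Nat.cast_add, add_smul]
    rw [Finset.sum_congr rfl e₃, Finset.sum_add_distrib]
    congr 1
    · rw [Finset.Nat.sum_antidiagonal_succ]
      simp
    · rw [Finset.Nat.sum_antidiagonal_succ']
      simp

theorem Deriv.app_plug {e : ℤ} (D : Deriv (GrHom.id T) e) (hα : D.app (q := e) (by omega) α = 0) {q : ℤ}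
    (h : q = p + e) (ℓ : ∀ n, T.V n p) (n : ℕ) : D.app h (plug α (add_zero p).symm ℓ n)
      = plug α (add_zero q).symm (fun n => D.app h (ℓ n)) n := by
  cases s
  · rw [plug_symm, plug_symm, D.map_comp_id (m := n + 1) (n := 0) (r := n) rfl (add_zero p).symm h
      (q' := e) (by omega) h (by omega) (by omega), hα]
    simp
  · rw [plug_nonsymm, plug_nonsymm, map_sum]
    refine Finset.sum_congr rfl fun j _ => ?_
    rw [D.map_comp_id (m := n + 1) (n := 0) (r := n) rfl (add_zero p).symm h
      (q' := e) (by omega) h (by omega) (by omega), hα]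
    simp

theorem Deriv.app_dpow {e : ℤ} (D : Deriv (GrHom.id T) e) (hα : D.app (q := e) (by omega) α = 0) {q : ℤ}
    (h : q = p + e) (ℓ : ∀ n, T.V n p) (j n : ℕ) :
    D.app h (OperadicTwisting.dpow α ℓ j n)
      = OperadicTwisting.dpow α (fun n => D.app h (ℓ n)) j n := by
  induction j generalizing n with
  | zero => rfl
  | succ j ih =>
    rw [dpow_succ, dpow_succ, Pi.smul_apply, Pi.smul_apply, map_smul, D.app_plug α hα]
    congr 2
    exact funext ih

end dpow

/-! ### The twisted operations -/

section symm

variable {T : GrOperad k .symmetric} (α : T.V 0 0) {p : ℤ}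

theorem dpow_symm [CharZero k] (ℓ : ∀ n, T.V n p) (j n : ℕ) :
    dpow α ℓ j n = (j.factorial : k)⁻¹ • plugFirst T α j (ℓ (n + j)) := by
  induction j generalizing ℓ with
  | zero => simp [dpow, plugFirst]
  | succ j ih =>
    rw [dpow_succ', Pi.smul_apply, ih, smul_smul, ← mul_inv, ← Nat.cast_mul, ← Nat.factorial_succ,
      plug_symm]
    rfl

end symm

section nonsymm

variable {T : GrOperad k .nonsymmetric} (α : T.V 0 0) {p : ℤ}

theorem plugAny_sum {ι : Type*} (I : Finset ι) (j b : ℕ) {n : ℕ} (F : ι → T.V (n + j) p) :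
    plugAny T α j b (∑ i ∈ I, F i) = ∑ i ∈ I, plugAny T α j b (F i) := by
  induction j generalizing b with
  | zero => rfl
  | succ j ih =>
    simp only [plugAny, map_sum, LinearMap.sum_apply, ih]
    rw [Finset.sum_comm]
    refine Finset.sum_congr rfl fun i _ => ?_
    split_ifs
    · rfl
    · simp

theorem sum_plugAny [CharZero k] (j b : ℕ) {n : ℕ} (x : T.V (n + (j + 1)) p) (hb : b ≤ n + (j + 1)) :
    ∑ i : Fin (n + (j + 1)), (if (i : ℕ) < b then plugAny T α j (b - 1)
        (T.comp (n := 0) (r := n + j) rfl (add_zero p).symm i x α) else 0)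
      = ((j + 1 : ℕ) : k) • plugAny T α (j + 1) b x := by
  induction j generalizing b with
  | zero => simp [plugAny]
  | succ j ih =>
    let G : Fin (n + (j + 1) + 1) → Fin (n + (j + 1)) → ℕ → T.V n p := fun i i' b' =>
      plugAny T α j b' (T.comp (n := 0) (r := n + j) rfl (add_zero p).symm i'
        (T.comp (n := 0) (r := n + (j + 1)) rfl (add_zero p).symm i x α) α)
    have hG : ∀ a : Fin (n + (j + 1)) × Fin (n + (j + 1) + 1), ∀ b', G (swapIdx a).2 (swapIdx a).1 b'
        = G a.2 a.1 b' := by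
      rintro ⟨i', i⟩ b'
      have := T.comp_outer (l := n + (j + 1) + 1) (m := 0) (n := 0) (a := n + (j + 1)) (b := n + (j + 1))
        (r := n + j) rfl rfl rfl rfl (add_zero p).symm (add_zero p).symm (add_zero p).symm
        (add_zero p).symm i (i.succAbove i') i' (swapIdx (i', i)).1 (Fin.succAbove_ne i i') (by
          rw [outerSlot, val_succAbove]
          split_ifs <;> omega) rfl x α α
      rw [mul_zero, Int.negOnePow_zero, one_smul] at this
      simp only [G, swapIdx]
      rw [this]
      rfl
    have e₁ : ∀ i : Fin (n + (j + 1) + 1), (if (i : ℕ) < b then plugAny T α (j + 1) (b - 1)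
        (T.comp (n := 0) (r := n + (j + 1)) rfl (add_zero p).symm i x α) else 0)
        = (∑ i' : Fin (n + (j + 1)), if (i : ℕ) < b ∧ (i' : ℕ) < i then G i i' i' else 0)
          + ∑ i' : Fin (n + (j + 1)), if (i : ℕ) < b ∧ (i' : ℕ) < b - 1 ∧ (i : ℕ) ≤ i' then G i i' i' else 0 := by
      intro i
      rw [← Finset.sum_add_distrib]
      split_ifs with h
      · rw [plugAny]
        refine Finset.sum_congr rfl fun i' _ => ?_
        simp only [G]
        by_cases h₁ : (i' : ℕ) < i
        · rw [if_pos (by omega), if_pos ⟨h, h₁⟩, if_neg (by omega)]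
          exact (add_zero _).symm
        · by_cases h₂ : (i' : ℕ) < b - 1
          · rw [if_pos h₂, if_neg (by omega), if_pos (by omega), zero_add]
          · rw [if_neg h₂, if_neg (by omega), if_neg (by omega), zero_add]
      · symm
        refine Finset.sum_eq_zero fun i' _ => ?_
        rw [if_neg (by omega), if_neg (by omega), zero_add]
    refine (Finset.sum_congr rfl fun i _ => e₁ i).trans ?_
    rw [Finset.sum_add_distrib]
    have e₂ : (∑ i : Fin (n + (j + 1) + 1), ∑ i' : Fin (n + (j + 1)),
        if (i : ℕ) < b ∧ (i' : ℕ) < i then G i i' i' else 0) = plugAny T α (j + 1 + 1) b x := by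
      rw [plugAny]
      refine Finset.sum_congr rfl fun i _ => ?_
      by_cases h : (i : ℕ) < b
      · rw [if_pos h, plugAny]
        refine Finset.sum_congr rfl fun i' _ => ?_
        by_cases h' : (i' : ℕ) < i
        · rw [if_pos ⟨h, h'⟩, if_pos h']
        · rw [if_neg (by omega), if_neg h']
      · rw [if_neg h]
        exact Finset.sum_eq_zero fun i' _ => if_neg (by omega)
    have e₃ : (∑ i : Fin (n + (j + 1) + 1), ∑ i' : Fin (n + (j + 1)),
        if (i : ℕ) < b ∧ (i' : ℕ) < b - 1 ∧ (i : ℕ) ≤ i' then G i i' i' else 0)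
        = ((j + 1 : ℕ) : k) • plugAny T α (j + 1 + 1) b x := by
      rw [plugAny, Finset.smul_sum]
      have e₄ : ∀ c : Fin (n + (j + 1) + 1), ((j + 1 : ℕ) : k) • (if (c : ℕ) < b then plugAny T α (j + 1) c
          (T.comp (n := 0) (r := n + (j + 1)) rfl (add_zero p).symm c x α) else 0)
          = ∑ i : Fin (n + (j + 1)), if (c : ℕ) < b ∧ (i : ℕ) < c then G c i (c - 1) else 0 := by
        intro c
        split_ifs with h
        · rw [← ih c _ (by omega)]
          refine Finset.sum_congr rfl fun i _ => ?_
          by_cases h' : (i : ℕ) < c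
          · rw [if_pos h', if_pos ⟨h, h'⟩]
          · rw [if_neg h', if_neg (by omega)]
        · rw [smul_zero]
          exact (Finset.sum_eq_zero fun i' _ => if_neg (by omega)).symm
      refine Eq.trans ?_ (Finset.sum_congr rfl fun c _ => (e₄ c).symm)
      rw [Finset.sum_comm, ← Fintype.sum_prod_type', Finset.sum_comm, ← Fintype.sum_prod_type']
      refine (Equiv.sum_comp ((swapIdx_involutive (n := n + j)).toPerm) _).symm.trans
        (Finset.sum_congr rfl fun a _ => ?_)
      change (if _ then G (swapIdx a).2 (swapIdx a).1 (swapIdx a).1 else 0) = _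
      rw [hG]
      obtain ⟨i', i⟩ := a
      have h₁ := val_succAbove i i'
      have h₂ : ((swapIdx (i', i)).2 : ℕ) = i.succAbove i' := rfl
      have h₃ : ((swapIdx (i', i)).1 : ℕ) = outerSlot (i.succAbove i') 0 i := rfl
      by_cases h : (i : ℕ) < b ∧ (i' : ℕ) < i
      · rw [if_pos h, if_pos]
        · have h₄ : ((swapIdx (i', i)).1 : ℕ) = (i : ℕ) - 1 := by
            rw [h₃, outerSlot, h₁]
            split_ifs <;> omega
          rw [h₄]
        · change ((swapIdx (i', i)).2 : ℕ) < b ∧ ((swapIdx (i', i)).1 : ℕ) < b - 1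
            ∧ ((swapIdx (i', i)).2 : ℕ) ≤ (swapIdx (i', i)).1
          rw [h₂, h₃, outerSlot, h₁]
          split_ifs <;> omega
      · rw [if_neg h, if_neg]
        change ¬ (((swapIdx (i', i)).2 : ℕ) < b ∧ ((swapIdx (i', i)).1 : ℕ) < b - 1
            ∧ ((swapIdx (i', i)).2 : ℕ) ≤ (swapIdx (i', i)).1)
        rw [h₂, h₃, outerSlot, h₁]
        split_ifs <;> omega
    rw [e₂, e₃, Nat.cast_succ (j + 1), add_smul, one_smul, add_comm]

theorem dpow_nonsymm [CharZero k] (ℓ : ∀ n, T.V n p) (j n : ℕ) :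
    dpow α ℓ j n = plugAny T α j (n + j) (ℓ (n + j)) := by
  induction j generalizing ℓ with
  | zero => rfl
  | succ j ih =>
    have := sum_plugAny α j (n + (j + 1)) (ℓ (n + (j + 1))) le_rfl
    rw [dpow_succ', Pi.smul_apply, ih, plug_nonsymm, plugAny_sum, inv_smul_eq_iff₀
      (Nat.cast_ne_zero.2 (Nat.succ_ne_zero j)), ← this]
    exact Finset.sum_congr rfl fun i _ => (if_pos i.2).symm

end nonsymm

section twisted

variable {P : GrOperad k s} {p : ℤ}

theorem hat.pi_comp_alpha (w : ℕ) {n : ℕ} (i : Fin (n + 1)) (x : (hat P).V (n + 1) p) :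
    hat.pi P (w + 1) ((hat P).comp (n := 0) (r := n) rfl (add_zero p).symm i x (hatAlpha P))
      = (hat P).comp (n := 0) (r := n) rfl (add_zero p).symm i (hat.pi P w x) (hatAlpha P) := by
  rw [hat.pi_comp, Finset.sum_eq_single (w, 1)]
  · exact congrArg _ (hat.pi_single_same 1 _)
  · rintro ⟨a, b⟩ hab hne
    rw [Finset.HasAntidiagonal.mem_antidiagonal] at hab
    have hb : b ≠ 1 := fun h => hne (by subst h; simpa using hab)
    rw [show hat.pi P b (hatAlpha P) = 0 from hat.pi_single_of_ne hb _, map_zero]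
  · intro h
    simp at h

theorem hat.pi_plug (w : ℕ) (ℓ : ∀ n, (hat P).V n p) (n : ℕ) :
    hat.pi P (w + 1) (plug (hatAlpha P) (add_zero p).symm ℓ n)
      = plug (hatAlpha P) (add_zero p).symm (fun n => hat.pi P w (ℓ n)) n := by
  cases s
  · rw [plug_symm, plug_symm, hat.pi_comp_alpha]
  · simp only [plug_nonsymm, map_sum, hat.pi_comp_alpha]

theorem hat.pi_dpow (ℓ : ∀ n, P.V n p) (w n : ℕ) :
    hat.pi P w (dpow (hatAlpha P) (fun n => hatOf (ℓ n)) w n)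
      = dpow (hatAlpha P) (fun n => hatOf (ℓ n)) w n := by
  induction w generalizing n with
  | zero => exact hat.pi_single_same 0 _
  | succ w ih =>
    rw [dpow_succ, Pi.smul_apply, map_smul, hat.pi_plug]
    congr 2
    exact funext ih

variable [CharZero k] (ℓ : ∀ n, P.V n (-1))

theorem pi_twistedOp (n w : ℕ) :
    hat.pi P w (twistedOp P ℓ n) = dpow (hatAlpha P) (fun n => hatOf (ℓ n)) w n := by
  rw [← hat.pi_dpow, hat.pi_apply, hat.pi_apply]
  congr 1
  cases s
  · rw [dpow_symm, map_smul]
    rfl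
  · rw [dpow_nonsymm]
    rfl

theorem hat.pi_quad₂ {e e' t : ℤ} (ht : t = e + e') (ℓ : ∀ n, (hat P).V n e) (ℓ' : ∀ n, (hat P).V n e')
    (w n : ℕ) : hat.pi P w (quad₂ (hat P) ht ℓ ℓ' n)
      = ∑ v ∈ Finset.HasAntidiagonal.antidiagonal w, quad₂ (hat P) ht (fun n => hat.pi P v.1 (ℓ n))
        (fun n => hat.pi P v.2 (ℓ' n)) n := by
  simp only [quad₂, map_sum]
  rw [Finset.sum_comm]
  refine Finset.sum_congr rfl fun q _ => ?_
  cases s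
  · simp only [quadTerm, LinearMap.sum_apply, map_sum, LinearMap.compr₂_apply, hat.pi_act, hat.pi_comp]
    rw [Finset.sum_comm]
  · simp only [quadTerm, LinearMap.sum_apply, map_sum, hat.pi_comp]
    rw [Finset.sum_comm]

variable {ℓ}

theorem twistedOp_invariant (hℓ : Invariant ℓ) : Invariant (twistedOp P ℓ) := by
  intro n σ
  refine hat.eq_of_pi fun w => ?_
  rw [hat.pi_act, pi_twistedOp]
  refine Invariant.dpow _ (fun n σ => ?_) w n σ
  rw [← hat.of_app, ← GrHom.map_act, hℓ]

theorem hatDeriv_twistedOp (hℓ : Invariant ℓ) (δ : Deriv (GrHom.id P) (-1))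
    (hδ : ∀ n, δ.app (q := -2) rfl (ℓ n) = - quad P ℓ n) (n : ℕ) :
    (hatDeriv δ).app (q := -2) rfl (twistedOp P ℓ n) = - quad (hat P) (twistedOp P ℓ) n := by
  refine hat.eq_of_pi fun w => ?_
  rw [pi_hatDeriv, pi_twistedOp, Deriv.app_dpow _ _ (hatDeriv_alpha δ _)]
  simp only [hatDeriv_of, hδ]
  rw [map_neg, quad_eq, hat.pi_quad₂]
  simp only [pi_twistedOp]
  rw [← dpow_quad₂ _ _ (fun n σ => by rw [← hat.of_app, ← GrHom.map_act, hℓ]), ← dpow_neg]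
  congr 1
  funext n
  rw [← hat.of_app, map_neg, quad_eq, GrHom.map_quad₂]
  rfl

theorem plugFam_smul {R : GrOperad k s} (c : k) (κ : ∀ n, R.V n p) (n : ℕ) :
    plugFam (c • κ) n = c • plugFam κ n := by
  cases s
  · simp [plugFam]
  · exact Prod.ext rfl (smul_zero c).symm

theorem mark_plug {κ ℓ : ∀ n, (hat P).V n p} (hκ : Invariant κ)
    (h : ∀ n, mark P (ℓ n) = markBimod.mk (hat P) (plugFam κ n)) (n : ℕ) :
    mark P (plug (hatAlpha P) (add_zero p).symm ℓ n)
      = markBimod.mk (hat P) (plugFam (plug (hatAlpha P) (add_zero p).symm κ) n)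
        + markBimod.mk (hat P) (plugFam ℓ n) := by
  cases s
  · rw [plug_symm, mark_comp, mark_alpha, h, markBimod.rcomp_mk, markBimod.lcomp_mk]
    simp only [plugFam]
    rw [Fam.rcomp_sing, Fam.lcomp_unit, one_smul, GrOperad.castL_self, plug_symm]
    congr 2
    exact Fam.sing_congr (by simp [outerSlot]) (hκ.comp_eq (hatAlpha P) _ _)
  · rw [plug_nonsymm, map_sum]
    simp only [mark_comp, mark_alpha, h, markBimod.rcomp_mk, markBimod.lcomp_mk]
    rw [Finset.sum_add_distrib, ← map_sum, ← map_sum]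
    congr 2
    · have e₁ : plugFam (plug (hatAlpha P) (add_zero p).symm κ) n
          = ∑ a : Fin (n + 1) × Fin (n + 1 + 1), Fam.sing a.1 ((hat P).comp (n := 0) (r := n + 1) rfl
            (add_zero p).symm a.2 (κ (n + 2)) (hatAlpha P)) := by
        rw [Fam.eq_sum (plugFam _ n), Fintype.sum_prod_type]
        refine (add_zero _).trans (Finset.sum_congr rfl fun j _ => ?_)
        exact (congrArg (Fam.sing j) (plug_nonsymm _ _ _ _)).trans (map_sum _ _ _)
      rw [e₁, ← Equiv.sum_comp swapIdx_involutive.toPerm, Fintype.sum_prod_type]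
      refine Finset.sum_congr rfl fun j _ => ?_
      rw [Fam.eq_sum (plugFam κ (n + 1)), map_add, LinearMap.add_apply, Fam.rcomp_unit, map_sum,
        LinearMap.sum_apply]
      refine (add_zero _).trans (Finset.sum_congr rfl fun i _ => ?_)
      rw [Fam.rcomp_sing]
      rfl
    · rw [Fam.eq_sum (plugFam ℓ n)]
      refine Eq.trans (Finset.sum_congr rfl fun j _ => ?_) (add_zero _).symm
      rw [Fam.lcomp_unit, one_smul, GrOperad.castL_self]
      rfl

theorem succ_smul_eq {V : Type u} [AddCommGroup V] [Module k V] (w : ℕ) (x : V) :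
    ((w + 1 : ℕ) : k) • x = (w : k) • x + x := by
  rw [Nat.cast_succ, add_smul, one_smul]

theorem mark_dpow (hℓ : Invariant ℓ) (w n : ℕ) :
    mark P (dpow (hatAlpha P) (fun n => hatOf (ℓ n)) (w + 1) n)
      = markBimod.mk (hat P) (plugFam (dpow (hatAlpha P) (fun n => hatOf (ℓ n)) w) n) := by
  have hinv : Invariant fun n => (hatOf (ℓ n) : (hat P).V n (-1)) := fun n σ => by
    simp only
    rw [← hat.of_app, ← GrHom.map_act, hℓ]
  induction w generalizing n with
  | zero =>
    have h0 : ∀ n, markBimod.mk (hat P) (plugFam (0 : ∀ n, (hat P).V n (-1)) n) = 0 := by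
      intro n
      rw [← zero_smul k (0 : ∀ n, (hat P).V n (-1)), plugFam_smul, zero_smul, map_zero]
    rw [dpow_succ, Pi.smul_apply, map_smul, dpow_zero, mark_plug (κ := 0) (fun n σ => map_zero _)
      (fun n => by rw [mark_of, h0])]
    have : plug (hatAlpha P) (add_zero (-1)).symm (0 : ∀ n, (hat P).V n (-1)) = 0 := by
      funext n
      rw [← zero_smul k (0 : ∀ n, (hat P).V n (-1)), plug_smul, zero_smul]
      simp
    rw [this, h0]
    simp
  | succ w ih =>
    rw [dpow_succ, Pi.smul_apply, map_smul, mark_plug (hinv.dpow _ w) ih, plug_dpow, plugFam_smul, map_smul,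
      ← succ_smul_eq, smul_smul, inv_mul_cancel₀ (Nat.cast_ne_zero.2 (Nat.succ_ne_zero _)), one_smul]

/-- The derivative of the twisted operations. -/
theorem mark_twistedOp (hℓ : Invariant ℓ) (n : ℕ) :
    mark P (twistedOp P ℓ n) = markBimod.mk (hat P) (plugFam (twistedOp P ℓ) n) := by
  refine (markBimod.grading P).eq_of_pi fun w => ?_
  change markBimod.pi P w _ = markBimod.pi P w _
  have e₁ : ∀ κ : ∀ n, (hat P).V n (-1), Fam.pi P w (plugFam κ n) = plugFam (fun n => hat.pi P w (κ n)) n := by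
    intro κ
    cases s
    · exact Fam.pi_sing w _ _
    · refine Prod.ext rfl ?_
      simp only [Fam.pi, plugFam, LinearMap.prodMap_apply]
      exact map_zero _
  rw [pi_mark, pi_twistedOp, mark_dpow hℓ, markBimod.pi_mk, markBimod.pi_mk, e₁, e₁]
  simp only [pi_twistedOp, hat.pi_dpow]

/-- The derivative of the twisted operations in a direction. -/
theorem dsub_twistedOp (hℓ : Invariant ℓ) {T : GrOperad k s} (f : GrHom (hat P) T) {e q : ℤ} (b : T.V 0 e)
    (h : q = -1 + e) (n : ℕ) : (dsub f b).app h (twistedOp P ℓ n)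
      = (e * -1).negOnePow • plug b h (fun n => f.app (twistedOp P ℓ n)) n := by
  rw [dsub_app, mark_twistedOp hℓ, markBimod.ins_mk, ins_plugFam]

end twisted

/-! ### The cofree twisting structure -/

/-- Indices of two generators of degree `-1`, of arity `0` and `1`. -/
inductive ExtGen : ℕ → ℤ → Type
  | zero : ExtGen 0 (-1)
  | one : ExtGen 1 (-1)

/-- The family given by two operations. -/
def ExtGen.val {T : GrOperad k s} (a : T.V 0 (-1)) (b : T.V 1 (-1)) : ∀ n p, ExtGen n p → T.V n p
  | _, _, .zero => a
  | _, _, .one => b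

/-- The family of differentials given by two operations. -/
def ExtGen.dval {T : GrOperad k s} (a : T.V 0 (-2)) (b : T.V 1 (-2)) :
    ∀ n p, ExtGen n p → T.V n (p + -1)
  | _, _, .zero => a
  | _, _, .one => b

theorem GrOperad.adL_self (T : GrOperad k s) (μ : T.V 1 (-1)) :
    T.adL μ (q := -2) rfl μ = T.comp (m := 1) (n := 1) (t := -2) rfl rfl 0 μ μ
      + T.comp (m := 1) (n := 1) (t := -2) rfl rfl 0 μ μ := by
  rw [T.adL_apply, show ((-1 : ℤ) * -1).negOnePow = -1 by decide]
  simp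

/-- The image of a morphism. -/
def GrHom.range {R T : GrOperad k s} (f : GrHom R T) : SubOperad T where
  carrier n p := LinearMap.range (f.app (n := n) (p := p))
  act_mem := by
    rintro n p σ _ ⟨x, rfl⟩
    exact ⟨R.act σ x, f.map_act σ x⟩
  comp_mem := by
    rintro m n r p q t hr ht i _ _ ⟨x, rfl⟩ ⟨y, rfl⟩
    exact ⟨R.comp hr ht i x y, f.map_comp hr ht i x y⟩

/-- A morphism with values in a suboperad. -/
def GrHom.codRestrict {R T : GrOperad k s} (f : GrHom R T) (S : SubOperad T)
    (h : ∀ n p (x : R.V n p), f.app x ∈ S.carrier n p) : GrHom R S.toGrOperad where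
  app {n p} := f.app.codRestrict (S.carrier n p) (h n p)
  map_act σ x := Subtype.ext (f.map_act σ x)
  map_comp hr ht i x y := Subtype.ext (f.map_comp hr ht i x y)

/-- A morphism onto its image. -/
def GrHom.toRange {R T : GrOperad k s} (f : GrHom R T) : GrHom R f.range.toGrOperad :=
  f.codRestrict f.range fun _ _ x => ⟨x, rfl⟩

theorem IsFlat.map {P R : DGOperad k s} (f : DGHom P R) {ℓ : ∀ n, P.V n (-1)}
    (h : IsFlat P ℓ) : IsFlat R (fun n => f.app (ℓ n)) where
  toIsCurved := h.toIsCurved.map f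
  zero_eq := (congrArg f.app h.zero_eq).trans (map_zero _)
  one_eq := (congrArg f.app h.one_eq).trans (map_zero _)

theorem isFlat_gen : IsFlat (flatInf k s) (presentedGen IsFlat) where
  invariant n σ := PresentedV.ext fun P ℓ hP => by
    exact (PresentedV.eval_act P ℓ hP σ (presentedGen IsFlat n)).trans (hP.invariant n σ)
  d_eq n := PresentedV.extL fun P ℓ hP => by
    have h := map_quad (gr (presentedLift P ℓ hP)) (presentedGen IsFlat) n
    refine (PresentedV.eval_d P ℓ hP _ (presentedGen IsFlat n)).trans ((hP.d_eq n).trans ?_)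
    exact ((LinearMap.map_neg _ _).trans (congrArg Neg.neg h)).symm
  zero_eq := PresentedV.ext fun _ _ hP => hP.zero_eq
  one_eq := PresentedV.ext fun _ _ hP => hP.one_eq

theorem isFlat_flatOp (P : Under (flatInf k s)) : IsFlat P.right (flatOp P) :=
  isFlat_gen.map (P := flatInf k s) (R := P.right) P.hom

/-- Operations with one input replaced by `ℓ₀` have weight one. -/
theorem hasWeight_ins {Q : GrOperad k s} {S : SubOperad Q} {ℓ₀ : Q.V 0 (-1)} {ℓ₁ : Q.V 1 (-1)}
    {R : GrOperad k s} (f : GrHom R Q) (hf : ∀ n p (x : R.V n p), f.app x ∈ S.carrier n p)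
    {n : ℕ} {p q : ℤ} (h : q = p + -1) (Y : Fam R n p) :
    HasWeight S ℓ₀ ℓ₁ 1 0 (Fam.ins f ℓ₀ h Y) := by
  induction Y using Fam.induction with
  | h j y =>
    rw [Fam.ins_sing]
    exact HasWeight.comp _ _ _ _ _ (HasWeight.mem _ (hf _ _ y)) HasWeight.ell₀
  | h₀ r =>
    rw [Fam.ins_unit]
    refine HasWeight.smul _ _ ?_
    by_cases hn : 0 = n ∧ -1 = q
    · obtain ⟨rfl, rfl⟩ := hn
      rw [GrOperad.castL_self]
      exact HasWeight.ell₀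
    · rw [GrOperad.castL_of_ne _ hn]
      exact HasWeight.zero _ _ _ _
  | ha Y Y' hY hY' =>
    rw [map_add]
    exact HasWeight.add _ _ hY hY'

namespace cofree

section

variable (P : DGOperad k s) (ℓ : ∀ n, P.V n (-1))

/-- The graded operad `hat P ∨ [ℓ₀] ∨ [ℓ₁]`. -/
def op : GrOperad k s := adj (hat P.toGrOperad) ExtGen

/-- The series in `α`, as operations. -/
def inc : GrHom (hat P.toGrOperad) (op P) := adj.of _ _

/-- The generators `ℓ₀` and `ℓ₁`. -/
def gen : ∀ n p, ExtGen n p → (op P).V n p := adj.gen _ _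

theorem isFree : IsFreeOn (inc P) (gen P) := adj.isFreeOn _ _

/-- The difference of `ℓ₀` and the twisted operation. -/
def u : (op P).V 0 (-1) := gen P 0 (-1) .zero - (inc P).app (twistedOp P.toGrOperad ℓ 0)

/-- The difference of `ℓ₁` and the twisted operation. -/
def m : (op P).V 1 (-1) := gen P 1 (-1) .one - (inc P).app (twistedOp P.toGrOperad ℓ 1)

theorem gen_zero : gen P 0 (-1) .zero = (inc P).app (twistedOp P.toGrOperad ℓ 0) + u P ℓ := by
  rw [u, add_sub_cancel]

theorem gen_one : gen P 1 (-1) .one = (inc P).app (twistedOp P.toGrOperad ℓ 1) + m P ℓ := by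
  rw [m, add_sub_cancel]

/-- The part of the differential that comes from the differential of `P`. -/
def dInner : Deriv (GrHom.id (op P)) (-1) :=
  (isFree P).deriv (GrHom.id _) ((hatDeriv P.dDeriv).postcomp (inc P)) (ExtGen.dval
    ((inc P).app ((hatDeriv P.dDeriv).app rfl (twistedOp P.toGrOperad ℓ 0)))
    ((inc P).app ((hatDeriv P.dDeriv).app rfl (twistedOp P.toGrOperad ℓ 1))
      + (op P).comp (m := 1) (n := 1) rfl rfl 0 (m P ℓ) (m P ℓ)))

/-- The part of the differential that replaces `α`. -/
def dAlpha : Deriv (GrHom.id (op P)) (-1) :=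
  (isFree P).deriv (GrHom.id _) (dsub (inc P) (u P ℓ)) (ExtGen.dval
    ((dsub (inc P) (u P ℓ)).app rfl (twistedOp P.toGrOperad ℓ 0))
    ((dsub (inc P) (u P ℓ)).app rfl (twistedOp P.toGrOperad ℓ 1)))

/-- The differential. -/
def d : Deriv (GrHom.id (op P)) (-1) :=
  ((dInner P ℓ).add (dAlpha P ℓ)).add ((op P).ad (m P ℓ)).neg

variable {n : ℕ} {p q : ℤ}

theorem dInner_inc (h : q = p + -1) (x : (hat P.toGrOperad).V n p) :
    (dInner P ℓ).app h ((inc P).app x) = (inc P).app ((hatDeriv P.dDeriv).app h x) :=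
  (isFree P).deriv_ι _ _ _ h x

theorem dAlpha_inc (h : q = p + -1) (x : (hat P.toGrOperad).V n p) :
    (dAlpha P ℓ).app h ((inc P).app x) = (dsub (inc P) (u P ℓ)).app h x :=
  (isFree P).deriv_ι _ _ _ h x

theorem dInner_u : (dInner P ℓ).app (q := -2) rfl (u P ℓ) = 0 := by
  rw [u, map_sub, dInner_inc]
  exact sub_eq_zero.2 ((isFree P).deriv_gen _ _ _ ExtGen.zero)

theorem dInner_m : (dInner P ℓ).app (q := -2) rfl (m P ℓ)
    = (op P).comp (m := 1) (n := 1) rfl rfl 0 (m P ℓ) (m P ℓ) := by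
  nth_rewrite 1 [m]
  rw [map_sub, dInner_inc]
  exact sub_eq_iff_eq_add'.2 ((isFree P).deriv_gen _ _ _ ExtGen.one)

theorem dAlpha_u : (dAlpha P ℓ).app (q := -2) rfl (u P ℓ) = 0 := by
  change (dAlpha P ℓ).app (q := -2) rfl (gen P 0 (-1) .zero - (inc P).app _) = 0
  rw [map_sub, dAlpha_inc]
  exact sub_eq_zero.2 ((isFree P).deriv_gen _ _ _ ExtGen.zero)

theorem dAlpha_m : (dAlpha P ℓ).app (q := -2) rfl (m P ℓ) = 0 := by
  rw [m, map_sub, dAlpha_inc]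
  exact sub_eq_zero.2 ((isFree P).deriv_gen _ _ _ ExtGen.one)

theorem d_apply (h : q = p + -1) (x : (op P).V n p) : (d P ℓ).app h x
    = (dInner P ℓ).app h x + (dAlpha P ℓ).app h x - (op P).adL (m P ℓ) h x :=
  (sub_eq_add_neg _ _).symm

theorem d_inc (h : q = p + -1) (x : (hat P.toGrOperad).V n p) : (d P ℓ).app h ((inc P).app x)
    = (inc P).app ((hatDeriv P.dDeriv).app h x) + (dsub (inc P) (u P ℓ)).app h x
      - (op P).adL (m P ℓ) h ((inc P).app x) := by
  rw [d_apply, dInner_inc, dAlpha_inc]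

theorem d_u : (d P ℓ).app (q := -2) rfl (u P ℓ)
    = - (op P).comp (m := 1) (n := 0) rfl rfl 0 (m P ℓ) (u P ℓ) := by
  rw [d_apply, dInner_u, dAlpha_u, GrOperad.adL_arity_zero]
  exact (congrArg (· - _) (add_zero 0)).trans (zero_sub _)

theorem d_m : (d P ℓ).app (q := -2) rfl (m P ℓ)
    = - (op P).comp (m := 1) (n := 1) rfl rfl 0 (m P ℓ) (m P ℓ) := by
  rw [d_apply, dInner_m, dAlpha_m, GrOperad.adL_self]
  abel

variable [CharZero k]

theorem d_d_inc (x : (hat P.toGrOperad).V n p) :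
    (d P ℓ).app (q := p + -1 + -1) rfl ((d P ℓ).app rfl ((inc P).app x)) = 0 := by
  have h₁ : (dInner P ℓ).app (q := p + -1 + -1) rfl ((dsub (inc P) (u P ℓ)).app rfl x)
      = - (dsub (inc P) (u P ℓ)).app rfl ((hatDeriv P.dDeriv).app rfl x) := by
    refine (dsub_hatDeriv P.dDeriv (inc P) (dInner P ℓ) (fun h x => dInner_inc P ℓ h x) (u P ℓ)
      rfl (dInner_u P ℓ) rfl rfl rfl x).trans ?_
    rw [show ((-1 : ℤ) * -1).negOnePow = -1 by decide]
    simp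
  have h₂ : (dAlpha P ℓ).app (q := p + -1 + -1) rfl ((dsub (inc P) (u P ℓ)).app rfl x) = 0 :=
    dsub_dsub (inc P) (u P ℓ) (dAlpha P ℓ) (fun h x => dAlpha_inc P ℓ h x) (dAlpha_u P ℓ) rfl rfl x
  have h₃ := (d P ℓ).map_adL (m P ℓ) (q := p + -1) (t := p + -1 + -1) rfl rfl (e'' := -2) rfl rfl
    ((inc P).app x)
  rw [d_m, GrOperad.adL_neg, ← GrOperad.adL_adL (op P) (m P ℓ) (q := p + -1) rfl rfl,
    show ((-1 : ℤ) * -1).negOnePow = -1 by decide, d_inc, map_sub, map_add] at h₃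
  rw [d_inc, map_sub, map_add, d_inc, d_apply P ℓ _ ((dsub (inc P) (u P ℓ)).app rfl x), h₁, h₂, h₃,
    hatDeriv_hatDeriv P.dDeriv (fun _ _ x => P.d_d _ _ x), map_zero]
  simp only [Units.neg_smul, one_smul]
  abel

theorem d_comp_m {n : ℕ} (z : (op P).V n (-1)) (hz : (d P ℓ).app (q := -2) rfl z
      = - (op P).comp (t := -2) (Nat.add_comm n 1) rfl 0 (m P ℓ) z) :
    (d P ℓ).app (q := -3) rfl ((op P).comp (t := -2) (Nat.add_comm n 1) rfl 0 (m P ℓ) z) = 0 := by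
  refine ((d P ℓ).map_comp_id (m := 1) (p' := -2) (q' := -2) (Nat.add_comm n 1) rfl rfl rfl rfl rfl
    rfl 0 (m P ℓ) z).trans ?_
  rw [hz, d_m,
    show ((-1 : ℤ) * -1).negOnePow = -1 by decide, map_neg, map_neg, LinearMap.neg_apply,
    Units.neg_smul, one_smul, neg_neg]
  exact neg_add_eq_zero.2 ((op P).comp_seq (l := 1) (m := 1) (n := n) (a := 1) (b := n) (r := n)
    (p := -1) (q := -1) (t := -1) (pq := -2) (qt := -2) (e := -3) rfl (Nat.add_comm n 1)
    (Nat.add_comm n 1) (Nat.add_comm n 1) rfl rfl rfl rfl 0 0 0 rfl (m P ℓ) (m P ℓ) z)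

theorem d_d {t : ℤ} (hq : q = p + -1) (ht : t = q + -1) (x : (op P).V n p) :
    (d P ℓ).app ht ((d P ℓ).app hq x) = 0 := by
  refine (isFree P).deriv_sq (d P ℓ) (fun n p x => d_d_inc P ℓ x) (fun n p x => ?_) hq ht x
  cases x with
  | zero =>
    rw [gen_zero P ℓ, map_add, map_add, d_d_inc]
    refine (zero_add _).trans ?_
    refine (congrArg _ (d_u P ℓ)).trans ((map_neg _ _).trans (neg_eq_zero.2 ?_))
    exact d_comp_m P ℓ _ (d_u P ℓ)
  | one =>
    rw [gen_one P ℓ, map_add, map_add, d_d_inc]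
    refine (zero_add _).trans ?_
    refine (congrArg _ (d_m P ℓ)).trans ((map_neg _ _).trans (neg_eq_zero.2 ?_))
    exact d_comp_m P ℓ _ (d_m P ℓ)

/-- The dg operad underlying the cofree twisting structure. -/
def dg : DGOperad k s := DGOperad.ofDeriv (op P) (d P ℓ) (fun hq ht x => d_d P ℓ hq ht x)

/-- The operations of the curved structure. -/
def curved (n : ℕ) : (op P).V n (-1) :=
  (inc P).app (twistedOp P.toGrOperad ℓ n) + (op P).castL n (-1) (u P ℓ)
    + (op P).castL n (-1) (m P ℓ)

theorem curved_zero : curved P ℓ 0 = gen P 0 (-1) .zero := by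
  rw [curved, GrOperad.castL_self, GrOperad.castL_of_ne _ (by decide), gen_zero P ℓ]
  exact add_zero _

theorem curved_one : curved P ℓ 1 = gen P 1 (-1) .one := by
  rw [curved, GrOperad.castL_self, GrOperad.castL_of_ne _ (by decide), gen_one P ℓ]
  exact congrArg (· + _) (add_zero _)

theorem curved_of_lt {n : ℕ} (hn : 1 < n) :
    curved P ℓ n = (inc P).app (twistedOp P.toGrOperad ℓ n) := by
  rw [curved, GrOperad.castL_of_ne _ (by omega), GrOperad.castL_of_ne _ (by omega)]
  exact (add_zero _).trans (add_zero _)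

theorem isCurved {ℓ : ∀ n, P.V n (-1)} (hℓ : IsCurved P ℓ) : IsCurved (dg P ℓ) (curved P ℓ) where
  invariant n σ := by
    change (op P).act σ (curved P ℓ n) = curved P ℓ n
    rcases n with _ | _ | n
    · rw [Subsingleton.elim σ 1]
      simp
    · rw [show σ = 1 from Subtype.ext (Equiv.ext fun i => Subsingleton.elim (α := Fin 1) _ _)]
      simp
    · rw [curved_of_lt P ℓ (by omega), ← (inc P).map_act,
        twistedOp_invariant hℓ.invariant]
  d_eq n := by
    change (d P ℓ).app (q := -2) rfl (curved P ℓ n) = - quad (op P) (curved P ℓ) n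
    have hinv : Invariant (fun n => (inc P).app (twistedOp P.toGrOperad ℓ n)) := fun n σ => by
      rw [← (inc P).map_act, twistedOp_invariant hℓ.invariant]
    refine Eq.trans ?_ (congrArg Neg.neg (quad_add_castL hinv (u P ℓ) (m P ℓ) n).symm)
    rw [curved, map_add, map_add, d_inc, hatDeriv_twistedOp hℓ.invariant P.dDeriv hℓ.d_eq,
      dsub_twistedOp hℓ.invariant, map_neg, map_quad,
      Fam.app_castL (d P ℓ) (q := -2) rfl rfl, Fam.app_castL (d P ℓ) (q := -2) rfl rfl, d_u, d_m,
      map_neg, map_neg, show ((-1 : ℤ) * -1).negOnePow = -1 by decide, Units.neg_smul, one_smul]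
    abel

theorem isFreeExtension : IsFreeExtension (inc P).range (curved P ℓ 0) (curved P ℓ 1) := by
  intro R φ a b
  rw [curved_zero, curved_one]
  refine ⟨(isFree P).lift ((inc P).toRange.trans φ) (ExtGen.val a b), ⟨GrHom.ext ?_,
    (isFree P).lift_gen _ _ ExtGen.zero, (isFree P).lift_gen _ _ ExtGen.one⟩, ?_⟩
  · rintro n p ⟨_, x, rfl⟩
    exact (isFree P).lift_ι _ _ x
  · rintro ψ ⟨h, h₀, h₁⟩
    refine (isFree P).hom_ext (fun n p x => ?_) (fun n p x => ?_)
    · rw [(isFree P).lift_ι]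
      exact congrArg (fun f : GrHom (inc P).range.toGrOperad R => f.app ((inc P).toRange.app x)) h
    · rw [(isFree P).lift_gen]
      cases x
      exacts [h₀, h₁]

theorem d_add_bracket (h : p = q + 1) (x : (hat P.toGrOperad).V n p) :
    ∃ (y : (hat P.toGrOperad).V n q) (Y : Fam (hat P.toGrOperad) n p),
      markBimod.mk _ Y = mark P.toGrOperad x ∧
      y = (hatDeriv P.dDeriv).app (by omega) x
        + (hat P.toGrOperad).adL (twistedOp P.toGrOperad ℓ 1) (by omega) x
        - (dsub (GrHom.id _) (twistedOp P.toGrOperad ℓ 0)).app (by omega) x ∧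
      (d P ℓ).app (by omega) ((inc P).app x)
        + (op P).bracket (gen P 1 (-1) .one) h ((inc P).app x)
      = (inc P).app y + (-1 * p).negOnePow • Fam.ins (inc P) (gen P 0 (-1) .zero) (by omega) Y := by
  obtain ⟨Y, hY⟩ : ∃ Y, markBimod.mk _ Y = mark P.toGrOperad x := ⟨_, markBimod.mk_nf _⟩
  refine ⟨_, Y, hY, rfl, ?_⟩
  rw [(op P).bracket_eq, d_inc, gen_one P ℓ, GrOperad.adL_add, gen_zero P ℓ, Fam.ins_add, dsub_app,
    dsub_app, ← hY, markBimod.ins_mk, markBimod.ins_mk, map_sub, map_add, map_sgn, Fam.map_ins,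
    GrHom.map_adL, smul_add]
  change _ = _ - _ • Fam.ins (inc P) _ _ Y + _
  abel

end

end cofree

/-- The cofree twisting structure on an operad under `L∞`. -/
def cofreeTwist [CharZero k] (P : Under (flatInf k s)) : Twist k s where
  Q := cofree.dg P.right (flatOp P)
  str := presentedLift _ (cofree.curved P.right (flatOp P))
    (cofree.isCurved P.right (isFlat_flatOp P).toIsCurved)
  Q00 := (cofree.inc P.right).range
  free := cofree.isFreeExtension P.right (flatOp P)
  op_mem n hn := ⟨_, (cofree.curved_of_lt P.right (flatOp P) hn).symm⟩
  d_add_bracket := by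
    rintro n p q h _ ⟨x, rfl⟩
    obtain ⟨y, Y, -, -, hy⟩ := cofree.d_add_bracket P.right (flatOp P) h x
    refine ⟨_, _, HasWeight.mem _ ⟨y, rfl⟩, ?_,
      (congrArg (fun m => _ + (cofree.op P.right).bracket m h _)
        (cofree.curved_one P.right (flatOp P))).trans hy⟩
    change HasWeight (cofree.inc P.right).range (cofree.curved P.right (flatOp P) 0)
      (cofree.curved P.right (flatOp P) 1) 1 0 _
    rw [← map_sgn, cofree.curved_zero]
    exact hasWeight_ins (S := (cofree.inc P.right).range) (cofree.inc P.right) (fun _ _ x => ⟨x, rfl⟩) (by omega) _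

/-! ### Evaluation of series -/

namespace hat

variable {P T U : GrOperad k s}

/-- The series `∑ t ^ w x_w(a)`. -/
def series (φ : GrHom P T) (a : T.V 0 0) : GrHom (hat P) (ps T) where
  app := LinearMap.pi fun w => CoprodV.evalL T φ a ∘ₗ coeff P w
  map_act σ x := funext fun w => CoprodV.evalL_act T φ a σ (coeff P w x)
  map_comp hr ht i x y := funext fun w => HatV.ev_compL T φ a hr ht i x y w

theorem coeff_series (φ : GrHom P T) (a : T.V 0 0) {n : ℕ} {p : ℤ} (w : ℕ) (x : (hat P).V n p) :
    ps.coeff T w ((series φ a).app x) = CoprodV.evalL T φ a (coeff P w x) := rfl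

theorem series_single (φ : GrHom P T) (a : T.V 0 0) {n : ℕ} {p : ℤ} {w : ℕ} (x : CoprodV P n p w) :
    (series φ a).app (single P w x) = ps.mono T w (CoprodV.evalL T φ a x) := by
  refine ps.ext fun v => ?_
  rw [coeff_series, ps.coeff_mono]
  split_ifs with h
  · subst h
    rw [coeff_single_same]
  · rw [coeff_single_of_ne h, map_zero]

theorem series_of (φ : GrHom P T) (a : T.V 0 0) {n : ℕ} {p : ℤ} (x : P.V n p) :
    (series φ a).app (hatOf x) = ps.mono T 0 (φ.app x) := series_single φ a (CoprodV.of x)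

theorem series_alpha (φ : GrHom P T) (a : T.V 0 0) :
    (series φ a).app (hatAlpha P) = ps.mono T 1 a := series_single φ a (CoprodV.alpha P)

theorem map_series (φ : GrHom P T) (a : T.V 0 0) (g : GrHom T U) :
    (series φ a).trans (ps.map g) = series (φ.trans g) (g.app a) :=
  GrHom.ext fun _ _ x => funext fun w => GrHom.map_eval φ a g (coeff P w x)

theorem coeff_series_pi (φ : GrHom P T) (a : T.V 0 0) {n : ℕ} {p : ℤ} (w : ℕ) (x : (hat P).V n p) :
    ps.coeff T w ((series φ a).app (pi P w x)) = ps.coeff T w ((series φ a).app x) := by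
  rw [coeff_series, coeff_series, pi_apply, coeff_single_same]

theorem map_single (f : GrHom (hat P) T) {n : ℕ} {p : ℤ} {w : ℕ} (x : CoprodV P n p w) :
    f.app (single P w x) = CoprodV.evalL T ((of P).trans f) (f.app (hatAlpha P)) x := by
  rw [← evalL_self]
  exact GrHom.map_eval (of P) (hatAlpha P) f x

/-- Derivations that agree on `P` and `α` agree on finite sums. -/
theorem deriv_single_congr {f : GrHom (hat P) T} {e : ℤ} (D D' : Deriv f e)
    (h : ∀ {n : ℕ} {p : ℤ} (x : P.V n p), D.app rfl (hatOf x) = D'.app rfl (hatOf x))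
    (h' : D.app rfl (hatAlpha P) = D'.app rfl (hatAlpha P)) {n : ℕ} {p q : ℤ} (hq : q = p + e)
    {w : ℕ} (x : CoprodV P n p w) : D.app hq (single P w x) = D'.app hq (single P w x) := by
  subst hq
  have e₁ : (of P).trans D.toDual = (of P).trans D'.toDual :=
    GrHom.ext fun n p x => Prod.ext rfl (h x)
  have e₂ : D.toDual.app (hatAlpha P) = D'.toDual.app (hatAlpha P) := Prod.ext rfl h'
  have e₃ : D.toDual.app (single P w x) = D'.toDual.app (single P w x) := by
    rw [map_single, map_single, e₁, e₂]
  exact congrArg Prod.snd e₃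

end hat

theorem ps.coeff_castL {T : GrOperad k s} (w : ℕ) {m m' : ℕ} {p p' : ℤ} (x : (ps T).V m p) :
    ps.coeff T w ((ps T).castL m' p' x) = T.castL m' p' (ps.coeff T w x) := by
  by_cases h : m = m' ∧ p = p'
  · obtain ⟨rfl, rfl⟩ := h
    rw [GrOperad.castL_self, GrOperad.castL_self]
  · rw [GrOperad.castL_of_ne _ h, GrOperad.castL_of_ne _ h, map_zero]

section insSeries

variable {P T : GrOperad k s} (φ : GrHom P T) (a : T.V 0 0) {e : ℤ} (b : T.V 0 e) {n : ℕ} {p q : ℤ}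
  (h : q = p + e)

theorem coeff_succ_ins (w : ℕ) (Y : Fam (hat P) n p) :
    ps.coeff T (w + 1) (Fam.ins (hat.series φ a) (ps.mono T 1 b) h (Fam.pi P w Y))
      = ps.coeff T (w + 1) (Fam.ins (hat.series φ a) (ps.mono T 1 b) h Y) := by
  induction Y using Fam.induction with
  | h j y =>
    rw [Fam.pi_sing, Fam.ins_sing, Fam.ins_sing, ps.coeff_comp_mono, ps.coeff_comp_mono,
      hat.coeff_series_pi]
  | h₀ r =>
    rw [Fam.pi_unit]
    split_ifs with hw
    · rfl
    · rw [map_zero, map_zero, Fam.ins_unit, map_smul, ps.coeff_castL, ps.coeff_mono,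
        if_neg (by omega), map_zero, smul_zero]
  | ha Y Y' hY hY' => simp only [map_add, hY, hY']

theorem coeff_zero_ins (Y : Fam (hat P) n p) :
    ps.coeff T 0 (Fam.ins (hat.series φ a) (ps.mono T 1 b) h Y) = 0 := by
  induction Y using Fam.induction with
  | h j y => rw [Fam.ins_sing, ps.coeff_comp_mono_lt _ _ _ _ Nat.one_pos]
  | h₀ r =>
    rw [Fam.ins_unit, map_smul, ps.coeff_castL, ps.coeff_mono, if_neg (by omega), map_zero,
      smul_zero]
  | ha Y Y' hY hY' => rw [map_add, map_add, hY, hY', add_zero]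

theorem coeff_ins_of (f : GrHom (hat P) T) (w : ℕ) (Y : Fam (hat P) n p) :
    ps.coeff T (w + 1) (Fam.ins (hat.series ((hat.of P).trans f) (f.app (hatAlpha P)))
      (ps.mono T 1 b) h Y) = Fam.ins f b h (Fam.pi P w Y) := by
  induction Y using Fam.induction with
  | h j y =>
    rw [Fam.pi_sing, Fam.ins_sing, Fam.ins_sing, ps.coeff_comp_mono, hat.pi_apply, hat.map_single]
    rfl
  | h₀ r =>
    rw [Fam.pi_unit, Fam.ins_unit, map_smul, ps.coeff_castL, ps.coeff_mono]
    split_ifs with hw hw'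
    · rw [Fam.ins_unit]
    · omega
    · omega
    · rw [map_zero, map_zero, smul_zero]
  | ha Y Y' hY hY' => simp only [map_add, hY, hY']

end insSeries

/-- A family vanishes if all insertions of odd elements vanish. -/
theorem Fam.norm_eq_zero_odd {R : GrOperad k s} {n : ℕ} {p : ℤ} {Y : Fam R n p}
    (h : ∀ (T : GrOperad k s) (f : GrHom R T) (b : T.V 0 (-1)), Fam.ins f b (q := p + -1) rfl Y = 0) :
    Fam.norm R Y = 0 := by
  refine Fam.norm_eq_zero fun T f b => ?_
  have key : ∀ Y : Fam R n p, dualSnd T 1 (Fam.ins (q := p + -1)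
      (f.trans (sqZeroInl T (shiftBimod T 1))) (sqZeroInr T (shiftBimod T 1) (n := 0) (p := -1) b)
      rfl Y) = (1 * p).negOnePow • Fam.ins (q := p + -1 + 1) f b (by omega) Y := by
    intro Y
    induction Y using Fam.induction with
    | h j y =>
      rw [Fam.ins_sing, Fam.ins_sing]
      refine (congrArg (· + _) (map_zero ((shiftBimod T 1).rcomp (n := 0) (r := n) (q := -1) rfl rfl j
        (0 : (shiftBimod T 1).V (n + 1) p)))).trans (zero_add _)
    | h₀ r =>
      rw [Fam.ins_unit, Fam.ins_unit, map_smul]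
      by_cases hn : n = 0 ∧ p = 0
      · obtain ⟨rfl, rfl⟩ := hn
        change r • dualSnd T 1 ((dual T 1).castL 0 (-1) _) = (0 : ℤ).negOnePow • r • T.castL 0 0 b
        rw [GrOperad.castL_self, GrOperad.castL_self, Int.negOnePow_zero, one_smul]
        rfl
      · rw [GrOperad.castL_of_ne _ (by omega), GrOperad.castL_of_ne _ (by omega)]
        simp
    | ha Y Y' hY hY' => simp only [map_add, hY, hY', smul_add]
  have h₁ := key Y
  rw [h, map_zero] at h₁
  have h₂ : ∀ q (hq : q = p + 0), q = p + -1 + 1 → Fam.ins f b hq Y = 0 := by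
    rintro q hq rfl
    exact (smul_eq_zero_iff_eq _).1 h₁.symm
  exact h₂ _ _ (by omega)

/-! ### Paths of elements -/

/-- Indices of two generators of arity `0`, of degree `0` and `-1`. -/
inductive PathGen : ℕ → ℤ → Type
  | alpha : PathGen 0 0
  | dot : PathGen 0 (-1)

/-- The family given by two elements. -/
def PathGen.val {T : GrOperad k s} (a : T.V 0 0) (b : T.V 0 (-1)) : ∀ n p, PathGen n p → T.V n p
  | _, _, .alpha => a
  | _, _, .dot => b

/-- The family of differentials given by two elements. -/
def PathGen.dval {T : GrOperad k s} (a : T.V 0 (-1)) (b : T.V 0 (-2)) :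
    ∀ n p, PathGen n p → T.V n (p + -1)
  | _, _, .alpha => a
  | _, _, .dot => b

namespace path

variable (Q : DGOperad k s)

/-- The graded operad obtained from `Q` by adjoining an element `α` and its differential. -/
def op : GrOperad k s := adj Q.toGrOperad PathGen

/-- The inclusion of `Q`. -/
def inc : GrHom Q.toGrOperad (op Q) := adj.of _ _

/-- The element `α`. -/
def alpha : (op Q).V 0 0 := adj.gen Q.toGrOperad PathGen 0 0 .alpha

/-- The differential of `α`. -/
def dot : (op Q).V 0 (-1) := adj.gen Q.toGrOperad PathGen 0 (-1) .dot

theorem isFree : IsFreeOn (inc Q) (PathGen.val (alpha Q) (dot Q)) := by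
  have h : PathGen.val (alpha Q) (dot Q) = adj.gen Q.toGrOperad PathGen := by
    funext n p x
    cases x <;> rfl
  rw [h]
  exact adj.isFreeOn Q.toGrOperad PathGen

/-- The differential. -/
def d : Deriv (GrHom.id (op Q)) (-1) :=
  (isFree Q).deriv (GrHom.id _) (Q.dDeriv.postcomp (inc Q)) (PathGen.dval (dot Q) 0)

variable {n : ℕ} {p q : ℤ}

theorem d_inc (h : q = p + -1) (x : Q.V n p) :
    (d Q).app h ((inc Q).app x) = (inc Q).app (Q.d (by omega) x) :=
  (isFree Q).deriv_ι _ _ _ h x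

theorem d_alpha : (d Q).app (q := -1) rfl (alpha Q) = dot Q :=
  (isFree Q).deriv_gen _ _ _ PathGen.alpha

theorem d_dot : (d Q).app (q := -2) rfl (dot Q) = 0 := (isFree Q).deriv_gen _ _ _ PathGen.dot

theorem d_d {t : ℤ} (hq : q = p + -1) (ht : t = q + -1) (x : (op Q).V n p) :
    (d Q).app ht ((d Q).app hq x) = 0 := by
  refine (isFree Q).deriv_sq (d Q) (fun n p x => ?_) (fun n p x => ?_) hq ht x
  · rw [d_inc, d_inc, Q.d_d, map_zero]
  · cases x with
    | alpha => exact (congrArg _ (d_alpha Q)).trans (d_dot Q)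
    | dot => exact (congrArg _ (d_dot Q)).trans (map_zero _)

variable {Q} {R : DGOperad k s}

/-- The morphism induced by a morphism of dg operads. -/
def map (g : GrHom Q.toGrOperad R.toGrOperad) : GrHom (op Q) (op R) :=
  (isFree Q).lift (g.trans (inc R)) (PathGen.val (alpha R) (dot R))

theorem map_inc (g : GrHom Q.toGrOperad R.toGrOperad) (x : Q.V n p) :
    (map g).app ((inc Q).app x) = (inc R).app (g.app x) := (isFree Q).lift_ι _ _ x

theorem map_alpha (g : GrHom Q.toGrOperad R.toGrOperad) : (map g).app (alpha Q) = alpha R :=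
  (isFree Q).lift_gen _ _ PathGen.alpha

theorem map_dot (g : GrHom Q.toGrOperad R.toGrOperad) : (map g).app (dot Q) = dot R :=
  (isFree Q).lift_gen _ _ PathGen.dot

theorem map_d (g : GrHom Q.toGrOperad R.toGrOperad) (hg : ∀ {n : ℕ} {p q : ℤ} (h : p = q + 1)
      (x : Q.V n p), g.app (Q.d h x) = R.d h (g.app x)) (h : q = p + -1) (x : (op Q).V n p) :
    (map g).app ((d Q).app h x) = (d R).app h ((map g).app x) := by
  refine (isFree Q).comm_deriv (map g) (d Q) (d R) (fun n p x => ?_) (fun n p x => ?_) h x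
  · rw [d_inc, map_inc, map_inc, d_inc, hg]
  · cases x with
    | alpha =>
      exact (congrArg _ (d_alpha Q)).trans ((map_dot g).trans
        ((d_alpha R).symm.trans (congrArg _ (map_alpha g).symm)))
    | dot =>
      refine (congrArg _ (d_dot Q)).trans ((map_zero _).trans ?_)
      exact ((congrArg _ (map_dot g)).trans (d_dot R)).symm

variable (Q) in
/-- The series `∑ t ^ w x_w(α)`. -/
def series : GrHom (hat Q.toGrOperad) (ps (op Q)) := hat.series (inc Q) (alpha Q)

theorem series_injective {x : (hat Q.toGrOperad).V n p} (h : (series Q).app x = 0) : x = 0 := by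
  refine HatV.ext fun R φ a w => ?_
  have e₁ := congrArg (fun y => ((isFree Q).lift φ (PathGen.val a 0)).app (ps.coeff (op Q) w y)) h
  simp only [map_zero] at e₁
  refine Eq.trans ?_ (e₁.trans (map_zero _).symm)
  refine Eq.trans ?_ (GrHom.map_eval (inc Q) (alpha Q) _ _).symm
  rw [(isFree Q).trans_lift]
  exact congrArg (fun b => CoprodV.evalL R φ b _)
    ((isFree Q).lift_gen φ (PathGen.val a 0) PathGen.alpha).symm

/-- The differential of a series. -/
theorem d_series (h : q = p + -1) (x : (hat Q.toGrOperad).V n p) :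
    (ps.deriv (d Q)).app h ((series Q).app x) = (series Q).app ((hatDeriv Q.dDeriv).app h x)
      + (dsub (series Q) (ps.mono (op Q) 1 (dot Q))).app h x := by
  let D : Deriv (series Q) (-1) := (ps.deriv (d Q)).precomp (series Q)
  let D' : Deriv (series Q) (-1) := ((hatDeriv Q.dDeriv).postcomp (series Q)).add
    (dsub (series Q) (ps.mono (op Q) 1 (dot Q)))
  have e₁ : ∀ (w : ℕ) (c : CoprodV Q.toGrOperad n p w),
      D.app h (hat.single Q.toGrOperad w c) = D'.app h (hat.single Q.toGrOperad w c) := by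
    intro w c
    refine hat.deriv_single_congr D D' (fun {n p} x => ?_) ?_ h c
    · change (ps.deriv (d Q)).app rfl ((series Q).app (hatOf x))
        = (series Q).app ((hatDeriv Q.dDeriv).app rfl (hatOf x))
          + (dsub (series Q) (ps.mono (op Q) 1 (dot Q))).app rfl (hatOf x)
      rw [dsub_of, hatDeriv_of]
      refine Eq.trans ?_ (add_zero _).symm
      refine ((congrArg _ (hat.series_of (inc Q) (alpha Q) x)).trans ?_).trans
        (hat.series_of (inc Q) (alpha Q) _).symm
      refine ps.ext fun v => ?_
      rw [ps.coeff_deriv, ps.coeff_mono, ps.coeff_mono]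
      split_ifs
      · exact d_inc Q rfl x
      · exact map_zero _
    · change (ps.deriv (d Q)).app rfl ((series Q).app (hatAlpha _))
        = (series Q).app ((hatDeriv Q.dDeriv).app rfl (hatAlpha _))
          + (dsub (series Q) (ps.mono (op Q) 1 (dot Q))).app rfl (hatAlpha _)
      rw [hatDeriv_alpha]
      refine ((congrArg _ (hat.series_alpha (inc Q) (alpha Q))).trans ?_).trans
        ((congrArg₂ (· + ·) (map_zero _) (dsub_alpha _ _ rfl)).trans (zero_add _)).symm
      refine ps.ext fun v => ?_
      rw [ps.coeff_deriv, ps.coeff_mono, ps.coeff_mono]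
      split_ifs
      · exact d_alpha Q
      · exact map_zero _
  refine ps.ext fun w => ?_
  have e₂ := congrArg (ps.coeff (op Q) w) (e₁ w (hat.coeff Q.toGrOperad w x))
  rw [← hat.pi_apply] at e₂
  refine Eq.trans (congrArg ((d Q).app h) (hat.coeff_series_pi (inc Q) (alpha Q) w x)).symm
    (e₂.trans ?_)
  refine (map_add _ _ _).trans ((congrArg₂ (· + ·) ?_ ?_).trans (map_add _ _ _).symm)
  · refine Eq.trans (congrArg (fun y => ps.coeff (op Q) w ((series Q).app y))
      (pi_hatDeriv Q.dDeriv h x w).symm) (hat.coeff_series_pi (inc Q) (alpha Q) w _)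
  · have e₃ : ∀ Z : (markBimod (hat Q.toGrOperad)).V n p, ∀ v,
        ps.coeff (op Q) (v + 1) (markBimod.ins (series Q) (ps.mono (op Q) 1 (dot Q)) h Z)
          = ps.coeff (op Q) (v + 1) (markBimod.ins (series Q) (ps.mono (op Q) 1 (dot Q)) h
            (markBimod.pi Q.toGrOperad v Z)) := by
      intro Z v
      induction Z using markBimod.induction with | h Z
      exact (coeff_succ_ins (inc Q) (alpha Q) (dot Q) h v Z).symm
    have e₄ : ∀ Z : (markBimod (hat Q.toGrOperad)).V n p,
        ps.coeff (op Q) 0 (markBimod.ins (series Q) (ps.mono (op Q) 1 (dot Q)) h Z) = 0 := by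
      intro Z
      induction Z using markBimod.induction with | h Z
      exact coeff_zero_ins (inc Q) (alpha Q) (dot Q) h Z
    rw [dsub_app, dsub_app, map_sgn, map_sgn]
    rcases w with _ | w
    · rw [e₄, e₄]
    · rw [e₃, e₃ (mark _ x), pi_mark x]

/-- Insertion of the differential of `α` is faithful. -/
theorem mk_eq_zero (h : q = p + -1) {Y : Fam (hat Q.toGrOperad) n p}
    (hY : Fam.ins (series Q) (ps.mono (op Q) 1 (dot Q)) h Y = 0) : markBimod.mk _ Y = 0 := by
  subst h
  refine (markBimod.grading Q.toGrOperad).eq_of_pi fun w => ?_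
  change markBimod.pi _ w _ = markBimod.pi _ w _
  rw [map_zero, markBimod.pi_mk, markBimod.mk_eq_zero]
  refine Fam.norm_eq_zero_odd fun T f b => ?_
  rw [← coeff_ins_of b rfl f w Y]
  let g := (isFree Q).lift ((hat.of Q.toGrOperad).trans f) (PathGen.val (f.app (hatAlpha _)) b)
  have e₁ : (series Q).trans (ps.map g)
      = hat.series ((hat.of Q.toGrOperad).trans f) (f.app (hatAlpha _)) := by
    refine (hat.map_series (inc Q) (alpha Q) g).trans ?_
    rw [(isFree Q).trans_lift]
    exact congrArg _ ((isFree Q).lift_gen _ _ PathGen.alpha)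
  have e₂ := congrArg (ps.map g).app hY
  have e₃ : g.app (dot Q) = b := (isFree Q).lift_gen _ _ PathGen.dot
  rw [Fam.map_ins, e₁, ps.map_mono, map_zero, e₃] at e₂
  exact (congrArg (ps.coeff T (w + 1)) e₂).trans (map_zero _)

end path

/-! ### The exponential of a twisting structure -/

theorem Deriv.oddComm_apply {T : GrOperad k s} (D : Deriv (GrHom.id T) (-1))
    (E : Deriv (GrHom.id T) 1) {n : ℕ} {p q a b : ℤ} (h : q = p + 0) (h₁ : q = a + -1)
    (h₂ : a = p + 1) (h₃ : q = b + 1) (h₄ : b = p + -1) (x : T.V n p) :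
    (D.oddComm E).app h x = D.app h₁ (E.app h₂ x) + E.app h₃ (D.app h₄ x) := by
  obtain rfl : b = p - 1 := by omega
  subst h₂
  rfl

theorem Deriv.comm_oddComm {T : GrOperad k s} (D : Deriv (GrHom.id T) (-1))
    (E : Deriv (GrHom.id T) 1)
    (hD : ∀ {n : ℕ} {p q t : ℤ} (hq : q = p + -1) (ht : t = q + -1) (x : T.V n p),
      D.app ht (D.app hq x) = 0) {n : ℕ} {p q : ℤ} (h : q = p + -1) (x : T.V n p) :
    D.app h ((D.oddComm E).app (by omega) x) = (D.oddComm E).app (by omega) (D.app h x) := by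
  rw [D.oddComm_apply E (q := p) (a := p + 1) (b := q) (by omega) (by omega) rfl (by omega) h,
    D.oddComm_apply E (p := q) (a := p) (b := q + -1) (by omega) h (by omega) (by omega) rfl, map_add,
    hD, hD, map_zero, zero_add, add_zero]

theorem mem_of_hasWeight {Q : GrOperad k s} {S : SubOperad Q} {ℓ₀ : Q.V 0 (-1)} {ℓ₁ : Q.V 1 (-1)}
    {i j n : ℕ} {p : ℤ} {x : Q.V n p} (h : HasWeight S ℓ₀ ℓ₁ i j x) :
    (i = 0 → j = 0 → x ∈ S.carrier n p) ∧ (i = 1 → j = 0 →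
      ∃ Y : Fam S.toGrOperad n (p + 1), x = Fam.ins S.incl ℓ₀ (by omega) Y) := by
  induction h with
  | mem x hx => exact ⟨fun _ _ => hx, fun h => by omega⟩
  | ell₀ =>
    refine ⟨fun h => by omega, fun _ _ => ⟨Fam.unit 1, ?_⟩⟩
    rw [Fam.ins_unit, GrOperad.castL_self, one_smul]
  | ell₁ => exact ⟨fun _ h => by omega, fun _ h => by omega⟩
  | zero i j n p => exact ⟨fun _ _ => zero_mem _, fun _ _ => ⟨0, (map_zero _).symm⟩⟩
  | add x y _ _ hx hy =>
    refine ⟨fun h h' => add_mem (hx.1 h h') (hy.1 h h'), fun h h' => ?_⟩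
    obtain ⟨X, rfl⟩ := hx.2 h h'
    obtain ⟨Y, rfl⟩ := hy.2 h h'
    exact ⟨X + Y, (map_add _ _ _).symm⟩
  | smul c x _ hx =>
    refine ⟨fun h h' => Submodule.smul_mem _ c (hx.1 h h'), fun h h' => ?_⟩
    obtain ⟨X, rfl⟩ := hx.2 h h'
    exact ⟨c • X, (map_smul _ _ _).symm⟩
  | act σ x _ hx =>
    refine ⟨fun h h' => S.act_mem σ (hx.1 h h'), fun h h' => ?_⟩
    obtain ⟨X, rfl⟩ := hx.2 h h'
    exact ⟨Fam.act σ X, (Fam.ins_act _ _ _ σ X).symm⟩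
  | @comp i j i' j' m n r p q t hr ht c x y _ _ hx hy =>
    refine ⟨fun h h' => S.comp_mem hr ht c (hx.1 (by omega) (by omega)) (hy.1 (by omega) (by omega)),
      fun h h' => ?_⟩
    rcases Nat.eq_zero_or_pos i with hi | hi
    · obtain ⟨Y, rfl⟩ := hy.2 (by omega) (by omega)
      exact ⟨_, Fam.comp_ins S.incl ℓ₀ hr (t := t + 1) (by omega) (by omega) ht c
        ⟨x, hx.1 (by omega) (by omega)⟩ Y⟩
    · obtain ⟨X, rfl⟩ := hx.2 (by omega) (by omega)
      refine ⟨(-1 * q).negOnePow • Fam.rcomp hr (by omega) c X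
        (⟨y, hy.1 (by omega) (by omega)⟩ : S.carrier n q), ?_⟩
      rw [map_sgn]
      exact Fam.ins_comp S.incl ℓ₀ hr (t := t + 1) (by omega) (by omega) ht c X
        ⟨y, hy.1 (by omega) (by omega)⟩

/-- A morphism that takes values in the image of an injective morphism factors. -/
theorem GrHom.exists_factor {R T U : GrOperad k s} (j : GrHom T U)
    (hj : ∀ {n : ℕ} {p : ℤ} (x : T.V n p), j.app x = 0 → x = 0) (F : GrHom R U)
    (hF : ∀ {n : ℕ} {p : ℤ} (y : R.V n p), ∃ x : T.V n p, j.app x = F.app y) :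
    ∃ Φ : GrHom R T, ∀ {n : ℕ} {p : ℤ} (y : R.V n p), j.app (Φ.app y) = F.app y := by
  have hinj : ∀ {n : ℕ} {p : ℤ} {x y : T.V n p}, j.app x = j.app y → x = y := fun h =>
    sub_eq_zero.1 (hj _ (by rw [map_sub, h, sub_self]))
  choose Φ hΦ using @hF
  let L : ∀ {n : ℕ} {p : ℤ}, R.V n p →ₗ[k] T.V n p := fun {n p} =>
    { toFun := fun x => Φ x
      map_add' := fun x y => hinj (by rw [hΦ, map_add, map_add, hΦ, hΦ])
      map_smul' := fun c x => hinj ((hΦ _).trans ((map_smul _ _ _).trans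
        ((congrArg (c • ·) (hΦ x).symm).trans (map_smul _ _ _).symm))) }
  have hL : ∀ {n : ℕ} {p : ℤ} (x : R.V n p), j.app (L x) = F.app x := fun x => hΦ x
  exact ⟨⟨L, fun σ x => hinj (by rw [j.map_act, hL, hL, F.map_act]),
    fun hr ht i x y => hinj (by rw [j.map_comp, hL, hL, hL, F.map_comp])⟩, hL⟩

/-- A morphism acts on finite expressions. -/
theorem CoprodV.exists_map {R P : GrOperad k s} (ψ : GrHom R P) {n : ℕ} {p : ℤ} {w : ℕ}
    (c : CoprodV R n p w) : ∃ c' : CoprodV P n p w, ∀ (T : GrOperad k s) (φ : GrHom P T) (a : T.V 0 0),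
      evalL T φ a c' = evalL T (ψ.trans φ) a c := by
  induction c using CoprodV.induction with
  | of x => exact ⟨CoprodV.of (ψ.app x), fun _ _ _ => rfl⟩
  | alpha => exact ⟨alpha P, fun _ _ _ => rfl⟩
  | zero => exact ⟨0, fun _ _ _ => by rw [map_zero, map_zero]⟩
  | add x y hx hy =>
    obtain ⟨x', hx⟩ := hx
    obtain ⟨y', hy⟩ := hy
    exact ⟨x' + y', fun T φ a => by rw [map_add, map_add, hx, hy]⟩
  | smul c x hx =>
    obtain ⟨x', hx⟩ := hx
    exact ⟨c • x', fun T φ a => by rw [map_smul, map_smul, hx]⟩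
  | act σ x hx =>
    obtain ⟨x', hx⟩ := hx
    exact ⟨actL σ x', fun T φ a => by rw [evalL_act, evalL_act, hx]⟩
  | comp hr ht hw i x y hx hy =>
    obtain ⟨x', hx⟩ := hx
    obtain ⟨y', hy⟩ := hy
    exact ⟨compL hr ht hw i x' y', fun T φ a => by rw [evalL_comp, evalL_comp, hx, hy]⟩

theorem CoprodV.exists_ins {P T : GrOperad k s} (φ : GrHom P T) (a : T.V 0 0) {n : ℕ} {p : ℤ}
    (Y : Fam P n p) :
    ∃ c : CoprodV P n p 1, evalL T φ a c = Fam.ins φ a (add_zero p).symm Y := by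
  induction Y using Fam.induction with
  | h j y =>
    refine ⟨compL (n := 0) rfl (add_zero p).symm rfl j (of y) (alpha P), ?_⟩
    rw [Fam.ins_sing, evalL_comp, evalL_of, evalL_alpha]
  | h₀ r =>
    rw [Fam.ins_unit]
    by_cases hn : 0 = n ∧ 0 = p
    · obtain ⟨rfl, rfl⟩ := hn
      refine ⟨r • alpha P, ?_⟩
      rw [GrOperad.castL_self, map_smul, evalL_alpha]
    · exact ⟨0, by rw [GrOperad.castL_of_ne _ hn, map_zero, smul_zero]⟩
  | ha Y Y' hY hY' =>
    obtain ⟨c, hc⟩ := hY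
    obtain ⟨c', hc'⟩ := hY'
    exact ⟨c + c', by rw [map_add, map_add, hc, hc']⟩

namespace Twist

variable (X : Twist k s)

/-- `Q` is freely generated by `ℓ₀` and `ℓ₁` over `Q00`. -/
theorem isFreeOn : IsFreeOn X.Q00.incl (ExtGen.val (curvedOp X.str 0) (curvedOp X.str 1)) := by
  intro T φ γ
  obtain ⟨ψ, ⟨h, h₀, h₁⟩, hu⟩ := X.free T φ (γ _ _ .zero) (γ _ _ .one)
  refine ⟨ψ, ⟨h, fun n p x => ?_⟩, fun ψ' h' => hu _ ⟨h'.1, h'.2 _ _ .zero, h'.2 _ _ .one⟩⟩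
  cases x
  exacts [h₀, h₁]

/-- The differential on `Q00`. -/
theorem exists_d {n : ℕ} {p q : ℤ} (h : p = q + 1) (y : X.Q00.toGrOperad.V n p) :
    ∃ (y' : X.Q00.toGrOperad.V n q) (Y : Fam X.Q00.toGrOperad n p),
      X.Q.d h (X.Q00.incl.app y) = X.Q00.incl.app y'
        + Fam.ins X.Q00.incl (curvedOp X.str 0) (by omega) Y
        - X.Q.adL (curvedOp X.str 1) (by omega) (X.Q00.incl.app y) := by
  subst h
  obtain ⟨x, z, hx, hz, e⟩ := X.d_add_bracket rfl (X.Q00.incl.app y) y.2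
  obtain ⟨Y, rfl⟩ := (mem_of_hasWeight hz).2 rfl rfl
  refine ⟨⟨x, (mem_of_hasWeight hx).1 rfl rfl⟩, Y, ?_⟩
  rw [GrOperad.bracket_eq] at e
  exact eq_sub_of_add_eq e

/-- The derivation that replaces `ℓ₀` by `α`. -/
def contr : Deriv (GrHom.id (path.op X.Q)) 1 :=
  (path.isFree X.Q).deriv (GrHom.id _)
    (X.isFreeOn.deriv (path.inc X.Q) (Deriv.zero _ 1) (fun _ _ x => match x with
      | .zero => (path.alpha X.Q : (path.op X.Q).V 0 0)
      | .one => 0))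
    (fun _ _ _ => 0)

variable {n : ℕ} {p q : ℤ}

theorem contr_incl (h : q = p + 1) (y : X.Q00.toGrOperad.V n p) :
    X.contr.app h ((path.inc X.Q).app (X.Q00.incl.app y)) = 0 :=
  ((path.isFree X.Q).deriv_ι _ _ _ h _).trans (X.isFreeOn.deriv_ι _ _ _ h y)

theorem contr_curvedOp (n : ℕ) : X.contr.app (q := 0) rfl ((path.inc X.Q).app (curvedOp X.str n))
    = (path.op X.Q).castL n 0 (path.alpha X.Q) := by
  rcases n with _ | _ | n
  · rw [GrOperad.castL_self]
    exact ((path.isFree X.Q).deriv_ι _ _ _ _ _).trans (X.isFreeOn.deriv_gen _ _ _ ExtGen.zero)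
  · rw [GrOperad.castL_of_ne _ (by decide)]
    exact ((path.isFree X.Q).deriv_ι _ _ _ _ _).trans (X.isFreeOn.deriv_gen _ _ _ ExtGen.one)
  · rw [GrOperad.castL_of_ne _ (by omega)]
    exact X.contr_incl _ ⟨_, X.op_mem _ (by omega)⟩

theorem contr_alpha : X.contr.app (q := 1) rfl (path.alpha X.Q) = 0 :=
  (path.isFree X.Q).deriv_gen _ _ _ PathGen.alpha

theorem contr_dot : X.contr.app (q := 0) rfl (path.dot X.Q) = 0 :=
  (path.isFree X.Q).deriv_gen _ _ _ PathGen.dot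

/-- The infinitesimal change of a twisting structure in the direction of `α`. -/
def flow : Deriv (GrHom.id (path.op X.Q)) 0 := (path.d X.Q).oddComm X.contr

theorem flow_alpha : X.flow.app (q := 0) rfl (path.alpha X.Q) = 0 := by
  refine ((path.d X.Q).oddComm_apply X.contr (a := 1) (b := -1) rfl rfl rfl rfl rfl _).trans ?_
  rw [contr_alpha, path.d_alpha, contr_dot, map_zero]
  exact add_zero _

theorem flow_dot : X.flow.app (q := -1) rfl (path.dot X.Q) = 0 := by
  refine ((path.d X.Q).oddComm_apply X.contr (a := 0) (b := -2) rfl rfl rfl rfl rfl _).trans ?_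
  rw [contr_dot, path.d_dot, map_zero, map_zero]
  exact add_zero _

theorem flow_incl (h : p = p + 0) (y : X.Q00.toGrOperad.V n p) : ∃ Y : Fam X.Q00.toGrOperad n p,
    X.flow.app h ((path.inc X.Q).app (X.Q00.incl.app y))
      = Fam.ins (X.Q00.incl.trans (path.inc X.Q)) (path.alpha X.Q) h Y := by
  obtain ⟨y', Y, e⟩ := X.exists_d (q := p - 1) (by omega) y
  refine ⟨(1 * p).negOnePow • Y, ?_⟩
  rw [flow, (path.d X.Q).oddComm_apply X.contr (a := p + 1) (b := p - 1) h (by omega) rfl (by omega)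
    (by omega), contr_incl, map_zero, zero_add, path.d_inc, e, map_sub, map_add, map_sub, map_add,
    contr_incl, GrHom.map_adL, Deriv.map_adL _ _ _ _ (e'' := 0) rfl rfl, contr_incl, map_zero,
    smul_zero]
  have e₁ : X.contr.app (q := 0) rfl ((path.inc X.Q).app (curvedOp X.str 1)) = 0 :=
    (X.contr_curvedOp 1).trans (GrOperad.castL_of_ne _ (by decide) _)
  rw [e₁, GrOperad.adL_zero, Fam.map_ins,
    Fam.app_ins (Deriv.zero (GrHom.id _) 1) (X.Q00.incl.trans (path.inc X.Q)) X.contr (fun h x =>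
      (X.contr_incl h x).trans (map_zero _).symm) _ (e'' := 0) rfl _ rfl]
  have e₂ : X.contr.app (q := 0) rfl ((path.inc X.Q).app (curvedOp X.str 0)) = path.alpha X.Q :=
    (X.contr_curvedOp 0).trans (GrOperad.castL_self _ _)
  have e₃ : Fam.deriv (Deriv.zero (GrHom.id X.Q00.toGrOperad) 1) (p := p) rfl Y = 0 :=
    Prod.ext (funext fun _ => rfl) rfl
  rw [e₂, e₃, map_zero, map_sgn]
  simp

theorem flow_curvedOp (n : ℕ) : X.flow.app (q := -1) rfl ((path.inc X.Q).app (curvedOp X.str n))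
    = plug (path.alpha X.Q) (q := -1) rfl (fun n => (path.inc X.Q).app (curvedOp X.str n)) n
      + (path.op X.Q).castL n (-1) (path.dot X.Q) := by
  have hd := (isCurved_curvedOp X.str).d_eq n
  refine ((path.d X.Q).oddComm_apply X.contr (a := 0) (b := -2) rfl rfl rfl rfl rfl _).trans ?_
  rw [contr_curvedOp, Fam.app_castL (path.d X.Q) (q := -1) rfl rfl, path.d_alpha, path.d_inc, hd,
    map_neg, map_neg, map_quad, quad_eq, Deriv.map_quad₂ _ _ (e₁ := 0) (e₁' := 0) rfl rfl]
  simp only [contr_curvedOp]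
  rw [quad₂_castL_zero_left, quad₂_castL_zero_right, show ((1 : ℤ) * -1).negOnePow = -1 by decide]
  simp [add_comm]

/-- The iterated flow of an operation in `Q00` has no components other than `Q00` and `α`. -/
theorem divPow_incl (w : ℕ) (y : X.Q00.toGrOperad.V n p) : ∃ c : CoprodV X.Q00.toGrOperad n p w,
    CoprodV.evalL (path.op X.Q) (X.Q00.incl.trans (path.inc X.Q)) (path.alpha X.Q) c
      = X.flow.divPow w ((path.inc X.Q).app (X.Q00.incl.app y)) := by
  have step : ∀ {n : ℕ} {p : ℤ} {w : ℕ} (c : CoprodV X.Q00.toGrOperad n p w),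
      ∃ c' : CoprodV X.Q00.toGrOperad n p (w + 1),
        CoprodV.evalL (path.op X.Q) (X.Q00.incl.trans (path.inc X.Q)) (path.alpha X.Q) c'
          = X.flow.app (add_zero p).symm
            (CoprodV.evalL (path.op X.Q) (X.Q00.incl.trans (path.inc X.Q)) (path.alpha X.Q) c) := by
    intro n p w c
    induction c using CoprodV.induction with
    | of y =>
      obtain ⟨Y, hY⟩ := X.flow_incl (add_zero _).symm y
      obtain ⟨c, hc⟩ := CoprodV.exists_ins (X.Q00.incl.trans (path.inc X.Q)) (path.alpha X.Q) Y
      exact ⟨c, hc.trans hY.symm⟩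
    | alpha => exact ⟨0, (map_zero _).trans X.flow_alpha.symm⟩
    | zero => exact ⟨0, by simp only [map_zero]⟩
    | add x y hx hy =>
      obtain ⟨x', hx⟩ := hx
      obtain ⟨y', hy⟩ := hy
      exact ⟨x' + y', by simp only [map_add, hx, hy]⟩
    | smul c x hx =>
      obtain ⟨x', hx⟩ := hx
      exact ⟨c • x', by simp only [map_smul, hx]⟩
    | act σ x hx =>
      obtain ⟨x', hx⟩ := hx
      exact ⟨CoprodV.actL σ x', by rw [CoprodV.evalL_act, CoprodV.evalL_act, hx, Deriv.map_act]⟩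
    | comp hr ht hw i x y hx hy =>
      obtain ⟨x', hx⟩ := hx
      obtain ⟨y', hy⟩ := hy
      refine ⟨CoprodV.compL hr ht (by omega) i x' y + CoprodV.compL hr ht (by omega) i x y', ?_⟩
      rw [map_add, CoprodV.evalL_comp, CoprodV.evalL_comp, CoprodV.evalL_comp, hx, hy,
        Deriv.map_comp_id _ hr ht (add_zero _).symm (add_zero _).symm _ ht ht]
      simp
  induction w with
  | zero => exact ⟨CoprodV.of y, rfl⟩
  | succ w ih =>
    obtain ⟨c, hc⟩ := ih
    obtain ⟨c', hc'⟩ := step c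
    refine ⟨((w + 1 : ℕ) : k)⁻¹ • c', ?_⟩
    rw [map_smul, hc', hc, Deriv.divPow_succ]

end Twist

/-! ### Morphisms to the cofree twisting structure -/

theorem plug_mono {T : GrOperad k s} (a : T.V 0 0) (w : ℕ) {p : ℤ} (κ : ∀ n, T.V n p) (n : ℕ) :
    plug (ps.mono T 1 a) (add_zero p).symm (fun n => ps.mono T w (κ n)) n
      = ps.mono T (w + 1) (plug a (add_zero p).symm κ n) := by
  cases s
  · rw [plug_symm, plug_symm, ps.mono_comp_mono]
  · rw [plug_nonsymm, plug_nonsymm, map_sum]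
    exact Finset.sum_congr rfl fun j _ => ps.mono_comp_mono _ _ _ _ _ _ _

theorem dpow_mono {T : GrOperad k s} (a : T.V 0 0) {p : ℤ} (κ : ∀ n, T.V n p) (w n : ℕ) :
    dpow (ps.mono T 1 a) (fun n => ps.mono T 0 (κ n)) w n = ps.mono T w (dpow a κ w n) := by
  induction w generalizing n with
  | zero => rfl
  | succ w ih =>
    rw [dpow_succ, dpow_succ, Pi.smul_apply, Pi.smul_apply, map_smul, ← plug_mono]
    exact congrArg (fun F => _ • plug _ _ F n) (funext ih)

theorem plug_castL_zero {T : GrOperad k s} (a : T.V 0 0) {p : ℤ} (u : T.V 0 p) :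
    plug a (add_zero p).symm (fun n => T.castL n p u) = 0 := by
  funext n
  cases s
  · rw [plug_symm, GrOperad.castL_of_ne _ (by omega), map_zero, LinearMap.zero_apply]
    rfl
  · rw [plug_nonsymm]
    refine Finset.sum_eq_zero fun j _ => ?_
    rw [GrOperad.castL_of_ne _ (by omega), map_zero, LinearMap.zero_apply]

theorem plug_zero {T : GrOperad k s} (a : T.V 0 0) {p : ℤ} :
    plug a (add_zero p).symm (0 : ∀ n, T.V n p) = 0 := by
  funext n
  cases s
  · simp [plug_symm]
  · simp [plug_nonsymm]

theorem plug_add {T : GrOperad k s} (a : T.V 0 0) {p : ℤ} (κ κ' : ∀ n, T.V n p) :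
    plug a (add_zero p).symm (κ + κ')
      = plug a (add_zero p).symm κ + plug a (add_zero p).symm κ' := by
  funext n
  cases s
  · simp [plug_symm]
  · simp [plug_nonsymm, Finset.sum_add_distrib]

theorem dpow_add {T : GrOperad k s} (a : T.V 0 0) {p : ℤ} (κ κ' : ∀ n, T.V n p) (w : ℕ) :
    dpow a (κ + κ') w = dpow a κ w + dpow a κ' w := by
  induction w with
  | zero => rfl
  | succ w ih => rw [dpow_succ, ih, plug_add, smul_add, dpow_succ, dpow_succ]

theorem dpow_castL_zero {T : GrOperad k s} (a : T.V 0 0) {p : ℤ} (u : T.V 0 p) (w : ℕ) :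
    dpow a (fun n => T.castL n p u) (w + 1) = 0 := by
  induction w with
  | zero => rw [dpow_succ, dpow_zero, plug_castL_zero, smul_zero]
  | succ w ih => rw [dpow_succ, ih, plug_zero, smul_zero]

section lift

variable [CharZero k] (X : Twist k s) {P : DGOperad k s} {ℓ : ∀ n, P.V n (-1)} (g : X.Q ⟶ P)

/-- The flow of a twisting structure, evaluated in `P`. -/
def expHom : GrHom X.Q.toGrOperad (ps (path.op P)) :=
  (path.inc X.Q).trans (X.flow.exp.trans (ps.map (path.map (gr g))))

theorem coeff_expHom (w : ℕ) {n : ℕ} {p : ℤ} (x : X.Q.V n p) :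
    ps.coeff _ w ((expHom X g).app x)
      = (path.map (gr g)).app (X.flow.divPow w ((path.inc X.Q).app x)) := rfl

theorem expHom_d {n : ℕ} {p q : ℤ} (h : p = q + 1) (h' : q = p + -1) (x : X.Q.V n p) :
    (ps.deriv (path.d P)).app h' ((expHom X g).app x) = (expHom X g).app (X.Q.d h x) :=
  ps.ext fun w => by
    refine (ps.coeff_deriv (path.d P) h' _ w).trans ?_
    rw [coeff_expHom, coeff_expHom, ← path.map_d (gr g) (fun h x => gr_map_d g h x),
      X.flow.divPow_comm (path.d X.Q)
        (fun hq x => (path.d X.Q).comm_oddComm X.contr (path.d_d X.Q) hq x), path.d_inc]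

theorem exists_series : ∃ Φ : GrHom X.Q00.toGrOperad (hat P.toGrOperad),
    ∀ {n : ℕ} {p : ℤ} (y : X.Q00.toGrOperad.V n p),
      (path.series P).app (Φ.app y) = (expHom X g).app (X.Q00.incl.app y) := by
  refine GrHom.exists_factor (path.series P) (fun _ h => path.series_injective h) (X.Q00.incl.trans (expHom X g))
    fun {n p} y => ?_
  have key : ∀ w, ∃ c : CoprodV P.toGrOperad n p w,
      CoprodV.evalL (path.op P) (path.inc P) (path.alpha P) c
        = ps.coeff _ w ((expHom X g).app (X.Q00.incl.app y)) := by
    intro w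
    obtain ⟨c, hc⟩ := X.divPow_incl w y
    obtain ⟨c', hc'⟩ := c.exists_map (X.Q00.incl.trans (gr g))
    refine ⟨c', ?_⟩
    rw [hc', coeff_expHom, ← hc, GrHom.map_eval, path.map_alpha]
    refine congrArg (fun φ => CoprodV.evalL _ φ _ c) (GrHom.ext fun n p x => ?_)
    exact (path.map_inc (gr g) _).symm
  choose c hc using key
  exact ⟨c, funext hc⟩

theorem divPow_curvedOp (w n : ℕ) : X.flow.divPow w ((path.inc X.Q).app (curvedOp X.str n))
    = dpow (path.alpha X.Q) (fun n => (path.inc X.Q).app (curvedOp X.str n)) w n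
      + if w = 1 then (path.op X.Q).castL n (-1) (path.dot X.Q) else 0 := by
  induction w generalizing n with
  | zero =>
    rw [if_neg (by omega)]
    exact (add_zero _).symm
  | succ w ih =>
    have hdot : X.flow.app (q := -1) rfl (if w = 1 then (path.op X.Q).castL n (-1) (path.dot X.Q) else 0)
        = 0 := by
      split_ifs
      · rw [Fam.app_castL X.flow (q := -1) rfl rfl, X.flow_dot, map_zero]
      · exact map_zero _
    have e₁ : (fun n => X.flow.app (q := -1) rfl ((path.inc X.Q).app (curvedOp X.str n)))
        = plug (path.alpha X.Q) (q := -1) rfl (fun n => (path.inc X.Q).app (curvedOp X.str n))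
          + fun n => (path.op X.Q).castL n (-1) (path.dot X.Q) := funext X.flow_curvedOp
    rw [Deriv.divPow_succ, ih, map_add, hdot, dpow_succ', Pi.smul_apply,
      Deriv.app_dpow _ _ X.flow_alpha, e₁, dpow_add, Pi.add_apply]
    refine (congrArg (_ • ·) (add_zero _)).trans ((smul_add _ _ _).trans (congrArg₂ (· + ·) rfl ?_))
    rcases w with _ | w
    · rw [if_pos rfl, dpow_zero]
      simp
    · rw [if_neg (by omega), dpow_castL_zero, Pi.zero_apply, smul_zero]

theorem series_twistedOp (n : ℕ) : (path.series P).app (twistedOp P.toGrOperad ℓ n)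
    = fun w => dpow (path.alpha P) (fun n => (path.inc P).app (ℓ n)) w n := by
  refine funext fun w => ?_
  refine (hat.coeff_series_pi (path.inc P) (path.alpha P) w _).symm.trans ?_
  rw [pi_twistedOp, GrHom.map_dpow, hat.series_alpha]
  simp only [hat.series_of]
  rw [dpow_mono, ps.coeff_mono_same]

variable (hg : ∀ n, (gr g).app (curvedOp X.str n) = ℓ n)

include hg in
theorem expHom_curvedOp (n : ℕ) : (expHom X g).app (curvedOp X.str n)
    = (path.series P).app (twistedOp P.toGrOperad ℓ n)
      + ps.mono _ 1 ((path.op P).castL n (-1) (path.dot P)) := by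
  refine ps.ext fun w => ?_
  rw [coeff_expHom, divPow_curvedOp, map_add, map_add, GrHom.map_dpow, path.map_alpha,
    series_twistedOp, ps.coeff_mono]
  simp only [path.map_inc, hg]
  congr 1
  split_ifs
  · rw [GrHom.map_castL, path.map_dot]
  · exact map_zero _

variable {Φ : GrHom X.Q00.toGrOperad (hat P.toGrOperad)}
  (hΦ : ∀ {n : ℕ} {p : ℤ} (y : X.Q00.toGrOperad.V n p),
    (path.series P).app (Φ.app y) = (expHom X g).app (X.Q00.incl.app y))

include hg hΦ in
theorem series_curvedOp {n : ℕ} (y : X.Q00.toGrOperad.V n (-1)) (hn : 1 < n)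
    (hy : X.Q00.incl.app y = curvedOp X.str n) : Φ.app y = twistedOp P.toGrOperad ℓ n := by
  refine sub_eq_zero.1 (path.series_injective ?_)
  rw [map_sub, hΦ, hy, expHom_curvedOp X g hg, GrOperad.castL_of_ne _ (by omega), map_zero]
  exact sub_eq_zero.2 (add_zero _)

include hg hΦ in
theorem series_d {n : ℕ} {p q : ℤ} (h : p = q + 1) (h' : q = p + -1) (y : X.Q00.toGrOperad.V n p)
    (y' : X.Q00.toGrOperad.V n q) (Y : Fam X.Q00.toGrOperad n p)
    (e : X.Q.d h (X.Q00.incl.app y) = X.Q00.incl.app y'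
        + Fam.ins X.Q00.incl (curvedOp X.str 0) h' Y
        - X.Q.adL (curvedOp X.str 1) h' (X.Q00.incl.app y)) :
    (-1 * p).negOnePow • mark P.toGrOperad (Φ.app y) = markBimod.mk _ (Fam.map Φ Y) ∧
      Φ.app y' = (hatDeriv P.dDeriv).app h' (Φ.app y)
        + (hat P.toGrOperad).adL (twistedOp P.toGrOperad ℓ 1) h' (Φ.app y)
        - (dsub (GrHom.id _) (twistedOp P.toGrOperad ℓ 0)).app h' (Φ.app y) := by
  obtain ⟨M, hM⟩ : ∃ M, markBimod.mk _ M = mark P.toGrOperad (Φ.app y) := ⟨_, markBimod.mk_nf _⟩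
  have e₀ := expHom_curvedOp X g hg 0
  have e₁ := expHom_curvedOp X g hg 1
  rw [GrOperad.castL_self] at e₀
  rw [GrOperad.castL_of_ne _ (by decide), map_zero] at e₁
  replace e₁ := e₁.trans (add_zero _)
  have hc : X.Q00.incl.trans (expHom X g) = Φ.trans (path.series P) :=
    GrHom.ext fun n p y => (hΦ y).symm
  have h₁ := expHom_d X g h h' (X.Q00.incl.app y)
  rw [e, map_sub, map_add, Fam.map_ins, GrHom.map_adL, e₀, e₁, hc, ← hΦ, ← hΦ, path.d_series,
    dsub_app, ← hM, markBimod.ins_mk, ← Fam.ins_map, Fam.ins_add, ← GrHom.map_adL] at h₁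
  have h₂ : Fam.ins (path.series P) ((path.series P).app (twistedOp P.toGrOperad ℓ 0)) h' (Fam.map Φ Y)
      = (path.series P).app (Fam.ins (GrHom.id _) (twistedOp P.toGrOperad ℓ 0) h' (Fam.map Φ Y)) :=
    (Fam.map_ins (GrHom.id _) (path.series P) _ _ _).symm
  have h₃ : (path.series P).app ((hatDeriv P.dDeriv).app h' (Φ.app y)
        + (hat P.toGrOperad).adL (twistedOp P.toGrOperad ℓ 1) h' (Φ.app y) - Φ.app y'
        - Fam.ins (GrHom.id _) (twistedOp P.toGrOperad ℓ 0) h' (Fam.map Φ Y))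
      + Fam.ins (path.series P) (ps.mono _ 1 (path.dot P)) h' ((-1 * p).negOnePow • M - Fam.map Φ Y)
      = 0 := by
    rw [map_sub, map_sub, map_add, map_sub, map_sgn, ← h₂, eq_sub_of_add_eq h₁]
    abel
  let κ := (path.isFree P).lift (path.inc P) (PathGen.val (path.alpha P) 0)
  have hκ : (path.series P).trans (ps.map κ) = path.series P := by
    refine (hat.map_series _ _ _).trans ?_
    rw [(path.isFree P).trans_lift]
    exact congrArg _ ((path.isFree P).lift_gen _ _ PathGen.alpha)
  have hκ' : κ.app (path.dot P) = 0 := (path.isFree P).lift_gen _ _ PathGen.dot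
  have hκx : ∀ x : (hat P.toGrOperad).V n q,
      (ps.map κ).app ((path.series P).app x) = (path.series P).app x :=
    fun x => congrArg (fun F : GrHom (hat P.toGrOperad) (ps (path.op P)) => F.app x) hκ
  have h₄ := congrArg (ps.map κ).app h₃
  rw [map_add, Fam.map_ins, ps.map_mono, hκ', map_zero, map_zero, Fam.ins_zero, hκx] at h₄
  replace h₄ := path.series_injective ((add_zero _).symm.trans h₄)
  rw [h₄, map_zero] at h₃
  have h₅ := path.mk_eq_zero h' ((zero_add _).symm.trans h₃)
  rw [map_sub, map_sgn, hM, sub_eq_zero] at h₅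
  refine ⟨h₅, ?_⟩
  have h₆ : (dsub (GrHom.id _) (twistedOp P.toGrOperad ℓ 0)).app h' (Φ.app y)
      = Fam.ins (GrHom.id _) (twistedOp P.toGrOperad ℓ 0) h' (Fam.map Φ Y) := by
    rw [dsub_app, ← map_sgn, h₅, markBimod.ins_mk]
  rw [h₆]
  exact (sub_eq_zero.1 ((sub_right_comm _ _ _).trans h₄)).symm

end lift

/-! ### The counit -/

/-- A series without `α` is an operation of `P`. -/
theorem CoprodV.evalL_weight_zero {P : GrOperad k s} {n : ℕ} {p : ℤ} {w : ℕ} (c : CoprodV P n p w) :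
    w = 0 → ∀ (R : GrOperad k s) (φ : GrHom P R) (a : R.V 0 0),
      evalL R φ a c = φ.app (evalL P (GrHom.id P) 0 c) := by
  induction c using CoprodV.induction with
  | of x => exact fun _ _ _ _ => rfl
  | alpha => exact fun h => by omega
  | zero => exact fun _ R φ a => by simp only [map_zero]
  | add x y hx hy => exact fun h R φ a => by simp only [map_add, hx h R φ a, hy h R φ a]
  | smul c x hx => exact fun h R φ a => by simp only [map_smul, hx h R φ a]
  | act σ x hx => exact fun h R φ a => by rw [evalL_act, evalL_act, φ.map_act, hx h R φ a]
  | comp hr ht hw i x y hx hy =>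
    exact fun h R φ a => by
      rw [evalL_comp, evalL_comp, φ.map_comp, hx (by omega) R φ a, hy (by omega) R φ a]

namespace hat

variable {P : GrOperad k s} {n : ℕ} {p : ℤ}

/-- The constant term of a series. -/
def counit (P : GrOperad k s) : GrHom (hat P) P where
  app := CoprodV.evalL P (GrHom.id P) 0 ∘ₗ coeff P 0
  map_act σ x := CoprodV.evalL_act P (GrHom.id P) 0 σ (coeff P 0 x)
  map_comp hr ht i x y := (HatV.ev_compL P (GrHom.id P) 0 hr ht i x y 0).trans (by
    rw [Finset.Nat.antidiagonal_zero, Finset.sum_singleton]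
    rfl)

theorem pi_zero (x : (hat P).V n p) : pi P 0 x = hatOf ((counit P).app x) := by
  refine congrArg (single P 0) (CoprodV.ext fun R φ a => ?_)
  exact CoprodV.evalL_weight_zero _ rfl R φ a

theorem counit_of (x : P.V n p) : (counit P).app (hatOf x) = x :=
  congrArg (CoprodV.evalL P (GrHom.id P) 0) (coeff_single_same 0 (CoprodV.of x))

theorem counit_pi_zero (x : (hat P).V n p) : (counit P).app (pi P 0 x) = (counit P).app x := by
  rw [pi_zero, counit_of]

end hat

theorem counit_twistedOp [CharZero k] {P : GrOperad k s} (ℓ : ∀ n, P.V n (-1)) (n : ℕ) :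
    (hat.counit P).app (twistedOp P ℓ n) = ℓ n := by
  rw [← hat.counit_pi_zero, pi_twistedOp, dpow_zero, hat.counit_of]

/-- Vanishing of `ℓ₀` and `ℓ₁` allows to restrict to `Q00`. -/
theorem Twist.map_proj (X : Twist k s) {T : GrOperad k s} (g : GrHom X.Q.toGrOperad T)
    (h₀ : g.app (curvedOp X.str 0) = 0) (h₁ : g.app (curvedOp X.str 1) = 0) {n : ℕ} {p : ℤ}
    (x : X.Q.V n p) : g.app (X.Q00.incl.app (X.proj.app x)) = g.app x := by
  have : (X.proj.trans X.Q00.incl).trans g = g := by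
    refine X.isFreeOn.hom_ext (fun n p y => ?_) (fun n p y => ?_)
    · exact congrArg (fun z => g.app (X.Q00.incl.app z)) (X.proj_coe y)
    · cases y with
      | zero =>
        refine (congrArg (fun z => g.app (X.Q00.incl.app z)) X.proj_zero).trans ?_
        exact ((congrArg _ (map_zero _)).trans (map_zero _)).trans h₀.symm
      | one =>
        refine (congrArg (fun z => g.app (X.Q00.incl.app z)) X.proj_one).trans ?_
        exact ((congrArg _ (map_zero _)).trans (map_zero _)).trans h₁.symm
  exact congrArg (fun F : GrHom X.Q.toGrOperad T => F.app x) this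

namespace cofree

variable (P : DGOperad k s) {ℓ : ∀ n, P.V n (-1)}

/-- The counit, before the passage to `Q00`. -/
def counit : GrHom (op P) P.toGrOperad := (isFree P).lift (hat.counit _) (ExtGen.val 0 0)

variable {n : ℕ} {p q : ℤ}

theorem counit_inc (x : (hat P.toGrOperad).V n p) :
    (counit P).app ((inc P).app x) = (hat.counit _).app x := (isFree P).lift_ι _ _ x

/-- Insertion of `ℓ₀` is faithful. -/
theorem mk_eq_zero (h : q = p + -1) {y : (hat P.toGrOperad).V n q} {Y : Fam (hat P.toGrOperad) n p}
    (hY : (inc P).app y + Fam.ins (inc P) (gen P 0 (-1) .zero) h Y = 0) : markBimod.mk _ Y = 0 := by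
  subst h
  refine markBimod.mk_eq_zero.2 (Fam.norm_eq_zero_odd fun T f b => ?_)
  have key : ∀ b : T.V 0 (-1), f.app y + Fam.ins f b rfl Y = 0 := by
    intro b
    have := congrArg ((isFree P).lift f (ExtGen.val b 0)).app hY
    rw [map_add, Fam.map_ins, (isFree P).trans_lift, (isFree P).lift_ι, (isFree P).lift_gen,
      map_zero] at this
    exact this
  have h₀ := key 0
  rw [Fam.ins_zero] at h₀
  have h₁ := key b
  rw [(add_zero _).symm.trans h₀] at h₁
  exact (zero_add _).symm.trans h₁

variable [CharZero k] (hℓ : IsFlat P ℓ)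

include hℓ in
theorem counit_u : (counit P).app (u P ℓ) = 0 := by
  rw [u, map_sub, counit_inc, counit_twistedOp, hℓ.zero_eq, sub_zero]
  exact (isFree P).lift_gen _ _ ExtGen.zero

include hℓ in
theorem counit_m : (counit P).app (m P ℓ) = 0 := by
  rw [m, map_sub, counit_inc, counit_twistedOp, hℓ.one_eq, sub_zero]
  exact (isFree P).lift_gen _ _ ExtGen.one

include hℓ in
theorem counit_curved (n : ℕ) : (counit P).app (curved P ℓ n) = ℓ n := by
  rw [curved, map_add, map_add, GrHom.map_castL, GrHom.map_castL, counit_u P hℓ, counit_m P hℓ,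
    counit_inc, counit_twistedOp, map_zero, map_zero]
  exact (add_zero _).trans (add_zero _)

include hℓ in
theorem counit_d (h : q = p + -1) (x : (op P).V n p) :
    (counit P).app ((d P ℓ).app h x) = P.d (by omega) ((counit P).app x) := by
  refine (isFree P).comm_deriv (counit P) (d P ℓ) P.dDeriv (fun n p x => ?_) (fun n p x => ?_) h x
  · have e₁ : (counit P).app ((dsub (inc P) (u P ℓ)).app rfl x) = 0 := by
      rw [dsub_app, ← markBimod.mk_nf (mark _ x), markBimod.ins_mk, map_sgn, Fam.map_ins,
        counit_u P hℓ, Fam.ins_zero, smul_zero]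
    rw [d_inc, map_sub, map_add, e₁, GrHom.map_adL, counit_m P hℓ, GrOperad.adL_zero, counit_inc,
      counit_inc, ← hat.counit_pi_zero, pi_hatDeriv, hat.pi_zero, hatDeriv_of, hat.counit_of]
    exact (sub_zero _).trans (add_zero _)
  · have key : ∀ n, (counit P).app ((d P ℓ).app (q := -2) rfl (curved P ℓ n))
        = P.dDeriv.app (q := -2) rfl ((counit P).app (curved P ℓ n)) := by
      intro n
      refine (congrArg (counit P).app ((isCurved P hℓ.toIsCurved).d_eq n)).trans ?_
      rw [counit_curved P hℓ]
      refine ((map_neg _ _).trans (congrArg Neg.neg (map_quad _ _ n))).trans ?_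
      refine Eq.trans ?_ (hℓ.d_eq n).symm
      exact congrArg (fun F => - quad _ F n) (funext (counit_curved P hℓ))
    cases x with
    | zero =>
      have := key 0
      rw [curved_zero] at this
      exact this
    | one =>
      have := key 1
      rw [curved_one] at this
      exact this

end cofree

section adjunction

variable [CharZero k]

/-- The counit of the cofree twisting structure, before the passage to `Q00`. -/
def cofreeCounit (P : Under (flatInf k s)) : (cofreeTwist P).Q ⟶ P.right :=
  DGHom.mk (P := cofree.dg P.right (flatOp P)) (cofree.counit P.right)
    (fun h x => cofree.counit_d P.right (isFlat_flatOp P) (by omega) x)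

/-- Morphisms to the cofree twisting structure. -/
theorem exists_hom (X : Twist k s) (P : Under (flatInf k s)) (g : X.Q ⟶ P.right)
    (hg : ∀ n, (gr g).app (curvedOp X.str n) = flatOp P n) :
    ∃ f : X ⟶ cofreeTwist P, f.hom ≫ cofreeCounit P = g := by
  obtain ⟨Φ, hΦ⟩ := exists_series X g
  let F : GrHom X.Q.toGrOperad (cofree.op P.right) :=
    X.isFreeOn.lift (Φ.trans (cofree.inc P.right)) (cofree.gen P.right)
  have hF : ∀ {n : ℕ} {p : ℤ} (y : X.Q00.toGrOperad.V n p),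
      F.app (X.Q00.incl.app y) = (cofree.inc P.right).app (Φ.app y) := fun y => X.isFreeOn.lift_ι _ _ y
  have hF₀ : F.app (curvedOp X.str 0) = cofree.gen P.right 0 (-1) .zero :=
    X.isFreeOn.lift_gen _ _ ExtGen.zero
  have hF₁ : F.app (curvedOp X.str 1) = cofree.gen P.right 1 (-1) .one :=
    X.isFreeOn.lift_gen _ _ ExtGen.one
  have hFc : ∀ n, F.app (curvedOp X.str n) = cofree.curved P.right (flatOp P) n := by
    intro n
    rcases n with _ | _ | n
    · rw [cofree.curved_zero, hF₀]
    · rw [cofree.curved_one]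
      exact hF₁
    · rw [cofree.curved_of_lt _ _ (by omega),
        ← series_curvedOp X g hg hΦ ⟨_, X.op_mem (n + 1 + 1) (by omega)⟩ (by omega) rfl]
      exact hF ⟨_, X.op_mem (n + 1 + 1) (by omega)⟩
  have hcomm : X.Q00.incl.trans F = Φ.trans (cofree.inc P.right) := X.isFreeOn.trans_lift _ _
  have hFd : ∀ {n : ℕ} {p q : ℤ} (h : q = p + -1) (x : X.Q.V n p),
      F.app (X.Q.dDeriv.app h x) = (cofree.d P.right (flatOp P)).app h (F.app x) := by
    intro n p q h x
    refine X.isFreeOn.comm_deriv F X.Q.dDeriv (cofree.d P.right (flatOp P)) (fun n p y => ?_)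
      (fun n p y => ?_) h x
    · obtain ⟨y', Y, e⟩ := X.exists_d (q := p + -1) (by omega) y
      obtain ⟨h₁, h₂⟩ := series_d X g hg hΦ (by omega) rfl y y' Y e
      obtain ⟨y₂, Y₂, h₃, h₄, h₅⟩ := cofree.d_add_bracket P.right (flatOp P) (q := p + -1) (by omega)
        (Φ.app y)
      rw [← h₄] at h₂
      have h₆ : (-1 * p).negOnePow • Fam.ins (q := p + -1) (cofree.inc P.right)
          (cofree.gen P.right 0 (-1) .zero) rfl Y₂
            = Fam.ins (cofree.inc P.right) (cofree.gen P.right 0 (-1) .zero) rfl (Fam.map Φ Y) := by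
        rw [← markBimod.ins_mk, ← markBimod.ins_mk, ← h₁, h₃, map_sgn]
      rw [GrOperad.bracket_eq, h₆, ← h₂] at h₅
      refine (congrArg F.app e).trans ?_
      rw [map_sub, map_add, Fam.map_ins, GrHom.map_adL, hF₁, hF₀, hF, hF, hcomm, ← Fam.ins_map]
      exact (eq_sub_of_add_eq h₅).symm
    · have key : ∀ n, F.app (X.Q.dDeriv.app (q := -2) rfl (curvedOp X.str n))
          = (cofree.d P.right (flatOp P)).app rfl (F.app (curvedOp X.str n)) := by
        intro n
        rw [hFc]
        refine (congrArg F.app ((isCurved_curvedOp X.str).d_eq n)).trans ?_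
        rw [map_neg, map_quad]
        refine Eq.trans ?_ ((cofree.isCurved P.right (isFlat_flatOp P).toIsCurved).d_eq n).symm
        exact congrArg (fun G => - quad _ G n) (funext hFc)
      cases y
      exacts [key 0, key 1]
  refine ⟨⟨DGHom.mk (R := cofree.dg P.right (flatOp P)) F (fun h x => hFd (by omega) x),
    presented_hom_ext hFc, fun x hx => ⟨Φ.app ⟨x, hx⟩, (hF ⟨x, hx⟩).symm⟩⟩, ?_⟩
  have key : F.trans (cofree.counit P.right) = gr g := by
    refine X.isFreeOn.hom_ext (fun n p y => ?_) (fun n p y => ?_)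
    · refine (congrArg _ (hF y)).trans ((cofree.counit_inc P.right _).trans ?_)
      have h₁ := congrArg (fun z => ((path.isFree P.right).lift (GrHom.id _)
        (PathGen.val 0 0)).app (ps.coeff (path.op P.right) 0 z)) (hΦ y)
      refine Eq.trans ?_ (h₁.trans ?_)
      · refine Eq.trans ?_ (GrHom.map_eval (path.inc P.right) (path.alpha P.right) _ _).symm
        rw [(path.isFree P.right).trans_lift]
        exact congrArg (fun a => CoprodV.evalL _ (GrHom.id _) a _)
          ((path.isFree P.right).lift_gen (GrHom.id _) (PathGen.val 0 0) PathGen.alpha).symm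
      · refine (congrArg _ (path.map_inc (gr g) _)).trans ?_
        exact (path.isFree P.right).lift_ι _ _ _
    · have h : ∀ n, (F.trans (cofree.counit P.right)).app (curvedOp X.str n)
          = (gr g).app (curvedOp X.str n) := fun n =>
        ((congrArg _ (hFc n)).trans (cofree.counit_curved P.right (isFlat_flatOp P) n)).trans (hg n).symm
      cases y
      exacts [h 0, h 1]
  exact DGHom.ext fun n p x => congrArg (fun G : GrHom X.Q.toGrOperad (und P) => G.app x) key

end adjunction

/-! ### Series are determined by their derivatives -/

section euler

variable {P : GrOperad k s} {n : ℕ} {p : ℤ}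

theorem dsub_hatAlpha_single {w : ℕ} (c : CoprodV P n p w) :
    (dsub (GrHom.id (hat P)) (hatAlpha P)).app (add_zero p).symm (hat.single P w c)
      = (w : k) • hat.single P w c := by
  induction c using CoprodV.induction with
  | of x => exact (dsub_of _ _ _ x).trans (by rw [Nat.cast_zero, zero_smul])
  | alpha => exact (dsub_alpha _ _ _).trans (by rw [Nat.cast_one, one_smul]; rfl)
  | zero => rw [map_zero, map_zero, smul_zero]
  | add x y hx hy => rw [map_add, map_add, hx, hy, smul_add]
  | smul c x hx => rw [map_smul, map_smul, hx, smul_comm]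
  | act σ x hx => rw [← hat.single_act, Deriv.map_act, hx, map_smul]
  | @comp m n r p q t v v' w hr ht hw i x y hx hy =>
    rw [← hat.single_comp hr ht hw, Deriv.map_comp_id _ (r := r) hr ht (add_zero p).symm (add_zero q).symm
      (add_zero t).symm ht ht, hx, hy, zero_mul, Int.negOnePow_zero, one_smul, map_smul, map_smul,
      LinearMap.smul_apply, ← add_smul, ← hw, Nat.cast_add]

theorem hat.pi_pi_same (w : ℕ) (x : (hat P).V n p) : hat.pi P w (hat.pi P w x) = hat.pi P w x :=
  hat.pi_single_same w _

theorem mark_pi_succ (w : ℕ) (x : (hat P).V n p) :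
    mark P (hat.pi P (w + 1) x) = markBimod.pi P w (mark P x) := by
  have key : ∀ v u, v ≠ u → ∀ y : (markBimod (hat P)).V n p,
      markBimod.pi P v (markBimod.pi P u y) = 0 := by
    intro v u h y
    induction y using markBimod.induction with | h Y
    rw [markBimod.pi_mk, markBimod.pi_mk]
    induction Y using Fam.induction with
    | h j y => rw [Fam.pi_sing, Fam.pi_sing, hat.pi_apply u, hat.pi_single_of_ne h, map_zero, map_zero]
    | h₀ r =>
      rw [Fam.pi_unit]
      split_ifs with h'
      · rw [Fam.pi_unit, if_neg (by omega), map_zero]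
      · rw [map_zero, map_zero]
    | ha Y Y' h h' => rw [map_add, map_add, map_add, h, h', add_zero]
  have key' : ∀ v, ∀ y : (markBimod (hat P)).V n p,
      markBimod.pi P v (markBimod.pi P v y) = markBimod.pi P v y := by
    intro v y
    induction y using markBimod.induction with | h Y
    rw [markBimod.pi_mk, markBimod.pi_mk]
    induction Y using Fam.induction with
    | h j y => rw [Fam.pi_sing, Fam.pi_sing, hat.pi_pi_same]
    | h₀ r =>
      rw [Fam.pi_unit]
      split_ifs with h'
      · rw [Fam.pi_unit, if_pos h']
      · rw [map_zero]
    | ha Y Y' h h' => rw [map_add, map_add, map_add, h, h', map_add]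
  refine (markBimod.grading P).eq_of_pi fun v => ?_
  change markBimod.pi P v _ = markBimod.pi P v _
  rw [pi_mark]
  by_cases h : v = w
  · subst h
    rw [hat.pi_pi_same, ← pi_mark, key']
  · rw [hat.pi_apply (w + 1), hat.pi_single_of_ne (by omega), map_zero, map_zero, key v w h]

/-- The positive terms of a series in terms of its derivative. -/
theorem hat.smul_pi_succ (w : ℕ) {x : (hat P).V n p} {Y : Fam (hat P) n p}
    (h : markBimod.mk _ Y = mark P x) : ((w + 1 : ℕ) : k) • hat.pi P (w + 1) x
      = Fam.ins (GrHom.id _) (hatAlpha P) (add_zero p).symm (Fam.pi P w Y) := by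
  rw [hat.pi_apply, ← dsub_hatAlpha_single, ← hat.pi_apply, dsub_app, mark_pi_succ, ← h,
    markBimod.pi_mk, markBimod.ins_mk, zero_mul, Int.negOnePow_zero, one_smul]

theorem hat.pi_succ [CharZero k] (w : ℕ) {x : (hat P).V n p} {Y : Fam (hat P) n p}
    (h : markBimod.mk _ Y = mark P x) : hat.pi P (w + 1) x = ((w + 1 : ℕ) : k)⁻¹ •
      Fam.ins (GrHom.id _) (hatAlpha P) (add_zero p).symm (Fam.pi P w Y) := by
  rw [← hat.smul_pi_succ w h, smul_smul, inv_mul_cancel₀ (Nat.cast_ne_zero.2 w.succ_ne_zero), one_smul]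

theorem hat.eq_hatOf [CharZero k] {x : (hat P).V n p} (h : mark P x = 0) :
    x = hatOf ((hat.counit P).app x) := by
  refine hat.eq_of_pi fun w => ?_
  rcases w with _ | w
  · rw [hat.pi_zero, hat.pi_zero, hat.counit_of]
  · rw [hat.pi_succ w (Y := 0) (by rw [map_zero, h]), map_zero, map_zero, smul_zero]
    exact (hat.pi_single_of_ne w.succ_ne_zero _).symm

theorem hat.eq_hatAlpha_add [CharZero k] {x : (hat P).V 0 0}
    (h : mark P x = markBimod.mk _ (Fam.unit 1)) :
    x = hatAlpha P + hatOf ((hat.counit P).app x) := by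
  have h₁ : mark P (x - hatAlpha P) = 0 := by rw [map_sub, h, mark_alpha, sub_self]
  have h₂ := hat.eq_hatOf h₁
  have h₃ : (hat.counit P).app (hatAlpha P) = 0 := by
    rw [← hat.counit_pi_zero]
    exact (congrArg _ (hat.pi_single_of_ne (by omega) _)).trans (map_zero _)
  rw [map_sub, h₃, sub_zero] at h₂
  exact (sub_eq_iff_eq_add'.1 h₂)

theorem coprodFilt_coeff_succ [CharZero k] {F : ℕ → ∀ (n : ℕ) (p : ℤ), P.V n p → Prop} {K w : ℕ}
    {x : (hat P).V n p} {Y : Fam (hat P) n p} (h : markBimod.mk _ Y = mark P x)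
    (hY : ∀ j, CoprodFilt F K (hat.coeff P w (Y.1 j))) (hY' : w = 0 → K ≠ 0 → Y.2 = 0) :
    CoprodFilt F K (hat.coeff P (w + 1) x) := by
  have e : hat.coeff P (w + 1) x = hat.coeff P (w + 1) (hat.pi P (w + 1) x) :=
    (hat.coeff_single_same _ _).symm
  rw [e, hat.pi_succ w h, map_smul, Fam.ins_apply, map_add, map_sum, map_smul]
  refine .smul _ _ (.add _ _ (Finset.sum_induction _ (fun z => CoprodFilt F K z)
    (fun _ _ => .add _ _) (.zero _ _ _ _) fun j _ => ?_) ?_)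
  · have : hat.coeff P (w + 1) ((hat P).comp (n := 0) (r := n) rfl (add_zero p).symm j
        (hat.pi P w (Y.1 j)) (hatAlpha P))
        = CoprodV.compL (n := 0) (r := n) (v' := 1) (w := w + 1) rfl (add_zero p).symm rfl j (hat.coeff P w (Y.1 j)) (CoprodV.alpha P) :=
      (congrArg _ (hat.single_comp (n := 0) (r := n) (v' := 1) (w := w + 1) rfl (add_zero p).symm
        rfl j _ _)).trans (hat.coeff_single_same _ _)
    rw [Fam.pi_fst]
    refine Eq.mpr (congrArg _ this) ?_
    exact .comp (L := 0) _ _ _ _ _ _ (hY j) .alpha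
  · by_cases hw : w = 0
    · by_cases hK : K = 0
      · subst hw
        refine .smul _ _ ?_
        by_cases hn : 0 = n ∧ 0 = p
        · obtain ⟨rfl, rfl⟩ := hn
          rw [GrOperad.castL_self, hK]
          exact Eq.mpr (congrArg _ (hat.coeff_single_same _ _)) CoprodFilt.alpha
        · rw [GrOperad.castL_of_ne _ hn, map_zero]
          exact .zero _ _ _ _
      · have : (Fam.pi P w Y).2 = 0 := by simp [Fam.pi, hY' hw hK]
        rw [this, zero_smul]
        exact .zero _ _ _ _
    · have : (Fam.pi P w Y).2 = 0 := by simp [Fam.pi, hw]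
      rw [this, zero_smul]
      exact .zero _ _ _ _

/-- Differentiation lowers the order of a series by at most one. -/
theorem HatFilt.nf_mark {m : ℕ} {x : (hat P).V n p} (h : HatFilt m x) :
    (∀ j, HatFilt (m - 1) ((markBimod.nf _ (mark P x)).1 j)) ∧
      (1 < m → (markBimod.nf _ (mark P x)).2 = 0) := by
  have key : ∀ w, w + 1 < m → Fam.pi P w (markBimod.nf _ (mark P x)) = 0 := by
    intro w hw
    rw [← markBimod.nf_pi, ← mark_pi_succ, hat.pi_apply]
    exact (congrArg (fun z => markBimod.nf _ (mark P (hat.single P (w + 1) z))) (h _ hw)).trans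
      (by rw [map_zero, map_zero, map_zero])
  refine ⟨fun j w hw => ?_, fun hm => ?_⟩
  · have h₁ := congrArg (fun Y : Fam (hat P) n p => hat.coeff P w (Y.1 j)) (key w (by omega))
    rw [Fam.pi_fst, hat.pi_apply, hat.coeff_single_same] at h₁
    exact h₁
  · have h₁ := congrArg Prod.snd (key 0 hm)
    simpa [Fam.pi] using h₁

end euler

theorem CoprodFilt.eq_zero {P : GrOperad k s} {K n : ℕ} {p : ℤ} {w : ℕ} {c : CoprodV P n p w}
    (h : CoprodFilt (fun K _ _ x => K = 0 ∨ x = 0) K c) : K ≠ 0 → c = 0 := by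
  induction h with
  | of x h =>
    intro hK
    rw [h.resolve_left hK]
    exact CoprodV.ext fun R φ a => map_zero φ.app
  | alpha => exact fun h => absurd rfl h
  | zero => exact fun _ => rfl
  | add x y _ _ hx hy => exact fun h => by rw [hx h, hy h, add_zero]
  | smul c x _ hx => exact fun h => by rw [hx h, smul_zero]
  | act σ x _ hx => exact fun h => by rw [hx h, map_zero]
  | @comp K L m n r p q t v v' w hr ht hw i x y _ _ hx hy =>
    intro h
    by_cases hK : K = 0
    · rw [hy (by omega), map_zero]
    · rw [hx hK, map_zero, LinearMap.zero_apply]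
  | mono x hK _ hx => exact fun h => hx (by omega)

section series

variable [CharZero k] {R P : GrOperad k s} (Ψ : GrHom (hat R) (hat P))
  (hΨ : ∀ {n : ℕ} {p : ℤ} (x : (hat R).V n p) (Y : Fam (hat R) n p),
    markBimod.mk _ Y = mark R x → markBimod.mk _ (Fam.map Ψ Y) = mark P (Ψ.app x))

include hΨ in
/-- A morphism compatible with differentiation is determined by its constant term. -/
theorem map_hatOf {n : ℕ} {p : ℤ} (ν : R.V n p) :
    Ψ.app (hatOf ν) = hatOf ((hat.counit P).app (Ψ.app (hatOf ν))) := by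
  refine hat.eq_hatOf ?_
  rw [← hΨ (hatOf ν) 0 (by rw [map_zero, mark_of]), map_zero, map_zero]

include hΨ in
theorem map_hatAlpha :
    Ψ.app (hatAlpha R) = hatAlpha P + hatOf ((hat.counit P).app (Ψ.app (hatAlpha R))) := by
  refine hat.eq_hatAlpha_add ?_
  rw [← hΨ (hatAlpha R) (Fam.unit 1) mark_alpha.symm, Fam.map_unit]

include hΨ in
theorem HatFilt.map {F : ℕ → ∀ (n : ℕ) (p : ℤ), P.V n p → Prop}
    (hF : ∀ (m n : ℕ) (p : ℤ) (x : (hat R).V n p), HatFilt m x →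
      F m n p ((hat.counit P).app (Ψ.app x)))
    {m n : ℕ} {p : ℤ} {x : (hat R).V n p} (h : HatFilt m x) : HatTotalFilt F m (Ψ.app x) := by
  intro w
  induction w generalizing m n p with
  | zero =>
    have e : hat.coeff P 0 (Ψ.app x) = CoprodV.of ((hat.counit P).app (Ψ.app x)) := by
      have := congrArg (hat.coeff P 0) (hat.pi_zero (Ψ.app x))
      rw [hat.pi_apply, hat.coeff_single_same] at this
      exact this.trans (hat.coeff_single_same 0 _)
    exact Eq.mpr (congrArg _ e) (.of _ (hF m n p x h))
  | succ w ih =>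
    obtain ⟨h₁, h₂⟩ := h.nf_mark
    have e : m - (w + 1) = m - 1 - w := by omega
    rw [e]
    refine coprodFilt_coeff_succ (hΨ x _ (markBimod.mk_nf _)) (fun j => ih (h₁ j)) fun hw hm => ?_
    exact h₂ (by omega)

end series

/-! ### The adjunction -/

/-- The projection of the cofree twisting structure to series. -/
def cofree.retract (P : DGOperad k s) : GrHom (cofree.op P) (hat P.toGrOperad) :=
  (cofree.isFree P).lift (GrHom.id _) (ExtGen.val 0 0)

theorem cofree.retract_inc (P : DGOperad k s) {n : ℕ} {p : ℤ} (x : (hat P.toGrOperad).V n p) :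
    (cofree.retract P).app ((cofree.inc P).app x) = x := (cofree.isFree P).lift_ι _ _ x

section

variable [CharZero k] (P : Under (flatInf k s)) {n : ℕ} {p q : ℤ}

/-- The identification of `Q00` with the completed coproduct. -/
def theta : GrHom (cofreeTwist P).Q00.toGrOperad (hat (und P)) :=
  (cofreeTwist P).Q00.incl.trans (cofree.retract P.right)

theorem inc_theta (x : (cofreeTwist P).Q00.toGrOperad.V n p) :
    (cofree.inc P.right).app ((theta P).app x) = (cofreeTwist P).Q00.incl.app x := by
  obtain ⟨_, y, rfl⟩ := x
  exact congrArg (cofree.inc P.right).app (cofree.retract_inc P.right y)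

/-- The inverse of `theta`. -/
def thetaInv : GrHom (hat (und P)) (cofreeTwist P).Q00.toGrOperad := (cofree.inc P.right).toRange

theorem theta_thetaInv (x : (hat (und P)).V n p) : (theta P).app ((thetaInv P).app x) = x :=
  cofree.retract_inc P.right x

theorem thetaInv_theta (x : (cofreeTwist P).Q00.toGrOperad.V n p) :
    (thetaInv P).app ((theta P).app x) = x := Subtype.ext (inc_theta P x)

theorem theta_bijective : Function.Bijective ((theta P).app (n := n) (p := p)) :=
  Function.bijective_iff_has_inverse.2 ⟨(thetaInv P).app, thetaInv_theta P, theta_thetaInv P⟩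

theorem curvedOp_cofreeTwist (n : ℕ) :
    curvedOp (cofreeTwist P).str n = cofree.curved P.right (flatOp P) n := rfl

theorem theta_proj (x : (cofreeTwist P).Q.V n p) :
    (theta P).app ((cofreeTwist P).proj.app x) = (cofree.retract P.right).app x := by
  refine (cofreeTwist P).map_proj (cofree.retract P.right) ?_ ?_ x
  · rw [curvedOp_cofreeTwist, cofree.curved_zero]
    exact (cofree.isFree P.right).lift_gen _ _ ExtGen.zero
  · rw [curvedOp_cofreeTwist, cofree.curved_one]
    exact (cofree.isFree P.right).lift_gen _ _ ExtGen.one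

theorem counit_theta (x : (cofreeTwist P).Q00.toGrOperad.V n p) :
    (hat.counit (und P)).app ((theta P).app x)
      = (gr (cofreeCounit P)).app ((cofreeTwist P).Q00.incl.app x) := by
  rw [← inc_theta]
  exact (cofree.counit_inc P.right _).symm

theorem cofreeCounit_proj (x : (cofreeTwist P).Q.V n p) :
    (gr (cofreeCounit P)).app ((cofreeTwist P).Q00.incl.app ((cofreeTwist P).proj.app x))
      = (gr (cofreeCounit P)).app x := by
  refine (cofreeTwist P).map_proj (gr (cofreeCounit P)) ?_ ?_ x
  · exact (cofree.counit_curved P.right (isFlat_flatOp P) 0).trans (isFlat_flatOp P).zero_eq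
  · exact (cofree.counit_curved P.right (isFlat_flatOp P) 1).trans (isFlat_flatOp P).one_eq

variable {P} {X : Twist k s} (f : X ⟶ cofreeTwist P)

/-- The series attached to a morphism to the cofree twisting structure. -/
def toHat : GrHom X.Q00.toGrOperad (hat (und P)) := (Twist.grMap f).trans (theta P)

theorem inc_toHat (y : X.Q00.toGrOperad.V n p) :
    (cofree.inc P.right).app ((toHat f).app y) = (gr f.hom).app (X.Q00.incl.app y) := inc_theta P _

theorem counit_toHat (y : X.Q00.toGrOperad.V n p) : (hat.counit (und P)).app ((toHat f).app y)
    = (gr (f.hom ≫ cofreeCounit P)).app (X.Q00.incl.app y) := counit_theta P _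

theorem mark_toHat (h : p = q + 1) (h' : q = p + -1) (y : X.Q00.toGrOperad.V n p)
    (y' : X.Q00.toGrOperad.V n q) (Y : Fam X.Q00.toGrOperad n p)
    (e : X.Q.d h (X.Q00.incl.app y) = X.Q00.incl.app y'
        + Fam.ins X.Q00.incl (curvedOp X.str 0) h' Y
        - X.Q.adL (curvedOp X.str 1) h' (X.Q00.incl.app y)) :
    markBimod.mk _ (Fam.map (toHat f) ((-1 * p).negOnePow • Y)) = mark (und P) ((toHat f).app y) := by
  have hc : X.Q00.incl.trans (gr f.hom) = (toHat f).trans (cofree.inc P.right) :=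
    GrHom.ext fun n p y => (inc_toHat f y).symm
  have h₀ : (gr f.hom).app (curvedOp X.str 0) = cofree.gen P.right 0 (-1) .zero :=
    (Twist.map_curvedOp f 0).trans (cofree.curved_zero P.right _)
  have h₁ : (gr f.hom).app (curvedOp X.str 1) = cofree.gen P.right 1 (-1) .one :=
    (Twist.map_curvedOp f 1).trans (cofree.curved_one P.right _)
  have e₁ : (cofree.d P.right (flatOp P)).app h' ((cofree.inc P.right).app ((toHat f).app y))
      = (cofree.inc P.right).app ((toHat f).app y')
        + Fam.ins (cofree.inc P.right) (cofree.gen P.right 0 (-1) .zero) h' (Fam.map (toHat f) Y)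
        - (cofree.op P.right).adL (cofree.gen P.right 1 (-1) .one) h'
          ((cofree.inc P.right).app ((toHat f).app y)) := by
    refine (congrArg ((cofree.d P.right (flatOp P)).app h') (inc_toHat f y)).trans ?_
    refine (gr_map_d f.hom h (X.Q00.incl.app y)).symm.trans ((congrArg (gr f.hom).app e).trans ?_)
    rw [map_sub, map_add, GrHom.map_adL, Fam.map_ins, h₀, h₁, hc]
    exact congrArg₂ (· - ·) (congrArg₂ (· + ·) (inc_toHat f y').symm (Fam.ins_map _ _ _ _ _).symm)
      (congrArg _ (inc_toHat f y).symm)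
  obtain ⟨y₂, Y₂, h₃, -, h₅⟩ := cofree.d_add_bracket P.right (flatOp P) h ((toHat f).app y)
  rw [GrOperad.bracket_eq] at h₅
  have e₃ : (cofree.inc P.right).app ((toHat f).app y' - y₂)
      + Fam.ins (cofree.inc P.right) (cofree.gen P.right 0 (-1) .zero) h'
        (Fam.map (toHat f) Y - (-1 * p).negOnePow • Y₂) = 0 := by
    have e₄ := (congrArg (· + (cofree.op P.right).adL (cofree.gen P.right 1 (-1) .one) h'
      ((cofree.inc P.right).app ((toHat f).app y))) e₁).symm.trans h₅
    rw [map_sub, map_sub, map_sgn]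
    have e₅ := e₄.symm.trans (sub_add_cancel _ _)
    rw [sub_add_sub_comm, ← e₅, sub_self]
  have e₆ := cofree.mk_eq_zero P.right h' e₃
  rw [map_sub, map_sgn, h₃, sub_eq_zero] at e₆
  rw [map_sgn, map_sgn, e₆, smul_smul, Int.units_mul_self, one_smul]

theorem exists_mark_toHat (y : X.Q00.toGrOperad.V n p) : ∃ Y : Fam X.Q00.toGrOperad n p,
    ∀ f : X ⟶ cofreeTwist P,
      markBimod.mk _ (Fam.map (toHat f) Y) = mark (und P) ((toHat f).app y) := by
  obtain ⟨y', Y, e⟩ := X.exists_d (q := p + -1) (by omega) y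
  exact ⟨_, fun f => mark_toHat f (by omega) rfl y y' Y e⟩

theorem cofree_hom_ext {f f' : X ⟶ cofreeTwist P}
    (h : f.hom ≫ cofreeCounit P = f'.hom ≫ cofreeCounit P) : f = f' := by
  have key : ∀ (w : ℕ) {n : ℕ} {p : ℤ} (y : X.Q00.toGrOperad.V n p),
      hat.pi _ w ((toHat f).app y) = hat.pi _ w ((toHat f').app y) := by
    intro w
    induction w with
    | zero =>
      intro n p y
      rw [hat.pi_zero, hat.pi_zero, counit_toHat, counit_toHat, h]
    | succ w ih =>
      intro n p y
      obtain ⟨Y, hY⟩ := exists_mark_toHat (P := P) y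
      rw [hat.pi_succ w (hY f), hat.pi_succ w (hY f')]
      refine congrArg (fun Z => _ • Fam.ins _ _ _ Z) ?_
      clear hY
      induction Y using Fam.induction with
      | h j y => rw [Fam.map_sing, Fam.map_sing, Fam.pi_sing, Fam.pi_sing, ih]
      | h₀ r => rw [Fam.map_unit, Fam.map_unit]
      | ha Y Y' h h' => rw [map_add, map_add, map_add, map_add, h, h']
  refine Twist.Hom.ext ?_
  have : gr f.hom = gr f'.hom := by
    refine X.isFreeOn.hom_ext (fun n p y => ?_) (fun n p y => ?_)
    · rw [← inc_toHat, ← inc_toHat, hat.eq_of_pi fun w => key w y]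
    · cases y
      exacts [(Twist.map_curvedOp f 0).trans (Twist.map_curvedOp f' 0).symm,
        (Twist.map_curvedOp f 1).trans (Twist.map_curvedOp f' 1).symm]
  exact DGHom.ext fun n p x => congrArg (fun G : GrHom _ _ => G.app x) this

variable (P) in
/-- The counit of the adjunction. -/
def cofreeEps : (Twist.forget k s).obj (cofreeTwist P) ⟶ P :=
  Under.homMk (DGHom.mk (P := (cofreeTwist P).dgQ00)
      ((cofreeTwist P).Q00.incl.trans (gr (cofreeCounit P)))
      (fun h x => (cofreeCounit_proj P _).trans (gr_map_d (cofreeCounit P) h _)))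
    (presented_hom_ext fun n => (cofreeCounit_proj P _).trans
      (cofree.counit_curved P.right (isFlat_flatOp P) n))

/-- The projection of a twisting structure to its underlying operad under `L∞`. -/
def toForget (X : Twist k s) : X.Q ⟶ ((Twist.forget k s).obj X).right := X.dgProj

theorem toForget_cofreeEps : toForget (cofreeTwist P) ≫ (cofreeEps P).right = cofreeCounit P :=
  DGHom.ext fun _ _ x => cofreeCounit_proj P x

theorem toForget_map {X Y : Twist k s} (f : X ⟶ Y) :
    toForget X ≫ ((Twist.forget k s).map f).right = f.hom ≫ toForget Y :=
  DGHom.ext fun _ _ x => Twist.grMap_proj f x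

theorem forget_hom_ext {X : Twist k s} {φ ψ : (Twist.forget k s).obj X ⟶ P}
    (h : toForget X ≫ φ.right = toForget X ≫ ψ.right) : φ = ψ := by
  refine Under.UnderMorphism.ext (DGHom.ext fun n p x => ?_)
  have := congrArg (fun F : X.Q ⟶ P.right => (gr F).app (X.Q00.incl.app x)) h
  refine Eq.trans ?_ (this.trans ?_)
  · exact congrArg (gr φ.right).app (X.proj_coe x).symm
  · exact congrArg (gr ψ.right).app (X.proj_coe x)

theorem exists_lift (φ : (Twist.forget k s).obj X ⟶ P) :
    ∃ f : X ⟶ cofreeTwist P, f.hom ≫ cofreeCounit P = toForget X ≫ φ.right :=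
  exists_hom X P _ fun n => congrArg (fun F => (gr F).app (presentedGen IsFlat n)) (Under.w φ)

/-- The bijection of the adjunction. -/
def cofreeEquiv (X : Twist k s) (P : Under (flatInf k s)) : ((Twist.forget k s).obj X ⟶ P) ≃ (X ⟶ cofreeTwist P) where
  toFun φ := (exists_lift φ).choose
  invFun f := (Twist.forget k s).map f ≫ cofreeEps P
  left_inv φ := forget_hom_ext (by
    refine Eq.trans ?_ (exists_lift φ).choose_spec
    rw [Under.comp_right, ← Category.assoc, toForget_map, Category.assoc, toForget_cofreeEps])
  right_inv f := cofree_hom_ext (by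
    rw [(exists_lift _).choose_spec, Under.comp_right, ← Category.assoc, toForget_map, Category.assoc,
      toForget_cofreeEps])

theorem cofreeEquiv_counit (φ : (Twist.forget k s).obj X ⟶ P) :
    (cofreeEquiv X P φ).hom ≫ cofreeCounit P = toForget X ≫ φ.right := (exists_lift φ).choose_spec

theorem cofreeEquiv_naturality {X' : Twist k s} (f : X' ⟶ X) (φ : (Twist.forget k s).obj X ⟶ P) :
    cofreeEquiv X' P ((Twist.forget k s).map f ≫ φ) = f ≫ cofreeEquiv X P φ := by
  refine cofree_hom_ext ?_
  rw [cofreeEquiv_counit, Under.comp_right, ← Category.assoc, toForget_map, Category.assoc,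
    ← cofreeEquiv_counit]
  rfl

end

variable (k s) in
/-- The forgetful functor is left adjoint to the cofree twisting structure. -/
def cofreeAdj [CharZero k] :
    Twist.forget k s ⊣ Adjunction.rightAdjointOfEquiv cofreeEquiv
      (fun _ _ _ f φ => cofreeEquiv_naturality f φ) :=
  Adjunction.adjunctionOfEquivRight _ _

/-! ### The comonad of the adjunction -/

section filtration

variable {P : GrOperad k s} {n : ℕ} {p : ℤ}

theorem hatFilt_iff {m : ℕ} {x : (hat P).V n p} : HatFilt m x ↔ ∀ w < m, hat.pi P w x = 0 := by
  refine forall₂_congr fun w _ => ⟨fun h => ?_, fun h => ?_⟩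
  · exact (congrArg (hat.single P w) h).trans (map_zero _)
  · exact (hat.coeff_single_same w _).symm.trans ((congrArg (hat.coeff P w) h).trans (map_zero _))

variable (P) in
/-- The `α`-filtration by subspaces. -/
def hatFilt (m n : ℕ) (p : ℤ) : Submodule k ((hat P).V n p) where
  carrier := {x | HatFilt m x}
  add_mem' {x y} hx hy := hatFilt_iff.2 fun w hw => by
    rw [map_add, hatFilt_iff.1 hx w hw, hatFilt_iff.1 hy w hw, add_zero]
  zero_mem' := hatFilt_iff.2 fun _ _ => map_zero _
  smul_mem' c x hx := hatFilt_iff.2 fun w hw => by rw [map_smul, hatFilt_iff.1 hx w hw, smul_zero]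

theorem mem_hatFilt {m : ℕ} {x : (hat P).V n p} : x ∈ hatFilt P m n p ↔ HatFilt m x := Iff.rfl

theorem sgn_mem_hatFilt {m : ℕ} {x : (hat P).V n p} (ε : ℤˣ) (h : x ∈ hatFilt P m n p) :
    ε • x ∈ hatFilt P m n p := by
  rcases Int.units_eq_one_or ε with rfl | rfl
  · rwa [one_smul]
  · rw [Units.neg_smul, one_smul]
    exact neg_mem h

theorem comp_mem_hatFilt {a b c m r : ℕ} {q t : ℤ} (hr : r + 1 = m + n) (ht : t = p + q)
    (i : Fin m) {x : (hat P).V m p} {y : (hat P).V n q} (hc : c ≤ a + b) (hx : x ∈ hatFilt P a m p)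
    (hy : y ∈ hatFilt P b n q) : (hat P).comp hr ht i x y ∈ hatFilt P c r t := by
  refine hatFilt_iff.2 fun w hw => ?_
  rw [hat.pi_comp]
  refine Finset.sum_eq_zero fun v hv => ?_
  rw [Finset.HasAntidiagonal.mem_antidiagonal] at hv
  by_cases h : v.1 < a
  · rw [hatFilt_iff.1 hx _ h, map_zero, LinearMap.zero_apply]
  · rw [hatFilt_iff.1 hy _ (by omega), map_zero]

theorem mem_hatFilt_zero (x : (hat P).V n p) : x ∈ hatFilt P 0 n p := hatFilt_iff.2 fun _ h => by omega

theorem hat.counit_eq_zero {x : (hat P).V n p} (h : HatFilt 1 x) : (hat.counit P).app x = 0 := by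
  rw [← hat.counit_pi_zero, hatFilt_iff.1 h 0 one_pos, map_zero]

theorem twistedOp_mem_hatFilt [CharZero k] {ℓ : ∀ n, P.V n (-1)} (h : ℓ n = 0) :
    twistedOp P ℓ n ∈ hatFilt P 1 n (-1) := by
  refine hatFilt_iff.2 fun w hw => ?_
  obtain rfl : w = 0 := by omega
  rw [hat.pi_zero, counit_twistedOp, h, ← hat.of_app, map_zero]

theorem adL_mem_hatFilt {e q : ℤ} (μ : (hat P).V 1 e) (h : q = p + e) {m : ℕ} {x : (hat P).V n p}
    (hx : x ∈ hatFilt P m n p) : (hat P).adL μ h x ∈ hatFilt P m n q := by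
  rw [GrOperad.adL_apply]
  refine sub_mem (comp_mem_hatFilt _ _ _ (zero_add m).ge (mem_hatFilt_zero μ) hx)
    (sgn_mem_hatFilt _ (sum_mem fun i _ => ?_))
  exact comp_mem_hatFilt _ _ _ (add_zero m).ge hx (mem_hatFilt_zero μ)

theorem dsub_mem_hatFilt {e q : ℤ} {u : (hat P).V 0 e} (hu : u ∈ hatFilt P 1 0 e) (h : q = p + e)
    {m : ℕ} {x : (hat P).V n p} (hx : x ∈ hatFilt P m n p) :
    (dsub (GrHom.id _) u).app h x ∈ hatFilt P m n q := by
  obtain ⟨h₁, h₂⟩ := HatFilt.nf_mark (mem_hatFilt.1 hx)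
  rw [dsub_app, ← markBimod.mk_nf (mark P x), markBimod.ins_mk, Fam.ins_apply]
  refine sgn_mem_hatFilt _ (add_mem (sum_mem fun j _ => ?_) ?_)
  · exact comp_mem_hatFilt (a := m - 1) (b := 1) _ _ _ (by omega) (h₁ j) hu
  · by_cases hm : 1 < m
    · rw [h₂ hm, zero_smul]
      exact zero_mem _
    · refine Submodule.smul_mem _ _ (hatFilt_iff.2 fun w hw => ?_)
      rw [hat.pi_castL, hatFilt_iff.1 hu w (by omega), map_zero]

theorem hatDeriv_mem_hatFilt {e q : ℤ} (δ : Deriv (GrHom.id P) e) (h : q = p + e)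
    {m : ℕ} {x : (hat P).V n p} (hx : x ∈ hatFilt P m n p) :
    (hatDeriv δ).app h x ∈ hatFilt P m n q :=
  hatFilt_iff.2 fun w hw => by rw [pi_hatDeriv, hatFilt_iff.1 hx w hw, map_zero]

end filtration

section comonad

variable [CharZero k] {P R : Under (flatInf k s)} {n : ℕ} {p q : ℤ}

theorem theta_d (h : p = q + 1) (h' : q = p + -1) (x : (cofreeTwist P).Q00.toGrOperad.V n p) :
    (theta P).app ((cofreeTwist P).dgQ00.d h x)
      = (hatDeriv P.right.dDeriv).app h' ((theta P).app x)
        + (hat (und P)).adL (twistedOp (und P) (flatOp P) 1) h' ((theta P).app x)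
        - (dsub (GrHom.id _) (twistedOp (und P) (flatOp P) 0)).app h' ((theta P).app x) := by
  refine (theta_proj P _).trans ?_
  obtain ⟨y, Y, -, hy, e⟩ := cofree.d_add_bracket P.right (flatOp P) h ((theta P).app x)
  rw [← hy]
  have e₁ := congrArg (cofree.retract P.right).app e
  have h₀ : (cofree.retract P.right).app (cofree.gen P.right 0 (-1) .zero) = 0 :=
    (cofree.isFree P.right).lift_gen _ _ ExtGen.zero
  have h₁ : (cofree.retract P.right).app (cofree.gen P.right 1 (-1) .one) = 0 :=
    (cofree.isFree P.right).lift_gen _ _ ExtGen.one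
  rw [GrOperad.bracket_eq, map_add, map_add, GrHom.map_adL, map_sgn, Fam.map_ins, h₀, h₁,
    Fam.ins_zero, GrOperad.adL_zero, smul_zero, cofree.retract_inc P.right y] at e₁
  refine Eq.trans ?_ ((add_zero _).symm.trans (e₁.trans (add_zero _)))
  exact congrArg (fun z => (cofree.retract P.right).app ((cofree.d P.right (flatOp P)).app h' z))
    (inc_theta P x).symm

/-- The morphism of completed coproducts given by a morphism of cofree twisting structures. -/
def hatMap (f : cofreeTwist R ⟶ cofreeTwist P) : GrHom (hat (und R)) (hat (und P)) :=
  (thetaInv R).trans (toHat f)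

theorem hatMap_theta (f : cofreeTwist R ⟶ cofreeTwist P)
    (x : (cofreeTwist R).Q00.toGrOperad.V n p) :
    (hatMap f).app ((theta R).app x) = (theta P).app ((Twist.grMap f).app x) :=
  congrArg (toHat f).app (thetaInv_theta R x)

theorem counit_hatMap (f : cofreeTwist R ⟶ cofreeTwist P) (x : (hat (und R)).V n p) :
    (hat.counit (und P)).app ((hatMap f).app x)
      = (gr (f.hom ≫ cofreeCounit P)).app ((cofree.inc R.right).app x) := counit_toHat f _

theorem mark_hatMap (f : cofreeTwist R ⟶ cofreeTwist P) (x : (hat (und R)).V n p)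
    (Y : Fam (hat (und R)) n p) (hY : markBimod.mk _ Y = mark (und R) x) :
    markBimod.mk _ (Fam.map (hatMap f) Y) = mark (und P) ((hatMap f).app x) := by
  obtain ⟨y, Y₂, h₁, -, e⟩ := cofree.d_add_bracket R.right (flatOp R) (q := p + -1) (by omega) x
  have e₁ : Fam.ins (q := p + -1) (cofree.inc R.right) (cofree.gen R.right 0 (-1) .zero) rfl Y₂
      = Fam.ins (cofree.inc R.right) (cofree.gen R.right 0 (-1) .zero) rfl Y := by
    rw [← markBimod.ins_mk, ← markBimod.ins_mk, h₁, hY]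
  rw [GrOperad.bracket_eq, e₁] at e
  have h₂ : curvedOp (cofreeTwist R).str 0 = cofree.gen R.right 0 (-1) .zero :=
    cofree.curved_zero R.right _
  have h₃ : curvedOp (cofreeTwist R).str 1 = cofree.gen R.right 1 (-1) .one :=
    cofree.curved_one R.right _
  have key := mark_toHat f (q := p + -1) (by omega) rfl ((thetaInv R).app x) ((thetaInv R).app y)
    ((-1 * p).negOnePow • Fam.map (thetaInv R) Y) (by
      rw [h₂, h₃, map_sgn]
      refine Eq.trans ?_ (congrArg (fun z => _ + (-1 * p).negOnePow • z - _)
        (Fam.ins_map (thetaInv R) (cofreeTwist R).Q00.incl _ rfl Y).symm)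
      exact eq_sub_of_add_eq e)
  rw [smul_smul, Int.units_mul_self, one_smul] at key
  exact key

theorem cofreeAdj_map (f : P ⟶ R) :
    ((Adjunction.rightAdjointOfEquiv (cofreeEquiv (k := k) (s := s))
      (fun _ _ _ f φ => cofreeEquiv_naturality f φ)).map f).hom ≫ cofreeCounit R
      = cofreeCounit P ≫ f.right := by
  refine (cofreeEquiv_counit _).trans ?_
  rw [Under.comp_right, ← Category.assoc]
  refine congrArg (· ≫ f.right) ?_
  refine (congrArg (fun g : (Twist.forget k s).obj (cofreeTwist P) ⟶ P =>
    toForget (cofreeTwist P) ≫ g.right) ?_).trans toForget_cofreeEps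
  exact (congrArg (· ≫ cofreeEps P) ((Twist.forget k s).map_id _)).trans (Category.id_comp _)

theorem cofreeAdj_unit (X : Twist k s) :
    ((cofreeAdj k s).unit.app X).hom ≫ cofreeCounit ((Twist.forget k s).obj X) = toForget X := by
  refine Eq.trans ?_ (cofreeEquiv_counit (𝟙 _))
  rfl

theorem cofreeAdj_counit (x : (cofreeTwist P).Q00.toGrOperad.V n p) :
    (undMap ((cofreeAdj k s).counit.app P)).app x = (hat.counit (und P)).app ((theta P).app x) :=
  (counit_theta P x).symm

theorem theta_d_of (h : p = q + 1) {x : (cofreeTwist P).Q00.toGrOperad.V n p} {ν : (und P).V n p}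
    (hx : (theta P).app x = hatOf ν) : (theta P).app ((cofreeTwist P).dgQ00.d h x)
      = hatOf (P.right.d h ν)
        + (hat (und P)).bracket (twistedOp (und P) (flatOp P) 1) h (hatOf ν) := by
  refine (theta_d h (by omega) x).trans ?_
  rw [hx, hatDeriv_of, dsub_of, GrOperad.bracket_eq]
  exact sub_zero _

theorem theta_d_alpha {x : (cofreeTwist P).Q00.toGrOperad.V 0 0} (h : (0 : ℤ) = -1 + 1)
    (hx : (theta P).app x = hatAlpha (und P)) : (theta P).app ((cofreeTwist P).dgQ00.d h x)
      = - twistedOp (und P) (flatOp P) 0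
        + (hat (und P)).bracket (twistedOp (und P) (flatOp P) 1) h (hatAlpha (und P)) := by
  refine (theta_d h rfl x).trans ?_
  rw [hx, hatDeriv_alpha, dsub_alpha, GrOperad.bracket_eq]
  exact (congrArg (· - _) (zero_add _)).trans ((sub_eq_add_neg _ _).trans (add_comm _ _))

theorem theta_d_filt (m : ℕ) (h : p = q + 1) {x : (cofreeTwist P).Q00.toGrOperad.V n p}
    (hx : HatFilt m ((theta P).app x)) :
    HatFilt m ((theta P).app ((cofreeTwist P).dgQ00.d h x)) := by
  refine Eq.mpr (congrArg (HatFilt m) (theta_d h (by omega) x)) ?_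
  exact mem_hatFilt.1 (sub_mem (add_mem (hatDeriv_mem_hatFilt _ _ hx) (adL_mem_hatFilt _ _ hx))
    (dsub_mem_hatFilt (twistedOp_mem_hatFilt (isFlat_flatOp P).zero_eq) _ hx))

theorem theta_flatOp {n : ℕ} (hn : 1 < n) :
    (theta P).app ((cofreeTwist P).proj.app (curvedOp (cofreeTwist P).str n))
      = twistedOp (und P) (flatOp P) n := by
  rw [theta_proj, curvedOp_cofreeTwist, cofree.curved_of_lt _ _ hn]
  exact cofree.retract_inc P.right _

section

variable (f : cofreeTwist R ⟶ cofreeTwist P)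

theorem theta_grMap_of {x : (cofreeTwist R).Q00.toGrOperad.V n p} {ν : (und R).V n p}
    (hx : (theta R).app x = hatOf ν) : (theta P).app ((Twist.grMap f).app x)
      = hatOf ((gr (f.hom ≫ cofreeCounit P)).app ((cofreeTwist R).Q00.incl.app x)) := by
  rw [← hatMap_theta, hx, map_hatOf _ (mark_hatMap f), ← hx, hatMap_theta]
  exact congrArg hatOf (counit_theta P _)

theorem theta_grMap_alpha {x : (cofreeTwist R).Q00.toGrOperad.V 0 0}
    (hx : (theta R).app x = hatAlpha (und R)) : (theta P).app ((Twist.grMap f).app x)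
      = hatAlpha (und P)
        + hatOf ((gr (f.hom ≫ cofreeCounit P)).app ((cofreeTwist R).Q00.incl.app x)) := by
  rw [← hatMap_theta, hx, map_hatAlpha _ (mark_hatMap f), ← hx, hatMap_theta]
  exact congrArg (fun z => _ + hatOf z) (counit_theta P _)

theorem theta_grMap_filt {F : ℕ → ∀ (n : ℕ) (p : ℤ), (und P).V n p → Prop}
    (hF : ∀ (m n : ℕ) (p : ℤ) (x : (cofreeTwist R).Q00.toGrOperad.V n p),
      HatFilt m ((theta R).app x) →
        F m n p ((gr (f.hom ≫ cofreeCounit P)).app ((cofreeTwist R).Q00.incl.app x)))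
    {m : ℕ} {x : (cofreeTwist R).Q00.toGrOperad.V n p} (hx : HatFilt m ((theta R).app x)) :
    HatTotalFilt F m ((theta P).app ((Twist.grMap f).app x)) := by
  rw [← hatMap_theta]
  refine HatFilt.map _ (mark_hatMap f) (fun m n p z hz => ?_) hx
  rw [counit_hatMap]
  refine hF m n p ((thetaInv R).app z) ?_
  rwa [theta_thetaInv]

end

theorem counit_incl_of {x : (cofreeTwist P).Q00.toGrOperad.V n p} {ν : (und P).V n p}
    (hx : (theta P).app x = hatOf ν) :
    (gr (cofreeCounit P)).app ((cofreeTwist P).Q00.incl.app x) = ν := by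
  rw [← counit_theta, hx, hat.counit_of]

theorem counit_incl_filt {x : (cofreeTwist P).Q00.toGrOperad.V n p}
    (hx : HatFilt 1 ((theta P).app x)) :
    (gr (cofreeCounit P)).app ((cofreeTwist P).Q00.incl.app x) = 0 := by
  rw [← counit_theta, hat.counit_eq_zero hx]

theorem hatFilt_hatAlpha (P : GrOperad k s) : HatFilt 1 (hatAlpha P) := fun w hw =>
  Pi.single_eq_of_ne (M := CoprodV P 0 0) (by omega) _

theorem isTwistingVia : IsTwistingVia (cofreeAdj k s).toComonad (fun P => theta P) where
  bijective P n p := theta_bijective P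
  op P n hn := theta_flatOp hn
  d_of P n p q h x ν hx := theta_d_of h hx
  d_alpha P x hx := theta_d_alpha _ hx
  d_filt P m n p q h x hx := theta_d_filt m h hx
  map_of {P R} f n p x ν hx := by
    refine (theta_grMap_of _ hx).trans (congrArg hatOf ?_)
    refine (congrArg (fun g : (cofreeTwist P).Q ⟶ R.right => (gr g).app _) (cofreeAdj_map f)).trans ?_
    exact congrArg (undMap f).app (counit_incl_of hx)
  map_alpha {P R} f x hx := by
    refine (theta_grMap_alpha _ hx).trans ?_
    refine (congrArg (fun z => _ + hatOf z) ?_).trans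
      ((congrArg (_ + ·) (map_zero (hat.of (und R)).app)).trans (add_zero _))
    refine (congrArg (fun g : (cofreeTwist P).Q ⟶ R.right => (gr g).app _) (cofreeAdj_map f)).trans ?_
    refine (congrArg (undMap f).app (counit_incl_filt (x := x) ?_)).trans (map_zero _)
    exact Eq.mpr (congrArg (HatFilt 1) hx) (hatFilt_hatAlpha _)
  map_filt {P R} f m n p x hx := by
    intro w hw
    refine (theta_grMap_filt (F := fun K _ _ x => K = 0 ∨ x = 0) _ (fun m n p x hx => ?_) hx w).eq_zero
      (by omega)
    by_cases hm : m = 0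
    · exact .inl hm
    · refine .inr ((congrArg (fun g : (cofreeTwist P).Q ⟶ R.right => (gr g).app _)
        (cofreeAdj_map f)).trans ?_)
      exact (congrArg (undMap f).app (counit_incl_filt (x := x) fun w hw => hx w (by omega))).trans
        (map_zero _)
  counit_of P n p x ν hx := (cofreeAdj_counit x).trans ((counit_theta P x).trans (counit_incl_of hx))
  counit_filt P n p x hx := (cofreeAdj_counit x).trans (hat.counit_eq_zero hx)
  comul_of P n p x ν hx := by
    refine (theta_grMap_of _ hx).trans (congrArg hatOf ?_)
    refine (congrArg (fun g : (cofreeTwist P).Q ⟶ _ => (gr g).app _)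
      (cofreeAdj_unit (cofreeTwist P))).trans ?_
    exact (cofreeTwist P).proj_coe x
  comul_alpha P x hx := by
    refine (theta_grMap_alpha _ hx).trans (congrArg (fun z => _ + hatOf z) ?_)
    refine (congrArg (fun g : (cofreeTwist P).Q ⟶ _ => (gr g).app _)
      (cofreeAdj_unit (cofreeTwist P))).trans ?_
    exact (cofreeTwist P).proj_coe x
  comul_filt P m n p x hx := by
    refine theta_grMap_filt _ (fun m n p x hx => ?_) hx
    refine Eq.mpr (congrArg (fun z => HatFilt m ((theta P).app z)) ?_) hx
    refine (congrArg (fun g : (cofreeTwist P).Q ⟶ _ => (gr g).app _)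
      (cofreeAdj_unit (cofreeTwist P))).trans ?_
    exact (cofreeTwist P).proj_coe x

end comonad

/-! ### Equalizers of cosplit pairs -/

namespace Twist

variable {X Y : Twist k s} (f g : X ⟶ Y)

/-- The equalizer of two morphisms, as a suboperad. -/
def eqSub : SubOperad X.Q.toGrOperad where
  carrier n p := LinearMap.eqLocus ((gr f.hom).app (n := n) (p := p)) (gr g.hom).app
  act_mem σ x hx := by
    rw [LinearMap.mem_eqLocus] at hx ⊢
    rw [(gr f.hom).map_act, (gr g.hom).map_act, hx]
  comp_mem hr ht i x y hx hy := by
    rw [LinearMap.mem_eqLocus] at hx hy ⊢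
    rw [(gr f.hom).map_comp, (gr g.hom).map_comp, hx, hy]

theorem d_mem_eqSub {n : ℕ} {p q : ℤ} (h : p = q + 1) {x : X.Q.V n p}
    (hx : x ∈ (eqSub f g).carrier n p) : X.Q.d h x ∈ (eqSub f g).carrier n q :=
  (gr_map_d f.hom h x).trans ((congrArg (Y.Q.d h) hx).trans (gr_map_d g.hom h x).symm)

/-- The equalizer of two morphisms, as a dg operad. -/
def eqOp : DGOperad k s where
  toGrOperad := (eqSub f g).toGrOperad
  d h := (X.Q.d h).restrict fun _ hx => d_mem_eqSub f g h hx
  d_d h h' x := Subtype.ext (X.Q.d_d h h' x.1)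
  d_act h σ x := Subtype.ext (X.Q.d_act h σ x.1)
  d_comp hr ht hp hq htt h₁ h₂ i x y :=
    Subtype.ext ((X.Q.d_comp hr ht hp hq htt h₁ h₂ i x.1 y.1).trans (by simp [Units.smul_def]; rfl))

/-- The structure morphism of the equalizer. -/
def eqStr : curvedInf k s ⟶ eqOp f g :=
  DGHom.mk (R := eqOp f g) ((gr X.str).codRestrict (eqSub f g) fun n p x =>
      congrArg (fun F : curvedInf k s ⟶ Y.Q => (gr F).app x) (f.w.trans g.w.symm))
    (fun h x => Subtype.ext (gr_map_d X.str h x))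

/-- The operations of the equalizer that do not involve `ℓ₀` and `ℓ₁`. -/
def eqQ00 : SubOperad (eqOp f g).toGrOperad where
  carrier n p := (X.Q00.carrier n p).comap ((eqSub f g).incl.app (n := n) (p := p))
  act_mem σ _ hx := X.Q00.act_mem σ hx
  comp_mem hr ht i _ _ hx hy := X.Q00.comp_mem hr ht i hx hy

variable (r : GrHom Y.Q00.toGrOperad X.Q00.toGrOperad)
  (hg : ∀ {n : ℕ} {p : ℤ} (y : X.Q00.toGrOperad.V n p), r.app ((grMap g).app y) = y)
  (hf : ∀ {n : ℕ} {p : ℤ} (y : X.Q00.toGrOperad.V n p),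
    (grMap f).app (r.app ((grMap f).app y)) = (grMap g).app (r.app ((grMap f).app y)))

/-- The retraction of `Q00` to the equalizer. -/
def eqRetract00 : GrHom X.Q00.toGrOperad (eqQ00 f g).toGrOperad :=
  (((((grMap f).trans r).trans X.Q00.incl).codRestrict (eqSub f g) fun _ _ y =>
    congrArg Subtype.val (hf y)) : GrHom X.Q00.toGrOperad (eqOp f g).toGrOperad).codRestrict
      (eqQ00 f g) fun _ _ y => (r.app ((grMap f).app y)).2

/-- The retraction of `Q` to the equalizer. -/
def eqRetract : GrHom X.Q.toGrOperad (eqOp f g).toGrOperad :=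
  X.isFreeOn.lift ((eqRetract00 f g r hf).trans (eqQ00 f g).incl)
    (ExtGen.val (curvedOp (eqStr f g) 0) (curvedOp (eqStr f g) 1))

variable {n : ℕ} {p q : ℤ}

theorem eqRetract_incl (y : X.Q00.toGrOperad.V n p) :
    (eqRetract f g r hf).app (X.Q00.incl.app y)
      = (eqQ00 f g).incl.app ((eqRetract00 f g r hf).app y) := X.isFreeOn.lift_ι _ _ y

theorem eqRetract_zero :
    (eqRetract f g r hf).app (curvedOp X.str 0) = curvedOp (eqStr f g) 0 :=
  X.isFreeOn.lift_gen _ _ ExtGen.zero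

theorem eqRetract_one :
    (eqRetract f g r hf).app (curvedOp X.str 1) = curvedOp (eqStr f g) 1 :=
  X.isFreeOn.lift_gen _ _ ExtGen.one

include hg in
theorem eqRetract_coe (x : (eqOp f g).V n p) :
    (eqRetract f g r hf).app ((eqSub f g).incl.app x) = x := by
  let ρ : GrHom Y.Q.toGrOperad X.Q.toGrOperad := Y.isFreeOn.lift (r.trans X.Q00.incl)
    (ExtGen.val (curvedOp X.str 0) (curvedOp X.str 1))
  have hρ₀ : ρ.app (curvedOp Y.str 0) = curvedOp X.str 0 := Y.isFreeOn.lift_gen _ _ ExtGen.zero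
  have hρ₁ : ρ.app (curvedOp Y.str 1) = curvedOp X.str 1 := Y.isFreeOn.lift_gen _ _ ExtGen.one
  have hρ : ∀ {n : ℕ} {p : ℤ} (y : Y.Q00.toGrOperad.V n p),
      ρ.app (Y.Q00.incl.app y) = X.Q00.incl.app (r.app y) := fun y => Y.isFreeOn.lift_ι _ _ y
  have h₁ : (gr g.hom).trans ρ = GrHom.id _ := by
    refine X.isFreeOn.hom_ext (fun n p y => ?_) (fun n p y => ?_)
    · exact (hρ ((grMap g).app y)).trans (congrArg X.Q00.incl.app (hg y))
    · cases y
      exacts [(congrArg ρ.app (map_curvedOp g 0)).trans hρ₀,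
        (congrArg ρ.app (map_curvedOp g 1)).trans hρ₁]
  have h₂ : (eqRetract f g r hf).trans (eqSub f g).incl = (gr f.hom).trans ρ := by
    refine X.isFreeOn.hom_ext (fun n p y => ?_) (fun n p y => ?_)
    · exact (congrArg (eqSub f g).incl.app (eqRetract_incl f g r hf y)).trans
        (hρ ((grMap f).app y)).symm
    · cases y
      · exact (congrArg (eqSub f g).incl.app (eqRetract_zero f g r hf)).trans
          ((congrArg ρ.app (map_curvedOp f 0)).trans hρ₀).symm
      · exact (congrArg (eqSub f g).incl.app (eqRetract_one f g r hf)).trans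
          ((congrArg ρ.app (map_curvedOp f 1)).trans hρ₁).symm
  refine Subtype.ext ?_
  refine (congrArg (fun F : GrHom X.Q.toGrOperad X.Q.toGrOperad => F.app x.1) h₂).trans ?_
  refine (congrArg ρ.app x.2).trans ?_
  exact congrArg (fun F : GrHom X.Q.toGrOperad X.Q.toGrOperad => F.app x.1) h₁

include hg in
theorem eqRetract00_coe (y : (eqQ00 f g).toGrOperad.V n p) :
    (eqRetract00 f g r hf).app ⟨y.1.1, y.2⟩ = y :=
  Subtype.ext ((eqRetract_incl f g r hf ⟨y.1.1, y.2⟩).symm.trans (eqRetract_coe f g r hg hf y.1))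

include hg hf in
theorem eqQ00_isFreeExtension :
    IsFreeExtension (eqQ00 f g) (curvedOp (eqStr f g) 0) (curvedOp (eqStr f g) 1) := by
  intro R φ a b
  let ψ : GrHom X.Q.toGrOperad R :=
    X.isFreeOn.lift ((eqRetract00 f g r hf).trans φ) (ExtGen.val a b)
  have hψ₀ : ψ.app (curvedOp X.str 0) = a := X.isFreeOn.lift_gen _ _ ExtGen.zero
  have hψ₁ : ψ.app (curvedOp X.str 1) = b := X.isFreeOn.lift_gen _ _ ExtGen.one
  refine ⟨(eqSub f g).incl.trans ψ, ⟨GrHom.ext fun n p y => ?_, hψ₀, hψ₁⟩, ?_⟩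
  · refine (X.isFreeOn.lift_ι _ _ ⟨y.1.1, y.2⟩).trans ?_
    exact congrArg φ.app (eqRetract00_coe f g r hg hf y)
  · rintro ψ' ⟨h, h₀, h₁⟩
    have key : (eqRetract f g r hf).trans ψ' = ψ := by
      refine X.isFreeOn.hom_ext (fun n p y => ?_) (fun n p y => ?_)
      · refine (congrArg ψ'.app (eqRetract_incl f g r hf y)).trans
          (Eq.trans ?_ (X.isFreeOn.lift_ι _ _ y).symm)
        exact congrArg (fun F : GrHom (eqQ00 f g).toGrOperad R => F.app _) h
      · cases y
        · exact ((congrArg ψ'.app (eqRetract_zero f g r hf)).trans h₀).trans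
            hψ₀.symm
        · exact ((congrArg ψ'.app (eqRetract_one f g r hf)).trans h₁).trans
            hψ₁.symm
    refine GrHom.ext fun n p x => ?_
    refine (congrArg ψ'.app (eqRetract_coe f g r hg hf x)).symm.trans ?_
    exact congrArg (fun F : GrHom X.Q.toGrOperad R => F.app ((eqSub f g).incl.app x)) key

include hg hf in
theorem eqOp_d_add_bracket (h : p = q + 1) (x : (eqOp f g).V n p)
    (hx : x ∈ (eqQ00 f g).carrier n p) : ∃ y z : (eqOp f g).V n q,
      HasWeight (eqQ00 f g) (curvedOp (eqStr f g) 0) (curvedOp (eqStr f g) 1) 0 0 y ∧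
      HasWeight (eqQ00 f g) (curvedOp (eqStr f g) 0) (curvedOp (eqStr f g) 1) 1 0 z ∧
      (eqOp f g).d h x + (eqOp f g).bracket (curvedOp (eqStr f g) 1) h x = y + z := by
  obtain ⟨y', Y, e⟩ := X.exists_d h ⟨x.1, hx⟩
  refine ⟨(eqRetract f g r hf).app (X.Q00.incl.app y'), (eqRetract f g r hf).app
    (Fam.ins X.Q00.incl (curvedOp X.str 0) (by omega) Y), ?_, ?_, ?_⟩
  · rw [eqRetract_incl]
    exact .mem _ ((eqRetract00 f g r hf).app y').2
  · rw [Fam.map_ins, eqRetract_zero]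
    refine hasWeight_ins (X.Q00.incl.trans (eqRetract f g r hf)) (fun n p y => ?_) (by omega) Y
    have := eqRetract_incl f g r hf y
    exact Eq.mpr (congrArg (· ∈ _) this) ((eqRetract00 f g r hf).app y).2
  · rw [← map_add, GrOperad.bracket_eq]
    refine (eqRetract_coe f g r hg hf _).symm.trans (congrArg (eqRetract f g r hf).app ?_)
    refine (map_add (eqSub f g).incl.app _ _).trans ((congrArg₂ (· + ·) rfl
      (GrHom.map_adL (eqSub f g).incl _ _ x)).trans ?_)
    exact (congrArg (· + _) e).trans (sub_add_cancel _ _)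

/-- The equalizer of a cosplit pair of twisting structures. -/
def eqTwist : Twist k s where
  Q := eqOp f g
  str := eqStr f g
  Q00 := eqQ00 f g
  free := eqQ00_isFreeExtension f g r hg hf
  op_mem n hn := X.op_mem n hn
  d_add_bracket h x hx := eqOp_d_add_bracket f g r hg hf h x hx

/-- The inclusion of the equalizer. -/
def eqι : eqTwist f g r hg hf ⟶ X where
  hom := DGHom.mk (P := eqOp f g) (eqSub f g).incl fun _ _ => rfl
  w := DGHom.ext fun _ _ _ => rfl
  map_mem _ hx := hx

theorem eqι_condition : eqι f g r hg hf ≫ f = eqι f g r hg hf ≫ g :=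
  Twist.Hom.ext (DGHom.ext fun _ _ x => x.2)

end Twist

/-! ### Comonadicity -/

theorem existsUnique_under_lift {A B C : Under (flatInf k s)} (ι : A ⟶ B)
    (hι : ∀ {n : ℕ} {p : ℤ} (x : (und A).V n p), (undMap ι).app x = 0 → x = 0) (φ : C ⟶ B)
    (hφ : ∀ {n : ℕ} {p : ℤ} (x : (und C).V n p), ∃ a, (undMap ι).app a = (undMap φ).app x) :
    ∃! ψ : C ⟶ A, ψ ≫ ι = φ := by
  have hι' : ∀ {n : ℕ} {p : ℤ} {x y : (und A).V n p}, (undMap ι).app x = (undMap ι).app y → x = y :=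
    fun h => sub_eq_zero.1 (hι _ (by rw [map_sub, h, sub_self]))
  obtain ⟨Φ, hΦ⟩ := GrHom.exists_factor (undMap ι) hι (undMap φ) hφ
  let Ψ : C.right ⟶ A.right := DGHom.mk Φ fun h x => hι' <| (hΦ _).trans <|
    (gr_map_d φ.right h x).trans <| (congrArg (B.right.d h) (hΦ x).symm).trans
      (gr_map_d ι.right h (Φ.app x)).symm
  have hw : C.hom ≫ Ψ = A.hom := by
    refine presented_hom_ext fun n => hι' ((hΦ _).trans ?_)
    refine (congrArg (fun F => (gr F).app (presentedGen IsFlat n)) (Under.w φ)).trans ?_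
    exact congrArg (fun F => (gr F).app (presentedGen IsFlat n)) (Under.w ι).symm
  refine ⟨Under.homMk Ψ hw, Under.UnderMorphism.ext (DGHom.ext fun _ _ x => hΦ x), fun ψ hψ => ?_⟩
  refine Under.UnderMorphism.ext (DGHom.ext fun n p x => hι' (Eq.trans ?_ (hΦ x).symm))
  exact congrArg (fun F => (undMap F).app x) hψ

namespace Twist

open Limits

section

variable {X Y : Twist k s} (f g : X ⟶ Y) (r : GrHom Y.Q00.toGrOperad X.Q00.toGrOperad)
  (hg : ∀ {n : ℕ} {p : ℤ} (y : X.Q00.toGrOperad.V n p), r.app ((grMap g).app y) = y)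
  (hf : ∀ {n : ℕ} {p : ℤ} (y : X.Q00.toGrOperad.V n p),
    (grMap f).app (r.app ((grMap f).app y)) = (grMap g).app (r.app ((grMap f).app y)))

/-- The equalizer in the category of twisting structures. -/
def isLimitEq : IsLimit (Fork.ofι (eqι f g r hg hf) (eqι_condition f g r hg hf)) :=
  Fork.IsLimit.ofExistsUnique fun c => by
    have hc : ∀ (n : ℕ) (p : ℤ) (x : c.pt.Q.V n p),
        (gr c.ι.hom).app x ∈ (eqSub f g).carrier n p := fun n p x =>
      congrArg (fun F : c.pt ⟶ Y => (gr F.hom).app x) c.condition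
    refine ⟨⟨DGHom.mk (R := eqOp f g) ((gr c.ι.hom).codRestrict (eqSub f g) hc)
      fun h x => Subtype.ext (gr_map_d c.ι.hom h x), ?_, fun x hx => c.ι.map_mem x hx⟩, ?_, ?_⟩
    · refine DGHom.ext fun n p x => Subtype.ext ?_
      exact congrArg (fun F : curvedInf k s ⟶ X.Q => (gr F).app x) c.ι.w
    · exact Twist.Hom.ext (DGHom.ext fun _ _ _ => rfl)
    · intro l hl
      refine Twist.Hom.ext (DGHom.ext fun n p x => Subtype.ext ?_)
      exact congrArg (fun F : c.pt ⟶ X => (gr F.hom).app x) hl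

theorem forget_eqι_condition :
    (Twist.forget k s).map (eqι f g r hg hf) ≫ (Twist.forget k s).map f
      = (Twist.forget k s).map (eqι f g r hg hf) ≫ (Twist.forget k s).map g := by
  rw [← Functor.map_comp, ← Functor.map_comp, eqι_condition]

/-- The forgetful functor preserves the equalizer. -/
def isLimitForgetEq : IsLimit (Fork.ofι ((Twist.forget k s).map (eqι f g r hg hf))
    (forget_eqι_condition f g r hg hf)) :=
  Fork.IsLimit.ofExistsUnique fun c => by
    refine existsUnique_under_lift _ (fun x hx => Subtype.ext (Subtype.ext ?_)) c.ι fun {n p} x => ?_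
    · have hx' : (grMap (eqι f g r hg hf)).app x = 0 := hx
      exact (congrArg X.Q00.incl.app hx').trans (map_zero _)
    · have := congrArg (fun F => (undMap F).app x) c.condition
      exact ⟨⟨⟨((undMap c.ι).app x).1, congrArg Subtype.val this⟩, ((undMap c.ι).app x).2⟩, rfl⟩

end

theorem exists_retraction {X Y : Twist k s} (f g : X ⟶ Y) [(Twist.forget k s).IsCosplitPair f g] :
    ∃ r : GrHom Y.Q00.toGrOperad X.Q00.toGrOperad,
      (∀ {n : ℕ} {p : ℤ} (y : X.Q00.toGrOperad.V n p), r.app ((grMap g).app y) = y) ∧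
      ∀ {n : ℕ} {p : ℤ} (y : X.Q00.toGrOperad.V n p),
        (grMap f).app (r.app ((grMap f).app y)) = (grMap g).app (r.app ((grMap f).app y)) := by
  have H := HasSplitEqualizer.isSplitEqualizer ((Twist.forget k s).map f) ((Twist.forget k s).map g)
  refine ⟨undMap H.rightRetraction, fun {n p} y => ?_, fun {n p} y => ?_⟩
  · exact congrArg (fun F : (Twist.forget k s).obj X ⟶ (Twist.forget k s).obj X => (undMap F).app y)
      H.bottom_rightRetraction
  · have h : (Twist.forget k s).map f ≫ H.rightRetraction ≫ (Twist.forget k s).map f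
        = (Twist.forget k s).map f ≫ H.rightRetraction ≫ (Twist.forget k s).map g := by
      rw [H.top_rightRetraction_assoc, H.top_rightRetraction_assoc, H.condition]
    exact congrArg (fun F : (Twist.forget k s).obj X ⟶ (Twist.forget k s).obj Y => (undMap F).app y) h

theorem hasEqualizer_of_isCosplitPair : Comonad.HasEqualizerOfIsCosplitPair (Twist.forget k s) where
  out f g _ := by
    obtain ⟨r, hg, hf⟩ := exists_retraction f g
    exact HasLimit.mk ⟨_, isLimitEq f g r hg hf⟩

/-- The forgetful functor preserves equalizers of cosplit pairs. -/
theorem preservesLimit_of_isCosplitPair :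
    Comonad.PreservesLimitOfIsCosplitPair (Twist.forget k s) where
  out f g _ := by
    obtain ⟨r, hg, hf⟩ := exists_retraction f g
    exact preservesLimit_of_preserves_limit_cone (isLimitEq f g r hg hf)
      ((isLimitMapConeForkEquiv _ (eqι_condition f g r hg hf)).symm (isLimitForgetEq f g r hg hf))

theorem forget_reflectsIsomorphisms : (Twist.forget k s).ReflectsIsomorphisms where
  reflects {X Y} f _ := by
    let r : GrHom Y.Q00.toGrOperad X.Q00.toGrOperad := undMap (inv ((Twist.forget k s).map f))
    have hr : ∀ {n : ℕ} {p : ℤ} (y : X.Q00.toGrOperad.V n p), r.app ((grMap f).app y) = y := fun y =>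
      congrArg (fun F : (Twist.forget k s).obj X ⟶ (Twist.forget k s).obj X => (undMap F).app y)
        (IsIso.hom_inv_id ((Twist.forget k s).map f))
    have hr' : ∀ {n : ℕ} {p : ℤ} (y : Y.Q00.toGrOperad.V n p), (grMap f).app (r.app y) = y := fun y =>
      congrArg (fun F : (Twist.forget k s).obj Y ⟶ (Twist.forget k s).obj Y => (undMap F).app y)
        (IsIso.inv_hom_id ((Twist.forget k s).map f))
    let ρ : GrHom Y.Q.toGrOperad X.Q.toGrOperad := Y.isFreeOn.lift (r.trans X.Q00.incl)
      (ExtGen.val (curvedOp X.str 0) (curvedOp X.str 1))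
    have hρ₀ : ρ.app (curvedOp Y.str 0) = curvedOp X.str 0 := Y.isFreeOn.lift_gen _ _ ExtGen.zero
    have hρ₁ : ρ.app (curvedOp Y.str 1) = curvedOp X.str 1 := Y.isFreeOn.lift_gen _ _ ExtGen.one
    have hρ : ∀ {n : ℕ} {p : ℤ} (y : Y.Q00.toGrOperad.V n p),
        ρ.app (Y.Q00.incl.app y) = X.Q00.incl.app (r.app y) := fun y => Y.isFreeOn.lift_ι _ _ y
    have h₁ : (gr f.hom).trans ρ = GrHom.id _ := by
      refine X.isFreeOn.hom_ext (fun n p y => ?_) (fun n p y => ?_)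
      · exact (hρ ((grMap f).app y)).trans (congrArg X.Q00.incl.app (hr y))
      · cases y
        exacts [(congrArg ρ.app (map_curvedOp f 0)).trans hρ₀,
          (congrArg ρ.app (map_curvedOp f 1)).trans hρ₁]
    have h₂ : ρ.trans (gr f.hom) = GrHom.id _ := by
      refine Y.isFreeOn.hom_ext (fun n p y => ?_) (fun n p y => ?_)
      · exact (congrArg (gr f.hom).app (hρ y)).trans (congrArg Subtype.val (hr' y))
      · cases y
        exacts [(congrArg (gr f.hom).app hρ₀).trans (map_curvedOp f 0),
          (congrArg (gr f.hom).app hρ₁).trans (map_curvedOp f 1)]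
    have h₁' : ∀ {n : ℕ} {p : ℤ} (x : X.Q.V n p), ρ.app ((gr f.hom).app x) = x := fun x =>
      congrArg (fun F : GrHom X.Q.toGrOperad X.Q.toGrOperad => F.app x) h₁
    have h₂' : ∀ {n : ℕ} {p : ℤ} (x : Y.Q.V n p), (gr f.hom).app (ρ.app x) = x := fun x =>
      congrArg (fun F : GrHom Y.Q.toGrOperad Y.Q.toGrOperad => F.app x) h₂
    refine ⟨⟨⟨DGHom.mk ρ fun h x => ?_, ?_, fun x hx => ?_⟩, ?_, ?_⟩⟩
    · rw [← h₁' (X.Q.d h (ρ.app x)), gr_map_d, h₂']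
    · refine DGHom.ext fun n p x => ?_
      refine (congrArg (fun F : curvedInf k s ⟶ Y.Q => ρ.app ((gr F).app x)) f.w).symm.trans ?_
      exact h₁' _
    · exact Eq.mpr (congrArg (· ∈ _) (hρ ⟨x, hx⟩)) (r.app ⟨x, hx⟩).2
    · exact Twist.Hom.ext (DGHom.ext fun _ _ x => h₁' x)
    · exact Twist.Hom.ext (DGHom.ext fun _ _ x => h₂' x)

end Twist

variable (k s) in
/-- The forgetful functor is comonadic. -/
abbrev comonadicForget [CharZero k] : ComonadicLeftAdjoint (Twist.forget k s) :=
  have := Twist.hasEqualizer_of_isCosplitPair (k := k) (s := s)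
  have := Twist.preservesLimit_of_isCosplitPair (k := k) (s := s)
  have := Twist.forget_reflectsIsomorphisms (k := k) (s := s)
  Comonad.comonadicOfHasPreservesFSplitEqualizersOfReflectsIsomorphisms (cofreeAdj k s)

theorem isTwistingComonad_comonadicForget [CharZero k] :
    IsTwistingComonad (comonadicForget k s).adj.toComonad := ⟨fun P => theta P, isTwistingVia⟩

end OperadicTwisting

end

/-- The forgetful functor from twisting structures to operads under `L∞` is comonadic, and the
corresponding comonad is the twisting comonad; likewise for nonsymmetric operads and `A∞`. -/
theorem theorem1p4 (k : Type u) [Field k] [CharZero k] (s : OperadicTwisting.Flavour) :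
    ∃ h : CategoryTheory.ComonadicLeftAdjoint (OperadicTwisting.Twist.forget k s),
      OperadicTwisting.IsTwistingComonad h.adj.toComonad :=
  ⟨OperadicTwisting.comonadicForget k s, OperadicTwisting.isTwistingComonad_comonadicForget⟩
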